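/- **Setting.** Let $Q:\mathbb R\to\mathbb R^3$ be a $C^1$, $2\pi$-periodic closed curve (supporting curve of an open string in the centre-of-mass frame), $L(\sigma)=\int_0^\sigma|Q'|$, $L_t=L(2\pi)$, $X=L_t^{-1}\oint Q\,dL$. For an integer $s\ge1$, $\tau\in\mathbb R$ and $e\in S^2$ put $$a_s^\tau(e)=\frac1{2\sqrt{2\pi}}\oint dQ(\sigma)\,\exp\Big[\frac{2\pi i s}{L_t}\Big(L(\sigma)-\frac{\tau L_t}{2\pi}-(Q(\sigma)-X)\cdot e\Big)\Big]\in\mathbb C^3,$$ $q_s^\tau=\operatorname{Re}a_s^\tau$, and let $V^\tau(e)=q_{s\perp}^\tau(e)=q_s^\tau-(q_s^\tau\cdot e)e$, a tangent vector field on $S^2$; $\tau$ is the evolution parameter (the marked point moves along the curve by the length $\tau L_t/2\pi$). Singular points are the zeros of $V^\tau$. A zero is a *node* (*saddle*) if its linear part has two real eigenvalues of the same sign (of opposite signs), and a *multi-saddle of multiplicity $m$* if $V^\tau=C\bar z^{\,m}+o(|z|^m)$, $C\neq0$, in a complex orthonormal coordinate $z$ of the tangent plane. Let $Q_0(\sigma)=(\cos\sigma,\sin\sigma,0)$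 be the straight-line string, let $\pm e_z=(0,0,\pm1)$ be the poles, and let $E(\tau)=(\cos(\frac\pi2+\tau),\sin(\frac\pi2+\tau),0)$. The $C^1$ distance is $\max(\sup|Q-R|,\sup|Q'-R'|)$. **Lemma.** 1. (*Straight string.*) For $Q=Q_0$, $s\ge1$ and every $\tau$, the singular points of $V^\tau$ are exactly the $2s$ distinct points $E(\tau+k\pi/s)$, $0\le k<2s$, of the equator, all of which are nodes, and, if $s\ge2$, the two poles, which are saddles if $s=2$ and multi-saddles of multiplicity $s-1$ if $s>2$. If $R_\tau$ is the rotation about the polar axis by the angle $\tau$, then $V^\tau(R_\tau e)=R_\tau V^0(e)$. So the nodes move along the equator, and the poles stay fixed while the saddle patterns rotate around them. 2. (*Small deformations.*) For all $s\ge1$, $\kappa>0$, $c>0$ there is $\delta>0$ such that the following holds for every $d\in(0,\delta]$ and every $C^1$ closed curve $Q$ whose $C^1$ distance from $Q_0$ is at most $d$. - (a) There is a continuous $N:\mathbb R\to S^2$ with $|N(\tau)-E(\tau)|<\kappa$ and with $N(\tau)=N(\tau')$ if and only if $\tau'-\tau\in2\pi\mathbb Z$, such that for every $\tau$ the $2s$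 points $N(\tau+k\pi/s)$, $0\le k<2s$, are nodes of $V^\tau$. Every other singular point of $V^\tau$ is at distance $<\kappa$ from a pole, and there is none if $s=1$. So the nodes move along a common trajectory near the equator, and in the time $\pi/s$ each of them moves to the neighbouring one. - (b) If $s=2$, then for each pole $p$ there is a continuous $z:\mathbb R\to S^2$ with period $\pi/2$ and $|z(\tau)-p|<\kappa$, such that $z(\tau)$ is a saddle of $V^\tau$ and the only zero $e$ of $V^\tau$ with $e\cdot p>\frac12$. If moreover $|(a_2^0)^1(p)+i(a_2^0)^2(p)|\ge c\,d$, then this loop is simple and is run through exactly once in the time $\pi/2$: $z(\tau)=z(\tau')$ if and only if $\tau'-\tau\in\frac\pi2\mathbb Z$. - (c) If $s>2$, $p$ is a pole, and $I$ is an interval of times on which $|V^\tau(p)|\ge c\,d$, then there are continuous maps $z_1,\dots,z_{s-1}:I\to S^2$ such that for every $\tau\in I$ the points $z_k(\tau)$ are pairwise distinct (non-degenerate) saddles of $V^\tau$ at distance $<\kappa$ from $p$, and every zero $e$ of $V^\tau$ with $e\cdot p>\frac12$ is one of them. 3. (*The conditions in* (b), (c) *are generic.*) For every $s\ge2$, every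 $C^1$ closed curve $\eta$ and every $r>0$ there are a $C^1$ closed curve $\eta'$ at $C^1$ distance at most $r$ from $\eta$ and numbers $\rho,c,\varepsilon_0>0$ such that for every $C^1$ closed curve $\zeta$ at $C^1$ distance at most $\rho$ from $\eta'$, every $0<\varepsilon<\varepsilon_0$ and both poles $p$, the curve $Q=Q_0+\varepsilon\zeta$ satisfies $|V^\tau(p)|\ge c\varepsilon$ for all $\tau$ and $|(a_s^0)^1(p)+i(a_s^0)^2(p)|\ge c\varepsilon$. 4. (*Reversal.*) For every $C^1$ closed curve $Q$, every $s\ge1$ and every $\tau$ one has $V^{\tau+2\pi}=V^\tau$ and $V^{\tau+\pi/s}=-V^\tau$. So after the time $\pi/s$ (the period of evolution divided by $2s$) the field reverses its direction, and its zeros, nodes, saddles and multi-saddles are the same as before. -/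

import Mathlib

open scoped RealInnerProductSpace

noncomputable section

namespace StringCurve

/-- Euclidean three-space. -/
abbrev E3 : Type := EuclideanSpace ℝ (Fin 3)

/-! ### Supporting curves of open strings in the centre-of-mass frame -/

/-- A closed curve of class `C¹`, with a parameter of period `2π`. -/
def IsClosedCurve (Q : ℝ → E3) : Prop :=
  ContDiff ℝ 1 Q ∧ Function.Periodic Q (2 * Real.pi)

/-- The `C¹` distance of `Q` and `R` is at most `d`. -/
def C1Close (d : ℝ) (Q R : ℝ → E3) : Prop :=
  ∀ σ, ‖Q σ - R σ‖ ≤ d ∧ ‖deriv Q σ - deriv R σ‖ ≤ d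

/-- Length `L(σ)` of the curve, counted from the marked point `σ = 0`. -/
def arcLength (Q : ℝ → E3) (σ : ℝ) : ℝ := ∫ t in (0 : ℝ)..σ, ‖deriv Q t‖

/-- Total length `L_t`. -/
def totalLength (Q : ℝ → E3) : ℝ := arcLength Q (2 * Real.pi)

/-- Average position `X = ∮ dL Q / L_t`. -/
def meanPosition (Q : ℝ → E3) : E3 :=
  (totalLength Q)⁻¹ • ∫ σ in (0 : ℝ)..(2 * Real.pi), ‖deriv Q σ‖ • Q σ

/-- The argument of the exponential in `a_n` at time `τ`.  The length is counted from the
marked point, which by the time `τ` has moved along the curve by the length `τ L_t / 2π`. -/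
def phase (Q : ℝ → E3) (n : ℕ) (τ : ℝ) (e : E3) (σ : ℝ) : ℝ :=
  2 * Real.pi * n / totalLength Q *
    ((arcLength Q σ - τ * totalLength Q / (2 * Real.pi)) - ⟪Q σ - meanPosition Q, e⟫)

/-- The `i`-th component of the amplitude `a_n(e)` at time `τ`. -/
def amplitude (Q : ℝ → E3) (n : ℕ) (τ : ℝ) (e : E3) (i : Fin 3) : ℂ :=
  (1 / (2 * Real.sqrt (2 * Real.pi)) : ℝ) *
    ∫ σ in (0 : ℝ)..(2 * Real.pi),
      (deriv Q σ i : ℂ) * Complex.exp (Complex.I * (phase Q n τ e σ : ℂ))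

/-- `q_n = Re a_n`. -/
def qVec (Q : ℝ → E3) (n : ℕ) (τ : ℝ) (e : E3) : E3 :=
  WithLp.toLp 2 fun i => (amplitude Q n τ e i).re

/-- The vector field `q_{n⊥}(e) = q_n - (q_n e) e` on the unit sphere, at time `τ`.  (The same
formula extends it to a neighbourhood of the sphere.) -/
def qPerp (Q : ℝ → E3) (n : ℕ) (τ : ℝ) (e : E3) : E3 :=
  qVec Q n τ e - ⟪qVec Q n τ e, e⟫ • e

/-- The straight-line string. -/
def straight (σ : ℝ) : E3 := !₂[Real.cos σ, Real.sin σ, 0]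

/-! ### Points and rotations -/

/-- The northern pole. -/
def north : E3 := !₂[0, 0, 1]

/-- The point of the equator with longitude `π/2 + τ`. -/
def equatorPoint (τ : ℝ) : E3 :=
  !₂[Real.cos (Real.pi / 2 + τ), Real.sin (Real.pi / 2 + τ), 0]

/-- Rotation about the polar axis by the angle `τ`. -/
def rotZ (τ : ℝ) (e : E3) : E3 :=
  !₂[Real.cos τ * e 0 - Real.sin τ * e 1, Real.sin τ * e 0 + Real.cos τ * e 1, e 2]

/-! ### Singular points of tangent vector fields on the unit sphere -/

/-- The linear part, on the tangent plane `p^⊥`, of the field `V` at its zero `p`. -/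
def linearPart (V : E3 → E3) (p : E3) : (ℝ ∙ p)ᗮ →ₗ[ℝ] (ℝ ∙ p)ᗮ :=
  ((ℝ ∙ p)ᗮ.orthogonalProjectionOnto.comp ((fderiv ℝ V p).comp (ℝ ∙ p)ᗮ.subtypeL)).toLinearMap

/-- Node: the linear part has two real eigenvalues (with multiplicity) of the same sign. -/
def IsNode (V : E3 → E3) (p : E3) : Prop :=
  ‖p‖ = 1 ∧ V p = 0 ∧ ∃ l m : ℝ, 0 < l * m ∧
    (linearPart V p).charpoly =
      (Polynomial.X - Polynomial.C l) * (Polynomial.X - Polynomial.C m)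

/-- Non-degenerate saddle: the linear part has two real eigenvalues of opposite signs. -/
def IsSaddle (V : E3 → E3) (p : E3) : Prop :=
  ‖p‖ = 1 ∧ V p = 0 ∧ ∃ l m : ℝ, l * m < 0 ∧
    (linearPart V p).charpoly =
      (Polynomial.X - Polynomial.C l) * (Polynomial.X - Polynomial.C m)

/-- Multi-saddle of multiplicity `m`: in the complex coordinate `z` of the tangent plane the
field is `C (z*)^m + o(|z|^m)` with `C ≠ 0`, so that it makes `m` revolutions in the direction
opposite to a passage around the point. -/
def IsMultiSaddle (V : E3 → E3) (p : E3) (m : ℕ) : Prop :=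
  ‖p‖ = 1 ∧ V p = 0 ∧ ∃ u v : E3, ‖u‖ = 1 ∧ ‖v‖ = 1 ∧ ⟪u, v⟫ = 0 ∧ ⟪u, p⟫ = 0 ∧ ⟪v, p⟫ = 0 ∧
    ∃ C : ℂ, C ≠ 0 ∧
      (fun e : E3 => ((⟪V e, u⟫ : ℂ) + Complex.I * (⟪V e, v⟫ : ℂ)) -
          C * (starRingEnd ℂ ((⟪e, u⟫ : ℂ) + Complex.I * (⟪e, v⟫ : ℂ))) ^ m)
        =o[nhdsWithin p (Metric.sphere 0 1)] fun e : E3 => ‖e - p‖ ^ m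

end StringCurve

end

/-! For the straight string the field is explicit. Let z be the horizontal part of e and B_n
(`planeBessel`) Bessel's integral as a function on the plane. Then q^τ is horizontal, and it is a
combination of e^{-isτ} B_{s+1}(sz) and e^{isτ} times the conjugate of B_{s-1}(sz)
(`qVec_straight`). In polar coordinates its radial and azimuthal components are, up to a common
positive factor, (J_{s-1}+J_{s+1}) cos ψ and -(J_{s-1}-J_{s+1}) sin ψ with ψ = s(φ-π/2-τ)
(`straightPlane_polar`). These Bessel combinations are positive multiples of J_s and J_s', which are
positive on (0, s] (`besselJ_pos`, `dBesselJ_pos`), so zeros occur only on the equator and at the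
poles. At an equatorial zero the linear part is diagonal, with entries proportional to s J_s'(s) and
J_s(s) with the same factor: a node. The two entries differ (`mul_dBesselJ_ne`), which makes the
node condition open. At a pole the leading Taylor term is a constant times conj(z)^{s-1}.

The straight field at time τ is the field at time 0 rotated by τ, hence stationary in the rotating
frame. A nearby curve gives a C¹-close field, uniformly in τ (`exists_c1Near`). Non-degenerate zeros
therefore persist by a quantitative inverse function theorem (`persistent_zero_string`), and
compactness of the sphere excludes zeros elsewhere (`zeros_near`). Uniqueness gives continuity in τ.
This yields the nodes for all s and the polar saddles for s = 2.

The field depends on time as V^{a+τ} = cos(sτ) V^a + sin(sτ) V^{a+π/2s} (`qPerp_time_eq`). So a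
point that is a zero at two times not differing by a multiple of π/s is a zero at all times. Near a
node this is impossible (`quarter_ne_near_node`). Near a pole with s = 2 it would force the
positively polarized amplitude at the pole to be O(d²) (`amplitude_plus_le_of_common_zero`). Hence
the trajectories have no unexpected self-intersections.

For s > 2 the field near a pole is w + C conj(z)^{s-1} plus a remainder, where w = V^τ(p) has size
between cd and Kd. With z = b conj(ξ) and C conj(b)^{s-1} = -w, the zeros solve a small perturbation
of ξ^{s-1} = 1 and lie near the s-1 roots of unity (`exists_perturbed_roots`). There the linear part
is dominated by a multiple of v ↦ conj(v), so each zero is a saddle (`exists_unfolding`).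

For genericity the amplitude at the poles is differentiated along a deformation. A vertical
oscillation of wave number s+1 moves the positively polarized rate along a real line and leaves the
negatively polarized one fixed. Outside finitely many oscillation strengths the two moduli differ
and the first is nonzero, at both poles; since |V^τ(p)| is at least half the difference of the
polarized moduli, this gives the bounds (`exists_generic_direction`). -/

open scoped RealInnerProductSpace

noncomputable section

namespace StringCurve

open Metric Filter Topology

/-! ### Linear parts on tangent planes -/

/-- The tangential part of a field along the unit sphere. -/
def tangential (q : E3 → E3) (e : E3) : E3 := q e - ⟪q e, e⟫ • e

/-- The compression of an endomorphism to the plane orthogonal to `p`. -/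
def compress (M : E3 →L[ℝ] E3) (p : E3) : (ℝ ∙ p)ᗮ →ₗ[ℝ] (ℝ ∙ p)ᗮ :=
  ((ℝ ∙ p)ᗮ.orthogonalProjectionOnto.comp (M.comp (ℝ ∙ p)ᗮ.subtypeL)).toLinearMap

/-- The map `v ↦ v - ⟪p, v⟫ p`. -/
def planeProj (p : E3) : E3 →L[ℝ] E3 := ContinuousLinearMap.id ℝ E3 - (innerSL ℝ p).smulRight p

@[simp] lemma planeProj_apply (p v : E3) : planeProj p v = v - ⟪p, v⟫ • p := by
  simp [planeProj]

/-- The trace of the compression of `M` to the plane orthogonal to `p`. -/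
def trOne (M : E3 →L[ℝ] E3) (p : E3) : ℝ :=
  LinearMap.trace ℝ E3 (M ∘L planeProj p).toLinearMap

/-- The trace of the square of the compression of `M` to the plane orthogonal to `p`. -/
def trTwo (M : E3 →L[ℝ] E3) (p : E3) : ℝ :=
  LinearMap.trace ℝ E3 (M ∘L planeProj p ∘L M ∘L planeProj p).toLinearMap

lemma subtype_comp_proj {p : E3} (hp : ‖p‖ = 1) (v : E3) :
    (((ℝ ∙ p)ᗮ.orthogonalProjectionOnto v : (ℝ ∙ p)ᗮ) : E3) = planeProj p v := by
  have := (ℝ ∙ p).starProjection_orthogonal_val v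
  rw [Submodule.starProjection_apply] at this
  rw [this, Submodule.starProjection_unit_singleton ℝ hp, planeProj_apply]

/-- The trace is cyclic, so the compression to a plane that varies with `p` is replaced by an
endomorphism of the fixed space, whose trace is visibly continuous in `(M, p)`. -/
lemma trace_compress {p : E3} (hp : ‖p‖ = 1) (M : E3 →L[ℝ] E3) :
    LinearMap.trace ℝ _ (compress M p) = trOne M p := by
  have h := LinearMap.trace_comp_comm' (R := ℝ)
    (M.toLinearMap ∘ₗ (ℝ ∙ p)ᗮ.subtype)
    ((ℝ ∙ p)ᗮ.orthogonalProjectionOnto).toLinearMap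
  unfold trOne compress
  refine Eq.trans ?_ (h.trans ?_)
  · rfl
  · congr 1
    ext1 v
    simp [subtype_comp_proj hp]

lemma trace_compress_sq {p : E3} (hp : ‖p‖ = 1) (M : E3 →L[ℝ] E3) :
    LinearMap.trace ℝ _ (compress M p ∘ₗ compress M p) = trTwo M p := by
  have h := LinearMap.trace_comp_comm' (R := ℝ)
    (M.toLinearMap ∘ₗ (ℝ ∙ p)ᗮ.subtype ∘ₗ compress M p)
    ((ℝ ∙ p)ᗮ.orthogonalProjectionOnto).toLinearMap
  unfold trTwo
  refine Eq.trans ?_ (h.trans ?_)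
  · rfl
  · congr 1
    ext1 v
    simp [subtype_comp_proj hp, compress, inner_sub_right, inner_smul_right]
    module

/-- In dimension two the determinant is half of (tr T)² - tr T², so the first two power sums of the
eigenvalues determine the characteristic polynomial. -/
lemma charpoly_eq_of_finrank_two {W : Type*} [AddCommGroup W] [Module ℝ W]
    [FiniteDimensional ℝ W] (hW : Module.finrank ℝ W = 2) (T : W →ₗ[ℝ] W) {l m : ℝ}
    (h1 : l + m = LinearMap.trace ℝ W T) (h2 : l ^ 2 + m ^ 2 = LinearMap.trace ℝ W (T ∘ₗ T)) :
    T.charpoly = (Polynomial.X - Polynomial.C l) * (Polynomial.X - Polynomial.C m) := by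
  let b := Module.finBasisOfFinrankEq ℝ W hW
  rw [LinearMap.trace_eq_matrix_trace ℝ b] at h1 h2
  rw [LinearMap.toMatrix_comp b b b] at h2
  rw [← LinearMap.charpoly_toMatrix T b, Matrix.charpoly_fin_two]
  set A := LinearMap.toMatrix b b T
  have hdet : A.det = l * m := by
    rw [Matrix.det_fin_two]
    simp only [Matrix.trace_fin_two, Matrix.mul_apply, Fin.sum_univ_two] at h1 h2
    linear_combination (-1 / 2) * (A 0 0 + A 1 1 + l + m) * h1 + (1 / 2) * h2
  rw [hdet, ← h1]
  simp only [map_add, map_mul]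
  ring

lemma finrank_plane {p : E3} (hp : ‖p‖ = 1) : Module.finrank ℝ (ℝ ∙ p)ᗮ = 2 := by
  have : Fact (Module.finrank ℝ E3 = 2 + 1) := ⟨by simp⟩
  exact Submodule.finrank_orthogonal_span_singleton (by rintro rfl; simp at hp)

/-- The quantity assumed nonnegative is the discriminant of the characteristic polynomial, and `l *
m` is its constant term, the determinant. -/
lemma charpoly_compress {p : E3} (hp : ‖p‖ = 1) (M : E3 →L[ℝ] E3)
    (h : 0 ≤ 2 * trTwo M p - trOne M p ^ 2) :
    ∃ l m : ℝ, l * m = (trOne M p ^ 2 - trTwo M p) / 2 ∧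
    (compress M p).charpoly =
      (Polynomial.X - Polynomial.C l) * (Polynomial.X - Polynomial.C m) := by
  set Δ := 2 * trTwo M p - trOne M p ^ 2 with hΔ
  have hs := Real.sq_sqrt h
  refine ⟨(trOne M p + √Δ) / 2, (trOne M p - √Δ) / 2, by nlinarith, ?_⟩
  refine charpoly_eq_of_finrank_two (finrank_plane hp) _ ?_ ?_
  · rw [trace_compress hp]; ring
  · rw [trace_compress_sq hp]; nlinarith

/-- `M v` being parallel to `p` means that the compression kills `v`, and the hypothesis on the
traces says that its determinant is nonzero. This is what makes the bordered system of
`exists_lagrange_equiv` invertible. -/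
lemma compress_injective {p : E3} (hp : ‖p‖ = 1) (M : E3 →L[ℝ] E3)
    (h : trOne M p ^ 2 ≠ trTwo M p) {v : E3} (hv : ⟪p, v⟫ = 0) {l : ℝ} (hMv : M v = l • p) :
    v = 0 := by
  have hW := finrank_plane hp
  let b := Module.finBasisOfFinrankEq ℝ _ hW
  have h1 := trace_compress hp M
  have h2 := trace_compress_sq hp M
  rw [LinearMap.trace_eq_matrix_trace ℝ b] at h1 h2
  rw [LinearMap.toMatrix_comp b b b] at h2
  have hdet : (compress M p).det ≠ 0 := by
    rw [← LinearMap.det_toMatrix b, Matrix.det_fin_two]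
    simp only [Matrix.trace_fin_two, Matrix.mul_apply, Fin.sum_univ_two] at h1 h2
    intro h0
    apply h
    rw [← h1, ← h2]
    linear_combination 2 * h0
  have hmem : v ∈ (ℝ ∙ p)ᗮ := by
    rw [Submodule.mem_orthogonal_singleton_iff_inner_right]; exact hv
  have hz : compress M p ⟨v, hmem⟩ = 0 := by
    apply Subtype.ext
    change (((ℝ ∙ p)ᗮ.orthogonalProjectionOnto (M v) : (ℝ ∙ p)ᗮ) : E3) = 0
    rw [subtype_comp_proj hp, hMv]
    simp [hp]
  have := LinearMap.ker_eq_bot'.1 ((LinearMap.equivOfDetNeZero _ hdet).ker) ⟨v, hmem⟩ hz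
  simpa using congrArg Subtype.val this

lemma hasFDerivAt_tangential {q : E3 → E3} {B : E3 →L[ℝ] E3} {p : E3} (hq : HasFDerivAt q B p) :
    ∃ A : E3 →L[ℝ] E3, HasFDerivAt (tangential q) A p ∧
      ∀ v, A v = B v - (⟪q p, p⟫ • v + (⟪q p, v⟫ + ⟪B v, p⟫) • p) := by
  have h := hq.sub ((hq.inner ℝ (hasFDerivAt_id p)).smul (hasFDerivAt_id p))
  refine ⟨_, h, fun v => ?_⟩
  simp

/-- Differentiating the normal part of the field produces multiples of `p`, which the projection
removes, and the shift by the normal component `⟪q p, p⟫`, which stays. -/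
lemma linearPart_tangential {q : E3 → E3} {B : E3 →L[ℝ] E3} {p : E3} (hp : ‖p‖ = 1)
    (hq : HasFDerivAt q B p) :
    linearPart (tangential q) p =
      compress (B - ⟪q p, p⟫ • ContinuousLinearMap.id ℝ E3) p := by
  obtain ⟨A, hA, hAv⟩ := hasFDerivAt_tangential hq
  unfold linearPart compress
  rw [hA.fderiv]
  ext1 v
  apply Subtype.ext
  simp only [ContinuousLinearMap.coe_coe, ContinuousLinearMap.comp_apply, subtype_comp_proj hp,
    planeProj_apply, hAv]
  simp only [sub_apply, smul_apply,
    ContinuousLinearMap.id_apply, Submodule.subtypeL_apply, inner_sub_right, inner_add_right,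
    inner_smul_right, real_inner_self_eq_norm_sq, hp]
  module

/-- The determinant condition for a node with distinct real eigenvalues. -/
def NodeCond (M : E3 →L[ℝ] E3) (p : E3) : Prop :=
  trTwo M p < trOne M p ^ 2 ∧ trOne M p ^ 2 < 2 * trTwo M p

/-- The determinant condition for a saddle. -/
def SaddleCond (M : E3 →L[ℝ] E3) (p : E3) : Prop := trOne M p ^ 2 < trTwo M p

lemma isNode_tangential {q : E3 → E3} {B : E3 →L[ℝ] E3} {p : E3} (hp : ‖p‖ = 1)
    (hq : HasFDerivAt q B p) (h0 : tangential q p = 0)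
    (h : NodeCond (B - ⟪q p, p⟫ • ContinuousLinearMap.id ℝ E3) p) : IsNode (tangential q) p := by
  obtain ⟨l, m, hlm, hc⟩ := charpoly_compress hp _ (by linarith [h.2])
  refine ⟨hp, h0, l, m, ?_, ?_⟩
  · rw [hlm]; linarith [h.1]
  · rw [linearPart_tangential hp hq, hc]

lemma isSaddle_tangential {q : E3 → E3} {B : E3 →L[ℝ] E3} {p : E3} (hp : ‖p‖ = 1)
    (hq : HasFDerivAt q B p) (h0 : tangential q p = 0)
    (h : SaddleCond (B - ⟪q p, p⟫ • ContinuousLinearMap.id ℝ E3) p) :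
    IsSaddle (tangential q) p := by
  unfold SaddleCond at h
  obtain ⟨l, m, hlm, hc⟩ := charpoly_compress hp _ (by nlinarith [sq_nonneg (trOne (B - ⟪q p, p⟫ • ContinuousLinearMap.id ℝ E3) p)])
  refine ⟨hp, h0, l, m, ?_, ?_⟩
  · rw [hlm]; linarith
  · rw [linearPart_tangential hp hq, hc]

lemma continuous_planeProj : Continuous planeProj := by
  unfold planeProj
  refine continuous_const.sub ?_
  have : Continuous fun x : (E3 →L[ℝ] ℝ) × E3 =>
    ContinuousLinearMap.smulRightL ℝ E3 E3 x.1 x.2 := by fun_prop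
  exact this.comp (f := fun p : E3 => (innerSL ℝ p, p)) (by fun_prop)

lemma continuous_trace : Continuous fun M : E3 →L[ℝ] E3 => LinearMap.trace ℝ E3 M.toLinearMap :=
  LinearMap.continuous_of_finiteDimensional
    ((LinearMap.trace ℝ E3) ∘ₗ (ContinuousLinearMap.coeLM ℝ : (E3 →L[ℝ] E3) →ₗ[ℝ] (E3 →ₗ[ℝ] E3)))

lemma continuous_trOne : Continuous fun x : (E3 →L[ℝ] E3) × E3 => trOne x.1 x.2 :=
  continuous_trace.comp (continuous_fst.clm_comp (continuous_planeProj.comp continuous_snd))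

lemma continuous_trTwo : Continuous fun x : (E3 →L[ℝ] E3) × E3 => trTwo x.1 x.2 := by
  have hP := continuous_planeProj.comp (continuous_snd (X := E3 →L[ℝ] E3) (Y := E3))
  exact continuous_trace.comp
    (continuous_fst.clm_comp (hP.clm_comp (continuous_fst.clm_comp hP)))

lemma isOpen_nodeCond : IsOpen {x : (E3 →L[ℝ] E3) × E3 | NodeCond x.1 x.2} :=
  (isOpen_lt continuous_trTwo (continuous_trOne.pow 2)).inter
    (isOpen_lt (continuous_trOne.pow 2) (continuous_const.mul continuous_trTwo))

lemma isOpen_saddleCond : IsOpen {x : (E3 →L[ℝ] E3) × E3 | SaddleCond x.1 x.2} :=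
  isOpen_lt (continuous_trOne.pow 2) continuous_trTwo

lemma trOne_eq_sum (M : E3 →L[ℝ] E3) (p : E3) :
    trOne M p = ∑ i, M (planeProj p (EuclideanSpace.single i 1)) i := by
  unfold trOne
  rw [LinearMap.trace_eq_sum_inner _ (EuclideanSpace.basisFun (Fin 3) ℝ)]
  simp [EuclideanSpace.inner_single_left]

lemma trTwo_eq_sum (M : E3 →L[ℝ] E3) (p : E3) :
    trTwo M p = ∑ i, M (planeProj p (M (planeProj p (EuclideanSpace.single i 1)))) i := by
  unfold trTwo
  rw [LinearMap.trace_eq_sum_inner _ (EuclideanSpace.basisFun (Fin 3) ℝ)]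
  simp [EuclideanSpace.inner_single_left]

/-- Both sides of the condition are homogeneous of degree two in `M`. Near a multi-saddle the linear
part is small, and this permits normalizing it. -/
lemma SaddleCond.of_smul {M : E3 →L[ℝ] E3} {p : E3} {c : ℝ} (h : SaddleCond (c • M) p) :
    SaddleCond M p := by
  unfold SaddleCond at *
  have h1 : trOne (c • M) p = c * trOne M p := by
    simp [trOne_eq_sum, Fin.sum_univ_three]
    ring
  have h2 : trTwo (c • M) p = c ^ 2 * trTwo M p := by
    simp only [trTwo_eq_sum, smul_apply, map_smul, PiLp.smul_apply,
      smul_eq_mul, Fin.sum_univ_three]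
    ring
  rw [h1, h2, mul_pow] at h
  by_contra! h'
  nlinarith [sq_nonneg c]

/-! ### Reversal of a field -/

lemma linearPart_neg (V : E3 → E3) (p : E3) : linearPart (-V) p = -linearPart V p := by
  unfold linearPart
  rw [fderiv_neg]
  ext1 v
  simp

lemma charpoly_neg_of {p : E3} (hp : ‖p‖ = 1) {T : (ℝ ∙ p)ᗮ →ₗ[ℝ] (ℝ ∙ p)ᗮ} {l m : ℝ}
    (h : T.charpoly = (Polynomial.X - Polynomial.C l) * (Polynomial.X - Polynomial.C m)) :
    (-T).charpoly =
      (Polynomial.X - Polynomial.C (-l)) * (Polynomial.X - Polynomial.C (-m)) := by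
  let b := Module.finBasisOfFinrankEq ℝ _ (finrank_plane hp)
  rw [← LinearMap.charpoly_toMatrix _ b, Matrix.charpoly_fin_two] at h ⊢
  rw [map_neg, Matrix.trace_neg, Matrix.det_neg]
  set A := LinearMap.toMatrix b b T
  -- The values at 0 and 1 recover the determinant and the trace.
  have h0 := congrArg (Polynomial.eval 0) h
  have h1 := congrArg (Polynomial.eval 1) h
  simp at h0 h1
  have ht : A.trace = l + m := by linarith
  rw [h0, ht]
  simp
  ring

lemma IsNode.neg {V : E3 → E3} {p : E3} (h : IsNode V p) : IsNode (-V) p := by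
  obtain ⟨hp, h0, l, m, hlm, hc⟩ := h
  refine ⟨hp, by simp [h0], -l, -m, by linarith, ?_⟩
  rw [linearPart_neg, charpoly_neg_of hp hc]

lemma IsSaddle.neg {V : E3 → E3} {p : E3} (h : IsSaddle V p) : IsSaddle (-V) p := by
  obtain ⟨hp, h0, l, m, hlm, hc⟩ := h
  refine ⟨hp, by simp [h0], -l, -m, by linarith, ?_⟩
  rw [linearPart_neg, charpoly_neg_of hp hc]

lemma IsMultiSaddle.neg {V : E3 → E3} {p : E3} {m : ℕ} (h : IsMultiSaddle V p m) :
    IsMultiSaddle (-V) p m := by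
  obtain ⟨hp, h0, u, v, hu, hv, huv, hup, hvp, C, hC, ho⟩ := h
  refine ⟨hp, by simp [h0], u, v, hu, hv, huv, hup, hvp, -C, neg_ne_zero.2 hC, ?_⟩
  refine ho.neg_left.congr_left fun e => ?_
  simp
  ring

/-! ### Persistence of nondegenerate zeros -/

/-- If `f + g` deviates from the isomorphism `f'` by a Lipschitz error below the inverse of the norm
of `f'.symm`, it is injective on the ball and covers a ball of proportional radius. The radius of
uniqueness `r₀` is fixed before the radius of existence `r`. -/
lemma exists_unique_zero_perturbed {X Y : Type*} [NormedAddCommGroup X] [NormedSpace ℝ X]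
    [CompleteSpace X] [NormedAddCommGroup Y] [NormedSpace ℝ Y] {f : X → Y} {f' : X ≃L[ℝ] Y}
    {x₀ : X} (h : HasStrictFDerivAt f (f' : X →L[ℝ] Y) x₀) (h0 : f x₀ = 0) :
    ∃ r₀ > 0, r₀ ≤ 1 ∧ ∀ r, 0 < r → r ≤ r₀ → ∃ ε > 0, ∀ g : X → Y,
      (∀ x ∈ closedBall x₀ r₀, ∀ y ∈ closedBall x₀ r₀, ‖g x - g y‖ ≤ ε * ‖x - y‖) →
      ‖g x₀‖ ≤ ε → (∃ x ∈ closedBall x₀ r, f x + g x = 0) ∧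
        ∀ x ∈ closedBall x₀ r₀, ∀ y ∈ closedBall x₀ r₀,
          f x + g x = 0 → f y + g y = 0 → x = y := by
  obtain ⟨K, hK0, hK⟩ : ∃ K : NNReal, 0 < K ∧ ∀ y, ‖f'.symm y‖ ≤ K * ‖y‖ :=
    ⟨‖(f'.symm : Y →L[ℝ] X)‖₊ + 1, by positivity, fun y =>
      ((f'.symm : Y →L[ℝ] X).le_opNorm y).trans (by push_cast; gcongr; simp)⟩
  have hKR : (0 : ℝ) < K := hK0
  -- The Lipschitz error budget 1/(2K) is divided equally between the nonlinearity of `f` and the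
  -- perturbation `g`.
  obtain ⟨s, hs, happ⟩ := h.approximates_deriv_on_nhds (c := (4 * K)⁻¹) (Or.inr (by positivity))
  obtain ⟨r₁, hr₁, hball⟩ := nhds_basis_closedBall.mem_iff.1 hs
  obtain ⟨r₀, hr₀, hr01, hsr⟩ : ∃ r₀ > 0, r₀ ≤ 1 ∧ r₀ ≤ r₁ :=
    ⟨min 1 r₁, by positivity, min_le_left _ _, min_le_right _ _⟩
  -- The image of the ball of radius `r` covers radius (1/K - 1/(2K)) r = r/(2K) about `g x₀`; the
  -- second bound on ε puts 0 inside.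
  refine ⟨r₀, hr₀, hr01, fun r hr hrs => ⟨min (4 * (K : ℝ))⁻¹ (r * (2 * (K : ℝ))⁻¹), by positivity,
    fun g hg hg0 => ?_⟩⟩
  have hcl : ApproximatesLinearOn (fun x => f x + g x) (f' : X →L[ℝ] Y) (closedBall x₀ r₀)
      (2 * K)⁻¹ := by
    intro x hx y hy
    have h1 := happ x (hball (closedBall_subset_closedBall hsr hx)) y
      (hball (closedBall_subset_closedBall hsr hy))
    have h2 := (hg x hx y hy).trans
      (mul_le_mul_of_nonneg_right (min_le_left _ _) (norm_nonneg (x - y)))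
    push_cast at h1 ⊢
    calc ‖f x + g x - (f y + g y) - (f' : X →L[ℝ] Y) (x - y)‖
        = ‖(f x - f y - (f' : X →L[ℝ] Y) (x - y)) + (g x - g y)‖ := by congr 1; abel
      _ ≤ (4 * (K : ℝ))⁻¹ * ‖x - y‖ + (4 * (K : ℝ))⁻¹ * ‖x - y‖ := (norm_add_le _ _).trans (add_le_add h1 h2)
      _ = (2 * (K : ℝ))⁻¹ * ‖x - y‖ := by field_simp; ring
  constructor
  · let inv : (f' : X →L[ℝ] Y).NonlinearRightInverse :=
      { toFun := f'.symm
        nnnorm := K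
        bound' := hK
        right_inv' := fun y => by simp }
    have hsurj := hcl.surjOn_closedBall_of_nonlinearRightInverse inv hr.le
      (closedBall_subset_closedBall hrs)
    have h0mem : (0 : Y) ∈ closedBall (f x₀ + g x₀)
        (((inv.nnnorm : ℝ)⁻¹ - ((2 * K)⁻¹ : NNReal)) * r) := by
      rw [mem_closedBall, dist_eq_norm, h0]
      simp only [zero_add, zero_sub, norm_neg]
      refine hg0.trans ((min_le_right _ _).trans (le_of_eq ?_))
      change _ = ((K : ℝ)⁻¹ - _) * r
      push_cast
      field_simp
      ring
    exact hsurj h0mem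
  · intro x hx y hy hx0 hy0
    have h1 := hcl x hx y hy
    simp only [hx0, hy0, sub_self, zero_sub, norm_neg] at h1
    have h2 := hK (f' (x - y))
    rw [f'.symm_apply_apply] at h2
    have h3 : ‖x - y‖ ≤ 1 / 2 * ‖x - y‖ := by
      calc ‖x - y‖ ≤ K * ‖f' (x - y)‖ := h2
        _ ≤ K * ((2 * K)⁻¹ * ‖x - y‖) := by
            gcongr
            exact_mod_cast h1
        _ = 1 / 2 * ‖x - y‖ := by push_cast; field_simp
    have := norm_nonneg (x - y)
    rw [← sub_eq_zero, ← norm_eq_zero]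
    linarith

/-- Two fields with given derivatives are `ε`-close, in the sense of class `C¹`, on the ball of
radius two. -/
def C1Near (ε : ℝ) (q : E3 → E3) (Dq : E3 → E3 →L[ℝ] E3) (q₀ : E3 → E3)
    (Dq₀ : E3 → E3 →L[ℝ] E3) : Prop :=
  ∀ x, ‖x‖ ≤ 2 → ‖q x - q₀ x‖ ≤ ε ∧ ‖Dq x - Dq₀ x‖ ≤ ε

lemma C1Near.lipschitz {ε : ℝ} {q q₀ : E3 → E3} {Dq Dq₀ : E3 → E3 →L[ℝ] E3}
    (h : C1Near ε q Dq q₀ Dq₀) (hq : ∀ x, HasFDerivAt q (Dq x) x)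
    (hq₀ : ∀ x, HasFDerivAt q₀ (Dq₀ x) x) {x y : E3} (hx : ‖x‖ ≤ 2) (hy : ‖y‖ ≤ 2) :
    ‖(q x - q₀ x) - (q y - q₀ y)‖ ≤ ε * ‖x - y‖ := by
  refine (convex_closedBall (0 : E3) 2).norm_image_sub_le_of_norm_hasFDerivWithin_le
    (f := fun x => q x - q₀ x) (f' := fun x => Dq x - Dq₀ x)
    (fun z _ => ((hq z).sub (hq₀ z)).hasFDerivWithinAt) (fun z hz => (h z ?_).2) ?_ ?_
  · simpa using hz
  · simpa using hy
  · simpa using hx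

lemma tangential_eq_zero_of_smul {q : E3 → E3} {e : E3} (he : ‖e‖ = 1) {l : ℝ}
    (h : q e = l • e) : tangential q e = 0 := by
  simp [tangential, h, real_inner_smul_left, he]

/-- The derivative of `(e, l) ↦ (q e - l • e, ‖e‖ ^ 2 - 1)` at a nondegenerate zero. -/
lemma exists_lagrange_equiv {p : E3} (hp : ‖p‖ = 1) (B : E3 →L[ℝ] E3) (μ : ℝ)
    (hne : trOne (B - μ • ContinuousLinearMap.id ℝ E3) p ^ 2 ≠
      trTwo (B - μ • ContinuousLinearMap.id ℝ E3) p) :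
    ∃ f' : (E3 × ℝ) ≃L[ℝ] (E3 × ℝ), ∀ x, f' x = (B x.1 - (μ • x.1 + x.2 • p), 2 * ⟪p, x.1⟫) := by
  let T : (E3 × ℝ) →ₗ[ℝ] (E3 × ℝ) :=
    { toFun := fun x => (B x.1 - (μ • x.1 + x.2 • p), 2 * ⟪p, x.1⟫)
      map_add' := fun x y => by
        refine Prod.ext ?_ ?_
        · simp; module
        · simp [inner_add_right]; ring
      map_smul' := fun c x => by
        refine Prod.ext ?_ ?_
        · simp; module
        · simp [inner_smul_right]; ring }
  -- In finite dimension injectivity suffices. A kernel element has `v` orthogonal to `p` with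
  -- compressed image zero, so `v = 0`, and then `l • p = 0`.
  have hT : Function.Injective T := by
    rw [injective_iff_map_eq_zero]
    rintro ⟨v, l⟩ h
    have h1 : B v - (μ • v + l • p) = 0 := congrArg Prod.fst h
    have h2 : 2 * ⟪p, v⟫ = 0 := congrArg Prod.snd h
    have hv : v = 0 := by
      refine compress_injective hp _ hne (l := l) (by linarith) ?_
      simp only [sub_apply, smul_apply, ContinuousLinearMap.id_apply]
      rw [← sub_eq_zero, ← h1]
      abel
    subst hv
    have hp0 : p ≠ 0 := by rintro rfl; simp at hp
    simp [hp0] at h1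
    simp [h1]
  exact ⟨(LinearEquiv.ofInjectiveEndo T hT).toContinuousLinearEquiv, fun x => rfl⟩

/-- A zero of the tangential part is a solution of q e = l e, |e|² = 1. As a system for `(e, l)`
this lives in a linear space and no charts of the sphere are needed. Uniqueness and the open
condition `O` hold on the fixed radius `κ₀`, while the zero is located within any prescribed `κ`. -/
theorem persistent_zero {q₀ : E3 → E3} {Dq₀ : E3 → E3 →L[ℝ] E3}
    (hq₀ : ∀ x, HasFDerivAt q₀ (Dq₀ x) x) (hc : Continuous Dq₀) {p : E3} (hp : ‖p‖ = 1)
    (h0 : tangential q₀ p = 0) {O : Set ((E3 →L[ℝ] E3) × E3)} (hO : IsOpen O)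
    (hmem : (Dq₀ p - ⟪q₀ p, p⟫ • ContinuousLinearMap.id ℝ E3, p) ∈ O)
    (hne : trOne (Dq₀ p - ⟪q₀ p, p⟫ • ContinuousLinearMap.id ℝ E3) p ^ 2 ≠
      trTwo (Dq₀ p - ⟪q₀ p, p⟫ • ContinuousLinearMap.id ℝ E3) p) :
    ∃ κ₀ > 0, κ₀ ≤ 1 ∧ ∀ κ, 0 < κ → κ ≤ κ₀ → ∃ ε > 0, ∀ q Dq,
      (∀ x, HasFDerivAt q (Dq x) x) → C1Near ε q Dq q₀ Dq₀ →
      (∃ e, ‖e‖ = 1 ∧ ‖e - p‖ ≤ κ ∧ tangential q e = 0) ∧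
      (∀ e e', ‖e‖ = 1 → ‖e'‖ = 1 → ‖e - p‖ ≤ κ₀ → ‖e' - p‖ ≤ κ₀ → tangential q e = 0 →
        tangential q e' = 0 → e = e') ∧
      ∀ e, ‖e‖ = 1 → ‖e - p‖ ≤ κ₀ → (Dq e - ⟪q e, e⟫ • ContinuousLinearMap.id ℝ E3, e) ∈ O := by
  set μ := ⟪q₀ p, p⟫ with hμ
  obtain ⟨f', hf'⟩ := exists_lagrange_equiv hp _ _ hne
  have hqc : Continuous q₀ := continuous_iff_continuousAt.2 fun x => (hq₀ x).continuousAt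
  have hstrict : HasStrictFDerivAt q₀ (Dq₀ p) p :=
    hasStrictFDerivAt_of_hasFDerivAt_of_continuousAt (Eventually.of_forall hq₀) hc.continuousAt
  let f : E3 × ℝ → E3 × ℝ := fun x => (q₀ x.1 - x.2 • x.1, ‖x.1‖ ^ 2 - 1)
  have hf : HasStrictFDerivAt f (f' : (E3 × ℝ) →L[ℝ] (E3 × ℝ)) (p, μ) := by
    have h1 : HasStrictFDerivAt (fun x : E3 × ℝ => x.1) (ContinuousLinearMap.fst ℝ E3 ℝ) (p, μ) :=
      hasStrictFDerivAt_fst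
    have h2 : HasStrictFDerivAt (fun x : E3 × ℝ => x.2) (ContinuousLinearMap.snd ℝ E3 ℝ) (p, μ) :=
      hasStrictFDerivAt_snd
    have h3 := (HasStrictFDerivAt.comp (p, μ) (f := Prod.fst) hstrict h1).sub (h2.smul h1)
    have h4 := ((HasStrictFDerivAt.comp (p, μ) (f := Prod.fst)
      (hasStrictFDerivAt_norm_sq p) h1).sub_const (1 : ℝ))
    refine (h3.prodMk h4).congr_fderiv ?_
    refine ContinuousLinearMap.ext fun x => ?_
    simp [hf']
  have hqp : q₀ p = μ • p := by
    have := h0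
    rwa [tangential, sub_eq_zero] at this
  have hf0 : f (p, μ) = 0 := by simp [f, hqp, hp]
  obtain ⟨r₀, hr₀, hr01, hZ⟩ := exists_unique_zero_perturbed hf hf0
  obtain ⟨ρ, hρ, hρO⟩ := Metric.isOpen_iff.1 hO _ hmem
  let Ψ : E3 → (E3 →L[ℝ] E3) × E3 := fun e =>
    (Dq₀ e - ⟪q₀ e, e⟫ • ContinuousLinearMap.id ℝ E3, e)
  have hΨ : Continuous Ψ := by fun_prop
  have hin : Continuous fun e : E3 => ⟪q₀ e, e⟫ := by fun_prop
  obtain ⟨κ₁, hκ₁, hκ₁b⟩ := Metric.continuousAt_iff.1 (hΨ.continuousAt (x := p)) (ρ / 2) (by positivity)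
  obtain ⟨κ₂, hκ₂, hκ₂b⟩ := Metric.continuousAt_iff.1 (hin.continuousAt (x := p)) (r₀ / 2) (by positivity)
  refine ⟨min (min (κ₁ / 2) (κ₂ / 2)) (min r₀ 1), by positivity,
    (min_le_right _ _).trans (min_le_right _ _), fun κ hκ hκle => ?_⟩
  have hκr : κ ≤ r₀ := hκle.trans ((min_le_right _ _).trans (min_le_left _ _))
  obtain ⟨ε, hε, hεZ⟩ := hZ κ hκ hκr
  refine ⟨min ε (min (r₀ / 2) (ρ / 8)), by positivity, fun q Dq hq hnear => ?_⟩
  set ε' := min ε (min (r₀ / 2) (ρ / 8)) with hε'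
  have hε'0 : 0 < ε' := by positivity
  have hε1 : ε' ≤ ε := min_le_left _ _
  have hε2 : ε' ≤ r₀ / 2 := (min_le_right _ _).trans (min_le_left _ _)
  have hε3 : ε' ≤ ρ / 8 := (min_le_right _ _).trans (min_le_right _ _)
  -- This is why `C1Near` uses the ball of radius two: it contains the unit ball about every unit
  -- vector.
  have h2 : ∀ x : E3, ‖x - p‖ ≤ 1 → ‖x‖ ≤ 2 := fun x hx => by
    have := norm_add_le (x - p) p
    rw [sub_add_cancel, hp] at this
    linarith
  have hzero : ∀ e : E3, ‖e‖ = 1 → ∀ l : ℝ,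
      (f (e, l) + (q e - q₀ e, (0 : ℝ)) = 0 ↔ q e = l • e) := by
    intro e he l
    simp only [f, he, Prod.mk_add_mk, Prod.mk_eq_zero]
    rw [← sub_eq_zero (b := l • e)]
    constructor
    · intro h; rw [← h.1]; abel
    · intro h; refine ⟨?_, by norm_num⟩; rw [← h]; abel
  have hlip : ∀ x ∈ closedBall ((p, μ) : E3 × ℝ) r₀, ∀ y ∈ closedBall ((p, μ) : E3 × ℝ) r₀,
      ‖((q x.1 - q₀ x.1, 0) : E3 × ℝ) - (q y.1 - q₀ y.1, 0)‖ ≤ ε * ‖x - y‖ := by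
    intro x hx y hy
    have aux : ∀ x ∈ closedBall ((p, μ) : E3 × ℝ) r₀, ‖x.1‖ ≤ 2 := fun x hx => by
      refine h2 _ (le_trans ?_ hr01)
      rw [mem_closedBall, dist_eq_norm] at hx
      exact (norm_fst_le (x - (p, μ))).trans hx
    have := hnear.lipschitz hq hq₀ (aux x hx) (aux y hy)
    rw [Prod.mk_sub_mk, sub_zero, Prod.norm_mk, norm_zero, max_eq_left (norm_nonneg _)]
    refine this.trans ?_
    gcongr
    exact norm_fst_le (x - y)
  have hsmall : ‖((q p - q₀ p, 0) : E3 × ℝ)‖ ≤ ε := by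
    rw [Prod.norm_mk, norm_zero, max_eq_left (norm_nonneg _)]
    exact ((hnear p (by rw [hp]; norm_num)).1).trans hε1
  obtain ⟨hex, huniq⟩ := hεZ (fun x => (q x.1 - q₀ x.1, 0)) hlip hsmall
  -- Closeness of the multipliers brings the pair `(e, ⟪q e, e⟫)` into the ball of `E3 × ℝ` where
  -- zeros are unique.
  have hlam : ∀ e : E3, ‖e‖ = 1 → ‖e - p‖ ≤ min (min (κ₁ / 2) (κ₂ / 2)) (min r₀ 1) →
      ‖⟪q e, e⟫ - ⟪q₀ e, e⟫‖ ≤ ε' := by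
    intro e he _
    rw [← inner_sub_left]
    refine (norm_inner_le_norm _ _).trans ?_
    rw [he, mul_one]
    exact (hnear e (by rw [he]; norm_num)).1
  refine ⟨?_, ?_, ?_⟩
  · obtain ⟨⟨e, l⟩, hx, hx0⟩ := hex
    have he : ‖e‖ = 1 := by
      have := congrArg Prod.snd hx0
      simp only [f, Prod.snd_add, Prod.snd_zero, add_zero] at this
      have h1 : ‖e‖ ^ 2 = 1 := by linarith
      exact (pow_eq_one_iff_of_nonneg (norm_nonneg e) two_ne_zero).1 h1
    refine ⟨e, he, ?_, tangential_eq_zero_of_smul he ((hzero e he l).1 hx0)⟩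
    rw [mem_closedBall, dist_eq_norm] at hx
    exact (norm_fst_le ((e, l) - (p, μ))).trans hx
  · intro e e' he he' hep hep' hz hz'
    have hmem' : ∀ e : E3, ‖e‖ = 1 → ‖e - p‖ ≤ min (min (κ₁ / 2) (κ₂ / 2)) (min r₀ 1) →
        (e, ⟪q e, e⟫) ∈ closedBall ((p, μ) : E3 × ℝ) r₀ := by
      intro e he hep
      rw [mem_closedBall, Prod.dist_eq, max_le_iff]
      refine ⟨?_, ?_⟩
      · rw [dist_eq_norm]
        exact hep.trans ((min_le_right _ _).trans (min_le_left _ _))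
      · have h3 := hκ₂b (x := e) (by
          rw [dist_eq_norm]
          have := hep.trans ((min_le_left _ _).trans (min_le_right _ _))
          linarith)
        have h4 := hlam e he hep
        rw [← dist_eq_norm] at h4
        have := dist_triangle ⟪q e, e⟫ ⟪q₀ e, e⟫ μ
        simp only at *
        linarith
    have hsm : ∀ e : E3, tangential q e = 0 → q e = ⟪q e, e⟫ • e := fun e h => by
      rwa [tangential, sub_eq_zero] at h
    exact congrArg Prod.fst (huniq _ (hmem' e he hep) _ (hmem' e' he' hep')
      ((hzero e he _).2 (hsm e hz)) ((hzero e' he' _).2 (hsm e' hz')))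
  · intro e he hep
    refine hρO ?_
    have h3 := hκ₁b (x := e) (by
      rw [dist_eq_norm]
      have := hep.trans ((min_le_left _ _).trans (min_le_left _ _))
      linarith)
    rw [mem_ball]
    refine (dist_triangle _ (Ψ e) _).trans_lt ?_
    have h4 : dist ((Dq e - ⟪q e, e⟫ • ContinuousLinearMap.id ℝ E3, e) : (E3 →L[ℝ] E3) × E3) (Ψ e)
        ≤ 2 * ε' := by
      rw [Prod.dist_eq, max_le_iff]
      refine ⟨?_, by simp [Ψ]; positivity⟩
      rw [dist_eq_norm]
      calc ‖Dq e - ⟪q e, e⟫ • ContinuousLinearMap.id ℝ E3 -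
            (Dq₀ e - ⟪q₀ e, e⟫ • ContinuousLinearMap.id ℝ E3)‖
          = ‖(Dq e - Dq₀ e) - (⟪q e, e⟫ - ⟪q₀ e, e⟫) • ContinuousLinearMap.id ℝ E3‖ := by
            congr 1; module
        _ ≤ ε' + ε' * 1 := by
            refine (norm_sub_le _ _).trans (add_le_add (hnear e (by rw [he]; norm_num)).2 ?_)
            rw [norm_smul]
            exact mul_le_mul (hlam e he hep) ContinuousLinearMap.norm_id_le (norm_nonneg _) hε'0.le
        _ = 2 * ε' := by ring
    linarith

/-! ### Continuous dependence of unique zeros -/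

/-- By compactness it suffices to identify every cluster point of `z` at `τ`. Such a point satisfies
the closed condition at time `τ`, hence equals `z τ` by uniqueness. -/
lemma continuousOn_of_unique {X Y : Type*} [TopologicalSpace X] [TopologicalSpace Y] {S : Set X}
    (hS : IsCompact S) {I : Set ℝ} {Φ : ℝ × X → Y} (hΦ : ContinuousOn Φ (I ×ˢ Set.univ))
    {T : Set Y} (hT : IsClosed T) {z : ℝ → X} (hz : ∀ τ ∈ I, z τ ∈ S ∧ Φ (τ, z τ) ∈ T)
    (huniq : ∀ τ ∈ I, ∀ e ∈ S, Φ (τ, e) ∈ T → e = z τ) : ContinuousOn z I := by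
  intro τ hτ
  refine hS.tendsto_nhds_of_unique_mapClusterPt
    (eventually_of_mem self_mem_nhdsWithin fun t ht => (hz t ht).1) fun e he hcl => ?_
  refine huniq τ hτ e he ?_
  rw [mapClusterPt_iff_ultrafilter] at hcl
  obtain ⟨U, hU, hUe⟩ := hcl
  have hpair : Tendsto (fun t => (t, z t)) U (𝓝[I ×ˢ Set.univ] (τ, e)) := by
    refine tendsto_nhdsWithin_iff.2 ⟨?_, ?_⟩
    · exact Tendsto.prodMk_nhds ((tendsto_id'.2 hU).mono_right nhdsWithin_le_nhds) hUe
    · filter_upwards [hU self_mem_nhdsWithin] with t ht using ⟨ht, trivial⟩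
  refine hT.mem_of_tendsto ((hΦ (τ, e) ⟨hτ, trivial⟩).tendsto.comp hpair) ?_
  filter_upwards [hU self_mem_nhdsWithin] with t ht using (hz t ht).2

/-! ### Perturbations of `ξ ^ m = 1` -/

/-- The derivative of 1 - x^m at 1 is multiplication by -m, which is invertible. The other roots of
unity are reduced to this one by a rotation. -/
lemma exists_root_near_one (m : ℕ) (hm : m ≠ 0) :
    ∃ θ₀ > 0, θ₀ ≤ 1 ∧ ∀ θ, 0 < θ → θ ≤ θ₀ → ∃ ε > 0, ∀ G : ℂ → ℂ,
      (∀ x ∈ closedBall (1 : ℂ) θ₀, ∀ y ∈ closedBall (1 : ℂ) θ₀, ‖G x - G y‖ ≤ ε * ‖x - y‖) →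
      ‖G 1‖ ≤ ε → (∃ x ∈ closedBall (1 : ℂ) θ, 1 - x ^ m + G x = 0) ∧
        ∀ x ∈ closedBall (1 : ℂ) θ₀, ∀ y ∈ closedBall (1 : ℂ) θ₀,
          1 - x ^ m + G x = 0 → 1 - y ^ m + G y = 0 → x = y := by
  have hm' : (-(m : ℂ)) ≠ 0 := by simpa using hm
  let u : ℂˣ := Units.mk0 _ hm'
  let f' : ℂ ≃L[ℝ] ℂ := (ContinuousLinearEquiv.unitsEquivAut ℂ u).restrictScalars ℝ
  have h : HasStrictFDerivAt (fun x : ℂ => 1 - x ^ m) (f' : ℂ →L[ℝ] ℂ) 1 := by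
    have := ((hasStrictDerivAt_pow m (1 : ℂ)).const_sub 1).hasStrictFDerivAt.restrictScalars ℝ
    refine this.congr_fderiv ?_
    refine ContinuousLinearMap.ext fun x => ?_
    simp [f', u]
  exact exists_unique_zero_perturbed h (by simp)

/-- The modulus |ξ^m - 1| is the product of the distances from ξ to the m roots of unity, so one of
these distances is small. -/
lemma exists_root_of_unity_near (m : ℕ) (hm : m ≠ 0) {θ : ℝ} (hθ : 0 < θ) {ξ : ℂ}
    (h : ‖ξ ^ m - 1‖ < θ ^ m) : ∃ ω : ℂ, ω ^ m = 1 ∧ ‖ξ - ω‖ < θ := by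
  by_contra! hcon
  have hprim := Complex.isPrimitiveRoot_exp m hm
  have hprod := congrArg (Polynomial.eval ξ)
    (Polynomial.X_pow_sub_one_eq_prod (Nat.pos_of_ne_zero hm) hprim)
  simp only [Polynomial.eval_sub, Polynomial.eval_pow, Polynomial.eval_X, Polynomial.eval_one,
    Polynomial.eval_prod, Polynomial.eval_C] at hprod
  rw [hprod, norm_prod] at h
  have : ∏ _x ∈ Polynomial.nthRootsFinset m (1 : ℂ), θ ≤
      ∏ x ∈ Polynomial.nthRootsFinset m (1 : ℂ), ‖ξ - x‖ := by
    refine Finset.prod_le_prod (fun _ _ => hθ.le) fun x hx => hcon x ?_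
    rwa [Polynomial.mem_nthRootsFinset (Nat.pos_of_ne_zero hm)] at hx
  rw [Finset.prod_const, hprim.card_nthRootsFinset] at this
  linarith

/-! ### Continuous roots of a nonvanishing function on an interval -/

/-- A logarithm of `u` is obtained by integrating u'/u from a base point; dividing it by `m` and
exponentiating gives the root up to a constant factor. -/
lemma exists_continuous_root {u : ℝ → ℂ} (hu : ContDiff ℝ 1 u) {I : Set ℝ} (hI : I.OrdConnected)
    (h0 : ∀ τ ∈ I, u τ ≠ 0) (m : ℕ) (hm : m ≠ 0) :
    ∃ b : ℝ → ℂ, ContinuousOn b I ∧ ∀ τ ∈ I, b τ ^ m = u τ := by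
  rcases I.eq_empty_or_nonempty with rfl | ⟨τ₀, hτ₀⟩
  · exact ⟨0, by simp, by simp⟩
  -- Passing to an open interval around `I` on which `u` does not vanish makes two-sided derivatives
  -- available at the endpoints of `I`.
  set J := connectedComponentIn {τ | u τ ≠ 0} τ₀ with hJ
  have hopen : IsOpen {τ | u τ ≠ 0} := isOpen_ne_fun hu.continuous continuous_const
  have hJo : IsOpen J := hopen.connectedComponentIn
  have hJp : IsPreconnected J := isPreconnected_connectedComponentIn
  have hIJ : I ⊆ J := hI.isPreconnected.subset_connectedComponentIn hτ₀ h0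
  have hJne : ∀ τ ∈ J, u τ ≠ 0 := fun τ hτ => connectedComponentIn_subset _ _ hτ
  have hJord : J.OrdConnected := hJp.ordConnected
  set v : ℝ → ℂ := fun τ => deriv u τ / u τ
  have hv : ContinuousOn v J := (hu.continuous_deriv le_rfl).continuousOn.div
    hu.continuous.continuousOn hJne
  set l : ℝ → ℂ := fun τ => ∫ t in τ₀..τ, v t
  have hl : ∀ τ ∈ J, HasDerivAt l (v τ) τ := by
    intro τ hτ
    refine intervalIntegral.integral_hasDerivAt_right ?_ ?_ ?_
    · exact (hv.mono (hJord.uIcc_subset (hIJ hτ₀) hτ)).intervalIntegrable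
    · exact hv.stronglyMeasurableAtFilter hJo τ hτ
    · exact hv.continuousAt (hJo.mem_nhds hτ)
  obtain ⟨c, hc⟩ : ∃ c : ℂ, ∀ τ ∈ J, u τ * Complex.exp (-l τ) = c := by
    have hd : ∀ τ ∈ J, HasDerivAt (fun τ => u τ * Complex.exp (-l τ)) 0 τ := by
      intro τ hτ
      have h1 := ((hu.differentiable one_ne_zero).differentiableAt (x := τ)).hasDerivAt.mul
        ((hl τ hτ).neg.cexp)
      refine h1.congr_deriv ?_
      have := hJne τ hτ
      simp only [v, Pi.neg_apply]
      field_simp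
      ring
    exact ⟨_, fun τ hτ => hJo.is_const_of_deriv_eq_zero hJp
      (fun τ hτ => (hd τ hτ).differentiableAt.differentiableWithinAt)
      (fun τ hτ => (hd τ hτ).deriv) hτ (hIJ hτ₀)⟩
  obtain ⟨c', hc'⟩ := IsAlgClosed.exists_pow_nat_eq c (Nat.pos_of_ne_zero hm)
  refine ⟨fun τ => c' * Complex.exp (l τ / m), ?_, fun τ hτ => ?_⟩
  · intro τ hτ
    have := (hl τ (hIJ hτ)).continuousAt.continuousWithinAt (s := I)
    exact continuousWithinAt_const.mul ((this.div_const _).cexp)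
  · have hm' : (m : ℂ) ≠ 0 := by exact_mod_cast hm
    rw [mul_pow, hc', ← Complex.exp_nat_mul, mul_div_cancel₀ _ hm', ← hc τ (hIJ hτ), mul_assoc,
      ← Complex.exp_add]
    simp

/-! ### The field as a vector-valued integral -/

/-- The constant `1 / (2 √(2π))`. -/
def ampConst : ℝ := 1 / (2 * Real.sqrt (2 * Real.pi))

lemma ampConst_pos : 0 < ampConst := by unfold ampConst; positivity

lemma ampConst_le_one : ampConst ≤ 1 := by
  unfold ampConst
  rw [div_le_one (by positivity)]
  have : 1 ≤ Real.sqrt (2 * Real.pi) := Real.one_le_sqrt.2 (by linarith [Real.pi_gt_three])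
  linarith

/-- The wave number `2πn / L_t`. -/
def waveNumber (Q : ℝ → E3) (n : ℕ) : ℝ := 2 * Real.pi * n / totalLength Q

/-- The derivative of `qVec` with respect to the direction. -/
def dqVec (Q : ℝ → E3) (n : ℕ) (τ : ℝ) (e : E3) : E3 →L[ℝ] E3 :=
  ampConst • ∫ σ in (0 : ℝ)..(2 * Real.pi),
    (Real.sin (phase Q n τ e σ) * waveNumber Q n) •
      (innerSL ℝ (Q σ - meanPosition Q)).smulRight (deriv Q σ)

lemma IsClosedCurve.continuous {Q : ℝ → E3} (h : IsClosedCurve Q) : Continuous Q := h.1.continuous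

lemma IsClosedCurve.continuous_deriv {Q : ℝ → E3} (h : IsClosedCurve Q) : Continuous (deriv Q) :=
  h.1.continuous_deriv le_rfl

lemma IsClosedCurve.continuous_arcLength {Q : ℝ → E3} (h : IsClosedCurve Q) :
    Continuous (arcLength Q) :=
  intervalIntegral.continuous_primitive
    (fun _ _ => h.continuous_deriv.norm.intervalIntegrable _ _) 0

lemma phase_eq (Q : ℝ → E3) (n : ℕ) (τ : ℝ) (e : E3) (σ : ℝ) :
    phase Q n τ e σ = waveNumber Q n *
      ((arcLength Q σ - τ * totalLength Q / (2 * Real.pi)) - ⟪Q σ - meanPosition Q, e⟫) := rfl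

lemma IsClosedCurve.continuous_phase {Q : ℝ → E3} (h : IsClosedCurve Q) (n : ℕ) :
    Continuous fun x : (ℝ × E3) × ℝ => phase Q n x.1.1 x.1.2 x.2 := by
  have h1 := h.continuous
  have h2 := h.continuous_arcLength
  simp only [phase_eq]
  fun_prop

lemma continuous_coord {f : ℝ → E3} (hf : Continuous f) (i : Fin 3) :
    Continuous fun σ => f σ i := by fun_prop

lemma amplitude_re_im {Q : ℝ → E3} (h : IsClosedCurve Q) (n : ℕ) (τ : ℝ) (e : E3) (i : Fin 3) :
    (amplitude Q n τ e i).re = ampConst * ∫ σ in (0 : ℝ)..(2 * Real.pi),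
        Real.cos (phase Q n τ e σ) * deriv Q σ i ∧
    (amplitude Q n τ e i).im = ampConst * ∫ σ in (0 : ℝ)..(2 * Real.pi),
        Real.sin (phase Q n τ e σ) * deriv Q σ i := by
  have hph : Continuous fun σ => phase Q n τ e σ :=
    (h.continuous_phase n).comp (f := fun σ => ((τ, e), σ)) (by fun_prop)
  have hd := continuous_coord h.continuous_deriv i
  have hint : IntervalIntegrable (fun σ => (deriv Q σ i : ℂ) *
      Complex.exp (Complex.I * (phase Q n τ e σ : ℂ))) MeasureTheory.volume 0 (2 * Real.pi) := by
    exact ((Complex.continuous_ofReal.comp hd).mul (Complex.continuous_exp.comp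
      (continuous_const.mul (Complex.continuous_ofReal.comp hph)))).intervalIntegrable _ _
  unfold amplitude
  rw [Complex.re_ofReal_mul, Complex.im_ofReal_mul]
  have h1 := Complex.reCLM.intervalIntegral_comp_comm hint
  have h2 := Complex.imCLM.intervalIntegral_comp_comm hint
  simp only [Complex.reCLM_apply, Complex.imCLM_apply] at h1 h2
  rw [← h1, ← h2]
  refine ⟨?_, ?_⟩
  · congr 1
    refine intervalIntegral.integral_congr fun σ _ => ?_
    simp only [Complex.re_ofReal_mul]
    rw [mul_comm Complex.I, Complex.exp_ofReal_mul_I_re, mul_comm]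
  · congr 1
    refine intervalIntegral.integral_congr fun σ _ => ?_
    simp only [Complex.im_ofReal_mul]
    rw [mul_comm Complex.I, Complex.exp_ofReal_mul_I_im, mul_comm]

lemma integral_apply {f : ℝ → E3} (hf : Continuous f) (a b : ℝ) (i : Fin 3) :
    (∫ σ in a..b, f σ) i = ∫ σ in a..b, f σ i :=
  ((EuclideanSpace.proj (𝕜 := ℝ) i).intervalIntegral_comp_comm (hf.intervalIntegrable a b)).symm

lemma qVec_eq_integral {Q : ℝ → E3} (h : IsClosedCurve Q) (n : ℕ) (τ : ℝ) (e : E3) :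
    qVec Q n τ e = ampConst • ∫ σ in (0 : ℝ)..(2 * Real.pi),
      Real.cos (phase Q n τ e σ) • deriv Q σ := by
  have hph : Continuous fun σ => phase Q n τ e σ :=
    (h.continuous_phase n).comp (f := fun σ => ((τ, e), σ)) (by fun_prop)
  have hd := h.continuous_deriv
  ext i
  rw [PiLp.smul_apply, integral_apply (by fun_prop), smul_eq_mul]
  exact (amplitude_re_im h n τ e i).1

lemma hasFDerivAt_qVec {Q : ℝ → E3} (h : IsClosedCurve Q) (n : ℕ) (τ : ℝ) (e : E3) :
    HasFDerivAt (qVec Q n τ) (dqVec Q n τ e) e := by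
  have hQ := h.continuous
  have hd := h.continuous_deriv
  have hph : ∀ e, Continuous fun σ => phase Q n τ e σ := fun e =>
    (h.continuous_phase n).comp (f := fun σ => ((τ, e), σ)) (by fun_prop)
  have hten : Continuous fun σ => (innerSL ℝ (Q σ - meanPosition Q)).smulRight (deriv Q σ) := by
    have : Continuous fun x : (E3 →L[ℝ] ℝ) × E3 =>
      ContinuousLinearMap.smulRightL ℝ E3 E3 x.1 x.2 := by fun_prop
    exact this.comp (f := fun σ => (innerSL ℝ (Q σ - meanPosition Q), deriv Q σ)) (by fun_prop)
  have hfun : qVec Q n τ = fun e => ampConst • ∫ σ in (0 : ℝ)..(2 * Real.pi),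
      Real.cos (phase Q n τ e σ) • deriv Q σ := funext fun e => qVec_eq_integral h n τ e
  rw [hfun]
  refine HasFDerivAt.const_smul ?_ ampConst
  refine (intervalIntegral.hasFDerivAt_integral_of_dominated_of_fderiv_le
    (bound := fun σ => |waveNumber Q n| * (‖Q σ - meanPosition Q‖ * ‖deriv Q σ‖))
    (F' := fun e σ => (Real.sin (phase Q n τ e σ) * waveNumber Q n) •
      (innerSL ℝ (Q σ - meanPosition Q)).smulRight (deriv Q σ)) univ_mem ?_ ?_ ?_ ?_ ?_ ?_)
  · refine Eventually.of_forall fun e => ?_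
    have := hph e
    exact (by fun_prop : Continuous fun σ => Real.cos (phase Q n τ e σ) • deriv Q σ).aestronglyMeasurable
  · have := hph e
    exact (by fun_prop : Continuous fun σ => Real.cos (phase Q n τ e σ) • deriv Q σ).intervalIntegrable _ _
  · have := hph e
    exact (((Real.continuous_sin.comp this).mul continuous_const).smul hten).aestronglyMeasurable
  · refine Eventually.of_forall fun σ _ e _ => ?_
    rw [norm_smul, norm_mul, ContinuousLinearMap.norm_smulRight_apply, innerSL_apply_norm]
    gcongr
    rw [Real.norm_eq_abs, Real.norm_eq_abs]
    exact mul_le_of_le_one_left (abs_nonneg _) (Real.abs_sin_le_one _)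
  · exact (by fun_prop : Continuous fun σ => |waveNumber Q n| *
      (‖Q σ - meanPosition Q‖ * ‖deriv Q σ‖)).intervalIntegrable _ _
  · refine Eventually.of_forall fun σ _ e _ => ?_
    have h1 : HasFDerivAt (fun e => phase Q n τ e σ)
        (-(waveNumber Q n) • innerSL ℝ (Q σ - meanPosition Q)) e := by
      simp only [phase_eq]
      have := (((innerSL ℝ (Q σ - meanPosition Q)).hasFDerivAt (x := e)).const_sub
        (arcLength Q σ - τ * totalLength Q / (2 * Real.pi))).const_mul (waveNumber Q n)
      refine this.congr_fderiv ?_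
      ext1 v
      simp
      ring
    refine (h1.cos.smul_const (deriv Q σ)).congr_fderiv ?_
    ext1 v
    simp only [ContinuousLinearMap.smulRight_apply, smul_apply, smul_smul, smul_eq_mul]
    congr 1
    ring

lemma continuous_dqVec {Q : ℝ → E3} (h : IsClosedCurve Q) (n : ℕ) (τ : ℝ) :
    Continuous (dqVec Q n τ) := by
  have hQ := h.continuous
  have hd := h.continuous_deriv
  have hten : Continuous fun σ => (innerSL ℝ (Q σ - meanPosition Q)).smulRight (deriv Q σ) := by
    have : Continuous fun x : (E3 →L[ℝ] ℝ) × E3 =>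
      ContinuousLinearMap.smulRightL ℝ E3 E3 x.1 x.2 := by fun_prop
    exact this.comp (f := fun σ => (innerSL ℝ (Q σ - meanPosition Q), deriv Q σ)) (by fun_prop)
  unfold dqVec
  have hph : Continuous fun x : E3 × ℝ => phase Q n τ x.1 x.2 :=
    (h.continuous_phase n).comp (f := fun x : E3 × ℝ => ((τ, x.1), x.2)) (by fun_prop)
  have hten' := hten.comp (continuous_snd (X := E3) (Y := ℝ))
  exact (intervalIntegral.continuous_parametric_intervalIntegral_of_continuous'
    (f := fun e σ => (Real.sin (phase Q n τ e σ) * waveNumber Q n) •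
      (innerSL ℝ (Q σ - meanPosition Q)).smulRight (deriv Q σ))
    (((Real.continuous_sin.comp hph).mul continuous_const).smul hten') _ _).const_smul ampConst

lemma continuous_qVec {Q : ℝ → E3} (h : IsClosedCurve Q) (n : ℕ) :
    Continuous fun x : ℝ × E3 => qVec Q n x.1 x.2 := by
  have hd := h.continuous_deriv
  simp only [qVec_eq_integral h]
  have hph := h.continuous_phase n
  have hd' := hd.comp (continuous_snd (X := ℝ × E3) (Y := ℝ))
  exact (intervalIntegral.continuous_parametric_intervalIntegral_of_continuous'
    (f := fun (x : ℝ × E3) σ => Real.cos (phase Q n x.1 x.2 σ) • deriv Q σ)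
    ((Real.continuous_cos.comp hph).smul hd') _ _).const_smul ampConst

lemma continuous_qPerp {Q : ℝ → E3} (h : IsClosedCurve Q) (n : ℕ) :
    Continuous fun x : ℝ × E3 => qPerp Q n x.1 x.2 := by
  have := continuous_qVec h n
  unfold qPerp
  fun_prop

lemma qPerp_eq_tangential (Q : ℝ → E3) (n : ℕ) (τ : ℝ) :
    qPerp Q n τ = tangential (qVec Q n τ) := rfl

/-! ### Dependence on the time -/

lemma phase_eq_sub {Q : ℝ → E3} (hL : totalLength Q ≠ 0) (n : ℕ) (τ : ℝ) (e : E3) (σ : ℝ) :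
    phase Q n τ e σ = phase Q n 0 e σ - n * τ := by
  unfold phase
  field_simp
  ring

/-- Time enters only as the shift -nτ of the phase, so the field at all times is spanned by the
cosine and sine integrals at one time. -/
lemma qVec_time {Q : ℝ → E3} (h : IsClosedCurve Q) (hL : totalLength Q ≠ 0) (n : ℕ) (a τ : ℝ)
    (e : E3) : qVec Q n (a + τ) e = Real.cos (n * τ) • qVec Q n a e +
      Real.sin (n * τ) • (ampConst • ∫ σ in (0 : ℝ)..(2 * Real.pi),
      Real.sin (phase Q n a e σ) • deriv Q σ) := by
  have hd := h.continuous_deriv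
  have hph : Continuous fun σ => phase Q n a e σ :=
    (h.continuous_phase n).comp (f := fun σ => ((a, e), σ)) (by fun_prop)
  rw [qVec_eq_integral h, qVec_eq_integral h, smul_comm, smul_comm _ ampConst, ← smul_add,
    ← intervalIntegral.integral_smul (Real.cos _), ← intervalIntegral.integral_smul (Real.sin _),
    ← intervalIntegral.integral_add]
  · congr 1
    refine intervalIntegral.integral_congr fun σ _ => ?_
    have : phase Q n (a + τ) e σ = phase Q n a e σ - n * τ := by
      rw [phase_eq_sub hL, phase_eq_sub hL n a]; ring
    simp only [this, Real.cos_sub, smul_smul, ← add_smul]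
    congr 1
    ring
  · exact Continuous.intervalIntegrable (by fun_prop) _ _
  · exact Continuous.intervalIntegrable (by fun_prop) _ _

lemma qVec_quarter {Q : ℝ → E3} (h : IsClosedCurve Q) (hL : totalLength Q ≠ 0) {n : ℕ}
    (hn : n ≠ 0) (a : ℝ) (e : E3) :
    qVec Q n (a + Real.pi / (2 * n)) e = ampConst • ∫ σ in (0 : ℝ)..(2 * Real.pi),
      Real.sin (phase Q n a e σ) • deriv Q σ := by
  have hn' : (n : ℝ) ≠ 0 := by exact_mod_cast hn
  rw [qVec_time h hL, show (n : ℝ) * (Real.pi / (2 * n)) = Real.pi / 2 by field_simp]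
  simp

lemma qVec_time_eq {Q : ℝ → E3} (h : IsClosedCurve Q) (hL : totalLength Q ≠ 0) {n : ℕ}
    (hn : n ≠ 0) (a τ : ℝ) (e : E3) : qVec Q n (a + τ) e = Real.cos (n * τ) • qVec Q n a e +
      Real.sin (n * τ) • qVec Q n (a + Real.pi / (2 * n)) e := by
  rw [qVec_quarter h hL hn, qVec_time h hL]

lemma amplitude_eq {Q : ℝ → E3} (h : IsClosedCurve Q) (hL : totalLength Q ≠ 0) {n : ℕ}
    (hn : n ≠ 0) (a : ℝ) (e : E3) (i : Fin 3) :
    amplitude Q n a e i = (qVec Q n a e i : ℂ) +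
      Complex.I * (qVec Q n (a + Real.pi / (2 * n)) e i : ℂ) := by
  have hd := h.continuous_deriv
  have hph : Continuous fun σ => phase Q n a e σ :=
    (h.continuous_phase n).comp (f := fun σ => ((a, e), σ)) (by fun_prop)
  apply Complex.ext
  · simp [qVec]
  · rw [(amplitude_re_im h n a e i).2, qVec_quarter h hL hn, PiLp.smul_apply,
      integral_apply (by fun_prop)]
    simp

lemma deriv_eq_zero_of_totalLength {Q : ℝ → E3} (h : IsClosedCurve Q) (hL : totalLength Q = 0)
    {σ : ℝ} (hσ : σ ∈ Set.Icc 0 (2 * Real.pi)) : deriv Q σ = 0 := by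
  by_contra hne
  have hpos : 0 < ∫ t in (0 : ℝ)..(2 * Real.pi), ‖deriv Q t‖ := by
    refine intervalIntegral.integral_pos (by positivity) h.continuous_deriv.norm.continuousOn
      (fun _ _ => norm_nonneg _) ⟨σ, hσ, norm_pos_iff.2 hne⟩
  exact hpos.ne' hL

lemma qVec_half_period {Q : ℝ → E3} (h : IsClosedCurve Q) {n : ℕ} (hn : n ≠ 0) (τ : ℝ) (e : E3) :
    qVec Q n (τ + Real.pi / n) e = -qVec Q n τ e := by
  -- For a curve of zero length the quotients by `totalLength` take the default value 0, and the
  -- time shift of the phase is lost. The velocity then vanishes on the period, so the field is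
  -- identically zero.
  by_cases hL : totalLength Q = 0
  · have : ∀ τ, qVec Q n τ e = 0 := fun τ => by
      rw [qVec_eq_integral h, intervalIntegral.integral_congr (g := fun _ => 0)]
      · simp
      · intro σ hσ
        rw [Set.uIcc_of_le (by positivity)] at hσ
        simp [deriv_eq_zero_of_totalLength h hL hσ]
    simp [this]
  · have hn' : (n : ℝ) ≠ 0 := by exact_mod_cast hn
    rw [qVec_time h hL, mul_div_cancel₀ _ hn']
    simp

lemma qPerp_half_period {Q : ℝ → E3} (h : IsClosedCurve Q) {n : ℕ} (hn : n ≠ 0) (τ : ℝ) :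
    qPerp Q n (τ + Real.pi / n) = -qPerp Q n τ := by
  funext e
  simp only [qPerp, qVec_half_period h hn, Pi.neg_apply, inner_neg_left]
  module

lemma qPerp_nat_half_period {Q : ℝ → E3} (h : IsClosedCurve Q) {n : ℕ} (hn : n ≠ 0) (τ : ℝ)
    (k : ℕ) : qPerp Q n (τ + k * Real.pi / n) = (-1 : ℝ) ^ k • qPerp Q n τ := by
  induction k with
  | zero => simp
  | succ k ih =>
    rw [show τ + ((k + 1 : ℕ) : ℝ) * Real.pi / n = (τ + k * Real.pi / n) + Real.pi / n by
      push_cast; ring, qPerp_half_period h hn, ih, pow_succ]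
    module

lemma qPerp_period {Q : ℝ → E3} (h : IsClosedCurve Q) {n : ℕ} (hn : n ≠ 0) (τ : ℝ) :
    qPerp Q n (τ + 2 * Real.pi) = qPerp Q n τ := by
  have hn' : (n : ℝ) ≠ 0 := by exact_mod_cast hn
  have := qPerp_nat_half_period h hn τ (2 * n)
  rw [show τ + ((2 * n : ℕ) : ℝ) * Real.pi / n = τ + 2 * Real.pi by push_cast; field_simp] at this
  rw [this]
  simp

theorem reversal {Q : ℝ → E3} (h : IsClosedCurve Q) {s : ℕ} (hs : 1 ≤ s) (τ : ℝ) :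
    (∀ e : E3, qPerp Q s (τ + 2 * Real.pi) e = qPerp Q s τ e) ∧
      (∀ e : E3, qPerp Q s (τ + Real.pi / s) e = -qPerp Q s τ e) ∧
      (∀ p : E3, (qPerp Q s (τ + Real.pi / s) p = 0 ↔ qPerp Q s τ p = 0) ∧
        (IsNode (qPerp Q s (τ + Real.pi / s)) p ↔ IsNode (qPerp Q s τ) p) ∧
        (IsSaddle (qPerp Q s (τ + Real.pi / s)) p ↔ IsSaddle (qPerp Q s τ) p) ∧
        (∀ m : ℕ, IsMultiSaddle (qPerp Q s (τ + Real.pi / s)) p m ↔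
          IsMultiSaddle (qPerp Q s τ) p m)) := by
  have hs0 : s ≠ 0 := by omega
  have hrev := qPerp_half_period h hs0 τ
  refine ⟨fun e => by rw [qPerp_period h hs0], fun e => by rw [hrev, Pi.neg_apply], fun p => ?_⟩
  rw [hrev]
  refine ⟨by simp, ⟨fun hp => ?_, fun hp => hp.neg⟩, ⟨fun hp => ?_, fun hp => hp.neg⟩,
    fun m => ⟨fun hp => ?_, fun hp => hp.neg⟩⟩
  all_goals simpa using hp.neg

/-! ### Curves near the straight-line string -/

lemma hasDerivAt_straight (σ : ℝ) :
    HasDerivAt straight !₂[-Real.sin σ, Real.cos σ, 0] σ := by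
  have h : HasDerivAt (fun σ : ℝ => (![Real.cos σ, Real.sin σ, 0] : Fin 3 → ℝ))
      ![-Real.sin σ, Real.cos σ, 0] σ := by
    rw [hasDerivAt_pi]
    intro i
    fin_cases i
    · exact Real.hasDerivAt_cos σ
    · exact Real.hasDerivAt_sin σ
    · exact hasDerivAt_const σ 0
  exact ((PiLp.continuousLinearEquiv 2 ℝ (fun _ : Fin 3 => ℝ)).symm.toContinuousLinearMap).hasFDerivAt.comp_hasDerivAt σ h

lemma deriv_straight : deriv straight = fun σ => !₂[-Real.sin σ, Real.cos σ, 0] :=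
  funext fun σ => (hasDerivAt_straight σ).deriv

lemma isClosedCurve_straight : IsClosedCurve straight := by
  refine ⟨contDiff_one_iff_deriv.2 ⟨fun σ => (hasDerivAt_straight σ).differentiableAt, ?_⟩, ?_⟩
  · rw [deriv_straight]
    refine (PiLp.continuous_toLp 2 _).comp (continuous_pi fun i => ?_)
    fin_cases i
    · exact Real.continuous_sin.neg
    · exact Real.continuous_cos
    · exact continuous_const
  · intro σ
    simp [straight]

lemma norm_straight (σ : ℝ) : ‖straight σ‖ = 1 := by
  simp [EuclideanSpace.norm_eq, straight, Fin.sum_univ_three]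

lemma norm_deriv_straight (σ : ℝ) : ‖deriv straight σ‖ = 1 := by
  simp [EuclideanSpace.norm_eq, deriv_straight, Fin.sum_univ_three]

/-- A closed curve at `C¹` distance at most `1/2` from the straight-line string. -/
def NearStraight (Q : ℝ → E3) : Prop := IsClosedCurve Q ∧ C1Close (1 / 2) Q straight

lemma C1Close.refl {d : ℝ} (hd : 0 ≤ d) (Q : ℝ → E3) : C1Close d Q Q := fun σ => by simpa

lemma C1Close.mono {d d' : ℝ} {Q R : ℝ → E3} (h : C1Close d Q R) (hd : d ≤ d') :
    C1Close d' Q R := fun σ => ⟨(h σ).1.trans hd, (h σ).2.trans hd⟩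

lemma nearStraight_straight : NearStraight straight :=
  ⟨isClosedCurve_straight, C1Close.refl (by norm_num) _⟩

namespace NearStraight

variable {Q R : ℝ → E3} (hQ : NearStraight Q) (hR : NearStraight R)
include hQ

lemma norm_le (σ : ℝ) : ‖Q σ‖ ≤ 3 / 2 := by
  have h1 := norm_add_le (Q σ - straight σ) (straight σ)
  have h2 := (hQ.2 σ).1
  rw [sub_add_cancel, norm_straight] at h1
  linarith

lemma norm_deriv_le (σ : ℝ) : ‖deriv Q σ‖ ≤ 3 / 2 := by
  have h1 := norm_add_le (deriv Q σ - deriv straight σ) (deriv straight σ)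
  have h2 := (hQ.2 σ).2
  rw [sub_add_cancel, norm_deriv_straight] at h1
  linarith

lemma le_norm_deriv (σ : ℝ) : 1 / 2 ≤ ‖deriv Q σ‖ := by
  have h1 := norm_sub_norm_le (deriv straight σ) (deriv Q σ)
  have h2 := (hQ.2 σ).2
  rw [norm_sub_rev] at h2
  rw [norm_deriv_straight] at h1
  linarith

lemma intervalIntegrable_norm_deriv (a b : ℝ) :
    IntervalIntegrable (fun t => ‖deriv Q t‖) MeasureTheory.volume a b :=
  hQ.1.continuous_deriv.norm.intervalIntegrable _ _

lemma arcLength_mem {σ : ℝ} (hσ : 0 ≤ σ) :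
    1 / 2 * σ ≤ arcLength Q σ ∧ arcLength Q σ ≤ 3 / 2 * σ := by
  have h1 := intervalIntegral.integral_mono_on hσ intervalIntegrable_const
    (hQ.intervalIntegrable_norm_deriv 0 σ) (fun t _ => hQ.le_norm_deriv t)
  have h2 := intervalIntegral.integral_mono_on hσ (hQ.intervalIntegrable_norm_deriv 0 σ)
    intervalIntegrable_const (fun t _ => hQ.norm_deriv_le t)
  simp only [intervalIntegral.integral_const, sub_zero, smul_eq_mul] at h1 h2
  exact ⟨by unfold arcLength; linarith, by unfold arcLength; linarith⟩

lemma totalLength_mem : Real.pi ≤ totalLength Q ∧ totalLength Q ≤ 3 * Real.pi := by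
  have := hQ.arcLength_mem (σ := 2 * Real.pi) (by positivity)
  unfold totalLength
  constructor <;> linarith

lemma totalLength_pos : 0 < totalLength Q := Real.pi_pos.trans_le hQ.totalLength_mem.1

lemma waveNumber_le (n : ℕ) : |waveNumber Q n| ≤ 2 * n := by
  have h := hQ.totalLength_pos
  unfold waveNumber
  rw [abs_of_nonneg (by positivity), div_le_iff₀ h]
  have := mul_le_mul_of_nonneg_left hQ.totalLength_mem.1 (Nat.cast_nonneg (α := ℝ) n)
  linarith

lemma norm_meanPosition_le : ‖meanPosition Q‖ ≤ 3 / 2 := by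
  have h := hQ.totalLength_pos
  unfold meanPosition
  rw [norm_smul, norm_inv, Real.norm_of_nonneg h.le, inv_mul_le_iff₀ h]
  have h1 := hQ.1.continuous_deriv
  have h2 := hQ.1.continuous
  refine (intervalIntegral.norm_integral_le_of_norm_le (g := fun t => ‖deriv Q t‖ * (3 / 2))
    (by positivity) (Eventually.of_forall fun t _ => ?_)
    (Continuous.intervalIntegrable (by fun_prop) _ _)).trans (le_of_eq ?_)
  · rw [norm_smul, norm_norm]
    gcongr
    exact hQ.norm_le t
  · rw [intervalIntegral.integral_mul_const]
    rfl

lemma norm_sub_meanPosition_le (σ : ℝ) : ‖Q σ - meanPosition Q‖ ≤ 3 := by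
  have := norm_sub_le (Q σ) (meanPosition Q)
  have := hQ.norm_le σ
  have := hQ.norm_meanPosition_le
  linarith

include hR

lemma abs_arcLength_sub_le {d : ℝ} (h : C1Close d Q R) {σ : ℝ} (hσ : 0 ≤ σ) :
    |arcLength Q σ - arcLength R σ| ≤ d * σ := by
  unfold arcLength
  rw [← intervalIntegral.integral_sub (hQ.intervalIntegrable_norm_deriv _ _)
    (hR.intervalIntegrable_norm_deriv _ _), ← Real.norm_eq_abs]
  have := intervalIntegral.norm_integral_le_of_norm_le_const (a := 0) (b := σ)
    (f := fun t => ‖deriv Q t‖ - ‖deriv R t‖) (C := d)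
    fun t _ => (abs_norm_sub_norm_le _ _).trans (h t).2
  rwa [sub_zero, abs_of_nonneg hσ] at this

lemma abs_totalLength_sub_le {d : ℝ} (h : C1Close d Q R) :
    |totalLength Q - totalLength R| ≤ 2 * Real.pi * d := by
  have := hQ.abs_arcLength_sub_le hR h (σ := 2 * Real.pi) (by positivity)
  unfold totalLength
  linarith

/-- Both lengths are at least π, so the product in the denominator cancels the factor π² of the
numerator. -/
lemma abs_waveNumber_sub_le {d : ℝ} (h : C1Close d Q R) (n : ℕ) :
    |waveNumber Q n - waveNumber R n| ≤ 4 * n * d := by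
  have hq := hQ.totalLength_pos
  have hr := hR.totalLength_pos
  have h0 := hQ.abs_totalLength_sub_le hR h
  have hd : 0 ≤ d := (norm_nonneg _).trans (h 0).1
  have : waveNumber Q n - waveNumber R n =
      2 * Real.pi * n * (totalLength R - totalLength Q) / (totalLength Q * totalLength R) := by
    unfold waveNumber
    field_simp
  rw [this, abs_div, abs_mul, abs_of_nonneg (by positivity : 0 ≤ 2 * Real.pi * (n : ℝ)),
    abs_of_pos (mul_pos hq hr), abs_sub_comm, div_le_iff₀ (mul_pos hq hr)]
  calc 2 * Real.pi * n * |totalLength Q - totalLength R|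
      ≤ 2 * Real.pi * n * (2 * Real.pi * d) := by gcongr
    _ = 4 * n * d * (Real.pi * Real.pi) := by ring
    _ ≤ 4 * n * d * (totalLength Q * totalLength R) := by
        gcongr
        · exact hQ.totalLength_mem.1
        · exact hR.totalLength_mem.1

lemma norm_meanPosition_sub_le {d : ℝ} (h : C1Close d Q R) :
    ‖meanPosition Q - meanPosition R‖ ≤ 9 * d := by
  have hq := hQ.totalLength_pos
  have hr := hR.totalLength_pos
  have hd : 0 ≤ d := (norm_nonneg _).trans (h 0).1
  have c1 := hQ.1.continuous_deriv
  have c2 := hQ.1.continuous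
  have c3 := hR.1.continuous_deriv
  have c4 := hR.1.continuous
  set I := fun Q : ℝ → E3 => ∫ σ in (0 : ℝ)..(2 * Real.pi), ‖deriv Q σ‖ • Q σ with hI
  have hIsub : ‖I Q - I R‖ ≤ 6 * Real.pi * d := by
    have hb : ∀ t, ‖‖deriv Q t‖ • Q t - ‖deriv R t‖ • R t‖ ≤ 3 * d := fun t => by
      have e : ‖deriv Q t‖ • Q t - ‖deriv R t‖ • R t =
          (‖deriv Q t‖ - ‖deriv R t‖) • Q t + ‖deriv R t‖ • (Q t - R t) := by module
      rw [e]
      refine (norm_add_le _ _).trans ?_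
      rw [norm_smul, norm_smul, norm_norm]
      calc _ ≤ d * (3 / 2) + (3 / 2) * d := by
            gcongr
            · exact (abs_norm_sub_norm_le _ _).trans (h t).2
            · exact hQ.norm_le t
            · exact hR.norm_deriv_le t
            · exact (h t).1
        _ = 3 * d := by ring
    have := intervalIntegral.norm_integral_le_of_norm_le_const (a := 0) (b := 2 * Real.pi)
      (C := 3 * d) (f := fun t => ‖deriv Q t‖ • Q t - ‖deriv R t‖ • R t) fun t _ => hb t
    rw [intervalIntegral.integral_sub (Continuous.intervalIntegrable (by fun_prop) _ _)
      (Continuous.intervalIntegrable (by fun_prop) _ _), sub_zero,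
      abs_of_nonneg (by positivity)] at this
    simp only [hI]
    linarith
  have hXR : I R = totalLength R • meanPosition R := by
    unfold meanPosition
    rw [smul_smul, mul_inv_cancel₀ hr.ne', one_smul]
  have e : meanPosition Q - meanPosition R = (totalLength Q)⁻¹ •
      ((I Q - I R) + (totalLength R - totalLength Q) • meanPosition R) := by
    rw [hXR, sub_smul, sub_add_sub_cancel, smul_sub, smul_smul, inv_mul_cancel₀ hq.ne', one_smul]
    rfl
  rw [e, norm_smul, norm_inv, Real.norm_of_nonneg hq.le, inv_mul_le_iff₀ hq]
  calc _ ≤ ‖I Q - I R‖ + |totalLength R - totalLength Q| * ‖meanPosition R‖ := by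
        refine (norm_add_le _ _).trans (le_of_eq ?_)
        rw [norm_smul, Real.norm_eq_abs]
    _ ≤ 6 * Real.pi * d + 2 * Real.pi * d * (3 / 2) := by
        rw [abs_sub_comm]
        gcongr
        · exact hQ.abs_totalLength_sub_le hR h
        · exact hR.norm_meanPosition_le
    _ = 9 * d * Real.pi := by ring
    _ ≤ 9 * d * totalLength Q := by
        gcongr
        exact hQ.totalLength_mem.1
    _ = _ := by ring

lemma norm_rel_sub_le {d : ℝ} (h : C1Close d Q R) (σ : ℝ) :
    ‖(Q σ - meanPosition Q) - (R σ - meanPosition R)‖ ≤ 10 * d := by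
  have e : (Q σ - meanPosition Q) - (R σ - meanPosition R) =
    (Q σ - R σ) - (meanPosition Q - meanPosition R) := by abel
  rw [e]
  have := norm_sub_le (Q σ - R σ) (meanPosition Q - meanPosition R)
  have := (h σ).1
  have := hQ.norm_meanPosition_sub_le hR h
  linarith

lemma abs_phase_sub_le {d : ℝ} (h : C1Close d Q R) (n : ℕ) (τ : ℝ) {e : E3} (he : ‖e‖ ≤ 2)
    {σ : ℝ} (h0 : 0 ≤ σ) (h1 : σ ≤ 2 * Real.pi) :
    |phase Q n τ e σ - phase R n τ e σ| ≤ 118 * n * d := by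
  have hd : 0 ≤ d := (norm_nonneg _).trans (h 0).1
  have hpi : Real.pi ≤ 16 / 5 := by linarith [Real.pi_lt_d2]
  -- The shift nτ is the same for both curves and cancels, so the bound is uniform in time.
  rw [phase_eq_sub hQ.totalLength_pos.ne', phase_eq_sub hR.totalLength_pos.ne', sub_sub_sub_cancel_right,
    phase_eq, phase_eq]
  simp only [zero_mul, zero_div, sub_zero]
  set u := arcLength Q σ - ⟪Q σ - meanPosition Q, e⟫
  set v := arcLength R σ - ⟪R σ - meanPosition R, e⟫
  -- The arc length is at most 3π < 10 and the scalar product at most 3 · 2.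
  have hu : |u| ≤ 16 := by
    have h2 := hQ.arcLength_mem h0
    have h3 := abs_real_inner_le_norm (Q σ - meanPosition Q) e
    have h4 := mul_le_mul (hQ.norm_sub_meanPosition_le σ) he (norm_nonneg _) (by norm_num)
    have h5 := abs_le.1 (h3.trans h4)
    rw [abs_le]
    constructor <;> simp only [u] <;> linarith
  -- The arc lengths contribute 2πd ≤ 7d and the relative positions 10d · 2. Together with the
  -- previous bound this gives 118 = 4 · 16 + 2 · 27.
  have huv : |u - v| ≤ 27 * d := by
    have h2 := hQ.abs_arcLength_sub_le hR h h0
    have h3 := abs_real_inner_le_norm ((Q σ - meanPosition Q) - (R σ - meanPosition R)) e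
    have h4 := mul_le_mul (hQ.norm_rel_sub_le hR h σ) he (norm_nonneg _) (by positivity)
    have h5 := abs_le.1 (h3.trans h4)
    have h6 := abs_le.1 h2
    have h7 : d * σ ≤ 7 * d := by nlinarith
    rw [inner_sub_left] at h5
    rw [abs_le]
    constructor <;> simp only [u, v] <;> linarith
  have e1 : waveNumber Q n * u - waveNumber R n * v =
    (waveNumber Q n - waveNumber R n) * u + waveNumber R n * (u - v) := by ring
  rw [e1]
  refine (abs_add_le _ _).trans ?_
  rw [abs_mul, abs_mul]
  calc _ ≤ 4 * n * d * 16 + 2 * n * (27 * d) := by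
        gcongr
        · exact hQ.abs_waveNumber_sub_le hR h n
        · exact hR.waveNumber_le n
    _ = _ := by ring

end NearStraight

lemma abs_cos_sub_le (x y : ℝ) : |Real.cos x - Real.cos y| ≤ |x - y| := by
  have := Real.lipschitzWith_cos.dist_le_mul x y
  simpa [Real.dist_eq] using this

lemma abs_sin_sub_le (x y : ℝ) : |Real.sin x - Real.sin y| ≤ |x - y| := by
  have := Real.lipschitzWith_sin.dist_le_mul x y
  simpa [Real.dist_eq] using this

lemma norm_smulRight_sub_le (a b x y : E3) :
    ‖(innerSL ℝ a).smulRight x - (innerSL ℝ b).smulRight y‖ ≤ ‖a - b‖ * ‖x‖ + ‖b‖ * ‖x - y‖ := by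
  have e : (innerSL ℝ a).smulRight x - (innerSL ℝ b).smulRight y =
      (innerSL ℝ (a - b)).smulRight x + (innerSL ℝ b).smulRight (x - y) := by
    ext1 v
    simp only [sub_apply, add_apply, ContinuousLinearMap.smulRight_apply, innerSL_apply_apply,
      inner_sub_left]
    module
  rw [e]
  refine (norm_add_le _ _).trans (le_of_eq ?_)
  rw [ContinuousLinearMap.norm_smulRight_apply, ContinuousLinearMap.norm_smulRight_apply,
    innerSL_apply_norm, innerSL_apply_norm]

lemma norm_ampConst_integral_sub_le {F : Type*} [NormedAddCommGroup F] [NormedSpace ℝ F]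
    {f g : ℝ → F} (hf : Continuous f) (hg : Continuous g) {C : ℝ}
    (h : ∀ σ, 0 ≤ σ → σ ≤ 2 * Real.pi → ‖f σ - g σ‖ ≤ C) :
    ‖ampConst • (∫ σ in (0 : ℝ)..(2 * Real.pi), f σ) -
      ampConst • ∫ σ in (0 : ℝ)..(2 * Real.pi), g σ‖ ≤ 2 * Real.pi * C := by
  have h2 : (0 : ℝ) ≤ 2 * Real.pi := by positivity
  rw [← smul_sub, ← intervalIntegral.integral_sub (hf.intervalIntegrable _ _)
    (hg.intervalIntegrable _ _), norm_smul, Real.norm_of_nonneg ampConst_pos.le]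
  refine (mul_le_of_le_one_left (norm_nonneg _) ampConst_le_one).trans ?_
  have := intervalIntegral.norm_integral_le_of_norm_le_const (a := 0) (b := 2 * Real.pi)
    (C := C) (f := fun t => f t - g t) fun t ht => by
      rw [Set.uIoc_of_le h2] at ht
      exact h t ht.1.le ht.2
  rw [sub_zero, abs_of_nonneg h2] at this
  linarith

/-- Velocity, arc length, wave number and centre of mass all depend in a Lipschitz way on the curve
in the C¹ norm. No dependence on τ appears, because the phase differences do not contain it. -/
theorem exists_c1Near (n : ℕ) : ∃ K > 0, ∀ Q R : ℝ → E3, NearStraight Q → NearStraight R →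
    ∀ d, C1Close d Q R → ∀ τ,
      C1Near (K * d) (qVec Q n τ) (dqVec Q n τ) (qVec R n τ) (dqVec R n τ) := by
  -- The larger of the two bounds on the integrands is 1062 n² + 54 n, from the derivative.
  refine ⟨2 * Real.pi * (1200 * (n ^ 2 + 1)), by positivity, fun Q R hQ hR d h τ e he => ?_⟩
  have hd : 0 ≤ d := (norm_nonneg _).trans (h 0).1
  have c1 := hQ.1.continuous_deriv
  have c2 := hQ.1.continuous
  have c3 := hR.1.continuous_deriv
  have c4 := hR.1.continuous
  have cph : ∀ {Q : ℝ → E3}, NearStraight Q → Continuous fun σ => phase Q n τ e σ := fun hQ =>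
    (hQ.1.continuous_phase n).comp (f := fun σ => ((τ, e), σ)) (by fun_prop)
  have p1 := cph hQ
  have p2 := cph hR
  have hn : (n : ℝ) ≤ n ^ 2 := by exact_mod_cast Nat.le_self_pow two_ne_zero n
  have hn0 : (0 : ℝ) ≤ n := Nat.cast_nonneg n
  rw [mul_assoc (2 * Real.pi)]
  constructor
  · rw [qVec_eq_integral hQ.1, qVec_eq_integral hR.1]
    refine norm_ampConst_integral_sub_le (by fun_prop) (by fun_prop) fun σ h0 h1 => ?_
    have e1 : Real.cos (phase Q n τ e σ) • deriv Q σ - Real.cos (phase R n τ e σ) • deriv R σ =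
        (Real.cos (phase Q n τ e σ) - Real.cos (phase R n τ e σ)) • deriv Q σ +
          Real.cos (phase R n τ e σ) • (deriv Q σ - deriv R σ) := by module
    rw [e1]
    refine (norm_add_le _ _).trans ?_
    rw [norm_smul, norm_smul, Real.norm_eq_abs, Real.norm_eq_abs]
    calc _ ≤ 118 * n * d * (3 / 2) + 1 * d := by
          gcongr
          · exact (abs_cos_sub_le _ _).trans (hQ.abs_phase_sub_le hR h n τ he h0 h1)
          · exact hQ.norm_deriv_le σ
          · exact Real.abs_cos_le_one _
          · exact (h σ).2
      _ ≤ _ := by nlinarith [mul_nonneg hd hn0, mul_le_mul_of_nonneg_right hn hd]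
  · have hten : ∀ {Q : ℝ → E3}, NearStraight Q →
        Continuous fun σ => (innerSL ℝ (Q σ - meanPosition Q)).smulRight (deriv Q σ) := by
      intro Q hQ
      have c1 := hQ.1.continuous_deriv
      have c2 := hQ.1.continuous
      have : Continuous fun x : (E3 →L[ℝ] ℝ) × E3 =>
        ContinuousLinearMap.smulRightL ℝ E3 E3 x.1 x.2 := by fun_prop
      exact this.comp (f := fun σ => (innerSL ℝ (Q σ - meanPosition Q), deriv Q σ)) (by fun_prop)
    have cs : ∀ {Q : ℝ → E3}, NearStraight Q →
        Continuous fun σ => Real.sin (phase Q n τ e σ) * waveNumber Q n := fun hQ =>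
      (Real.continuous_sin.comp (cph hQ)).mul continuous_const
    refine norm_ampConst_integral_sub_le ((cs hQ).smul (hten hQ)) ((cs hR).smul (hten hR))
      fun σ h0 h1 => ?_
    set A := (innerSL ℝ (Q σ - meanPosition Q)).smulRight (deriv Q σ) with hA
    set B := (innerSL ℝ (R σ - meanPosition R)).smulRight (deriv R σ) with hB
    have hAn : ‖A‖ ≤ 3 * (3 / 2) := by
      rw [hA, ContinuousLinearMap.norm_smulRight_apply, innerSL_apply_norm]
      exact mul_le_mul (hQ.norm_sub_meanPosition_le σ) (hQ.norm_deriv_le σ) (norm_nonneg _)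
        (by norm_num)
    have hAB : ‖A - B‖ ≤ 10 * d * (3 / 2) + 3 * d := by
      refine (norm_smulRight_sub_le _ _ _ _).trans ?_
      gcongr
      · exact hQ.norm_rel_sub_le hR h σ
      · exact hQ.norm_deriv_le σ
      · exact hR.norm_sub_meanPosition_le σ
      · exact (h σ).2
    have e1 : (Real.sin (phase Q n τ e σ) * waveNumber Q n) • A -
        (Real.sin (phase R n τ e σ) * waveNumber R n) • B =
        ((Real.sin (phase Q n τ e σ) - Real.sin (phase R n τ e σ)) * waveNumber Q n) • A +
        (Real.sin (phase R n τ e σ) * (waveNumber Q n - waveNumber R n)) • A +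
        (Real.sin (phase R n τ e σ) * waveNumber R n) • (A - B) := by module
    change ‖(Real.sin (phase Q n τ e σ) * waveNumber Q n) • A -
        (Real.sin (phase R n τ e σ) * waveNumber R n) • B‖ ≤ _
    rw [e1]
    refine (norm_add₃_le).trans ?_
    simp only [norm_smul, norm_mul, Real.norm_eq_abs]
    calc _ ≤ 118 * n * d * (2 * n) * (3 * (3 / 2)) + 1 * (4 * n * d) * (3 * (3 / 2)) +
          1 * (2 * n) * (10 * d * (3 / 2) + 3 * d) := by
          gcongr
          · exact (abs_sin_sub_le _ _).trans (hQ.abs_phase_sub_le hR h n τ he h0 h1)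
          · exact hQ.waveNumber_le n
          · exact Real.abs_sin_le_one _
          · exact hQ.abs_waveNumber_sub_le hR h n
          · exact Real.abs_sin_le_one _
          · exact hR.waveNumber_le n
      _ ≤ _ := by nlinarith [mul_nonneg hd hn0, mul_le_mul_of_nonneg_right hn hd]

/-! ### Bessel functions -/

/-- The integrand of Bessel's integral in the plane. -/
def besselKernel (n : ℤ) (z : ℂ) (σ : ℝ) : ℂ :=
  Complex.exp (((n * σ - (z.re * Real.cos σ + z.im * Real.sin σ) : ℝ) : ℂ) * Complex.I)

/-- Bessel's integral `∮ exp i(nσ - Re (z̄ exp iσ)) dσ`, as a function of the complex plane. -/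
def planeBessel (n : ℤ) (z : ℂ) : ℂ := ∫ σ in (0 : ℝ)..(2 * Real.pi), besselKernel n z σ

/-- The real derivative of `planeBessel`. -/
def dPlaneBessel (n : ℤ) (z : ℂ) : ℂ →L[ℝ] ℂ :=
  planeBessel (n + 1) z • ((-(Complex.I / 2)) • (Complex.conjCLE : ℂ →L[ℝ] ℂ)) +
    planeBessel (n - 1) z • ((-(Complex.I / 2)) • ContinuousLinearMap.id ℝ ℂ)

lemma dPlaneBessel_apply (n : ℤ) (z v : ℂ) : dPlaneBessel n z v = -(Complex.I / 2) *
    ((starRingEnd ℂ) v * planeBessel (n + 1) z + v * planeBessel (n - 1) z) := by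
  simp [dPlaneBessel]
  ring

lemma continuous_besselKernel (n : ℤ) :
    Continuous fun x : ℂ × ℝ => besselKernel n x.1 x.2 := by
  unfold besselKernel
  have h1 : Continuous fun x : ℂ × ℝ => x.1.re := Complex.continuous_re.comp continuous_fst
  have h2 : Continuous fun x : ℂ × ℝ => x.1.im := Complex.continuous_im.comp continuous_fst
  have h3 : Continuous fun x : ℂ × ℝ =>
    (n * x.2 - (x.1.re * Real.cos x.2 + x.1.im * Real.sin x.2) : ℝ) := by fun_prop
  exact Complex.continuous_exp.comp ((Complex.continuous_ofReal.comp h3).mul continuous_const)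

lemma continuous_besselKernel_right (n : ℤ) (z : ℂ) : Continuous (besselKernel n z) :=
  (continuous_besselKernel n).comp (Continuous.prodMk_right z)

lemma norm_besselKernel (n : ℤ) (z : ℂ) (σ : ℝ) : ‖besselKernel n z σ‖ = 1 :=
  Complex.norm_exp_ofReal_mul_I _

lemma besselKernel_add_one (n : ℤ) (z : ℂ) (σ : ℝ) :
    besselKernel (n + 1) z σ = besselKernel n z σ * Complex.exp (σ * Complex.I) := by
  unfold besselKernel
  rw [← Complex.exp_add]
  congr 1
  push_cast
  ring

lemma besselKernel_sub_one (n : ℤ) (z : ℂ) (σ : ℝ) :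
    besselKernel (n - 1) z σ = besselKernel n z σ * Complex.exp (-(σ * Complex.I)) := by
  unfold besselKernel
  rw [← Complex.exp_add]
  congr 1
  push_cast
  ring

lemma conj_mul_exp_add (v : ℂ) (σ : ℝ) :
    (starRingEnd ℂ) v * Complex.exp (σ * Complex.I) + v * Complex.exp (-(σ * Complex.I)) =
      2 * ((v.re * Real.cos σ + v.im * Real.sin σ : ℝ) : ℂ) := by
  rw [← neg_mul, Complex.exp_mul_I, Complex.exp_mul_I, Complex.cos_neg, Complex.sin_neg,
    ← Complex.ofReal_cos, ← Complex.ofReal_sin]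
  apply Complex.ext
  · simp
    ring
  · simp
    ring

lemma norm_planeBessel_le (n : ℤ) (z : ℂ) : ‖planeBessel n z‖ ≤ 2 * Real.pi := by
  have := intervalIntegral.norm_integral_le_of_norm_le_const (a := 0) (b := 2 * Real.pi) (C := 1)
    (f := besselKernel n z) fun σ _ => (norm_besselKernel n z σ).le
  rwa [sub_zero, abs_of_nonneg (by positivity), one_mul] at this

/-- Differentiation in the direction v multiplies the kernel by -i(Re v cos σ + Im v sin σ). Written
with exponentials, this factor shifts the index by +1 and -1. -/
lemma hasFDerivAt_planeBessel (n : ℤ) (z : ℂ) :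
    HasFDerivAt (planeBessel n) (dPlaneBessel n z) z := by
  set A : ℂ →L[ℝ] ℂ := (-(Complex.I / 2)) • (Complex.conjCLE : ℂ →L[ℝ] ℂ)
  set B : ℂ →L[ℝ] ℂ := (-(Complex.I / 2)) • ContinuousLinearMap.id ℝ ℂ
  have hint : ∀ (n : ℤ) (z : ℂ), IntervalIntegrable (besselKernel n z) MeasureTheory.volume 0
    (2 * Real.pi) := fun n z => (continuous_besselKernel_right n z).intervalIntegrable _ _
  have hD : dPlaneBessel n z = ∫ σ in (0 : ℝ)..(2 * Real.pi),
      (besselKernel (n + 1) z σ • A + besselKernel (n - 1) z σ • B) := by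
    rw [intervalIntegral.integral_add, intervalIntegral.integral_smul_const,
      intervalIntegral.integral_smul_const]
    · rfl
    · exact ((continuous_besselKernel_right _ z).smul continuous_const).intervalIntegrable _ _
    · exact ((continuous_besselKernel_right _ z).smul continuous_const).intervalIntegrable _ _
  rw [hD]
  refine intervalIntegral.hasFDerivAt_integral_of_dominated_of_fderiv_le
    (F := fun z σ => besselKernel n z σ)
    (F' := fun z σ => besselKernel (n + 1) z σ • A + besselKernel (n - 1) z σ • B)
    (bound := fun _ => ‖A‖ + ‖B‖) univ_mem ?_ (hint n z) ?_ ?_ intervalIntegrable_const ?_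
  · exact Eventually.of_forall fun z => (continuous_besselKernel_right n z).aestronglyMeasurable
  · exact (((continuous_besselKernel_right _ z).smul continuous_const).add
      ((continuous_besselKernel_right _ z).smul continuous_const)).aestronglyMeasurable
  · refine Eventually.of_forall fun σ _ z _ => (norm_add_le _ _).trans (le_of_eq ?_)
    rw [norm_smul _ A, norm_smul _ B, norm_besselKernel, norm_besselKernel, one_mul, one_mul]
  · refine Eventually.of_forall fun σ _ z _ => ?_
    have h1 : HasFDerivAt (fun z : ℂ => (n * σ - (z.re * Real.cos σ + z.im * Real.sin σ) : ℝ))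
        (-(Real.cos σ • Complex.reCLM + Real.sin σ • Complex.imCLM)) z := by
      refine HasFDerivAt.const_sub ?_ _
      have h2 := (Complex.reCLM.hasFDerivAt (x := z)).mul_const (Real.cos σ)
      have h3 := (Complex.imCLM.hasFDerivAt (x := z)).mul_const (Real.sin σ)
      exact h2.add h3
    have h4 := ((Complex.ofRealCLM.hasFDerivAt.comp z h1).mul_const Complex.I).cexp
    refine h4.congr_fderiv ?_
    refine ContinuousLinearMap.ext fun v => ?_
    have h5 := conj_mul_exp_add v σ
    have h6 : (besselKernel (n + 1) z σ • A + besselKernel (n - 1) z σ • B) v =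
        besselKernel n z σ * (-(Complex.I / 2) * ((starRingEnd ℂ) v * Complex.exp (σ * Complex.I) +
          v * Complex.exp (-(σ * Complex.I)))) := by
      simp [A, B, besselKernel_add_one, besselKernel_sub_one]
      ring
    rw [h6, h5]
    have h7 : Complex.exp ((Complex.ofRealCLM ∘ fun z : ℂ =>
        (n * σ - (z.re * Real.cos σ + z.im * Real.sin σ) : ℝ)) z * Complex.I) =
        besselKernel n z σ := rfl
    rw [h7]
    simp
    ring

/-! ### Bessel functions of a real argument: polar form, derivative, recurrence. -/

/-- The integral `∮ cos (nθ - x sin θ) dθ`, which is `2π` times Bessel's function. -/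
def besselJ (n : ℤ) (x : ℝ) : ℝ := ∫ θ in (0 : ℝ)..(2 * Real.pi), Real.cos (n * θ - x * Real.sin θ)

/-- The imaginary part is the integral of an odd function of period 2π over a full period. -/
lemma integral_exp_bessel (n : ℤ) (x : ℝ) :
    ∫ θ in (0 : ℝ)..(2 * Real.pi),
      Complex.exp (((n * θ - x * Real.sin θ : ℝ) : ℂ) * Complex.I) = (besselJ n x : ℂ) := by
  have hph : Continuous fun θ : ℝ => (n * θ - x * Real.sin θ : ℝ) := by fun_prop
  have hint : IntervalIntegrable (fun θ : ℝ =>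
      Complex.exp (((n * θ - x * Real.sin θ : ℝ) : ℂ) * Complex.I)) MeasureTheory.volume 0
      (2 * Real.pi) := (Complex.continuous_exp.comp
        ((Complex.continuous_ofReal.comp hph).mul continuous_const)).intervalIntegrable _ _
  have h1 := Complex.reCLM.intervalIntegral_comp_comm hint
  have h2 := Complex.imCLM.intervalIntegral_comp_comm hint
  simp only [Complex.reCLM_apply, Complex.imCLM_apply, Complex.exp_ofReal_mul_I_re,
    Complex.exp_ofReal_mul_I_im] at h1 h2
  apply Complex.ext
  · rw [← h1]; rfl
  · rw [← h2, Complex.ofReal_im]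
    have hper : Function.Periodic (fun θ : ℝ => Real.sin (n * θ - x * Real.sin θ))
        (2 * Real.pi) := fun θ => by
      simp only
      rw [Real.sin_add_two_pi, show (n : ℝ) * (θ + 2 * Real.pi) - x * Real.sin θ =
        (n * θ - x * Real.sin θ) + n * (2 * Real.pi) by ring, Real.sin_add_int_mul_two_pi]
    have h3 := hper.intervalIntegral_add_eq 0 (-Real.pi)
    rw [zero_add, show -Real.pi + 2 * Real.pi = Real.pi by ring] at h3
    rw [h3]
    have h4 := intervalIntegral.integral_comp_neg (a := -Real.pi) (b := Real.pi)
      (fun θ : ℝ => Real.sin (n * θ - x * Real.sin θ))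
    rw [neg_neg] at h4
    have h5 : ∀ θ : ℝ, Real.sin (n * -θ - x * Real.sin (-θ)) = -Real.sin (n * θ - x * Real.sin θ) :=
      fun θ => by rw [← Real.sin_neg, Real.sin_neg θ]; congr 1; ring
    simp only [h5, intervalIntegral.integral_neg] at h4
    linarith

/-- The substitution θ = σ + π/2 - φ turns cos(σ - φ) into sin θ; periodicity restores the interval
of integration. -/
lemma planeBessel_polar (n : ℤ) (ρ φ : ℝ) :
    planeBessel n (ρ * Complex.exp (φ * Complex.I)) =
      Complex.exp (((n * (φ - Real.pi / 2) : ℝ) : ℂ) * Complex.I) * (besselJ n ρ : ℂ) := by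
  set g : ℝ → ℂ := fun θ => Complex.exp (((n * θ - ρ * Real.sin θ : ℝ) : ℂ) * Complex.I) with hg
  have hper : Function.Periodic g (2 * Real.pi) := fun θ => by
    simp only [hg]
    rw [Real.sin_add_two_pi, show (((n : ℝ) * (θ + 2 * Real.pi) - ρ * Real.sin θ : ℝ) : ℂ) *
      Complex.I = ((n * θ - ρ * Real.sin θ : ℝ) : ℂ) * Complex.I +
        n * (2 * Real.pi * Complex.I) by push_cast; ring, Complex.exp_add,
      Complex.exp_int_mul_two_pi_mul_I, mul_one]
  have hk : ∀ σ : ℝ, besselKernel n (ρ * Complex.exp (φ * Complex.I)) σ =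
      Complex.exp (((n * (φ - Real.pi / 2) : ℝ) : ℂ) * Complex.I) * g (σ + (Real.pi / 2 - φ)) := by
    intro σ
    simp only [hg, besselKernel]
    rw [← Complex.exp_add, ← add_mul, ← Complex.ofReal_add]
    congr 3
    rw [show σ + (Real.pi / 2 - φ) = (σ - φ) + Real.pi / 2 by ring, Real.sin_add_pi_div_two,
      Real.cos_sub, Complex.re_ofReal_mul, Complex.im_ofReal_mul, Complex.exp_ofReal_mul_I_re,
      Complex.exp_ofReal_mul_I_im]
    ring
  unfold planeBessel
  simp only [hk]
  rw [intervalIntegral.integral_const_mul, intervalIntegral.integral_comp_add_right, zero_add,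
    add_comm (2 * Real.pi), hper.intervalIntegral_add_eq _ 0, zero_add, ← integral_exp_bessel]

lemma planeBessel_I (n : ℤ) (x : ℝ) : planeBessel n (x * Complex.I) = (besselJ n x : ℂ) := by
  have := planeBessel_polar n x (Real.pi / 2)
  rw [sub_self, mul_zero, Complex.ofReal_zero, zero_mul, Complex.exp_zero, one_mul] at this
  rw [← this]
  congr 2
  rw [Complex.ofReal_div, Complex.ofReal_ofNat, Complex.exp_pi_div_two_mul_I]

/-- The function is the restriction of `planeBessel` to the imaginary axis, where the plane
derivative in the direction i is known. -/
lemma hasDerivAt_besselJ (n : ℤ) (x : ℝ) :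
    HasDerivAt (besselJ n) ((besselJ (n - 1) x - besselJ (n + 1) x) / 2) x := by
  have h1 : HasDerivAt (fun x : ℝ => (x : ℂ) * Complex.I) (1 * Complex.I) x :=
    (Complex.ofRealCLM.hasDerivAt (x := x)).mul_const Complex.I
  have h2 := (hasFDerivAt_planeBessel n (x * Complex.I)).comp_hasDerivAt x h1
  rw [dPlaneBessel_apply, planeBessel_I, planeBessel_I] at h2
  have h3 := Complex.reCLM.hasFDerivAt.comp_hasDerivAt x h2
  refine (h3.congr_deriv ?_).congr_of_eventuallyEq (Eventually.of_forall fun y => ?_)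
  · simp
    ring
  · simp [planeBessel_I]

lemma continuous_besselJ (n : ℤ) : Continuous (besselJ n) :=
  continuous_iff_continuousAt.2 fun x => (hasDerivAt_besselJ n x).continuousAt

/-- The integral over a period of the derivative of sin(nθ - x sin θ) vanishes. -/
lemma besselJ_recurrence (n : ℤ) (x : ℝ) :
    n * besselJ n x = x / 2 * (besselJ (n - 1) x + besselJ (n + 1) x) := by
  have h : ∀ θ ∈ Set.uIcc 0 (2 * Real.pi), HasDerivAt
      (fun θ : ℝ => Real.sin (n * θ - x * Real.sin θ))
      (n * Real.cos (n * θ - x * Real.sin θ) -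
        x / 2 * (Real.cos ((n - 1 : ℤ) * θ - x * Real.sin θ) +
          Real.cos ((n + 1 : ℤ) * θ - x * Real.sin θ))) θ := by
    intro θ _
    have h1 : HasDerivAt (fun θ : ℝ => n * θ - x * Real.sin θ) (n * 1 - x * Real.cos θ) θ :=
      ((hasDerivAt_id θ).const_mul (n : ℝ)).sub ((Real.hasDerivAt_sin θ).const_mul x)
    refine h1.sin.congr_deriv ?_
    rw [show ((n - 1 : ℤ) : ℝ) * θ - x * Real.sin θ = (n * θ - x * Real.sin θ) - θ by
      push_cast; ring, show ((n + 1 : ℤ) : ℝ) * θ - x * Real.sin θ =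
      (n * θ - x * Real.sin θ) + θ by push_cast; ring, Real.cos_sub _ θ, Real.cos_add _ θ]
    ring
  have h2 := intervalIntegral.integral_eq_sub_of_hasDerivAt h
    (Continuous.intervalIntegrable (by fun_prop) _ _)
  rw [intervalIntegral.integral_sub, intervalIntegral.integral_const_mul,
    intervalIntegral.integral_const_mul, intervalIntegral.integral_add] at h2
  · have h3 : Real.sin (n * (2 * Real.pi) - x * Real.sin (2 * Real.pi)) -
        Real.sin (n * 0 - x * Real.sin 0) = 0 := by
      simp [Real.sin_two_pi]
      have := Real.sin_int_mul_pi (2 * n)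
      rw [← this]; congr 1; push_cast; ring
    rw [h3] at h2
    unfold besselJ
    linarith
  all_goals exact Continuous.intervalIntegrable (by fun_prop) _ _

/-! ### Positivity of Bessel functions -/

/-- The derivative of `besselJ`. -/
def dBesselJ (n : ℤ) (x : ℝ) : ℝ := (besselJ (n - 1) x - besselJ (n + 1) x) / 2

lemma continuous_dBesselJ (n : ℤ) : Continuous (dBesselJ n) :=
  ((continuous_besselJ _).sub (continuous_besselJ _)).div_const 2

lemma mul_dBesselJ_eq_sub (n : ℤ) (x : ℝ) :
    x * dBesselJ n x = x * besselJ (n - 1) x - n * besselJ n x := by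
  have := besselJ_recurrence n x
  unfold dBesselJ
  linarith

lemma mul_dBesselJ_eq_sub' (n : ℤ) (x : ℝ) :
    x * dBesselJ n x = n * besselJ n x - x * besselJ (n + 1) x := by
  have := besselJ_recurrence n x
  unfold dBesselJ
  linarith

/-- This is Bessel's equation in the form x(xJ')' = (n² - x²)J, deduced from the two ladder
relations for the indices n and n-1. -/
lemma hasDerivAt_mul_dBesselJ (n : ℤ) {x : ℝ} (hx : x ≠ 0) :
    HasDerivAt (fun x => x * dBesselJ n x) ((n ^ 2 - x ^ 2) / x * besselJ n x) x := by
  have h1 := ((hasDerivAt_id x).mul (hasDerivAt_besselJ (n - 1) x)).sub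
    ((hasDerivAt_besselJ n x).const_mul (n : ℝ))
  refine (h1.congr_deriv ?_).congr_of_eventuallyEq
    (Eventually.of_forall fun y => mul_dBesselJ_eq_sub n y)
  have h2 := mul_dBesselJ_eq_sub n x
  have h3 := mul_dBesselJ_eq_sub' (n - 1) x
  rw [sub_add_cancel] at h3
  unfold dBesselJ at h2 h3
  simp only [id, show n - 1 + 1 = n by ring] at h3 ⊢
  push_cast at h2 h3
  rw [div_mul_eq_mul_div, eq_div_iff hx]
  linear_combination x * h3 - n * h2

lemma besselJ_zero_pos : 0 < besselJ 0 0 := by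
  simp [besselJ]
  exact Real.pi_pos

lemma besselJ_zero {n : ℕ} (hn : n ≠ 0) : besselJ n 0 = 0 := by
  have := besselJ_recurrence n 0
  simpa [hn] using this

/-- The derivative of y^{n+1} J_{n+1} is y^{n+1} J_n, and the function vanishes at 0, so positivity
passes from one index to the next on the same interval. -/
lemma besselJ_pos_near_zero (n : ℕ) : ∃ δ > 0, ∀ x, 0 < x → x < δ → 0 < besselJ n x := by
  induction n with
  | zero =>
    have h := (continuous_besselJ 0).continuousAt.eventually (lt_mem_nhds besselJ_zero_pos)
    obtain ⟨δ, hδ, hb⟩ := Metric.eventually_nhds_iff.1 h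
    refine ⟨δ, hδ, fun x h0 h1 => hb ?_⟩
    rwa [Real.dist_eq, sub_zero, abs_of_pos h0]
  | succ n ih =>
    obtain ⟨δ, hδ, hpos⟩ := ih
    refine ⟨δ, hδ, fun x h0 h1 => ?_⟩
    have hd : ∀ y, HasDerivAt (fun y => y ^ (n + 1) * besselJ (n + 1 : ℕ) y)
        (y ^ (n + 1) * besselJ n y) y := fun y => by
      refine ((hasDerivAt_pow (n + 1) y).mul (hasDerivAt_besselJ (n + 1 : ℕ) y)).congr_deriv ?_
      have h2 := mul_dBesselJ_eq_sub (n + 1 : ℕ) y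
      unfold dBesselJ at h2
      simp only [Nat.cast_add, Nat.cast_one, add_sub_cancel_right, Nat.add_sub_cancel, Int.cast_add, Int.cast_natCast,
        Int.cast_one] at h2 ⊢
      linear_combination y ^ n * h2
    have hmono : StrictMonoOn (fun y => y ^ (n + 1) * besselJ (n + 1 : ℕ) y) (Set.Icc 0 x) := by
      refine strictMonoOn_of_deriv_pos (convex_Icc 0 x)
        (fun y _ => (hd y).continuousAt.continuousWithinAt) fun y hy => ?_
      rw [interior_Icc] at hy
      rw [(hd y).deriv]
      exact mul_pos (pow_pos hy.1 _) (hpos y hy.1 (hy.2.trans h1))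
    have := hmono ⟨le_rfl, h0.le⟩ ⟨h0.le, le_rfl⟩ h0
    simp only [ne_eq, Nat.add_eq_zero_iff, one_ne_zero, and_false, not_false_eq_true, zero_pow,
      zero_mul] at this
    exact (mul_pos_iff_of_pos_left (pow_pos h0 _)).1 this

/-- By Bessel's equation xJ' starts at 0 and increases as long as J > 0 and x < n. -/
lemma dBesselJ_pos_of {n : ℕ} {b : ℝ} (hbn : b ≤ n)
    (h : ∀ x, 0 < x → x < b → 0 < besselJ n x) {x : ℝ} (h0 : 0 < x) (h1 : x ≤ b) :
    0 < dBesselJ n x := by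
  have hmono : StrictMonoOn (fun y => y * dBesselJ n y) (Set.Icc 0 x) := by
    refine strictMonoOn_of_deriv_pos (convex_Icc 0 x)
      (continuous_id.mul (continuous_dBesselJ n)).continuousOn fun y hy => ?_
    rw [interior_Icc] at hy
    rw [(hasDerivAt_mul_dBesselJ n hy.1.ne').deriv]
    have hyn : y < n := by linarith [hy.2]
    have : 0 < (n : ℝ) ^ 2 - y ^ 2 := by nlinarith [hy.1]
    have hJ := h y hy.1 (hy.2.trans_le h1)
    have hy1 := hy.1
    push_cast
    positivity
  have := hmono ⟨le_rfl, h0.le⟩ ⟨h0.le, le_rfl⟩ h0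
  simp only [zero_mul] at this
  exact (mul_pos_iff_of_pos_left h0).1 this

/-- Otherwise there is a first point `y` where J fails to be positive. Up to it J' > 0, so J
increases on `[a, y]` from a positive value and cannot have failed there. -/
theorem besselJ_pos {n : ℕ} {x : ℝ} (h0 : 0 < x) (h1 : x ≤ n) :
    0 < besselJ n x := by
  obtain ⟨δ, hδ, hpos⟩ := besselJ_pos_near_zero n
  by_contra hneg
  -- The search for the first failure starts at some `a > 0`, since J_n(0) = 0 for n ≥ 1.
  obtain ⟨a, ha0, haδ, hax⟩ : ∃ a, 0 < a ∧ a < δ ∧ a < x :=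
    ⟨min δ x / 2, by positivity, by linarith [min_le_left δ x, lt_min hδ h0],
      by linarith [min_le_right δ x, lt_min hδ h0]⟩
  set S := {y | besselJ n y ≤ 0} ∩ Set.Icc a x with hS
  have hSc : IsCompact S := isCompact_Icc.inter_left
    (isClosed_le (continuous_besselJ n) continuous_const)
  have hSne : S.Nonempty := ⟨x, not_lt.1 hneg, hax.le, le_rfl⟩
  have hmem := hSc.sInf_mem hSne
  set y := sInf S with hy
  have hbelow : ∀ t, 0 < t → t < y → 0 < besselJ n t := by
    intro t ht0 hty
    by_cases hta : t < a
    · exact hpos t ht0 (hta.trans haδ)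
    · by_contra hcon
      exact absurd (csInf_le hSc.bddBelow (show t ∈ S from
        ⟨not_lt.1 hcon, not_lt.1 hta, hty.le.trans hmem.2.2⟩)) (not_le.2 hty)
  have hay : a < y := by
    refine lt_of_le_of_ne hmem.2.1 fun h => ?_
    have h2 := hpos a ha0 haδ
    have h3 : besselJ n y ≤ 0 := hmem.1
    rw [← h] at h3
    linarith
  have hmono : StrictMonoOn (besselJ n) (Set.Icc a y) := by
    refine strictMonoOn_of_deriv_pos (convex_Icc a y) (continuous_besselJ n).continuousOn
      fun t ht => ?_
    rw [interior_Icc] at ht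
    rw [(hasDerivAt_besselJ n t).deriv]
    exact dBesselJ_pos_of (hmem.2.2.trans h1) hbelow (ha0.trans ht.1) ht.2.le
  have h2 := hmono ⟨le_rfl, hay.le⟩ ⟨hay.le, le_rfl⟩ hay
  have h3 := hpos a ha0 haδ
  have h4 : besselJ n y ≤ 0 := hmem.1
  linarith

theorem dBesselJ_pos {n : ℕ} {x : ℝ} (h0 : 0 < x) (h1 : x ≤ n) : 0 < dBesselJ n x :=
  dBesselJ_pos_of le_rfl (fun _ h0 h1 => besselJ_pos h0 h1.le) h0 h1

/-- The inequality separates the two eigenvalues at the nodes of the straight string. For n = 1 it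
follows from J' = J - J_2 at the point 1. For larger n the energy-like function (xJ')² - (n² - l
x²)J² vanishes at 0 and increases, so it is positive at n. -/
theorem mul_dBesselJ_ne {n : ℕ} (hn : 1 ≤ n) : n * dBesselJ n n ≠ besselJ n n := by
  have hn0 : (0 : ℝ) < n := by exact_mod_cast hn
  rcases hn.eq_or_lt with rfl | hn2
  · have h1 := mul_dBesselJ_eq_sub' (1 : ℕ) 1
    have h2 : 0 < besselJ (2 : ℕ) 1 := besselJ_pos one_pos (by norm_num)
    norm_num at h1 h2 ⊢
    linarith
  · have hn2' : (2 : ℝ) ≤ n := by exact_mod_cast hn2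
    -- This value makes n² - l n² = 1, so that F(n) compares nJ'(n) with J(n).
    set l : ℝ := 1 - 1 / (n : ℝ) ^ 2 with hl
    set F : ℝ → ℝ := fun x =>
      (x * dBesselJ n x) ^ 2 - (n ^ 2 - l * x ^ 2) * besselJ n x ^ 2 with hF
    have hFc : Continuous F := by
      have := continuous_besselJ n
      have := continuous_dBesselJ n
      fun_prop
    have hFd : ∀ x, 0 < x → HasDerivAt F (2 * x * besselJ n x *
        (l * besselJ n x - (1 - l) * (x * dBesselJ n x))) x := by
      intro x hx
      have h1 := ((hasDerivAt_mul_dBesselJ n hx.ne').pow 2).sub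
        ((((hasDerivAt_pow 2 x).const_mul l).const_sub ((n : ℝ) ^ 2)).mul
          ((hasDerivAt_besselJ n x).pow 2))
      refine h1.congr_deriv ?_
      simp only [dBesselJ, Pi.pow_apply, Int.cast_natCast]
      field_simp
      ring
    have hmono : StrictMonoOn F (Set.Icc 0 n) := by
      refine strictMonoOn_of_deriv_pos (convex_Icc _ _) hFc.continuousOn fun x hx => ?_
      rw [interior_Icc] at hx
      rw [(hFd x hx.1).deriv]
      have hJ := besselJ_pos hx.1 hx.2.le
      have hJ1 : 0 < besselJ (n + 1 : ℕ) x :=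
        besselJ_pos hx.1 (by push_cast; linarith [hx.2])
      have h2 := mul_dBesselJ_eq_sub' n x
      push_cast at h2 hJ1
      -- Positivity of J_{n+1} bounds the logarithmic derivative of J by n/x; the term with 1 - l =
      -- 1/n² is then at most J/n ≤ J/2, less than lJ.
      have h3 : x * dBesselJ n x ≤ n * besselJ n x := by
        rw [h2]; linarith [mul_pos hx.1 hJ1]
      have h4 : 1 - l = 1 / (n : ℝ) ^ 2 := by rw [hl]; ring
      have h5 : (1 - l) * (x * dBesselJ n x) ≤ 1 / n * besselJ n x := by
        rw [h4]
        calc _ ≤ 1 / (n : ℝ) ^ 2 * (n * besselJ n x) := by gcongr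
          _ = _ := by field_simp
      have h6 : 1 / (n : ℝ) ≤ 1 / 2 := one_div_le_one_div_of_le two_pos hn2'
      have h7 : l ≥ 3 / 4 := by
        have : 1 / (n : ℝ) ^ 2 ≤ 1 / 4 := one_div_le_one_div_of_le (by norm_num) (by nlinarith)
        linarith
      have hx1 := hx.1
      have h8 : 0 < l * besselJ n x - (1 - l) * (x * dBesselJ n x) := by nlinarith
      positivity
    have h1 := hmono ⟨le_rfl, hn0.le⟩ ⟨hn0.le, le_rfl⟩ hn0
    have h2 : F 0 = 0 := by simp [hF, besselJ_zero (by omega : n ≠ 0)]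
    have h3 : F n = (n * dBesselJ n n) ^ 2 - besselJ n n ^ 2 := by
      simp only [hF, hl]
      field_simp
      ring
    rw [h2, h3] at h1
    intro h
    rw [h] at h1
    simp at h1

/-! ### Behaviour of the Bessel integral at the origin -/

lemma planeBessel_zero_right {n : ℤ} (hn : n ≠ 0) : planeBessel n 0 = 0 := by
  have h := planeBessel_I n 0
  rw [Complex.ofReal_zero, zero_mul] at h
  have h1 := besselJ_recurrence n 0
  rw [zero_div, zero_mul, mul_eq_zero] at h1
  rw [h, h1.resolve_left (by exact_mod_cast hn), Complex.ofReal_zero]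

lemma norm_dPlaneBessel_apply_le {n : ℤ} {z : ℂ} {a b : ℝ} (ha : ‖planeBessel (n + 1) z‖ ≤ a)
    (hb : ‖planeBessel (n - 1) z‖ ≤ b) (v : ℂ) :
    ‖dPlaneBessel n z v‖ ≤ (a + b) / 2 * ‖v‖ := by
  rw [dPlaneBessel_apply, norm_mul, norm_neg, norm_div, Complex.norm_I, Complex.norm_ofNat]
  have : ‖(starRingEnd ℂ) v * planeBessel (n + 1) z + v * planeBessel (n - 1) z‖ ≤
      ‖v‖ * a + ‖v‖ * b := by
    refine (norm_add_le _ _).trans ?_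
    rw [norm_mul, norm_mul, RCLike.norm_conj]
    gcongr
  linarith

/-- The derivative of B_{m+1} involves B_{m+2} and B_m, and both satisfy the bound of order k.
Separating the exponent from the index lets one induction hypothesis serve both, and the mean value
inequality gains a power of |z|. -/
lemma norm_planeBessel_le_pow (k n : ℕ) (hkn : k ≤ n) (z : ℂ) :
    ‖planeBessel n z‖ ≤ 2 * Real.pi * ‖z‖ ^ k := by
  induction k generalizing n z with
  | zero => simpa using norm_planeBessel_le n z
  | succ k ih =>
    obtain ⟨m, rfl⟩ : ∃ m, n = m + 1 := ⟨n - 1, by omega⟩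
    have h1 := (convex_closedBall (0 : ℂ) ‖z‖).norm_image_sub_le_of_norm_hasFDerivWithin_le
      (f := planeBessel (m + 1 : ℕ)) (f' := dPlaneBessel (m + 1 : ℕ))
      (C := 2 * Real.pi * ‖z‖ ^ k) (x := 0) (y := z)
      (fun w _ => (hasFDerivAt_planeBessel _ w).hasFDerivWithinAt) (fun w hw => ?_)
      (by simp) (by simp)
    · rw [planeBessel_zero_right (by push_cast; omega), sub_zero, sub_zero] at h1
      rw [pow_succ]
      linarith
    · refine ContinuousLinearMap.opNorm_le_bound _ (by positivity) fun v => ?_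
      have hw' : ‖w‖ ≤ ‖z‖ := by simpa using hw
      have hle : 2 * Real.pi * ‖w‖ ^ k ≤ 2 * Real.pi * ‖z‖ ^ k := by gcongr
      have h2 := ih (m + 2) (by omega) w
      have h3 := ih m (by omega) w
      refine (norm_dPlaneBessel_apply_le (a := 2 * Real.pi * ‖z‖ ^ k)
        (b := 2 * Real.pi * ‖z‖ ^ k) ?_ ?_ v).trans (le_of_eq (by ring))
      · have : (((m + 1 : ℕ) : ℤ) + 1) = ((m + 2 : ℕ) : ℤ) := by push_cast; ring
        rw [this]
        exact h2.trans hle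
      · have : (((m + 1 : ℕ) : ℤ) - 1) = (m : ℤ) := by push_cast; ring
        rw [this]
        exact h3.trans hle

lemma norm_dPlaneBessel_le_pow (n : ℕ) (z : ℂ) :
    ‖dPlaneBessel (n + 1 : ℕ) z‖ ≤ 2 * Real.pi * ‖z‖ ^ n := by
  refine ContinuousLinearMap.opNorm_le_bound _ (by positivity) fun v => ?_
  refine (norm_dPlaneBessel_apply_le (a := 2 * Real.pi * ‖z‖ ^ n)
        (b := 2 * Real.pi * ‖z‖ ^ n) ?_ ?_ v).trans (le_of_eq (by ring))
  · have : (((n + 1 : ℕ) : ℤ) + 1) = ((n + 2 : ℕ) : ℤ) := by push_cast; ring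
    rw [this]
    exact norm_planeBessel_le_pow n (n + 2) (by omega) z
  · have : (((n + 1 : ℕ) : ℤ) - 1) = (n : ℤ) := by push_cast; ring
    rw [this]
    exact norm_planeBessel_le_pow n n le_rfl z

/-- The leading Taylor coefficient of `planeBessel n`. -/
def besselCoeff : ℕ → ℂ
  | 0 => 2 * Real.pi
  | n + 1 => -(Complex.I / 2) * besselCoeff n / (n + 1)

lemma besselCoeff_ne_zero (n : ℕ) : besselCoeff n ≠ 0 := by
  induction n with
  | zero => simp [besselCoeff, Real.pi_ne_zero]
  | succ n ih =>
    rw [besselCoeff]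
    have : (n : ℂ) + 1 ≠ 0 := by exact_mod_cast n.succ_ne_zero
    simp [ih, this]

lemma planeBessel_zero_zero : planeBessel 0 0 = 2 * Real.pi := by
  have := planeBessel_I 0 0
  rw [Complex.ofReal_zero, zero_mul] at this
  rw [this]
  simp [besselJ]

lemma dPlaneBessel_sub_apply (n : ℕ) (z v : ℂ) :
    dPlaneBessel (n + 1 : ℕ) z v - (n + 1) * besselCoeff (n + 1) * z ^ n * v =
      -(Complex.I / 2) * ((starRingEnd ℂ) v * planeBessel (n + 2 : ℕ) z +
        v * (planeBessel n z - besselCoeff n * z ^ n)) := by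
  rw [dPlaneBessel_apply, besselCoeff]
  have h1 : (((n + 1 : ℕ) : ℤ) + 1) = ((n + 2 : ℕ) : ℤ) := by push_cast; ring
  have h2 : (((n + 1 : ℕ) : ℤ) - 1) = (n : ℤ) := by push_cast; ring
  have : (n : ℂ) + 1 ≠ 0 := by exact_mod_cast n.succ_ne_zero
  rw [h1, h2]
  field_simp
  ring

/-- By `dPlaneBessel_sub_apply` the derivative of the remainder consists of B_{n+2}, which is small
to order n+1, and of the remainder at the preceding index. The mean value inequality from 0
completes the induction. -/
lemma exists_planeBessel_expansion (n : ℕ) : ∃ A > 0, ∀ z : ℂ, ‖z‖ ≤ 1 →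
    ‖planeBessel n z - besselCoeff n * z ^ n‖ ≤ A * ‖z‖ ^ (n + 1) := by
  induction n with
  | zero =>
    refine ⟨2 * Real.pi, by positivity, fun z _ => ?_⟩
    have h1 := (convex_univ (𝕜 := ℝ) (E := ℂ)).norm_image_sub_le_of_norm_hasFDerivWithin_le
      (𝕜 := ℝ) (f := planeBessel 0) (f' := dPlaneBessel 0) (C := 2 * Real.pi) (x := 0) (y := z)
      (fun w _ => (hasFDerivAt_planeBessel _ w).hasFDerivWithinAt) (fun w _ => ?_) trivial trivial
    · rw [planeBessel_zero_zero, sub_zero] at h1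
      simpa [besselCoeff] using h1
    · refine ContinuousLinearMap.opNorm_le_bound _ (by positivity) fun v => ?_
      exact (norm_dPlaneBessel_apply_le (norm_planeBessel_le _ _) (norm_planeBessel_le _ _)
        v).trans (le_of_eq (by ring))
  | succ n ih =>
    obtain ⟨A, hA, hAb⟩ := ih
    refine ⟨(2 * Real.pi + A) / 2, by positivity, fun z hz => ?_⟩
    have hd : ∀ w : ℂ, HasFDerivAt
        (fun w => planeBessel (n + 1 : ℕ) w - besselCoeff (n + 1) * w ^ (n + 1))
        (dPlaneBessel (n + 1 : ℕ) w -
          ((n + 1) * besselCoeff (n + 1) * w ^ n) • ContinuousLinearMap.id ℝ ℂ) w := by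
      intro w
      have h2 := (((hasDerivAt_pow (n + 1) w).const_mul
        (besselCoeff (n + 1))).hasFDerivAt.restrictScalars ℝ)
      refine ((hasFDerivAt_planeBessel _ w).sub h2).congr_fderiv ?_
      refine ContinuousLinearMap.ext fun v => ?_
      simp
      ring
    have h1 := (convex_closedBall (0 : ℂ) ‖z‖).norm_image_sub_le_of_norm_hasFDerivWithin_le
      (C := (2 * Real.pi + A) / 2 * ‖z‖ ^ (n + 1)) (x := 0) (y := z)
      (fun w _ => (hd w).hasFDerivWithinAt) (fun w hw => ?_) (by simp) (by simp)
    · rw [planeBessel_zero_right (by push_cast; omega)] at h1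
      simp only [ne_eq, Nat.add_eq_zero_iff, one_ne_zero, and_false, not_false_eq_true, zero_pow,
        mul_zero, sub_zero] at h1
      rw [pow_succ ‖z‖ (n + 1)]
      linarith
    · refine ContinuousLinearMap.opNorm_le_bound _ (by positivity) fun v => ?_
      have hw' : ‖w‖ ≤ ‖z‖ := by simpa using hw
      have e : (dPlaneBessel (n + 1 : ℕ) w -
          ((n + 1) * besselCoeff (n + 1) * w ^ n) • ContinuousLinearMap.id ℝ ℂ) v =
          dPlaneBessel (n + 1 : ℕ) w v - (n + 1) * besselCoeff (n + 1) * w ^ n * v := by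
        simp
      rw [e, dPlaneBessel_sub_apply, norm_mul, norm_neg, norm_div, Complex.norm_I,
        Complex.norm_ofNat]
      have h2 : ‖(starRingEnd ℂ) v * planeBessel (n + 2 : ℕ) w +
          v * (planeBessel n w - besselCoeff n * w ^ n)‖ ≤
          ‖v‖ * (2 * Real.pi * ‖z‖ ^ (n + 1)) + ‖v‖ * (A * ‖z‖ ^ (n + 1)) := by
        refine (norm_add_le _ _).trans ?_
        rw [norm_mul, norm_mul, RCLike.norm_conj]
        gcongr
        · exact (norm_planeBessel_le_pow (n + 1) (n + 2) (by omega) w).trans (by gcongr)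
        · exact (hAb w (hw'.trans hz)).trans (by gcongr)
      linarith

lemma exists_dPlaneBessel_expansion (n : ℕ) : ∃ A > 0, ∀ z : ℂ, ‖z‖ ≤ 1 → ∀ v : ℂ,
    ‖dPlaneBessel (n + 1 : ℕ) z v - (n + 1) * besselCoeff (n + 1) * z ^ n * v‖ ≤
      A * ‖z‖ ^ (n + 1) * ‖v‖ := by
  obtain ⟨A, hA, hAb⟩ := exists_planeBessel_expansion n
  refine ⟨(2 * Real.pi + A) / 2, by positivity, fun z hz v => ?_⟩
  rw [dPlaneBessel_sub_apply, norm_mul, norm_neg, norm_div, Complex.norm_I, Complex.norm_ofNat]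
  have h2 : ‖(starRingEnd ℂ) v * planeBessel (n + 2 : ℕ) z +
      v * (planeBessel n z - besselCoeff n * z ^ n)‖ ≤
      ‖v‖ * (2 * Real.pi * ‖z‖ ^ (n + 1)) + ‖v‖ * (A * ‖z‖ ^ (n + 1)) := by
    refine (norm_add_le _ _).trans ?_
    rw [norm_mul, norm_mul, RCLike.norm_conj]
    gcongr
    · exact norm_planeBessel_le_pow (n + 1) (n + 2) (by omega) z
    · exact hAb z hz
  linarith

/-! ### Horizontal components as complex numbers -/

/-- The horizontal component of a vector, as a complex number. -/
def horiz : E3 →L[ℝ] ℂ :=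
  (EuclideanSpace.proj (𝕜 := ℝ) (0 : Fin 3)).smulRight (1 : ℂ) +
    (EuclideanSpace.proj (𝕜 := ℝ) (1 : Fin 3)).smulRight Complex.I

@[simp] lemma horiz_re (e : E3) : (horiz e).re = e 0 := by simp [horiz]

@[simp] lemma horiz_im (e : E3) : (horiz e).im = e 1 := by simp [horiz]

/-- A complex number as a horizontal vector. -/
def embed : ℂ →L[ℝ] E3 :=
  Complex.reCLM.smulRight (EuclideanSpace.single 0 1) +
    Complex.imCLM.smulRight (EuclideanSpace.single 1 1)

@[simp] lemma embed_zero (w : ℂ) : embed w 0 = w.re := by simp [embed]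

@[simp] lemma embed_one (w : ℂ) : embed w 1 = w.im := by simp [embed]

@[simp] lemma embed_two (w : ℂ) : embed w 2 = 0 := by simp [embed]

@[simp] lemma horiz_embed (w : ℂ) : horiz (embed w) = w := by
  apply Complex.ext <;> simp

lemma eq_of_horiz_eq {e f : E3} (h : horiz e = horiz f) (h2 : e 2 = f 2) : e = f := by
  ext i
  fin_cases i
  · simpa using congrArg Complex.re h
  · simpa using congrArg Complex.im h
  · exact h2

lemma norm_sq_eq (e : E3) : ‖e‖ ^ 2 = ‖horiz e‖ ^ 2 + e 2 ^ 2 := by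
  rw [EuclideanSpace.norm_sq_eq, Complex.sq_norm, Complex.normSq_apply, Fin.sum_univ_three]
  simp
  ring

lemma norm_embed (w : ℂ) : ‖embed w‖ = ‖w‖ := by
  have := norm_sq_eq (embed w)
  rw [horiz_embed, embed_two] at this
  exact (pow_left_inj₀ (norm_nonneg _) (norm_nonneg _) two_ne_zero).1 (by rw [this]; ring)

lemma norm_horiz_le (e : E3) : ‖horiz e‖ ≤ ‖e‖ := by
  have := norm_sq_eq e
  exact le_of_sq_le_sq (by nlinarith [sq_nonneg (e 2)]) (norm_nonneg _)

lemma horiz_equatorPoint (τ : ℝ) :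
    horiz (equatorPoint τ) = Complex.exp (((Real.pi / 2 + τ : ℝ) : ℂ) * Complex.I) := by
  apply Complex.ext
  · rw [Complex.exp_ofReal_mul_I_re]; simp [equatorPoint]
  · rw [Complex.exp_ofReal_mul_I_im]; simp [equatorPoint]

lemma equatorPoint_eq_iff (τ τ' : ℝ) :
    equatorPoint τ = equatorPoint τ' ↔ ∃ j : ℤ, τ' = τ + j * (2 * Real.pi) := by
  constructor
  · intro h
    have h1 := congrArg horiz h
    rw [horiz_equatorPoint, horiz_equatorPoint, Complex.exp_eq_exp_iff_exists_int] at h1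
    obtain ⟨n, hn⟩ := h1
    refine ⟨-n, ?_⟩
    have h2 : (((Real.pi / 2 + τ : ℝ) : ℂ)) = ((Real.pi / 2 + τ' + n * (2 * Real.pi) : ℝ) : ℂ) := by
      refine mul_right_cancel₀ Complex.I_ne_zero (hn.trans ?_)
      push_cast
      ring
    have h3 := Complex.ofReal_injective h2
    push_cast
    linarith
  · rintro ⟨j, rfl⟩
    unfold equatorPoint
    rw [← add_assoc, Real.cos_add_int_mul_two_pi, Real.sin_add_int_mul_two_pi]

lemma norm_equatorPoint (τ : ℝ) : ‖equatorPoint τ‖ = 1 := by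
  simp [EuclideanSpace.norm_eq, equatorPoint, Fin.sum_univ_three]

lemma horiz_rotZ (τ : ℝ) (e : E3) :
    horiz (rotZ τ e) = Complex.exp ((τ : ℂ) * Complex.I) * horiz e := by
  apply Complex.ext
  · rw [Complex.mul_re, Complex.exp_ofReal_mul_I_re, Complex.exp_ofReal_mul_I_im]; simp [rotZ]
  · rw [Complex.mul_im, Complex.exp_ofReal_mul_I_re, Complex.exp_ofReal_mul_I_im]
    simp [rotZ]
    ring

lemma rotZ_two (τ : ℝ) (e : E3) : rotZ τ e 2 = e 2 := by simp [rotZ]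

lemma norm_rotZ (τ : ℝ) (e : E3) : ‖rotZ τ e‖ = ‖e‖ := by
  refine (pow_left_inj₀ (norm_nonneg _) (norm_nonneg _) two_ne_zero).1 ?_
  rw [norm_sq_eq, norm_sq_eq, horiz_rotZ, rotZ_two, norm_mul, Complex.norm_exp_ofReal_mul_I, one_mul]

lemma rotZ_rotZ (a b : ℝ) (e : E3) : rotZ a (rotZ b e) = rotZ (a + b) e := by
  refine eq_of_horiz_eq ?_ (by simp [rotZ_two])
  rw [horiz_rotZ, horiz_rotZ, horiz_rotZ, ← mul_assoc, ← Complex.exp_add]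
  push_cast
  ring_nf

lemma rotZ_zero (e : E3) : rotZ 0 e = e := by
  refine eq_of_horiz_eq ?_ (rotZ_two _ _)
  simp [horiz_rotZ]

/-- Rotation about the polar axis as a linear isometry. -/
def rotIso (τ : ℝ) : E3 ≃ₗᵢ[ℝ] E3 where
  toFun := rotZ τ
  invFun := rotZ (-τ)
  left_inv e := by rw [rotZ_rotZ, neg_add_cancel, rotZ_zero]
  right_inv e := by rw [rotZ_rotZ, add_neg_cancel, rotZ_zero]
  map_add' x y := by
    refine eq_of_horiz_eq ?_ (by simp [rotZ_two])
    rw [map_add, horiz_rotZ, horiz_rotZ, horiz_rotZ, map_add, mul_add]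
  map_smul' c x := by
    refine eq_of_horiz_eq ?_ (by simp [rotZ_two])
    simp only [RingHom.id_apply]
    rw [map_smul, horiz_rotZ, horiz_rotZ, map_smul, mul_smul_comm]
  norm_map' := norm_rotZ τ

lemma rotZ_equatorPoint (τ θ : ℝ) : rotZ τ (equatorPoint θ) = equatorPoint (τ + θ) := by
  refine eq_of_horiz_eq ?_ (by simp [rotZ_two, equatorPoint])
  rw [horiz_rotZ, horiz_equatorPoint, horiz_equatorPoint, ← Complex.exp_add]
  push_cast
  ring_nf

lemma eq_pole_of_horiz {e : E3} (he : ‖e‖ = 1) (h : horiz e = 0) : e = north ∨ e = -north := by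
  have h2 := norm_sq_eq e
  rw [he, h] at h2
  have h3 : e 2 ^ 2 = 1 := by rw [norm_zero] at h2; linarith
  rcases sq_eq_sq_iff_eq_or_eq_neg.1 (h3.trans (one_pow 2).symm) with h4 | h4
  · left
    exact eq_of_horiz_eq (by rw [h]; apply Complex.ext <;> simp [north]) (by simp [north, h4])
  · right
    exact eq_of_horiz_eq (by rw [h]; apply Complex.ext <;> simp [north]) (by simp [north, h4])

/-! ### The field of the straight-line string -/

lemma arcLength_straight (σ : ℝ) : arcLength straight σ = σ := by
  simp [arcLength, norm_deriv_straight]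

lemma totalLength_straight : totalLength straight = 2 * Real.pi := arcLength_straight _

lemma meanPosition_straight : meanPosition straight = 0 := by
  have h : ∫ σ in (0 : ℝ)..(2 * Real.pi), straight σ = 0 := by
    ext i
    rw [integral_apply isClosedCurve_straight.continuous]
    fin_cases i <;> simp [straight]
  simp [meanPosition, norm_deriv_straight, h]

lemma phase_straight (s : ℕ) (τ : ℝ) (e : E3) (σ : ℝ) : phase straight s τ e σ =
    s * σ - (s * e 0 * Real.cos σ + s * e 1 * Real.sin σ) - s * τ := by
  unfold phase
  rw [totalLength_straight, arcLength_straight, meanPosition_straight, sub_zero,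
    EuclideanSpace.inner_eq_star_dotProduct]
  simp [straight, dotProduct, Fin.sum_univ_three]
  field_simp
  ring

/-- The horizontal field of the straight-line string, in the complex coordinate. -/
def straightPlane (s : ℕ) (τ : ℝ) (z : ℂ) : ℂ := (Complex.I * ampConst / 2) *
  (Complex.exp ((-(s * τ) : ℝ) * Complex.I) * planeBessel (s + 1) (s * z) +
    Complex.exp ((s * τ : ℝ) * Complex.I) * (starRingEnd ℂ) (planeBessel (s - 1) (s * z)))

/-- The velocity is i e^{iσ} and the cosine is the half-sum of two conjugate exponentials. The
velocity raises the index of one to s+1; the other becomes the conjugate of the kernel with index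
s-1. -/
lemma cos_phase_straight (s : ℕ) (τ : ℝ) (e : E3) (σ : ℝ) :
    horiz (Real.cos (phase straight s τ e σ) • deriv straight σ) =
    (Complex.I / 2) * (Complex.exp ((-(s * τ) : ℝ) * Complex.I) *
      besselKernel (s + 1) (s * horiz e) σ + Complex.exp ((s * τ : ℝ) * Complex.I) *
      (starRingEnd ℂ) (besselKernel (s - 1) (s * horiz e) σ)) := by
  have h1 : horiz (deriv straight σ) = Complex.I * Complex.exp (σ * Complex.I) := by
    apply Complex.ext
    · rw [Complex.I_mul_re, Complex.exp_ofReal_mul_I_im]; simp [deriv_straight]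
    · rw [Complex.I_mul_im, Complex.exp_ofReal_mul_I_re]; simp [deriv_straight]
  have h2 : Complex.exp ((-(s * τ) : ℝ) * Complex.I) * besselKernel (s + 1) (s * horiz e) σ =
      Complex.exp ((phase straight s τ e σ : ℝ) * Complex.I) * Complex.exp (σ * Complex.I) := by
    unfold besselKernel
    rw [← Complex.exp_add, ← Complex.exp_add, phase_straight]
    congr 1
    simp
    ring
  have h3 : Complex.exp ((s * τ : ℝ) * Complex.I) *
      (starRingEnd ℂ) (besselKernel (s - 1) (s * horiz e) σ) =
      Complex.exp (-((phase straight s τ e σ : ℝ) * Complex.I)) * Complex.exp (σ * Complex.I) := by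
    unfold besselKernel
    rw [← Complex.exp_conj, ← Complex.exp_add, ← Complex.exp_add, phase_straight]
    congr 1
    rw [map_mul, Complex.conj_ofReal, Complex.conj_I]
    simp
    ring
  rw [map_smul, h1, h2, h3, ← add_mul, Complex.real_smul, Complex.ofReal_cos, Complex.cos]
  ring_nf

lemma qVec_straight (s : ℕ) (τ : ℝ) (e : E3) :
    qVec straight s τ e = embed (straightPlane s τ (horiz e)) := by
  have hd := isClosedCurve_straight.continuous_deriv
  have hph : Continuous fun σ => phase straight s τ e σ :=
    (isClosedCurve_straight.continuous_phase s).comp (f := fun σ => ((τ, e), σ)) (by fun_prop)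
  have hc : Continuous fun σ => Real.cos (phase straight s τ e σ) • deriv straight σ := by fun_prop
  rw [qVec_eq_integral isClosedCurve_straight]
  refine eq_of_horiz_eq ?_ ?_
  · rw [map_smul, horiz_embed, ← horiz.intervalIntegral_comp_comm (hc.intervalIntegrable _ _)]
    simp only [cos_phase_straight]
    have k1 := continuous_besselKernel_right (s + 1) (s * horiz e)
    have k2 : Continuous fun σ => (starRingEnd ℂ) (besselKernel (s - 1) (s * horiz e) σ) :=
      Complex.continuous_conj.comp (continuous_besselKernel_right (s - 1) (s * horiz e))
    have k3 : Continuous fun σ => Complex.exp ((-(s * τ) : ℝ) * Complex.I) *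
      besselKernel (s + 1) (s * horiz e) σ := continuous_const.mul k1
    have k4 : Continuous fun σ => Complex.exp ((s * τ : ℝ) * Complex.I) *
      (starRingEnd ℂ) (besselKernel (s - 1) (s * horiz e) σ) := continuous_const.mul k2
    rw [intervalIntegral.integral_const_mul, intervalIntegral.integral_add
      (k3.intervalIntegrable _ _) (k4.intervalIntegrable _ _), intervalIntegral.integral_const_mul,
      intervalIntegral.integral_const_mul]
    have h3 := (Complex.conjCLE : ℂ →L[ℝ] ℂ).intervalIntegral_comp_comm
      ((continuous_besselKernel_right (s - 1) (s * horiz e)).intervalIntegrable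
        (μ := MeasureTheory.volume) 0 (2 * Real.pi))
    simp only [ContinuousLinearEquiv.coe_coe, Complex.conjCLE_apply] at h3
    rw [h3, Complex.real_smul]
    unfold straightPlane planeBessel
    ring
  · rw [embed_two, PiLp.smul_apply, integral_apply hc]
    simp [deriv_straight]

lemma planeBessel_rotate (n : ℤ) (τ : ℝ) (z : ℂ) :
    planeBessel n (Complex.exp (τ * Complex.I) * z) =
      Complex.exp ((n * τ : ℝ) * Complex.I) * planeBessel n z := by
  conv_lhs => rw [← Complex.norm_mul_exp_arg_mul_I z]
  conv_rhs => rw [← Complex.norm_mul_exp_arg_mul_I z]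
  rw [planeBessel_polar, mul_left_comm, ← Complex.exp_add, ← add_mul, ← Complex.ofReal_add,
    planeBessel_polar, ← mul_assoc, ← Complex.exp_add]
  congr 2
  push_cast
  ring

lemma straightPlane_rotate (s : ℕ) (a τ : ℝ) (z : ℂ) :
    straightPlane s (a + τ) (Complex.exp (τ * Complex.I) * z) =
      Complex.exp (τ * Complex.I) * straightPlane s a z := by
  unfold straightPlane
  have h : ∀ w : ℂ, (s : ℂ) * (Complex.exp (τ * Complex.I) * w) =
    Complex.exp (τ * Complex.I) * (s * w) := fun w => by ring
  rw [h, planeBessel_rotate, planeBessel_rotate, map_mul, ← Complex.exp_conj]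
  have e1 : Complex.exp ((-(s * (a + τ)) : ℝ) * Complex.I) *
      Complex.exp ((((s + 1 : ℤ) : ℝ) * τ : ℝ) * Complex.I) =
      Complex.exp (τ * Complex.I) * Complex.exp ((-(s * a) : ℝ) * Complex.I) := by
    rw [← Complex.exp_add, ← Complex.exp_add]
    congr 1
    push_cast
    ring
  have e2 : Complex.exp ((s * (a + τ) : ℝ) * Complex.I) *
      Complex.exp ((starRingEnd ℂ) ((((s - 1 : ℤ) : ℝ) * τ : ℝ) * Complex.I)) =
      Complex.exp (τ * Complex.I) * Complex.exp ((s * a : ℝ) * Complex.I) := by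
    rw [← Complex.exp_add, ← Complex.exp_add]
    congr 1
    rw [map_mul, Complex.conj_ofReal, Complex.conj_I]
    push_cast
    ring
  linear_combination (Complex.I * ampConst / 2) * (planeBessel (s + 1) (s * z) * e1 +
    (starRingEnd ℂ) (planeBessel (s - 1) (s * z)) * e2)

lemma qVec_straight_rotate (s : ℕ) (a τ : ℝ) (e : E3) :
    qVec straight s (a + τ) (rotZ τ e) = rotZ τ (qVec straight s a e) := by
  rw [qVec_straight, qVec_straight, horiz_rotZ, straightPlane_rotate]
  refine eq_of_horiz_eq ?_ (by simp [rotZ_two])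
  rw [horiz_embed, horiz_rotZ, horiz_embed]

lemma inner_rotZ (τ : ℝ) (x y : E3) : ⟪rotZ τ x, rotZ τ y⟫ = ⟪x, y⟫ :=
  (rotIso τ).inner_map_map x y

lemma rotZ_sub (τ : ℝ) (x y : E3) : rotZ τ (x - y) = rotZ τ x - rotZ τ y := map_sub (rotIso τ) x y

lemma rotZ_smul (τ c : ℝ) (x : E3) : rotZ τ (c • x) = c • rotZ τ x := map_smul (rotIso τ) c x

lemma qPerp_straight_rotate (s : ℕ) (a τ : ℝ) (e : E3) :
    qPerp straight s (a + τ) (rotZ τ e) = rotZ τ (qPerp straight s a e) := by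
  unfold qPerp
  rw [qVec_straight_rotate, inner_rotZ, rotZ_sub, rotZ_smul]

/-- After the factor e^{iφ} is taken out, the real part is the radial component and the imaginary
part the azimuthal one. -/
lemma straightPlane_polar (s : ℕ) (τ ρ φ : ℝ) :
    straightPlane s τ (ρ * Complex.exp (φ * Complex.I)) =
      Complex.exp (φ * Complex.I) * ((ampConst / 2 : ℝ) *
        (((besselJ (s - 1) (s * ρ) + besselJ (s + 1) (s * ρ)) *
          Real.cos (s * (φ - Real.pi / 2 - τ)) : ℝ) -
        ((besselJ (s - 1) (s * ρ) - besselJ (s + 1) (s * ρ)) *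
          Real.sin (s * (φ - Real.pi / 2 - τ)) : ℝ) * Complex.I)) := by
  unfold straightPlane
  have h : (s : ℂ) * (ρ * Complex.exp (φ * Complex.I)) =
    ((s * ρ : ℝ) : ℂ) * Complex.exp (φ * Complex.I) := by push_cast; ring
  rw [h, planeBessel_polar, planeBessel_polar, map_mul, Complex.conj_ofReal, ← Complex.exp_conj]
  set ψ : ℝ := s * (φ - Real.pi / 2 - τ) with hψ
  have hI : Complex.exp ((-(Real.pi / 2) : ℝ) * Complex.I) = -Complex.I := by
    rw [Complex.ofReal_neg, Complex.ofReal_div, Complex.ofReal_ofNat, neg_mul, Complex.exp_neg,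
      Complex.exp_pi_div_two_mul_I, Complex.inv_I]
  have e1 : Complex.exp ((-(s * τ) : ℝ) * Complex.I) *
      Complex.exp ((((s + 1 : ℤ) : ℝ) * (φ - Real.pi / 2) : ℝ) * Complex.I) =
      -Complex.I * (Complex.exp (φ * Complex.I) * Complex.exp (ψ * Complex.I)) := by
    rw [← hI, ← Complex.exp_add, ← Complex.exp_add, ← Complex.exp_add, hψ]
    congr 1
    push_cast
    ring
  have e2 : Complex.exp ((s * τ : ℝ) * Complex.I) *
      Complex.exp ((starRingEnd ℂ) ((((s - 1 : ℤ) : ℝ) * (φ - Real.pi / 2) : ℝ) * Complex.I)) =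
      -Complex.I * (Complex.exp (φ * Complex.I) * Complex.exp (-(ψ * Complex.I))) := by
    rw [← hI, ← Complex.exp_add, ← Complex.exp_add, ← Complex.exp_add, hψ]
    congr 1
    rw [map_mul, Complex.conj_ofReal, Complex.conj_I]
    push_cast
    ring
  have e3 : Complex.exp (ψ * Complex.I) = Real.cos ψ + Real.sin ψ * Complex.I := by
    rw [Complex.exp_mul_I, Complex.ofReal_cos, Complex.ofReal_sin]
  have e4 : Complex.exp (-(ψ * Complex.I)) = Real.cos ψ - Real.sin ψ * Complex.I := by
    rw [← neg_mul, Complex.exp_mul_I, Complex.cos_neg, Complex.sin_neg, Complex.ofReal_cos,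
      Complex.ofReal_sin]
    ring
  rw [e3] at e1
  rw [e4] at e2
  push_cast at e1 e2 ⊢
  linear_combination (Complex.I * ampConst / 2) * (besselJ (s + 1) (s * ρ) * e1 +
    besselJ (s - 1) (s * ρ) * e2) - (ampConst / 2) * Complex.exp (φ * Complex.I) *
    (besselJ (s + 1) (s * ρ) * (Complex.cos ψ + Complex.sin ψ * Complex.I) +
      besselJ (s - 1) (s * ρ) * (Complex.cos ψ - Complex.sin ψ * Complex.I)) * Complex.I_sq

/-! ### Singular points of the straight-line string -/

lemma norm_north : ‖north‖ = 1 := by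
  simp [EuclideanSpace.norm_eq, north, Fin.sum_univ_three]

lemma horiz_north : horiz north = 0 := by apply Complex.ext <;> simp [north]

lemma horiz_pole {p : E3} (hp : p = north ∨ p = -north) : horiz p = 0 := by
  rcases hp with rfl | rfl <;> simp [horiz_north]

lemma norm_pole {p : E3} (hp : p = north ∨ p = -north) : ‖p‖ = 1 := by
  rcases hp with rfl | rfl <;> simp [norm_north]

lemma straightPlane_zero {s : ℕ} (hs : 2 ≤ s) (τ : ℝ) : straightPlane s τ 0 = 0 := by
  unfold straightPlane
  rw [mul_zero, planeBessel_zero_right (by omega), planeBessel_zero_right (by omega)]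
  simp

/-- For s = 1 the second index is 0, and B_0 does not vanish at the origin; this is why the poles
are singular only for s ≥ 2. -/
lemma straightPlane_one_zero_ne (τ : ℝ) : straightPlane 1 τ 0 ≠ 0 := by
  unfold straightPlane
  rw [mul_zero, planeBessel_zero_right (by norm_num),
    show ((1 : ℕ) : ℤ) - 1 = 0 from rfl, planeBessel_zero_zero]
  have h1 := ampConst_pos.ne'
  have h2 := Real.pi_ne_zero
  simp [h1, h2, Complex.exp_ne_zero]

lemma tangential_eq_zero_iff {q : E3 → E3} {e : E3} : tangential q e = 0 ↔ q e = ⟪q e, e⟫ • e :=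
  sub_eq_zero

/-- By the recurrence this sum equals 2/ρ times J_s(sρ), while the difference below is 2J_s'(sρ);
the argument stays in (0, s]. -/
lemma besselJ_sum_pos {s : ℕ} (hs : 1 ≤ s) {ρ : ℝ} (h0 : 0 < ρ) (h1 : ρ ≤ 1) :
    0 < besselJ (s - 1) (s * ρ) + besselJ (s + 1) (s * ρ) := by
  have hs0 : (0 : ℝ) < s := by exact_mod_cast hs
  have h := besselJ_recurrence s (s * ρ)
  have hJ := besselJ_pos (n := s) (x := s * ρ) (by positivity) (by nlinarith)
  rw [Int.cast_natCast] at h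
  have h2 : 0 < s * ρ / 2 * (besselJ (s - 1) (s * ρ) + besselJ (s + 1) (s * ρ)) := by
    rw [← h]; positivity
  exact (mul_pos_iff_of_pos_left (by positivity)).1 h2

lemma besselJ_diff_pos {s : ℕ} (hs : 1 ≤ s) {ρ : ℝ} (h0 : 0 < ρ) (h1 : ρ ≤ 1) :
    0 < besselJ (s - 1) (s * ρ) - besselJ (s + 1) (s * ρ) := by
  have hs0 : (0 : ℝ) < s := by exact_mod_cast hs
  have := dBesselJ_pos (n := s) (x := s * ρ) (by positivity) (by nlinarith)
  unfold dBesselJ at this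
  linarith

lemma equatorPoint_add_int {s : ℕ} (hs : 1 ≤ s) (τ : ℝ) (k : ℤ) :
    ∃ j : ℕ, j < 2 * s ∧ equatorPoint (τ + k * Real.pi / s) =
      equatorPoint (τ + j * Real.pi / s) := by
  have hs0 : (s : ℝ) ≠ 0 := by positivity
  have hpos : (0 : ℤ) < 2 * s := by omega
  have h0 := Int.emod_nonneg k hpos.ne'
  have h1 := Int.emod_lt_of_pos k hpos
  refine ⟨(k % (2 * s)).toNat, by omega, ?_⟩
  rw [equatorPoint_eq_iff]
  refine ⟨-(k / (2 * s)), ?_⟩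
  have h2 : (((k % (2 * s)).toNat : ℤ) : ℝ) = k - 2 * s * ((k / (2 * s) : ℤ) : ℝ) := by
    rw [Int.toNat_of_nonneg h0, Int.emod_def]
    push_cast
    ring
  rw [Int.cast_natCast] at h2
  rw [h2]
  push_cast
  field_simp
  ring

lemma straightPlane_equator (s : ℕ) (θ τ : ℝ) :
    straightPlane s τ (horiz (equatorPoint θ)) =
      Complex.exp (((Real.pi / 2 + θ : ℝ) : ℂ) * Complex.I) * ((ampConst / 2 : ℝ) *
        (((besselJ (s - 1) s + besselJ (s + 1) s) * Real.cos (s * (θ - τ)) : ℝ) -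
        ((besselJ (s - 1) s - besselJ (s + 1) s) * Real.sin (s * (θ - τ)) : ℝ) * Complex.I)) := by
  have h := straightPlane_polar s τ 1 (Real.pi / 2 + θ)
  rw [Complex.ofReal_one, one_mul, mul_one,
    show Real.pi / 2 + θ - Real.pi / 2 - τ = θ - τ by ring] at h
  rw [horiz_equatorPoint, h]

lemma qPerp_straight_equator {s : ℕ} (hs : 1 ≤ s) (τ : ℝ) (k : ℤ) :
    qPerp straight s τ (equatorPoint (τ + k * Real.pi / s)) = 0 := by
  have hs0 : (s : ℝ) ≠ 0 := by positivity
  rw [qPerp_eq_tangential]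
  refine tangential_eq_zero_of_smul (norm_equatorPoint _) (l := ampConst / 2 *
    ((besselJ (s - 1) s + besselJ (s + 1) s) * Real.cos (k * Real.pi))) ?_
  rw [qVec_straight, straightPlane_equator]
  have h1 : (s : ℝ) * (τ + k * Real.pi / s - τ) = k * Real.pi := by field_simp; ring
  rw [h1, Real.sin_int_mul_pi, mul_zero, Complex.ofReal_zero, zero_mul, sub_zero,
    ← Complex.ofReal_mul]
  refine eq_of_horiz_eq ?_ (by simp [equatorPoint])
  rw [horiz_embed, map_smul, horiz_equatorPoint, Complex.real_smul, mul_comm]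

/-- At a zero q = l e. Away from the poles the azimuthal component must vanish, which forces sin ψ =
0. Since q is horizontal, l e_2 = 0 as well, and l = 0 would also kill the radial component. -/
theorem qPerp_straight_eq_zero_iff {s : ℕ} (hs : 1 ≤ s) (τ : ℝ) {e : E3} (he : ‖e‖ = 1) :
    qPerp straight s τ e = 0 ↔
      (∃ k : ℕ, k < 2 * s ∧ e = equatorPoint (τ + k * Real.pi / s)) ∨
        (2 ≤ s ∧ (e = north ∨ e = -north)) := by
  have hs0 : (s : ℝ) ≠ 0 := by positivity
  constructor
  · intro h
    rw [qPerp_eq_tangential, tangential_eq_zero_iff, qVec_straight] at h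
    set z := horiz e with hz
    set l := ⟪embed (straightPlane s τ z), e⟫
    have h2 : 0 = l * e 2 := by simpa using congrArg (fun v : E3 => v 2) h
    have h3 : straightPlane s τ z = l * z := by
      have := congrArg horiz h
      rwa [horiz_embed, map_smul, Complex.real_smul] at this
    have hzn : ‖z‖ ≤ 1 := he ▸ norm_horiz_le e
    rcases eq_or_ne z 0 with hz0 | hz0
    · right
      refine ⟨?_, eq_pole_of_horiz he hz0⟩
      by_contra hs2
      obtain rfl : s = 1 := by omega
      rw [hz0, mul_zero] at h3
      exact straightPlane_one_zero_ne τ h3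
    · left
      have hzpos : 0 < ‖z‖ := norm_pos_iff.2 hz0
      have hzp := Complex.norm_mul_exp_arg_mul_I z
      set ρ := ‖z‖
      set φ := Complex.arg z
      have hR := besselJ_sum_pos hs hzpos hzn
      have hD := besselJ_diff_pos hs hzpos hzn
      -- The common factor e^{iφ} is moved to the front and cancelled; the imaginary part of what
      -- remains is the azimuthal component.
      rw [← hzp, straightPlane_polar, mul_left_comm ((_ : ℝ) : ℂ) ((_ : ℝ) : ℂ),
        mul_comm (ρ : ℂ), mul_comm (l : ℂ) (Complex.exp _), mul_assoc (Complex.exp _) (l : ℂ)] at h3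
      have h4 := mul_left_cancel₀ (Complex.exp_ne_zero _) h3
      set ψ := (s : ℝ) * (φ - Real.pi / 2 - τ) with hψ
      have hc := ampConst_pos
      have hre := congrArg Complex.re h4
      have him := congrArg Complex.im h4
      simp only [Complex.mul_re, Complex.mul_im, Complex.sub_re, Complex.sub_im, Complex.ofReal_re,
        Complex.ofReal_im, Complex.I_re, Complex.I_im, mul_zero, mul_one, zero_mul, sub_zero,
        add_zero, zero_sub] at hre him
      have hsin : Real.sin ψ = 0 := by
        have h5 : ampConst / 2 * ((besselJ (s - 1) (s * ρ) - besselJ (s + 1) (s * ρ)) *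
          Real.sin ψ) = 0 := by linarith
        simpa [hc.ne', hD.ne'] using h5
      have he2 : e 2 = 0 := by
        -- If l = 0, the positive factor J_{s-1}+J_{s+1} gives cos ψ = 0 together with sin ψ = 0.
        rcases mul_eq_zero.1 h2.symm with hl | h
        · exfalso
          have h6 : ampConst / 2 * ((besselJ (s - 1) (s * ρ) + besselJ (s + 1) (s * ρ)) *
            Real.cos ψ) = 0 := by rw [hl] at hre; linarith
          have h7 : Real.cos ψ = 0 := by simpa [hc.ne', hR.ne'] using h6
          have := Real.sin_sq_add_cos_sq ψ
          rw [hsin, h7] at this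
          norm_num at this
        · exact h
      have hρ : ρ = 1 := by
        have := norm_sq_eq e
        rw [he, he2] at this
        have h5 : ρ ^ 2 = 1 := by simp only [ρ, z]; linarith
        exact (pow_eq_one_iff_of_nonneg (norm_nonneg z) two_ne_zero).1 h5
      obtain ⟨k, hk⟩ := Real.sin_eq_zero_iff.1 hsin
      obtain ⟨j, hj, hjk⟩ := equatorPoint_add_int hs τ k
      refine ⟨j, hj, ?_⟩
      rw [← hjk]
      refine eq_of_horiz_eq ?_ (by rw [he2]; simp [equatorPoint])
      rw [horiz_equatorPoint, ← hz, ← hzp, hρ, Complex.ofReal_one, one_mul]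
      congr 3
      rw [hψ] at hk
      field_simp
      linarith
  · rintro (⟨k, _, rfl⟩ | ⟨hs2, hp⟩)
    · exact_mod_cast qPerp_straight_equator hs τ k
    · rw [qPerp_eq_tangential]
      refine tangential_eq_zero_of_smul he (l := 0) ?_
      rw [qVec_straight, horiz_pole hp, straightPlane_zero hs2]
      simp

lemma equatorPoint_injOn {s : ℕ} (hs : 1 ≤ s) (τ : ℝ) {j k : ℕ} (hj : j < 2 * s) (hk : k < 2 * s)
    (h : equatorPoint (τ + j * Real.pi / s) = equatorPoint (τ + k * Real.pi / s)) : j = k := by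
  have hs0 : (s : ℝ) ≠ 0 := by positivity
  obtain ⟨i, hi⟩ := (equatorPoint_eq_iff _ _).1 h
  have h1 : (k : ℝ) = j + i * (2 * s) := by
    have hpi := Real.pi_ne_zero
    field_simp at hi
    refine mul_left_cancel₀ hpi ?_
    linear_combination hi
  have h2 : (k : ℤ) = j + i * (2 * s) := by exact_mod_cast h1
  have h3 : i = 0 := by
    have a1 : i < 1 := by by_contra hc; nlinarith
    have a2 : -1 < i := by by_contra hc; nlinarith
    omega
  rw [h3] at h2
  omega

theorem ncard_equator_zeros {s : ℕ} (hs : 1 ≤ s) (τ : ℝ) :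
    {e : E3 | ‖e‖ = 1 ∧ e 2 = 0 ∧ qPerp straight s τ e = 0}.ncard = 2 * s := by
  have : {e : E3 | ‖e‖ = 1 ∧ e 2 = 0 ∧ qPerp straight s τ e = 0} =
      ((Finset.range (2 * s)).image fun k : ℕ => equatorPoint (τ + k * Real.pi / s) : Set E3) := by
    ext e
    simp only [Set.mem_ofPred_eq, Finset.coe_image, Set.mem_image, Finset.coe_range, Set.mem_Iio]
    constructor
    · rintro ⟨he, he2, h0⟩
      rcases (qPerp_straight_eq_zero_iff hs τ he).1 h0 with ⟨k, hk, rfl⟩ | ⟨_, rfl | rfl⟩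
      · exact ⟨k, hk, rfl⟩
      · simp [north] at he2
      · simp [north] at he2
    · rintro ⟨k, hk, rfl⟩
      exact ⟨norm_equatorPoint _, by simp [equatorPoint], by
        exact_mod_cast qPerp_straight_equator hs τ k⟩
  rw [this, Set.ncard_coe_finset, Finset.card_image_of_injOn, Finset.card_range]
  intro j hj k hk h
  exact equatorPoint_injOn hs τ (by simpa using hj) (by simpa using hk) h

/-! ### Derivatives of the straight field -/

/-- The real derivative of `straightPlane`. -/
def dStraightPlane (s : ℕ) (τ : ℝ) (z : ℂ) : ℂ →L[ℝ] ℂ :=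
  (Complex.I * ampConst / 2 * s) •
    (Complex.exp ((-(s * τ) : ℝ) * Complex.I) • dPlaneBessel (s + 1) (s * z) +
    Complex.exp ((s * τ : ℝ) * Complex.I) •
      ((Complex.conjCLE : ℂ →L[ℝ] ℂ).comp (dPlaneBessel (s - 1) (s * z))))

lemma dStraightPlane_apply (s : ℕ) (τ : ℝ) (z v : ℂ) : dStraightPlane s τ z v =
    (Complex.I * ampConst / 2 * s) *
    (Complex.exp ((-(s * τ) : ℝ) * Complex.I) * dPlaneBessel (s + 1) (s * z) v +
    Complex.exp ((s * τ : ℝ) * Complex.I) *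
      (starRingEnd ℂ) (dPlaneBessel (s - 1) (s * z) v)) := by
  simp [dStraightPlane]
  ring

lemma hasFDerivAt_straightPlane (s : ℕ) (τ : ℝ) (z : ℂ) :
    HasFDerivAt (straightPlane s τ) (dStraightPlane s τ z) z := by
  have h0 : HasFDerivAt (fun z : ℂ => (s : ℂ) * z) ((s : ℂ) • ContinuousLinearMap.id ℝ ℂ) z :=
    (hasFDerivAt_id z).const_mul (s : ℂ)
  have h1 := (hasFDerivAt_planeBessel (s + 1) (s * z)).comp z h0
  have h2 := (hasFDerivAt_planeBessel (s - 1) (s * z)).comp z h0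
  have h3 := (Complex.conjCLE : ℂ →L[ℝ] ℂ).hasFDerivAt.comp z h2
  have h4 := ((h1.const_mul (Complex.exp ((-(s * τ) : ℝ) * Complex.I))).add
    (h3.const_mul (Complex.exp ((s * τ : ℝ) * Complex.I)))).const_mul (Complex.I * ampConst / 2)
  refine h4.congr_fderiv ?_
  refine ContinuousLinearMap.ext fun v => ?_
  have hs : ∀ (n : ℤ) (w : ℂ), dPlaneBessel n w ((s : ℂ) * v) = s * dPlaneBessel n w v :=
    fun n w => by
      have := (dPlaneBessel n w).map_smul (s : ℝ) v
      simpa using this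
  rw [dStraightPlane_apply]
  simp [hs]
  ring

lemma dqVec_straight (s : ℕ) (τ : ℝ) (e : E3) :
    dqVec straight s τ e = embed.comp ((dStraightPlane s τ (horiz e)).comp horiz) := by
  refine (hasFDerivAt_qVec isClosedCurve_straight s τ e).unique ?_
  have h1 := embed.hasFDerivAt.comp e ((hasFDerivAt_straightPlane s τ (horiz e)).comp e
    horiz.hasFDerivAt)
  refine h1.congr_of_eventuallyEq (Eventually.of_forall fun x => qVec_straight s τ x)

/-! ### Leading terms of the straight field at the poles. -/

/-- The leading coefficient of the straight field at the poles, at time zero. -/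
def poleCoeff (s : ℕ) : ℂ :=
  Complex.I * ampConst / 2 * (s : ℂ) ^ (s - 1) * (starRingEnd ℂ) (besselCoeff (s - 1))

lemma poleCoeff_ne_zero {s : ℕ} (hs : 1 ≤ s) : poleCoeff s ≠ 0 := by
  have hs0 : (s : ℂ) ≠ 0 := by exact_mod_cast (by omega : s ≠ 0)
  have h1 := ampConst_pos.ne'
  have h2 := besselCoeff_ne_zero (s - 1)
  simp [poleCoeff, h1, h2, hs0]

/-- The conjugate of B_{s-1} supplies the leading term, and B_{s+1} is of higher order. Time enters
only through factors of modulus one, so one constant serves all τ. -/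
theorem exists_straightPlane_expansion {s : ℕ} (hs : 2 ≤ s) : ∃ A > 0, ∀ (τ : ℝ) (z : ℂ),
    s * ‖z‖ ≤ 1 →
    ‖straightPlane s τ z - poleCoeff s * Complex.exp ((s * τ : ℝ) * Complex.I) *
      (starRingEnd ℂ) z ^ (s - 1)‖ ≤ A * ‖z‖ ^ s ∧
    ∀ v, ‖dStraightPlane s τ z v - poleCoeff s * Complex.exp ((s * τ : ℝ) * Complex.I) *
      ((s - 1 : ℕ) * (starRingEnd ℂ) z ^ (s - 2) * (starRingEnd ℂ) v)‖ ≤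
        A * ‖z‖ ^ (s - 1) * ‖v‖ := by
  obtain ⟨k, rfl⟩ : ∃ k, s = k + 2 := ⟨s - 2, by omega⟩
  obtain ⟨A, hA, hAb⟩ := exists_planeBessel_expansion (k + 1)
  obtain ⟨B, hB, hBb⟩ := exists_dPlaneBessel_expansion k
  have i1 : (((k + 2 : ℕ) : ℤ) + 1) = ((k + 2 + 1 : ℕ) : ℤ) := by push_cast; ring
  have i2 : (((k + 2 : ℕ) : ℤ) - 1) = ((k + 1 : ℕ) : ℤ) := by push_cast; ring
  set S : ℝ := ((k + 2 : ℕ) : ℝ) with hS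
  have hS0 : 0 < S := by positivity
  have hnorm : ∀ z : ℂ, ‖(((k + 2 : ℕ) : ℂ)) * z‖ = S * ‖z‖ := fun z => by
    rw [norm_mul, Complex.norm_natCast]
  have hcoef : ‖(Complex.I * ampConst / 2 : ℂ)‖ ≤ 1 := by
    rw [norm_div, norm_mul, Complex.norm_I, Complex.norm_of_nonneg ampConst_pos.le,
      Complex.norm_ofNat]
    linarith [ampConst_le_one]
  refine ⟨(2 * Real.pi + A) * S ^ (k + 2) + S * (2 * Real.pi + B) * S ^ (k + 1), by positivity,
    fun τ z hz => ⟨?_, fun v => ?_⟩⟩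
  · have e1 : straightPlane (k + 2) τ z - poleCoeff (k + 2) *
        Complex.exp (((k + 2 : ℕ) * τ : ℝ) * Complex.I) * (starRingEnd ℂ) z ^ (k + 2 - 1) =
        (Complex.I * ampConst / 2) * (Complex.exp ((-((k + 2 : ℕ) * τ) : ℝ) * Complex.I) *
          planeBessel (k + 2 + 1 : ℕ) ((k + 2 : ℕ) * z) +
        Complex.exp (((k + 2 : ℕ) * τ : ℝ) * Complex.I) * (starRingEnd ℂ)
          (planeBessel (k + 1 : ℕ) ((k + 2 : ℕ) * z) -
            besselCoeff (k + 1) * ((k + 2 : ℕ) * z) ^ (k + 1))) := by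
      unfold straightPlane poleCoeff
      rw [i1, i2, show k + 2 - 1 = k + 1 by omega]
      simp only [map_sub, map_mul, map_pow, Complex.conj_natCast]
      ring
    rw [e1, norm_mul]
    refine (mul_le_of_le_one_left (norm_nonneg _) hcoef).trans ((norm_add_le _ _).trans ?_)
    rw [norm_mul, norm_mul, Complex.norm_exp_ofReal_mul_I, Complex.norm_exp_ofReal_mul_I,
      RCLike.norm_conj, one_mul, one_mul]
    have h1 := norm_planeBessel_le_pow (k + 2) (k + 2 + 1) (by omega) ((k + 2 : ℕ) * z)
    have h2 := hAb ((k + 2 : ℕ) * z) (by rw [hnorm]; exact hz)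
    rw [hnorm, mul_pow S] at h1 h2
    have : 0 ≤ S * (2 * Real.pi + B) * S ^ (k + 1) * ‖z‖ ^ (k + 2) := by positivity
    have e2 : k + 1 + 1 = k + 2 := by ring
    rw [e2] at h2
    linarith
  · have e1 : dStraightPlane (k + 2) τ z v - poleCoeff (k + 2) *
        Complex.exp (((k + 2 : ℕ) * τ : ℝ) * Complex.I) *
        ((k + 2 - 1 : ℕ) * (starRingEnd ℂ) z ^ (k + 2 - 2) * (starRingEnd ℂ) v) =
        (Complex.I * ampConst / 2) * (((k + 2 : ℕ) : ℂ) *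
          (Complex.exp ((-((k + 2 : ℕ) * τ) : ℝ) * Complex.I) *
          dPlaneBessel (k + 2 + 1 : ℕ) ((k + 2 : ℕ) * z) v +
        Complex.exp (((k + 2 : ℕ) * τ : ℝ) * Complex.I) * (starRingEnd ℂ)
          (dPlaneBessel (k + 1 : ℕ) ((k + 2 : ℕ) * z) v -
            (k + 1) * besselCoeff (k + 1) * ((k + 2 : ℕ) * z) ^ k * v))) := by
      rw [dStraightPlane_apply]
      unfold poleCoeff
      rw [i1, i2, show k + 2 - 1 = k + 1 by omega, show k + 2 - 2 = k by omega]
      simp only [map_sub, map_mul, map_pow, Complex.conj_natCast, map_add, map_one, mul_pow]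
      push_cast
      ring
    rw [e1, norm_mul]
    refine (mul_le_of_le_one_left (norm_nonneg _) hcoef).trans ?_
    rw [norm_mul, Complex.norm_natCast]
    have h0 : ‖Complex.exp ((-((k + 2 : ℕ) * τ) : ℝ) * Complex.I) *
          dPlaneBessel (k + 2 + 1 : ℕ) ((k + 2 : ℕ) * z) v +
        Complex.exp (((k + 2 : ℕ) * τ : ℝ) * Complex.I) * (starRingEnd ℂ)
          (dPlaneBessel (k + 1 : ℕ) ((k + 2 : ℕ) * z) v -
            (k + 1) * besselCoeff (k + 1) * ((k + 2 : ℕ) * z) ^ k * v)‖ ≤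
        (2 * Real.pi + B) * S ^ (k + 1) * ‖z‖ ^ (k + 1) * ‖v‖ := by
      refine (norm_add_le _ _).trans ?_
      rw [norm_mul, norm_mul, Complex.norm_exp_ofReal_mul_I, Complex.norm_exp_ofReal_mul_I,
        RCLike.norm_conj, one_mul, one_mul]
      have h1 := (dPlaneBessel (k + 2 + 1 : ℕ) ((k + 2 : ℕ) * z)).le_of_opNorm_le
        (norm_dPlaneBessel_le_pow (k + 2) ((k + 2 : ℕ) * z)) v
      have h2 := hBb ((k + 2 : ℕ) * z) (by rw [hnorm]; exact hz) v
      rw [hnorm] at h1 h2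
      have h3 : (S * ‖z‖) ^ (k + 2) ≤ (S * ‖z‖) ^ (k + 1) :=
        pow_le_pow_of_le_one (by positivity) hz (by omega)
      have h4 : 2 * Real.pi * (S * ‖z‖) ^ (k + 2) * ‖v‖ ≤
        2 * Real.pi * (S * ‖z‖) ^ (k + 1) * ‖v‖ := by gcongr
      rw [mul_pow S ‖z‖ (k + 1)] at h2 h4
      linarith
    calc S * _ ≤ S * ((2 * Real.pi + B) * S ^ (k + 1) * ‖z‖ ^ (k + 1) * ‖v‖) := by gcongr
      _ ≤ _ := by
        rw [show k + 2 - 1 = k + 1 by omega]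
        have : 0 ≤ (2 * Real.pi + A) * S ^ (k + 2) * ‖z‖ ^ (k + 1) * ‖v‖ := by positivity
        linarith

/-! ### Linear parts at the singular points of the straight field -/

/-- The anti-holomorphic linear map `z ↦ u z̄` on horizontal vectors. -/
def reflection (u : ℂ) : E3 →L[ℝ] E3 :=
  embed.comp ((u • (Complex.conjCLE : ℂ →L[ℝ] ℂ)).comp horiz)

lemma continuous_reflection : Continuous reflection := by
  unfold reflection
  have h : Continuous fun u : ℂ => u • (Complex.conjCLE : ℂ →L[ℝ] ℂ) := by fun_prop
  exact continuous_const.clm_comp (h.clm_comp continuous_const)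

lemma planeProj_pole {p : E3} (hp : p = north ∨ p = -north) (v : E3) :
    planeProj p v = embed (horiz v) := by
  rcases hp with rfl | rfl <;> ext i <;> fin_cases i <;>
    simp [north, EuclideanSpace.inner_eq_star_dotProduct, dotProduct, Fin.sum_univ_three]

lemma horiz_single : horiz (EuclideanSpace.single (0 : Fin 3) 1) = 1 ∧
    horiz (EuclideanSpace.single (1 : Fin 3) 1) = Complex.I ∧
    horiz (EuclideanSpace.single (2 : Fin 3) 1) = 0 := by
  refine ⟨?_, ?_, ?_⟩ <;> apply Complex.ext <;> simp

/-- On the horizontal plane the map z ↦ u conj(z) has trace 0, and its square is |u|² times the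
identity. -/
lemma saddleCond_reflection {u : ℂ} (hu : u ≠ 0) {p : E3} (hp : p = north ∨ p = -north) :
    SaddleCond (reflection u) p := by
  have h1 : 0 < u.re ^ 2 + u.im ^ 2 := by
    have := Complex.normSq_pos.2 hu
    rw [Complex.normSq_apply] at this
    linarith
  unfold SaddleCond
  rw [trOne_eq_sum, trTwo_eq_sum]
  simp only [planeProj_pole hp, Fin.sum_univ_three, horiz_single.1, horiz_single.2.1,
    horiz_single.2.2]
  simp [reflection]
  nlinarith

/-- The tangent plane at this point is spanned by the first and third axes. There the linear part is
diagonal, with entries Re(W 1) - μ and -μ: both negative, and different because Re(W 1) ≠ 0. -/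
lemma nodeCond_of_plane {W : ℂ →L[ℝ] ℂ} {μ : ℝ} (hprod : (W 1).re - μ < 0) (hμ : 0 < μ)
    (hne : (W 1).re ≠ 0) : NodeCond (embed.comp (W.comp horiz) -
      μ • ContinuousLinearMap.id ℝ E3) (equatorPoint 0) := by
  have h0 : planeProj (equatorPoint 0) (EuclideanSpace.single 0 1) =
      EuclideanSpace.single 0 1 := by
    simp [equatorPoint, EuclideanSpace.inner_single_right]
  have h1 : planeProj (equatorPoint 0) (EuclideanSpace.single 1 1) = 0 := by
    rw [planeProj_apply, sub_eq_zero]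
    ext i
    fin_cases i <;> simp [equatorPoint, EuclideanSpace.inner_single_right]
  have h2 : planeProj (equatorPoint 0) (EuclideanSpace.single 2 1) =
      EuclideanSpace.single 2 1 := by
    simp [equatorPoint, EuclideanSpace.inner_single_right]
  have hin : ∀ v : E3, ⟪equatorPoint 0, v⟫ = v 1 := fun v => by
    simp [equatorPoint, EuclideanSpace.inner_eq_star_dotProduct, dotProduct, Fin.sum_univ_three]
  have t1 : trOne (embed.comp (W.comp horiz) - μ • ContinuousLinearMap.id ℝ E3)
      (equatorPoint 0) = ((W 1).re - μ) - μ := by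
    rw [trOne_eq_sum, Fin.sum_univ_three, h0, h1, h2]
    simp [horiz_single]
    ring
  have t2 : trTwo (embed.comp (W.comp horiz) - μ • ContinuousLinearMap.id ℝ E3)
      (equatorPoint 0) = ((W 1).re - μ) ^ 2 + μ ^ 2 := by
    have hE : horiz (equatorPoint 0) = Complex.I := by
      apply Complex.ext <;> simp [equatorPoint]
    have hX : planeProj (equatorPoint 0) ((embed.comp (W.comp horiz) -
        μ • ContinuousLinearMap.id ℝ E3) (EuclideanSpace.single 0 1)) =
        ((W 1).re - μ) • EuclideanSpace.single 0 1 := by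
      rw [planeProj_apply, hin]
      ext i
      fin_cases i <;> simp [horiz_single, equatorPoint]
    have hZ : planeProj (equatorPoint 0) ((embed.comp (W.comp horiz) -
        μ • ContinuousLinearMap.id ℝ E3) (EuclideanSpace.single 2 1)) =
        (-μ) • EuclideanSpace.single 2 1 := by
      rw [planeProj_apply, hin]
      ext i
      fin_cases i <;> simp [horiz_single, equatorPoint]
    rw [trTwo_eq_sum, Fin.sum_univ_three, h0, h1, h2, hX, hZ]
    simp [horiz_single]
    ring
  unfold NodeCond
  rw [t1, t2]
  constructor
  · nlinarith
  · have : 0 < (W 1).re ^ 2 := by positivity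
    nlinarith

/-- The recurrences turn the diagonal entries of `nodeCond_of_plane` into -c s J_s'(s) and -c
J_s(s), with c = `ampConst`. -/
theorem nodeCond_straight {s : ℕ} (hs : 1 ≤ s) :
    NodeCond (dqVec straight s 0 (equatorPoint 0) -
      ⟪qVec straight s 0 (equatorPoint 0), equatorPoint 0⟫ • ContinuousLinearMap.id ℝ E3)
      (equatorPoint 0) := by
  have hs0 : (0 : ℝ) < s := by exact_mod_cast hs
  have hE : horiz (equatorPoint 0) = Complex.I := by
    apply Complex.ext <;> simp [equatorPoint]
  have hJ := besselJ_pos (n := s) hs0 le_rfl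
  have hD := dBesselJ_pos (n := s) hs0 le_rfl
  have hne := mul_dBesselJ_ne hs
  have hc := ampConst_pos
  have hrec := besselJ_recurrence s s
  have hrec1 := besselJ_recurrence (s + 1) s
  have hrec2 := besselJ_recurrence (s - 1) s
  rw [sub_add_cancel] at hrec2
  rw [add_sub_cancel_right] at hrec1
  have hμ : ⟪qVec straight s 0 (equatorPoint 0), equatorPoint 0⟫ = ampConst * besselJ s s := by
    rw [qVec_straight, straightPlane_equator]
    have h1 : Complex.exp (((Real.pi / 2 + 0 : ℝ) : ℂ) * Complex.I) = Complex.I := by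
      rw [add_zero, Complex.ofReal_div, Complex.ofReal_ofNat, Complex.exp_pi_div_two_mul_I]
    rw [h1]
    simp [equatorPoint, EuclideanSpace.inner_eq_star_dotProduct, dotProduct, Fin.sum_univ_three]
    have : besselJ (s - 1) s + besselJ (s + 1) s = 2 * besselJ s s := by
      push_cast at hrec
      refine mul_left_cancel₀ hs0.ne' ?_
      linarith
    linear_combination (ampConst / 2) * this
  have hW : (dStraightPlane s 0 Complex.I 1).re =
      ampConst * besselJ s s - ampConst * (s * dBesselJ s s) := by
    have hI : ∀ n : ℤ, planeBessel n (s * Complex.I) = (besselJ n s : ℂ) := fun n => by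
      exact_mod_cast planeBessel_I n s
    rw [dStraightPlane_apply, dPlaneBessel_apply, dPlaneBessel_apply]
    simp only [hI, sub_add_cancel, add_sub_cancel_right]
    simp [Complex.conj_ofNat]
    unfold dBesselJ
    push_cast at hrec hrec1 hrec2
    have a1 : (s : ℝ) * besselJ (s + 1 + 1) s = 2 * (s + 1) * besselJ (s + 1) s - s * besselJ s s := by
      linarith
    have a2 : (s : ℝ) * besselJ (s - 1 - 1) s = 2 * (s - 1) * besselJ (s - 1) s - s * besselJ s s := by
      linarith
    have a3 : besselJ (s - 1) s + besselJ (s + 1) s = 2 * besselJ s s := by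
      refine mul_left_cancel₀ hs0.ne' ?_
      linarith
    linear_combination (ampConst / 4) * a1 - (ampConst / 4) * a2 + (ampConst / 2) * a3
  rw [dqVec_straight, hμ, hE]
  refine nodeCond_of_plane ?_ (by positivity) ?_
  · rw [hW]
    have := mul_pos hc (mul_pos hs0 hD)
    linarith
  · rw [hW, ← mul_sub]
    exact mul_ne_zero hc.ne' (sub_ne_zero.2 hne.symm)

theorem saddleCond_straight {p : E3} (hp : p = north ∨ p = -north) :
    SaddleCond (dqVec straight 2 0 p -
      ⟪qVec straight 2 0 p, p⟫ • ContinuousLinearMap.id ℝ E3) p := by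
  have hq : qVec straight 2 0 p = 0 := by
    rw [qVec_straight, horiz_pole hp, straightPlane_zero le_rfl, map_zero]
  have hW : dqVec straight 2 0 p = reflection (poleCoeff 2) := by
    obtain ⟨A, hA, h⟩ := exists_straightPlane_expansion (s := 2) le_rfl
    rw [dqVec_straight, horiz_pole hp]
    unfold reflection
    congr 2
    refine ContinuousLinearMap.ext fun v => ?_
    -- At z = 0 and s = 2 the error term of the derivative expansion vanishes, so the derivative
    -- equals its leading term exactly.
    have := (h 0 0 (by simp)).2 v
    simp at this
    simpa [sub_eq_zero] using this
  have h0 : ∀ B : E3 →L[ℝ] E3, B - (0 : ℝ) • ContinuousLinearMap.id ℝ E3 = B := fun B => by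
    ext v; simp
  rw [hq, inner_zero_left, hW, h0]
  exact saddleCond_reflection (poleCoeff_ne_zero (by norm_num)) hp

theorem isMultiSaddle_straight {s : ℕ} (hs : 2 < s) (τ : ℝ) {p : E3}
    (hp : p = north ∨ p = -north) : IsMultiSaddle (qPerp straight s τ) p (s - 1) := by
  have hp0 := horiz_pole hp
  have hcoord : ∀ x : E3, (⟪x, EuclideanSpace.single (0 : Fin 3) (1 : ℝ)⟫ : ℂ) +
      Complex.I * (⟪x, EuclideanSpace.single (1 : Fin 3) (1 : ℝ)⟫ : ℂ) = horiz x := fun x => by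
    apply Complex.ext <;> simp [EuclideanSpace.inner_single_right]
  refine ⟨norm_pole hp, (qPerp_straight_eq_zero_iff (by omega) τ (norm_pole hp)).2
    (Or.inr ⟨hs.le, hp⟩), EuclideanSpace.single 0 1, EuclideanSpace.single 1 1, by simp, by simp,
    by simp [EuclideanSpace.inner_single_right], ?_, ?_,
    poleCoeff s * Complex.exp ((s * τ : ℝ) * Complex.I),
    mul_ne_zero (poleCoeff_ne_zero (by omega)) (Complex.exp_ne_zero _), ?_⟩
  · rcases hp with rfl | rfl <;> simp [north, EuclideanSpace.inner_single_left]
  · rcases hp with rfl | rfl <;> simp [north, EuclideanSpace.inner_single_left]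
  obtain ⟨A, hA, h⟩ := exists_straightPlane_expansion hs.le
  simp only [hcoord]
  have hbig : (fun e : E3 => (horiz (qPerp straight s τ e) : ℂ) -
      poleCoeff s * Complex.exp ((s * τ : ℝ) * Complex.I) * (starRingEnd ℂ) (horiz e) ^ (s - 1))
      =O[nhdsWithin p (Metric.sphere 0 1)] fun e : E3 => ‖e - p‖ ^ s := by
    refine Asymptotics.IsBigO.of_bound (2 * A + ‖poleCoeff s‖) ?_
    have h1 : ∀ᶠ e in 𝓝 p, s * ‖horiz e‖ < 1 := by
      have hc : Continuous fun e : E3 => (s : ℝ) * ‖horiz e‖ := by fun_prop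
      refine hc.continuousAt.eventually_lt continuousAt_const ?_
      simp [hp0]
    filter_upwards [mem_nhdsWithin_of_mem_nhds h1, self_mem_nhdsWithin] with e he hes
    have hes : ‖e‖ = 1 := by simpa using hes
    set z := horiz e
    have hz1 : ‖z‖ ≤ 1 := hes ▸ norm_horiz_le e
    have hzp : ‖z‖ ≤ ‖e - p‖ := by
      have := norm_horiz_le (e - p)
      rwa [map_sub, hp0, sub_zero] at this
    obtain ⟨hb, -⟩ := h τ z he.le
    have hsp : ‖straightPlane s τ z‖ ≤ (A + ‖poleCoeff s‖) * ‖z‖ ^ (s - 1) := by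
      have h2 : ‖poleCoeff s * Complex.exp ((s * τ : ℝ) * Complex.I) *
          (starRingEnd ℂ) z ^ (s - 1)‖ = ‖poleCoeff s‖ * ‖z‖ ^ (s - 1) := by
        rw [norm_mul, norm_mul, Complex.norm_exp_ofReal_mul_I, norm_pow, RCLike.norm_conj, mul_one]
      have h3 := norm_le_norm_sub_add (straightPlane s τ z)
        (poleCoeff s * Complex.exp ((s * τ : ℝ) * Complex.I) * (starRingEnd ℂ) z ^ (s - 1))
      have h4 : ‖z‖ ^ s ≤ ‖z‖ ^ (s - 1) := pow_le_pow_of_le_one (norm_nonneg _) hz1 (by omega)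
      have h5 : A * ‖z‖ ^ s ≤ A * ‖z‖ ^ (s - 1) := by gcongr
      linarith
    have hV : horiz (qPerp straight s τ e) =
        straightPlane s τ z - (⟪qVec straight s τ e, e⟫ : ℂ) * z := by
      rw [qPerp, map_sub, map_smul, qVec_straight, horiz_embed, Complex.real_smul]
    -- The normal component is of order |z|^{s-1}, so subtracting it times z changes the horizontal
    -- part only at order |z|^s.
    have hin : ‖(⟪qVec straight s τ e, e⟫ : ℂ)‖ ≤ (A + ‖poleCoeff s‖) * ‖z‖ ^ (s - 1) := by
      rw [Complex.norm_real]
      refine (norm_inner_le_norm _ _).trans ?_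
      rw [hes, mul_one, qVec_straight, norm_embed]
      exact hsp
    have hpw : ‖z‖ ^ (s - 1) * ‖z‖ = ‖z‖ ^ s := by rw [← pow_succ]; congr 1; omega
    rw [hV, Real.norm_of_nonneg (by positivity), sub_right_comm]
    calc _ ≤ _ := norm_sub_le _ _
      _ ≤ A * ‖z‖ ^ s + (A + ‖poleCoeff s‖) * ‖z‖ ^ (s - 1) * ‖z‖ := by
        rw [norm_mul (_ : ℂ) z]
        gcongr
      _ = (2 * A + ‖poleCoeff s‖) * ‖z‖ ^ s := by rw [mul_assoc, hpw]; ring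
      _ ≤ _ := by gcongr
  refine hbig.trans_isLittleO ?_
  have h2 : Tendsto (fun e : E3 => ‖e - p‖) (nhdsWithin p (Metric.sphere 0 1)) (𝓝 0) := by
    have : Continuous fun e : E3 => ‖e - p‖ := by fun_prop
    have := this.tendsto p
    simp only [sub_self, norm_zero] at this
    exact this.mono_left nhdsWithin_le_nhds
  have h3 : (fun x : ℝ => x ^ s) =o[𝓝 0] fun x : ℝ => x ^ (s - 1) :=
    Asymptotics.isLittleO_pow_pow (by omega)
  exact h3.comp_tendsto h2

/-! ### Pulling the field back to the rotating frame -/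

/-- Conjugation of an endomorphism by the rotation about the polar axis. -/
def conjRot (τ : ℝ) (M : E3 →L[ℝ] E3) : E3 →L[ℝ] E3 :=
  ((rotIso τ).symm.toContinuousLinearEquiv : E3 →L[ℝ] E3) ∘L M ∘L
    ((rotIso τ).toContinuousLinearEquiv : E3 →L[ℝ] E3)

@[simp] lemma conjRot_apply (τ : ℝ) (M : E3 →L[ℝ] E3) (v : E3) :
    conjRot τ M v = rotZ (-τ) (M (rotZ τ v)) := rfl

lemma conjRot_sub_smul_id (τ c : ℝ) (M : E3 →L[ℝ] E3) :
    conjRot τ M - c • ContinuousLinearMap.id ℝ E3 =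
      conjRot τ (M - c • ContinuousLinearMap.id ℝ E3) := by
  refine ContinuousLinearMap.ext fun v => ?_
  simp only [sub_apply, smul_apply, conjRot_apply,
    ContinuousLinearMap.id_apply, rotZ_sub, rotZ_smul, rotZ_rotZ, neg_add_cancel, rotZ_zero]

lemma conjRot_comp (τ : ℝ) (M N : E3 →L[ℝ] E3) : conjRot τ (M ∘L N) = conjRot τ M ∘L conjRot τ N := by
  refine ContinuousLinearMap.ext fun v => ?_
  simp [rotZ_rotZ, rotZ_zero]

lemma conjRot_planeProj (τ : ℝ) (p : E3) : conjRot τ (planeProj (rotZ τ p)) = planeProj p := by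
  refine ContinuousLinearMap.ext fun v => ?_
  rw [conjRot_apply, planeProj_apply, planeProj_apply, inner_rotZ, rotZ_sub, rotZ_smul, rotZ_rotZ,
    rotZ_rotZ, neg_add_cancel, rotZ_zero, rotZ_zero]

lemma trace_conjRot (τ : ℝ) (M : E3 →L[ℝ] E3) :
    LinearMap.trace ℝ E3 (conjRot τ M).toLinearMap = LinearMap.trace ℝ E3 M.toLinearMap :=
  LinearMap.trace_conj' M.toLinearMap (rotIso τ).symm.toLinearEquiv

/-- Conjugation by a rotation carries the projection along the rotated point to the projection along
`p`, and the trace is invariant. So the node and saddle conditions may be checked in either frame.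
-/
lemma trOne_conjRot (τ : ℝ) (M : E3 →L[ℝ] E3) (p : E3) :
    trOne (conjRot τ M) p = trOne M (rotZ τ p) := by
  unfold trOne
  rw [← trace_conjRot τ (M ∘L planeProj (rotZ τ p)), conjRot_comp, conjRot_planeProj]

lemma trTwo_conjRot (τ : ℝ) (M : E3 →L[ℝ] E3) (p : E3) :
    trTwo (conjRot τ M) p = trTwo M (rotZ τ p) := by
  unfold trTwo
  rw [← trace_conjRot τ (M ∘L planeProj (rotZ τ p) ∘L M ∘L planeProj (rotZ τ p)), conjRot_comp,
    conjRot_comp, conjRot_comp, conjRot_planeProj]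

lemma norm_conjRot_le (τ : ℝ) (M : E3 →L[ℝ] E3) : ‖conjRot τ M‖ ≤ ‖M‖ := by
  refine ContinuousLinearMap.opNorm_le_bound _ (norm_nonneg _) fun v => ?_
  rw [conjRot_apply, norm_rotZ]
  simpa [norm_rotZ] using M.le_opNorm (rotZ τ v)

/-- The field `qVec` in the frame that rotates with the straight string. -/
def rotField (Q : ℝ → E3) (s : ℕ) (τ : ℝ) (e : E3) : E3 := rotZ (-τ) (qVec Q s τ (rotZ τ e))

lemma hasFDerivAt_rotField {Q : ℝ → E3} (h : IsClosedCurve Q) (s : ℕ) (τ : ℝ) (e : E3) :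
    HasFDerivAt (rotField Q s τ) (conjRot τ (dqVec Q s τ (rotZ τ e))) e :=
  ((rotIso τ).symm.toContinuousLinearEquiv : E3 →L[ℝ] E3).hasFDerivAt.comp e
    ((hasFDerivAt_qVec h s τ (rotZ τ e)).comp e
      ((rotIso τ).toContinuousLinearEquiv : E3 →L[ℝ] E3).hasFDerivAt)

/-- The straight field is stationary in the rotating frame. All comparisons can thus be made with
one field, and the thresholds do not depend on τ. -/
lemma rotField_straight (s : ℕ) (τ : ℝ) : rotField straight s τ = qVec straight s 0 := by
  funext e
  have := qVec_straight_rotate s 0 τ e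
  rw [zero_add] at this
  rw [rotField, this, rotZ_rotZ, neg_add_cancel, rotZ_zero]

lemma conjRot_dqVec_straight (s : ℕ) (τ : ℝ) (e : E3) :
    conjRot τ (dqVec straight s τ (rotZ τ e)) = dqVec straight s 0 e := by
  have h := hasFDerivAt_rotField isClosedCurve_straight s τ e
  rw [rotField_straight] at h
  exact h.unique (hasFDerivAt_qVec isClosedCurve_straight s 0 e)

lemma inner_rotField (Q : ℝ → E3) (s : ℕ) (τ : ℝ) (e : E3) :
    ⟪rotField Q s τ e, e⟫ = ⟪qVec Q s τ (rotZ τ e), rotZ τ e⟫ := by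
  rw [← inner_rotZ τ (rotField Q s τ e) e, rotField, rotZ_rotZ, add_neg_cancel, rotZ_zero]

lemma tangential_rotField (Q : ℝ → E3) (s : ℕ) (τ : ℝ) (e : E3) :
    tangential (rotField Q s τ) e = rotZ (-τ) (qPerp Q s τ (rotZ τ e)) := by
  rw [tangential, inner_rotField, qPerp, rotZ_sub, rotZ_smul, rotZ_rotZ, neg_add_cancel, rotZ_zero,
    rotField]

lemma tangential_rotField_eq_zero {Q : ℝ → E3} {s : ℕ} {τ : ℝ} {e : E3} :
    tangential (rotField Q s τ) e = 0 ↔ qPerp Q s τ (rotZ τ e) = 0 := by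
  rw [tangential_rotField, ← norm_eq_zero, norm_rotZ, norm_eq_zero]

lemma C1Near.rotField {Q : ℝ → E3} {s : ℕ} {τ ε : ℝ}
    (h : C1Near ε (qVec Q s τ) (dqVec Q s τ) (qVec straight s τ) (dqVec straight s τ)) :
    C1Near ε (rotField Q s τ) (fun e => conjRot τ (dqVec Q s τ (rotZ τ e)))
      (qVec straight s 0) (dqVec straight s 0) := by
  intro x hx
  obtain ⟨h1, h2⟩ := h (rotZ τ x) (by rwa [norm_rotZ])
  constructor
  · rw [← rotField_straight s τ, StringCurve.rotField, StringCurve.rotField, ← rotZ_sub, norm_rotZ]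
    exact h1
  · rw [← conjRot_dqVec_straight s τ]
    have : conjRot τ (dqVec Q s τ (rotZ τ x)) - conjRot τ (dqVec straight s τ (rotZ τ x)) =
        conjRot τ (dqVec Q s τ (rotZ τ x) - dqVec straight s τ (rotZ τ x)) := by
      refine ContinuousLinearMap.ext fun v => ?_
      simp [rotZ_sub]
    rw [this]
    exact (norm_conjRot_le _ _).trans h2

/-! ### Persistence of non-degenerate zeros, uniformly in time -/

/-- In the rotating frame every time is a perturbation, of the same size, of the straight field at
time 0; the result of `persistent_zero` is then rotated back. -/
theorem persistent_zero_string {s : ℕ} {p : E3} (hp : ‖p‖ = 1) (h0 : qPerp straight s 0 p = 0)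
    {P : (E3 →L[ℝ] E3) → E3 → Prop} (hO : IsOpen {x : (E3 →L[ℝ] E3) × E3 | P x.1 x.2})
    (hP : P (dqVec straight s 0 p - ⟪qVec straight s 0 p, p⟫ • ContinuousLinearMap.id ℝ E3) p)
    (hrot : ∀ τ M e, P (conjRot τ M) e → P M (rotZ τ e))
    (hne : trOne (dqVec straight s 0 p -
        ⟪qVec straight s 0 p, p⟫ • ContinuousLinearMap.id ℝ E3) p ^ 2 ≠
      trTwo (dqVec straight s 0 p - ⟪qVec straight s 0 p, p⟫ • ContinuousLinearMap.id ℝ E3) p) :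
    ∃ κ₀ > 0, κ₀ ≤ 1 ∧ ∀ κ, 0 < κ → κ ≤ κ₀ → ∃ δ > 0, ∀ Q, NearStraight Q → C1Close δ Q straight →
      ∀ τ, (∃ e, ‖e‖ = 1 ∧ ‖e - rotZ τ p‖ ≤ κ ∧ qPerp Q s τ e = 0) ∧
      (∀ e e', ‖e‖ = 1 → ‖e'‖ = 1 → ‖e - rotZ τ p‖ ≤ κ₀ → ‖e' - rotZ τ p‖ ≤ κ₀ →
        qPerp Q s τ e = 0 → qPerp Q s τ e' = 0 → e = e') ∧
      ∀ e, ‖e‖ = 1 → ‖e - rotZ τ p‖ ≤ κ₀ →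
        P (dqVec Q s τ e - ⟪qVec Q s τ e, e⟫ • ContinuousLinearMap.id ℝ E3) e := by
  obtain ⟨K, hK, hKb⟩ := exists_c1Near s
  obtain ⟨κ₀, hκ₀, hκ₁, h⟩ := persistent_zero (hasFDerivAt_qVec isClosedCurve_straight s 0)
    (continuous_dqVec isClosedCurve_straight s 0) hp h0 hO hP hne
  refine ⟨κ₀, hκ₀, hκ₁, fun κ hκ hκκ => ?_⟩
  obtain ⟨ε, hε, hb⟩ := h κ hκ hκκ
  refine ⟨ε / K, by positivity, fun Q hQ hd τ => ?_⟩
  have hnear := hKb Q straight hQ nearStraight_straight _ hd τ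
  rw [mul_div_cancel₀ _ hK.ne'] at hnear
  obtain ⟨⟨e₀, he1, he2, he3⟩, huniq, hcond⟩ :=
    hb _ _ (hasFDerivAt_rotField hQ.1 s τ) hnear.rotField
  have hback : ∀ e : E3, rotZ τ (rotZ (-τ) e) = e := fun e => by
    rw [rotZ_rotZ, add_neg_cancel, rotZ_zero]
  have hdist : ∀ e : E3, ‖rotZ (-τ) e - p‖ = ‖e - rotZ τ p‖ := fun e => by
    rw [← norm_rotZ τ, rotZ_sub, hback]
  refine ⟨⟨rotZ τ e₀, by rwa [norm_rotZ], by rwa [← rotZ_sub, norm_rotZ],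
    tangential_rotField_eq_zero.1 he3⟩, fun e e' h1 h2 h3 h4 h5 h6 => ?_, fun e h1 h2 => ?_⟩
  · have := huniq (rotZ (-τ) e) (rotZ (-τ) e') (by rwa [norm_rotZ]) (by rwa [norm_rotZ])
      (by rwa [hdist]) (by rwa [hdist]) (by rwa [tangential_rotField_eq_zero, hback])
      (by rwa [tangential_rotField_eq_zero, hback])
    rw [← hback e, this, hback]
  · have := hcond (rotZ (-τ) e) (by rwa [norm_rotZ]) (by rwa [hdist])
    simp only [Set.mem_ofPred_eq, inner_rotField, hback, conjRot_sub_smul_id] at this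
    simpa [hback] using hrot _ _ _ this

lemma nodeCond_conjRot (τ : ℝ) (M : E3 →L[ℝ] E3) (e : E3) (h : NodeCond (conjRot τ M) e) :
    NodeCond M (rotZ τ e) := by
  rwa [NodeCond, trOne_conjRot, trTwo_conjRot] at h

lemma saddleCond_conjRot (τ : ℝ) (M : E3 →L[ℝ] E3) (e : E3) (h : SaddleCond (conjRot τ M) e) :
    SaddleCond M (rotZ τ e) := by
  rwa [SaddleCond, trOne_conjRot, trTwo_conjRot] at h

/-! ### Zeros of the perturbed field lie near zeros of the straight field -/

lemma norm_tangential_sub_le (q q' : E3 → E3) {e : E3} (he : ‖e‖ = 1) :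
    ‖tangential q e - tangential q' e‖ ≤ 2 * ‖q e - q' e‖ := by
  have h1 : tangential q e - tangential q' e =
      (q e - q' e) - ⟪q e - q' e, e⟫ • e := by
    simp only [tangential, inner_sub_left, sub_smul]
    abel
  rw [h1]
  refine (norm_sub_le _ _).trans ?_
  rw [norm_smul, he, mul_one]
  have := norm_inner_le_norm (𝕜 := ℝ) (q e - q' e) e
  rw [he, mul_one] at this
  linarith

lemma equatorPoint_add (τ θ : ℝ) : equatorPoint (τ + θ) = rotZ τ (equatorPoint θ) :=
  (rotZ_equatorPoint τ θ).symm

lemma rotZ_pole (τ : ℝ) {p : E3} (hp : p = north ∨ p = -north) : rotZ τ p = p := by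
  refine eq_of_horiz_eq ?_ (rotZ_two _ _)
  rw [horiz_rotZ, horiz_pole hp, mul_zero]

/-- Outside the chosen neighbourhoods the straight field is bounded below on a compact part of the
sphere. A perturbation that changes the field by less than this bound creates no zeros there. -/
theorem zeros_near {s : ℕ} (hs : 1 ≤ s) {r : ℝ} (hr : 0 < r) :
    ∃ δ > 0, ∀ Q, NearStraight Q → C1Close δ Q straight → ∀ τ e, ‖e‖ = 1 → qPerp Q s τ e = 0 →
      (∃ k : ℕ, k < 2 * s ∧ ‖e - equatorPoint (τ + k * Real.pi / s)‖ < r) ∨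
        (2 ≤ s ∧ (‖e - north‖ < r ∨ ‖e - -north‖ < r)) := by
  obtain ⟨K, hK, hKb⟩ := exists_c1Near s
  set Z : Set E3 := {e | (∃ k : ℕ, k < 2 * s ∧ ‖e - equatorPoint (k * Real.pi / s)‖ < r) ∨
        (2 ≤ s ∧ (‖e - north‖ < r ∨ ‖e - -north‖ < r))} with hZ
  have hZo : IsOpen Z := by
    have h1 : ∀ p : E3, IsOpen {e : E3 | ‖e - p‖ < r} := fun p =>
      isOpen_lt (by fun_prop) continuous_const
    have : Z = (⋃ k : ℕ, ⋃ _ : k < 2 * s, {e | ‖e - equatorPoint (k * Real.pi / s)‖ < r}) ∪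
        (⋃ _ : 2 ≤ s, ({e | ‖e - north‖ < r} ∪ {e | ‖e - -north‖ < r})) := by
      ext e
      simp [hZ]
    rw [this]
    exact (isOpen_iUnion fun k => isOpen_iUnion fun _ => h1 _).union
      (isOpen_iUnion fun _ => (h1 _).union (h1 _))
  have hcomp : IsCompact (sphere (0 : E3) 1 \ Z) := (isCompact_sphere 0 1).diff hZo
  have hc : ContinuousOn (fun e => ‖qPerp straight s 0 e‖) (sphere (0 : E3) 1 \ Z) := by
    refine (Continuous.norm ?_).continuousOn
    exact (continuous_qPerp isClosedCurve_straight s).comp (f := fun e : E3 => ((0 : ℝ), e))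
      (by fun_prop)
  have hpos : ∀ e ∈ sphere (0 : E3) 1 \ Z, 0 < ‖qPerp straight s 0 e‖ := by
    rintro e ⟨he, heZ⟩
    rw [norm_pos_iff]
    intro h0
    refine heZ ?_
    rcases (qPerp_straight_eq_zero_iff hs 0 (by simpa using he)).1 h0 with ⟨k, hk, rfl⟩ | ⟨h2, h3⟩
    · exact Or.inl ⟨k, hk, by rw [zero_add, sub_self, norm_zero]; exact hr⟩
    · refine Or.inr ⟨h2, ?_⟩
      rcases h3 with rfl | rfl
      · left; simpa
      · right; simpa
  obtain ⟨μ, hμ, hμb⟩ := hcomp.exists_forall_le' hc hpos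
  -- With this δ the tangential fields differ by at most 2 · K · δ = μ/2.
  refine ⟨μ / (4 * K), by positivity, fun Q hQ hd τ e he h0 => ?_⟩
  have hnear := hKb Q straight hQ nearStraight_straight _ hd τ
  have h1 := norm_tangential_sub_le (rotField Q s τ) (qVec straight s 0) (e := rotZ (-τ) e)
    (by rwa [norm_rotZ])
  have h2 := (hnear.rotField (rotZ (-τ) e) (by rw [norm_rotZ, he]; norm_num)).1
  have hback : rotZ τ (rotZ (-τ) e) = e := by rw [rotZ_rotZ, add_neg_cancel, rotZ_zero]
  rw [tangential_rotField_eq_zero.2 (by rwa [hback]), zero_sub, norm_neg] at h1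
  have h3 : K * (μ / (4 * K)) = μ / 4 := by field_simp
  have hmem : rotZ (-τ) e ∈ Z := by
    by_contra hcon
    have := hμb (rotZ (-τ) e) ⟨by simp [norm_rotZ, he], hcon⟩
    rw [← qPerp_eq_tangential] at h1
    linarith
  have hdist : ∀ p : E3, ‖rotZ (-τ) e - p‖ = ‖e - rotZ τ p‖ := fun p => by
    rw [← norm_rotZ τ, rotZ_sub, hback]
  simp only [hZ, Set.mem_ofPred_eq, hdist, ← equatorPoint_add, rotZ_pole τ (Or.inl rfl),
    rotZ_pole τ (Or.inr rfl)] at hmem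
  exact hmem

/-- A zero in the cap around a pole is near that pole. -/
theorem zeros_near_pole {s : ℕ} (hs : 1 ≤ s) {r : ℝ} (hr : 0 < r) :
    ∃ δ > 0, ∀ Q, NearStraight Q → C1Close δ Q straight → ∀ p : E3, p = north ∨ p = -north →
      ∀ τ e, ‖e‖ = 1 → 1 / 2 < ⟪e, p⟫ → qPerp Q s τ e = 0 → ‖e - p‖ < r := by
  obtain ⟨δ, hδ, h⟩ := zeros_near hs (r := min r (1 / 2)) (by positivity)
  refine ⟨δ, hδ, fun Q hQ hd p hp τ e he hep h0 => ?_⟩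
  -- A zero of the straight field on the equator or at the opposite pole has nonpositive scalar
  -- product with `p`, so it is at distance more than 1/2 from the cap.
  have hfar : ∀ x : E3, ‖e - x‖ < min r (1 / 2) → ⟪x, p⟫ ≤ 0 → False := fun x hx hxp => by
    have h1 := real_inner_le_norm (e - x) p
    rw [inner_sub_left, norm_pole hp, mul_one] at h1
    have := hx.trans_le (min_le_right _ _)
    linarith
  have hnn : ⟪north, north⟫ = 1 := by rw [real_inner_self_eq_norm_sq, norm_north]; norm_num
  rcases h Q hQ hd τ e he h0 with ⟨k, -, hk⟩ | ⟨-, h1 | h1⟩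
  · refine (hfar _ hk ?_).elim
    rcases hp with rfl | rfl <;>
      simp [equatorPoint, north, EuclideanSpace.inner_eq_star_dotProduct, dotProduct,
        Fin.sum_univ_three]
  · rcases hp with rfl | rfl
    · exact h1.trans_le (min_le_left _ _)
    · exact (hfar _ h1 (by rw [inner_neg_right, hnn]; norm_num)).elim
  · rcases hp with rfl | rfl
    · exact (hfar _ h1 (by rw [inner_neg_left, hnn]; norm_num)).elim
    · exact h1.trans_le (min_le_left _ _)

/-! ### The nodes near the equator -/

lemma qPerp_time_eq {Q : ℝ → E3} (h : IsClosedCurve Q) (hL : totalLength Q ≠ 0) {n : ℕ}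
    (hn : n ≠ 0) (a τ : ℝ) (e : E3) : qPerp Q n (a + τ) e = Real.cos (n * τ) • qPerp Q n a e +
      Real.sin (n * τ) • qPerp Q n (a + Real.pi / (2 * n)) e := by
  simp only [qPerp, qVec_time_eq h hL hn a τ, inner_add_left, real_inner_smul_left]
  module

lemma qPerp_int_period {Q : ℝ → E3} (h : IsClosedCurve Q) {n : ℕ} (hn : n ≠ 0) (τ : ℝ) (j : ℤ) :
    qPerp Q n (τ + j * (2 * Real.pi)) = qPerp Q n τ :=
  (Function.Periodic.int_mul (f := qPerp Q n) (fun τ => qPerp_period h hn τ) j) τ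

lemma qPerp_nat_half_period_cases {Q : ℝ → E3} (h : IsClosedCurve Q) {n : ℕ} (hn : n ≠ 0) (τ : ℝ)
    (k : ℕ) : qPerp Q n τ = qPerp Q n (τ + k * Real.pi / n) ∨
      qPerp Q n τ = -qPerp Q n (τ + k * Real.pi / n) := by
  rw [qPerp_nat_half_period h hn]
  rcases neg_one_pow_eq_or ℝ k with h1 | h1 <;> simp [h1]

/-- At a zero of V^τ only the quarter-period field contributes at time τ', with the factor sin(n(τ'
- τ)). -/
lemma sin_eq_zero_of_common_zero {Q : ℝ → E3} (hQ : NearStraight Q) {n : ℕ} (hn : n ≠ 0)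
    {τ τ' : ℝ} {e : E3} (h : qPerp Q n τ e = 0) (h' : qPerp Q n τ' e = 0)
    (hne : qPerp Q n (τ + Real.pi / (2 * n)) e ≠ 0) : ∃ k : ℤ, τ' = τ + k * Real.pi / n := by
  have h1 := qPerp_time_eq hQ.1 hQ.totalLength_pos.ne' hn τ (τ' - τ) e
  rw [add_sub_cancel, h, h', smul_zero, zero_add] at h1
  have h2 : Real.sin (n * (τ' - τ)) = 0 := by
    rcases smul_eq_zero.1 h1.symm with h2 | h2
    · exact h2
    · exact (hne h2).elim
  obtain ⟨k, hk⟩ := Real.sin_eq_zero_iff.1 h2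
  have hn' : (n : ℝ) ≠ 0 := by exact_mod_cast hn
  refine ⟨k, ?_⟩
  rw [hk]
  field_simp
  ring

/-- A quarter period moves the equatorial zeros halfway between their places; the point 0 among them
would make an odd number divisible by four. -/
lemma qPerp_straight_quarter_ne {s : ℕ} (hs : 1 ≤ s) :
    qPerp straight s (Real.pi / (2 * s)) (equatorPoint 0) ≠ 0 := by
  have hs0 : (s : ℝ) ≠ 0 := by positivity
  intro h
  rcases (qPerp_straight_eq_zero_iff hs _ (norm_equatorPoint 0)).1 h with ⟨k, -, hk⟩ | ⟨-, h | h⟩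
  · obtain ⟨j, hj⟩ := (equatorPoint_eq_iff _ _).1 hk
    have hpi := Real.pi_ne_zero
    field_simp at hj
    have h1 : (1 + 2 * k : ℝ) = 4 * s * j := by
      refine mul_left_cancel₀ hpi ?_
      linear_combination hj
    have h2 : (1 + 2 * k : ℤ) = 4 * s * j := by exact_mod_cast h1
    have h3 : (1 + 2 * k : ℤ) = 2 * (2 * (s * j)) := by rw [h2]; ring
    omega
  · have := congrArg (fun v : E3 => v 2) h
    simp [equatorPoint, north] at this
  · have := congrArg (fun v : E3 => v 2) h
    simp [equatorPoint, north] at this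

/-- Near a node the field does not vanish a quarter of a period later. -/
theorem quarter_ne_near_node {s : ℕ} (hs : 1 ≤ s) :
    ∃ r > 0, ∃ δ > 0, ∀ Q, NearStraight Q → C1Close δ Q straight → ∀ τ e, ‖e‖ = 1 →
      ‖e - equatorPoint τ‖ ≤ r → qPerp Q s (τ + Real.pi / (2 * s)) e ≠ 0 := by
  obtain ⟨K, hK, hKb⟩ := exists_c1Near s
  set V : E3 → E3 := qPerp straight s (Real.pi / (2 * s)) with hV
  have hVc : Continuous V := (continuous_qPerp isClosedCurve_straight s).comp
    (f := fun e : E3 => (Real.pi / (2 * s), e)) (by fun_prop)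
  set μ := ‖V (equatorPoint 0)‖ with hμ
  have hμ0 : 0 < μ := norm_pos_iff.2 (qPerp_straight_quarter_ne hs)
  have hev : ∀ᶠ e in 𝓝 (equatorPoint 0), μ / 2 < ‖V e‖ :=
    continuousAt_const.eventually_lt hVc.norm.continuousAt (by linarith)
  obtain ⟨r, hr, hrb⟩ := Metric.eventually_nhds_iff.1 hev
  refine ⟨r / 2, by positivity, μ / (4 * K), by positivity, fun Q hQ hd τ e he hre h0 => ?_⟩
  have hnear := hKb Q straight hQ nearStraight_straight _ hd (τ + Real.pi / (2 * s))
  have h1 := norm_tangential_sub_le (qVec Q s (τ + Real.pi / (2 * s)))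
    (qVec straight s (τ + Real.pi / (2 * s))) he
  have h2 := (hnear e (by rw [he]; norm_num)).1
  have h3 : K * (μ / (4 * K)) = μ / 4 := by field_simp
  have hback : rotZ τ (rotZ (-τ) e) = e := by rw [rotZ_rotZ, add_neg_cancel, rotZ_zero]
  have h4 : qPerp straight s (τ + Real.pi / (2 * s)) e = rotZ τ (V (rotZ (-τ) e)) := by
    rw [hV, ← qPerp_straight_rotate, hback, add_comm]
  have h5 : ‖rotZ (-τ) e - equatorPoint 0‖ ≤ r / 2 := by
    rw [← norm_rotZ τ, rotZ_sub, hback, rotZ_equatorPoint, add_zero]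
    exact hre
  have h6 := hrb (y := rotZ (-τ) e) (by rw [dist_eq_norm]; linarith)
  rw [← qPerp_eq_tangential, ← qPerp_eq_tangential, h0, h4, zero_sub, norm_neg, norm_rotZ] at h1
  linarith

lemma exists_equator_gap {s : ℕ} (hs : 1 ≤ s) : ∃ g > 0, ∀ k : ℕ, 0 < k → k < 2 * s → ∀ τ,
    g ≤ ‖equatorPoint τ - equatorPoint (τ + k * Real.pi / s)‖ := by
  have h1 : ∀ k ∈ Finset.Ioo 0 (2 * s), ∀ᶠ g in 𝓝[>] (0 : ℝ),
      g ≤ ‖equatorPoint 0 - equatorPoint (k * Real.pi / s)‖ := fun k hk => by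
    rw [Finset.mem_Ioo] at hk
    have hpos : 0 < ‖equatorPoint 0 - equatorPoint (k * Real.pi / s)‖ := by
      rw [norm_pos_iff, sub_ne_zero]
      intro h
      have := equatorPoint_injOn hs 0 (j := 0) (k := k) (by omega) hk.2 (by simpa using h)
      omega
    filter_upwards [mem_nhdsWithin_of_mem_nhds (Iic_mem_nhds hpos)] with g hg using hg
  obtain ⟨g, hg, hg0⟩ := (((Finset.eventually_all _).2 h1).and self_mem_nhdsWithin).exists
  refine ⟨g, hg0, fun k hk hk2 τ => ?_⟩
  have := hg k (Finset.mem_Ioo.2 ⟨hk, hk2⟩)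
  rwa [equatorPoint_add τ, ← add_zero τ, equatorPoint_add τ 0, add_zero, ← rotZ_sub, norm_rotZ]

theorem continuous_zero {Q : ℝ → E3} (hQ : IsClosedCurve Q) {s : ℕ} {κ₀ : ℝ} {x N : ℝ → E3}
    (hx : Continuous x)
    (hN : ∀ τ, ‖N τ‖ = 1 ∧ ‖N τ - x τ‖ ≤ κ₀ ∧ qPerp Q s τ (N τ) = 0)
    (huniq : ∀ τ e e', ‖e‖ = 1 → ‖e'‖ = 1 → ‖e - x τ‖ ≤ κ₀ → ‖e' - x τ‖ ≤ κ₀ →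
        qPerp Q s τ e = 0 → qPerp Q s τ e' = 0 → e = e') : Continuous N := by
  rw [← continuousOn_univ]
  have hΦ : Continuous fun y : ℝ × E3 => (qPerp Q s y.1 y.2, ‖y.2 - x y.1‖) := by
    have := continuous_qPerp hQ s
    fun_prop
  refine continuousOn_of_unique (isCompact_sphere (0 : E3) 1) hΦ.continuousOn
    (T := {0} ×ˢ Set.Iic κ₀) (isClosed_singleton.prod isClosed_Iic) (fun τ _ => ?_)
    fun τ _ e he heT => ?_
  · obtain ⟨h1, h2, h3⟩ := hN τ
    exact ⟨by simpa using h1, by simpa using ⟨h3, h2⟩⟩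
  · obtain ⟨h1, h2, h3⟩ := hN τ
    obtain ⟨h4, h5⟩ : qPerp Q s τ e = 0 ∧ ‖e - x τ‖ ≤ κ₀ := by simpa using heT
    exact huniq τ e (N τ) (by simpa using he) h1 h5 h2 h4 h3

lemma continuous_equatorPoint : Continuous equatorPoint := by
  unfold equatorPoint
  refine (PiLp.continuous_toLp 2 _).comp (continuous_pi fun i => ?_)
  fin_cases i
  · change Continuous fun a => Real.cos (Real.pi / 2 + a)
    fun_prop
  · change Continuous fun a => Real.sin (Real.pi / 2 + a)
    fun_prop
  · simpa using continuous_const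

/-- `N τ` is the only zero of V^τ near E(τ). The fields at times τ and τ + kπ/s agree up to sign, so
`N (τ + kπ/s)` is a node of V^τ too, and one trajectory produces all 2s of them. -/
theorem exists_nodes {s : ℕ} (hs : 1 ≤ s) {κ : ℝ} (hκ : 0 < κ) :
    ∃ δ > 0, ∀ Q, NearStraight Q → C1Close δ Q straight →
      ∃ N : ℝ → E3, Continuous N ∧
        (∀ τ τ' : ℝ, N τ = N τ' ↔ ∃ j : ℤ, τ' = τ + j * (2 * Real.pi)) ∧
        (∀ τ : ℝ, ‖N τ - equatorPoint τ‖ < κ) ∧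
        (∀ τ : ℝ, ∀ k : ℕ, k < 2 * s → IsNode (qPerp Q s τ) (N (τ + k * Real.pi / s))) ∧
        (∀ (τ : ℝ) (e : E3), ‖e‖ = 1 → qPerp Q s τ e = 0 →
          (∃ k : ℕ, k < 2 * s ∧ e = N (τ + k * Real.pi / s)) ∨
          (2 ≤ s ∧ (‖e - north‖ < κ ∨ ‖e - -north‖ < κ))) := by
  have hs0 : s ≠ 0 := by omega
  have hnode := nodeCond_straight hs
  have hz0 : qPerp straight s 0 (equatorPoint 0) = 0 := by
    simpa using qPerp_straight_equator hs 0 0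
  obtain ⟨κ₀, hκ₀, -, hpers⟩ := persistent_zero_string (norm_equatorPoint 0) hz0 isOpen_nodeCond
    hnode nodeCond_conjRot hnode.1.ne'
  obtain ⟨r, hr, δ₁, hδ₁, hquarter⟩ := quarter_ne_near_node hs
  obtain ⟨g, hg, hgap⟩ := exists_equator_gap hs
  -- The bound g/4 ensures that one point cannot be close to two different equatorial zeros, which
  -- are at least g apart.
  set κ' := min (min κ₀ (κ / 2)) (min r (g / 4)) with hκ'
  have hκ'0 : 0 < κ' := by positivity
  have a1 : κ' ≤ κ₀ := (min_le_left _ _).trans (min_le_left _ _)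
  have a2 : κ' ≤ κ / 2 := (min_le_left _ _).trans (min_le_right _ _)
  have a3 : κ' ≤ r := (min_le_right _ _).trans (min_le_left _ _)
  have a4 : κ' ≤ g / 4 := (min_le_right _ _).trans (min_le_right _ _)
  obtain ⟨δ₂, hδ₂, hpers⟩ := hpers κ' hκ'0 a1
  obtain ⟨δ₃, hδ₃, hzeros⟩ := zeros_near hs (r := min κ₀ κ) (by positivity)
  refine ⟨min δ₁ (min δ₂ δ₃), by positivity, fun Q hQ hd => ?_⟩
  have hpers := hpers Q hQ (hd.mono ((min_le_right _ _).trans (min_le_left _ _)))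
  have hzeros := hzeros Q hQ (hd.mono ((min_le_right _ _).trans (min_le_right _ _)))
  have hquarter := hquarter Q hQ (hd.mono (min_le_left _ _))
  simp only [rotZ_equatorPoint, add_zero] at hpers
  choose N hN1 hN2 hN3 using fun τ => (hpers τ).1
  have huniq := fun τ => (hpers τ).2.1
  have hcont : Continuous N := continuous_zero hQ.1 continuous_equatorPoint
    (fun τ => ⟨hN1 τ, (hN2 τ).trans a1, hN3 τ⟩) huniq
  refine ⟨N, hcont, fun τ τ' => ⟨fun h => ?_, ?_⟩, fun τ => (hN2 τ).trans_lt (by linarith),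
    fun τ k _ => ?_, fun τ e he h0 => ?_⟩
  -- A common position at two times forces a difference kπ/s; the gap between distinct equatorial
  -- points then leaves only whole turns.
  · obtain ⟨k, hk⟩ := sin_eq_zero_of_common_zero hQ hs0 (hN3 τ) (by rw [h]; exact hN3 τ')
      (hquarter τ (N τ) (hN1 τ) ((hN2 τ).trans a3))
    obtain ⟨j, hj, hjk⟩ := equatorPoint_add_int hs τ k
    rw [← equatorPoint_eq_iff]
    rw [← hk] at hjk
    rcases Nat.eq_zero_or_pos j with rfl | hjpos
    · rw [hjk]; simp
    · exfalso
      have h1 := hgap j hjpos hj τ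
      rw [← hjk] at h1
      have h2 := norm_sub_le_norm_sub_add_norm_sub (equatorPoint τ) (N τ) (equatorPoint τ')
      have h3 := hN2 τ
      have h4 := hN2 τ'
      rw [← h] at h4
      rw [norm_sub_rev] at h3
      linarith
  · rintro ⟨j, rfl⟩
    have hE : equatorPoint (τ + j * (2 * Real.pi)) = equatorPoint τ :=
      ((equatorPoint_eq_iff _ _).2 ⟨j, rfl⟩).symm
    refine huniq τ _ _ (hN1 _) (hN1 _) ((hN2 τ).trans a1) ?_ (hN3 _) ?_
    · rw [← hE]; exact (hN2 _).trans a1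
    · rw [← qPerp_int_period hQ.1 hs0 τ j]; exact hN3 _
  · set σ := τ + k * Real.pi / s
    have hn : IsNode (qPerp Q s σ) (N σ) := isNode_tangential (hN1 σ)
      (hasFDerivAt_qVec hQ.1 s σ (N σ)) (hN3 σ) ((hpers σ).2.2 (N σ) (hN1 σ) ((hN2 σ).trans a1))
    rcases qPerp_nat_half_period_cases hQ.1 hs0 τ k with h | h
    · rw [h]; exact hn
    · rw [h]; exact hn.neg
  · rcases hzeros τ e he h0 with ⟨k, hk, hek⟩ | ⟨h2, h3⟩
    · left
      refine ⟨k, hk, ?_⟩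
      refine huniq _ _ _ he (hN1 _) (hek.le.trans (min_le_left _ _)) ((hN2 _).trans a1) ?_ (hN3 _)
      rcases qPerp_nat_half_period_cases hQ.1 hs0 τ k with h | h
      · rw [← h]; exact h0
      · rw [h] at h0; simpa using h0
    · exact Or.inr ⟨h2, h3.imp (fun h => h.trans_le (min_le_right _ _))
        fun h => h.trans_le (min_le_right _ _)⟩

/-! ### Types of the singular points of the straight field -/

theorem isNode_straight {s : ℕ} (hs : 1 ≤ s) (τ : ℝ) (k : ℕ) :
    IsNode (qPerp straight s τ) (equatorPoint (τ + k * Real.pi / s)) := by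
  have hs0 : s ≠ 0 := by omega
  have hnode := nodeCond_straight hs
  set σ := τ + k * Real.pi / s
  have hz : qPerp straight s σ (equatorPoint σ) = 0 := by
    simpa using qPerp_straight_equator hs σ 0
  have hc : NodeCond (dqVec straight s σ (equatorPoint σ) - ⟪qVec straight s σ (equatorPoint σ),
      equatorPoint σ⟫ • ContinuousLinearMap.id ℝ E3) (equatorPoint σ) := by
    have h1 : equatorPoint σ = rotZ σ (equatorPoint 0) := by rw [rotZ_equatorPoint, add_zero]
    rw [h1]
    refine nodeCond_conjRot σ _ _ ?_
    rw [← conjRot_sub_smul_id, conjRot_dqVec_straight, ← inner_rotField, rotField_straight]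
    exact hnode
  have hn := isNode_tangential (norm_equatorPoint σ)
    (hasFDerivAt_qVec isClosedCurve_straight s σ (equatorPoint σ)) hz hc
  rw [← qPerp_eq_tangential] at hn
  rcases qPerp_nat_half_period_cases isClosedCurve_straight hs0 τ k with h | h
  · rw [h]; exact hn
  · rw [h]; exact hn.neg

theorem isSaddle_straight (τ : ℝ) {p : E3} (hp : p = north ∨ p = -north) :
    IsSaddle (qPerp straight 2 τ) p := by
  have hz : qPerp straight 2 τ p = 0 :=
    (qPerp_straight_eq_zero_iff (by norm_num) τ (norm_pole hp)).2 (Or.inr ⟨le_rfl, hp⟩)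
  refine isSaddle_tangential (norm_pole hp) (hasFDerivAt_qVec isClosedCurve_straight 2 τ p) hz ?_
  have h := saddleCond_conjRot τ
    (dqVec straight 2 τ p - ⟪qVec straight 2 τ p, p⟫ • ContinuousLinearMap.id ℝ E3) p
  rw [rotZ_pole τ hp] at h
  refine h ?_
  have h1 := conjRot_dqVec_straight 2 τ p
  have h2 := inner_rotField straight 2 τ p
  rw [rotZ_pole τ hp] at h1 h2
  rw [← conjRot_sub_smul_id, h1, ← h2, rotField_straight]
  exact saddleCond_straight hp

/-! ### The saddles near the poles at `s = 2` -/

/-- With t = ⟪e, p⟫ in [0, 1] one has |e - p|² = 2(1 - t) ≤ 2(1 - t²), and 1 - t² is the square of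
the horizontal part. -/
lemma norm_sub_pole_le {p e : E3} (hp : p = north ∨ p = -north) (he : ‖e‖ = 1)
    (hep : 0 ≤ ⟪e, p⟫) : ‖e - p‖ ≤ 2 * ‖horiz e‖ := by
  have h1 := norm_sub_sq_real e p
  rw [he, norm_pole hp] at h1
  have h2 := norm_sq_eq e
  rw [he] at h2
  have h3 : ⟪e, p⟫ ^ 2 = e 2 ^ 2 := by
    rcases hp with rfl | rfl <;>
      simp [north, EuclideanSpace.inner_eq_star_dotProduct, dotProduct, Fin.sum_univ_three]
  have h4 : ⟪e, p⟫ ≤ 1 := by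
    have := real_inner_le_norm e p
    rwa [he, norm_pole hp, one_mul] at this
  exact le_of_sq_le_sq (by nlinarith [sq_nonneg ‖horiz e‖]) (by positivity)

/-- The positively polarized component of the amplitude. -/
lemma amplitude_plus_eq {Q : ℝ → E3} (hQ : NearStraight Q) {n : ℕ} (hn : n ≠ 0) (e : E3) :
    amplitude Q n 0 e 0 + Complex.I * amplitude Q n 0 e 1 =
      horiz (qVec Q n 0 e) + Complex.I * horiz (qVec Q n (Real.pi / (2 * n)) e) := by
  rw [amplitude_eq hQ.1 hQ.totalLength_pos.ne' hn, amplitude_eq hQ.1 hQ.totalLength_pos.ne' hn,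
    zero_add]
  apply Complex.ext <;> simp
  ring

/-- At a zero common to all times both n - p and the multipliers are O(d). Transferring the fields
from n to p costs O(d²), and the linear parts at the two times cancel in the positively polarized
combination. -/
theorem amplitude_plus_le_of_common_zero : ∃ B > 0, ∃ r > 0, ∀ Q, NearStraight Q → ∀ d,
    C1Close d Q straight → ∀ p : E3, p = north ∨ p = -north → ∀ n : E3, ‖n‖ = 1 → ‖n - p‖ ≤ r →
      qPerp Q 2 0 n = 0 → qPerp Q 2 (Real.pi / (2 * (2 : ℕ))) n = 0 →
      ‖amplitude Q 2 0 p 0 + Complex.I * amplitude Q 2 0 p 1‖ ≤ B * d ^ 2 := by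
  obtain ⟨K, hK, hKb⟩ := exists_c1Near 2
  obtain ⟨A, hA, hexp⟩ := exists_straightPlane_expansion (s := 2) le_rfl
  set C := ‖poleCoeff 2‖ with hC
  have hC0 : 0 < C := norm_pos_iff.2 (poleCoeff_ne_zero (by norm_num))
  refine ⟨8 * K * (4 * K / C) + 2 * A * (4 * K / C) ^ 2, by positivity,
    -- The bound 1/2 keeps 2|z| ≤ 1, the domain of the expansion, and C/(2A) lets the quadratic
    -- remainder be absorbed by the linear term.
    min (1 / 2) (C / (2 * A)), by positivity, fun Q hQ d hd p hp n hn hnr h0 h1 => ?_⟩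
  set z := horiz n with hz
  have hd0 : 0 ≤ d := (norm_nonneg _).trans (hd 0).1
  have hzr : ‖z‖ ≤ min (1 / 2) (C / (2 * A)) := by
    have := norm_horiz_le (n - p)
    rw [map_sub, horiz_pole hp, sub_zero] at this
    exact this.trans hnr
  have hz1 : ‖z‖ ≤ 1 / 2 := hzr.trans (min_le_left _ _)
  have hz2 : A * ‖z‖ ≤ C / 2 := by
    have := hzr.trans (min_le_right _ _)
    rw [le_div_iff₀ (by positivity)] at this
    linarith
  have hnp : ‖n - p‖ ≤ 2 * ‖z‖ := by
    refine norm_sub_pole_le hp hn ?_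
    have h2 := norm_sub_sq_real n p
    rw [hn, norm_pole hp] at h2
    have h3 := hnr.trans (min_le_left _ _)
    nlinarith [norm_nonneg (n - p)]
  have hn2 : 1 / 2 ≤ |n 2| := by
    have h2 := norm_sq_eq n
    rw [hn, ← sq_abs (n 2)] at h2
    have h3 : ‖z‖ ^ 2 ≤ (1 / 2) ^ 2 := by gcongr
    rw [← hz] at h2
    nlinarith [abs_nonneg (n 2)]
  -- The straight field is horizontal, so the vertical component of the perturbed one is O(d); since
  -- |n_2| ≥ 1/2, the multiplier is O(d).
  have hmul : ∀ σ, qPerp Q 2 σ n = 0 → ∃ μ : ℝ, |μ| ≤ 2 * (K * d) ∧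
      qVec Q 2 σ n = μ • n ∧ ‖(μ : ℂ) * z - straightPlane 2 σ z‖ ≤ K * d := fun σ hσ => by
    have h2 := (hKb Q straight hQ nearStraight_straight d hd σ n (by rw [hn]; norm_num)).1
    have h3 : qVec Q 2 σ n = ⟪qVec Q 2 σ n, n⟫ • n := tangential_eq_zero_iff.1 hσ
    set μ := ⟪qVec Q 2 σ n, n⟫
    rw [h3, qVec_straight] at h2
    refine ⟨μ, ?_, h3, ?_⟩
    · have h4 := (PiLp.norm_apply_le (μ • n - embed (straightPlane 2 σ (horiz n))) 2).trans h2
      simp only [PiLp.sub_apply, PiLp.smul_apply, embed_two, sub_zero, smul_eq_mul, norm_mul,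
        Real.norm_eq_abs] at h4
      nlinarith [abs_nonneg μ]
    · have h4 := (norm_horiz_le _).trans h2
      rwa [map_sub, map_smul, horiz_embed, Complex.real_smul] at h4
  obtain ⟨μ₀, hμ₀, hq₀, hs₀⟩ := hmul 0 h0
  obtain ⟨μ₁, hμ₁, hq₁, hs₁⟩ := hmul _ h1
  have e₀ := (hexp 0 z (by push_cast; linarith)).1
  have e₁ := (hexp (Real.pi / (2 * (2 : ℕ))) z (by push_cast; linarith)).1
  have hi : Complex.exp ((((2 : ℕ) : ℝ) * (Real.pi / (2 * (2 : ℕ))) : ℝ) * Complex.I) =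
      Complex.I := by
    rw [show (((2 : ℕ) : ℝ) * (Real.pi / (2 * (2 : ℕ)))) = Real.pi / 2 by push_cast; ring,
      Complex.ofReal_div, Complex.ofReal_ofNat, Complex.exp_pi_div_two_mul_I]
  rw [hi] at e₁
  simp only [mul_zero, Complex.ofReal_zero, zero_mul, Complex.exp_zero, mul_one,
    show 2 - 1 = 1 from rfl, pow_one] at e₀ e₁
  have hzd : ‖z‖ ≤ 4 * K / C * d := by
    have h2 : ‖poleCoeff 2 * (starRingEnd ℂ) z‖ = C * ‖z‖ := by rw [norm_mul, RCLike.norm_conj]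
    have h3 : ‖poleCoeff 2 * (starRingEnd ℂ) z‖ ≤ ‖straightPlane 2 0 z - poleCoeff 2 *
        (starRingEnd ℂ) z‖ + ‖(μ₀ : ℂ) * z - straightPlane 2 0 z‖ + ‖(μ₀ : ℂ) * z‖ := by
      have : poleCoeff 2 * (starRingEnd ℂ) z = -(straightPlane 2 0 z - poleCoeff 2 *
        (starRingEnd ℂ) z) - ((μ₀ : ℂ) * z - straightPlane 2 0 z) + (μ₀ : ℂ) * z := by ring
      conv_lhs => rw [this]
      refine (norm_add_le _ _).trans ?_
      gcongr
      refine (norm_sub_le _ _).trans ?_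
      rw [norm_neg]
    have h4 : ‖(μ₀ : ℂ) * z‖ ≤ 2 * (K * d) * (1 / 2) := by
      rw [norm_mul, Complex.norm_real, Real.norm_eq_abs]
      gcongr
    have h5 : A * ‖z‖ ^ 2 ≤ C / 2 * ‖z‖ := by nlinarith [norm_nonneg z]
    rw [div_mul_eq_mul_div, le_div_iff₀ hC0]
    linarith
  -- The difference of the perturbed and straight fields has Lipschitz constant Kd, and |n - p| ≤
  -- 2|z| is itself O(d).
  have hg : ∀ σ, ‖horiz (qVec Q 2 σ p) - (horiz (qVec Q 2 σ n) - straightPlane 2 σ z)‖ ≤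
      K * d * (2 * ‖z‖) := fun σ => by
    have h2 := (hKb Q straight hQ nearStraight_straight d hd σ).lipschitz
      (hasFDerivAt_qVec hQ.1 2 σ) (hasFDerivAt_qVec isClosedCurve_straight 2 σ)
      (x := p) (y := n) (by rw [norm_pole hp]; norm_num) (by rw [hn]; norm_num)
    have h3 := (norm_horiz_le _).trans h2
    rw [qVec_straight, qVec_straight, horiz_pole hp, straightPlane_zero le_rfl, map_zero, sub_zero,
      map_sub, map_sub, horiz_embed, norm_sub_rev p n] at h3
    exact h3.trans (by gcongr)
  have g₀ := hg 0
  have g₁ := hg (Real.pi / (2 * (2 : ℕ)))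
  rw [hq₀, map_smul, Complex.real_smul, ← hz] at g₀
  rw [hq₁, map_smul, Complex.real_smul, ← hz] at g₁
  rw [amplitude_plus_eq hQ two_ne_zero]
  set a₀ := horiz (qVec Q 2 0 p)
  set a₁ := horiz (qVec Q 2 (Real.pi / (2 * (2 : ℕ))) p)
  set s₀ := straightPlane 2 0 z
  set s₁ := straightPlane 2 (Real.pi / (2 * (2 : ℕ))) z
  set L := poleCoeff 2 * (starRingEnd ℂ) z
  -- A quarter period multiplies the leading term L by i, and L + i(iL) = 0; every group on the
  -- right is O(d²).
  have key : a₀ + Complex.I * a₁ = (a₀ - ((μ₀ : ℂ) * z - s₀)) +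
      Complex.I * (a₁ - ((μ₁ : ℂ) * z - s₁)) + ((μ₀ : ℂ) * z + Complex.I * ((μ₁ : ℂ) * z)) -
      ((s₀ - L) + Complex.I * (s₁ - poleCoeff 2 * Complex.I * (starRingEnd ℂ) z)) := by
    simp only [L]
    linear_combination (-poleCoeff 2 * (starRingEnd ℂ) z) * Complex.I_sq
  rw [key]
  have hmz : ∀ μ : ℝ, |μ| ≤ 2 * (K * d) → ‖(μ : ℂ) * z‖ ≤ 2 * (K * d) * ‖z‖ := fun μ hμ => by
    rw [norm_mul, Complex.norm_real, Real.norm_eq_abs]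
    gcongr
  have m₀ := hmz _ hμ₀
  have m₁ := hmz _ hμ₁
  have tri : ∀ x y : ℂ, ‖x + Complex.I * y‖ ≤ ‖x‖ + ‖y‖ := fun x y => by
    simpa using norm_add_le x (Complex.I * y)
  have t1 := tri (a₀ - ((μ₀ : ℂ) * z - s₀)) (a₁ - ((μ₁ : ℂ) * z - s₁))
  have t2 := tri ((μ₀ : ℂ) * z) ((μ₁ : ℂ) * z)
  have t3 := tri (s₀ - L) (s₁ - poleCoeff 2 * Complex.I * (starRingEnd ℂ) z)
  have hfin : 8 * (K * d) * ‖z‖ + 2 * (A * ‖z‖ ^ 2) ≤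
      (8 * K * (4 * K / C) + 2 * A * (4 * K / C) ^ 2) * d ^ 2 := by
    calc 8 * (K * d) * ‖z‖ + 2 * (A * ‖z‖ ^ 2)
        ≤ 8 * (K * d) * (4 * K / C * d) + 2 * (A * (4 * K / C * d) ^ 2) := by gcongr
      _ = _ := by ring
  have u1 := norm_sub_le ((a₀ - ((μ₀ : ℂ) * z - s₀)) +
      Complex.I * (a₁ - ((μ₁ : ℂ) * z - s₁)) + ((μ₀ : ℂ) * z + Complex.I * ((μ₁ : ℂ) * z)))
      ((s₀ - L) + Complex.I * (s₁ - poleCoeff 2 * Complex.I * (starRingEnd ℂ) z))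
  have u2 := norm_add_le ((a₀ - ((μ₀ : ℂ) * z - s₀)) +
      Complex.I * (a₁ - ((μ₁ : ℂ) * z - s₁))) ((μ₀ : ℂ) * z + Complex.I * ((μ₁ : ℂ) * z))
  linarith

/-- The zero near the pole persists with its type, and the half-period reversal gives the period
π/2. If the loop met itself at any other time, its point would be a zero for all times,
contradicting the lower bound cd because Bd² is smaller. -/
theorem exists_saddle_two {κ : ℝ} (hκ : 0 < κ) {c : ℝ} (hc : 0 < c) {p : E3}
    (hp : p = north ∨ p = -north) : ∃ δ > 0, ∀ Q, NearStraight Q → ∀ d, 0 < d → d ≤ δ →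
      C1Close d Q straight →
      ∃ z : ℝ → E3, Continuous z ∧ Function.Periodic z (Real.pi / (2 : ℕ)) ∧
        (∀ τ : ℝ, ‖z τ - p‖ < κ ∧ IsSaddle (qPerp Q 2 τ) (z τ)) ∧
        (∀ (τ : ℝ) (e : E3), ‖e‖ = 1 → 1 / 2 < ⟪e, p⟫ → qPerp Q 2 τ e = 0 → e = z τ) ∧
        (c * d ≤ ‖amplitude Q 2 0 p 0 + Complex.I * amplitude Q 2 0 p 1‖ →
          ∀ τ τ' : ℝ, z τ = z τ' ↔ ∃ j : ℤ, τ' = τ + j * (Real.pi / (2 : ℕ))) := by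
  have hsad := saddleCond_straight hp
  have hz0 : qPerp straight 2 0 p = 0 :=
    (qPerp_straight_eq_zero_iff (by norm_num) 0 (norm_pole hp)).2 (Or.inr ⟨le_rfl, hp⟩)
  obtain ⟨κ₀, hκ₀, -, hpers⟩ := persistent_zero_string (norm_pole hp) hz0 isOpen_saddleCond
    hsad saddleCond_conjRot (ne_of_lt hsad)
  obtain ⟨B, hB, r, hr, hamp⟩ := amplitude_plus_le_of_common_zero
  set κ' := min (min κ₀ (κ / 2)) r with hκ'
  have a1 : κ' ≤ κ₀ := (min_le_left _ _).trans (min_le_left _ _)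
  have a2 : κ' ≤ κ / 2 := (min_le_left _ _).trans (min_le_right _ _)
  have a3 : κ' ≤ r := min_le_right _ _
  obtain ⟨δ₁, hδ₁, hpers⟩ := hpers κ' (by positivity) a1
  obtain ⟨δ₂, hδ₂, hzeros⟩ := zeros_near_pole (s := 2) (by norm_num) hκ₀
  refine ⟨min (min δ₁ δ₂) (c / (2 * B)), by positivity, fun Q hQ d hd0 hdδ hd => ?_⟩
  have hpers := hpers Q hQ (hd.mono (hdδ.trans ((min_le_left _ _).trans (min_le_left _ _))))
  have hzeros := hzeros Q hQ (hd.mono (hdδ.trans ((min_le_left _ _).trans (min_le_right _ _)))) p hp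
  have hdB : B * d ≤ c / 2 := by
    have := hdδ.trans (min_le_right _ _)
    rw [le_div_iff₀ (by positivity)] at this
    linarith
  simp only [rotZ_pole _ hp] at hpers
  choose z hz1 hz2 hz3 using fun τ => (hpers τ).1
  have huniq := fun τ => (hpers τ).2.1
  have hper : Function.Periodic z (Real.pi / (2 : ℕ)) := fun τ => by
    refine huniq τ _ _ (hz1 _) (hz1 _) ((hz2 _).trans a1) ((hz2 _).trans a1) ?_ (hz3 _)
    have := hz3 (τ + Real.pi / (2 : ℕ))
    rw [qPerp_half_period hQ.1 two_ne_zero] at this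
    simpa using this
  refine ⟨z, continuous_zero hQ.1 continuous_const (fun τ => ⟨hz1 τ, (hz2 τ).trans a1, hz3 τ⟩) huniq,
    hper, fun τ => ⟨(hz2 τ).trans_lt (by linarith), isSaddle_tangential (hz1 τ)
      (hasFDerivAt_qVec hQ.1 2 τ (z τ)) (hz3 τ) ((hpers τ).2.2 _ (hz1 τ) ((hz2 τ).trans a1))⟩,
    fun τ e he hep h0 => huniq τ e (z τ) he (hz1 τ) (hzeros τ e he hep h0).le ((hz2 τ).trans a1) h0
      (hz3 τ), fun hcd τ τ' => ⟨fun h => ?_, ?_⟩⟩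
  · by_cases hV : qPerp Q 2 (τ + Real.pi / (2 * (2 : ℕ))) (z τ) = 0
    · exfalso
      have hall : ∀ σ, qPerp Q 2 σ (z τ) = 0 := fun σ => by
        have := qPerp_time_eq hQ.1 hQ.totalLength_pos.ne' two_ne_zero τ (σ - τ) (z τ)
        rwa [add_sub_cancel, hz3, hV, smul_zero, smul_zero, add_zero] at this
      have := hamp Q hQ d hd p hp (z τ) (hz1 τ) ((hz2 τ).trans a3) (hall _) (hall _)
      nlinarith
    · obtain ⟨k, hk⟩ := sin_eq_zero_of_common_zero hQ two_ne_zero (hz3 τ) (by rw [h]; exact hz3 τ') hV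
      exact ⟨k, by rw [hk]; ring⟩
  · rintro ⟨j, rfl⟩
    exact ((hper.int_mul j) τ).symm

/-! ### Perturbed roots of unity -/

/-- The substitution ξ = ωx reduces a neighbourhood of each root of unity ω to a neighbourhood of 1,
and smallness of G excludes other solutions in the disc of radius two. One Lipschitz bound on G
controls both its increments and, by G(0) = 0, its values. -/
lemma exists_perturbed_roots (m : ℕ) (hm : m ≠ 0) : ∃ θ > 0, θ ≤ 1 / 2 ∧ ∃ ε > 0,
    (∀ ω ω' : ℂ, ω ^ m = 1 → ω' ^ m = 1 → ‖ω - ω'‖ ≤ 2 * θ → ω = ω') ∧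
    ∀ G : ℂ → ℂ, G 0 = 0 → (∀ x y, ‖x‖ ≤ 2 → ‖y‖ ≤ 2 → ‖G x - G y‖ ≤ ε * ‖x - y‖) →
      (∀ ω : ℂ, ω ^ m = 1 → ∃ ξ, ‖ξ - ω‖ ≤ θ ∧ 1 - ξ ^ m + G ξ = 0) ∧
      (∀ ω ξ ξ' : ℂ, ω ^ m = 1 → ‖ξ - ω‖ ≤ θ → ‖ξ' - ω‖ ≤ θ → 1 - ξ ^ m + G ξ = 0 →
        1 - ξ' ^ m + G ξ' = 0 → ξ = ξ') ∧
      (∀ ξ, ‖ξ‖ ≤ 2 → 1 - ξ ^ m + G ξ = 0 → ∃ ω : ℂ, ω ^ m = 1 ∧ ‖ξ - ω‖ ≤ θ) := by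
  obtain ⟨θ₀, hθ₀, hθ₁, h⟩ := exists_root_near_one m hm
  obtain ⟨ε, hε, hb⟩ := h (θ₀ / 2) (by positivity) (by linarith)
  have hnorm : ∀ ω : ℂ, ω ^ m = 1 → ‖ω‖ = 1 := fun ω hω => Complex.norm_eq_one_of_pow_eq_one hω hm
  refine ⟨θ₀ / 2, by positivity, by linarith, min ε ((θ₀ / 2) ^ m / 4), by positivity,
    fun ω ω' hω hω' hd => ?_, fun G hG0 hG => ?_⟩
  -- Roots of unity are separated by the uniqueness statement with G = 0, applied to ω/ω' and 1.
  · obtain ⟨-, huniq⟩ := hb 0 (by simp; intros; positivity) (by simpa using hε.le)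
    have h0 : ω' ≠ 0 := by rintro rfl; simp [hm] at hω'
    have h1 := huniq (ω / ω') (by
      rw [mem_closedBall, dist_eq_norm, div_sub_one h0, norm_div, hnorm _ hω']; linarith) 1
      (by simp [hθ₀.le]) (by simp [div_pow, hω, hω']) (by simp)
    rwa [div_eq_one_iff_eq h0] at h1
  have hsub : ∀ ω : ℂ, ω ^ m = 1 →
      (∃ x ∈ closedBall (1 : ℂ) (θ₀ / 2), 1 - x ^ m + G (ω * x) = 0) ∧
      ∀ x ∈ closedBall (1 : ℂ) θ₀, ∀ y ∈ closedBall (1 : ℂ) θ₀, 1 - x ^ m + G (ω * x) = 0 →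
        1 - y ^ m + G (ω * y) = 0 → x = y := fun ω hω => by
    have h2 : ∀ x ∈ closedBall (1 : ℂ) θ₀, ‖ω * x‖ ≤ 2 := fun x hx => by
      rw [norm_mul, hnorm ω hω, one_mul]
      rw [mem_closedBall, dist_eq_norm] at hx
      have := norm_le_norm_sub_add x 1
      rw [norm_one] at this
      linarith
    refine hb (fun x => G (ω * x)) (fun x hx y hy => ?_) ?_
    · refine (hG _ _ (h2 x hx) (h2 y hy)).trans ?_
      rw [← mul_sub, norm_mul, hnorm ω hω, one_mul]
      gcongr
      exact min_le_left _ _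
    · have := hG (ω * 1) 0 (h2 1 (by simp [hθ₀.le])) (by simp)
      rw [hG0, sub_zero, sub_zero, norm_mul, hnorm ω hω, norm_one, mul_one, mul_one, mul_one] at this
      simpa using this.trans (min_le_left _ _)
  have hmove : ∀ ω ξ : ℂ, ω ^ m = 1 → ‖ξ - ω‖ ≤ θ₀ / 2 → ξ / ω ∈ closedBall (1 : ℂ) θ₀ :=
    fun ω ξ hω hξ => by
      have h0 : ω ≠ 0 := by rintro rfl; simp [hm] at hω
      rw [mem_closedBall, dist_eq_norm, div_sub_one h0, norm_div, hnorm _ hω]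
      linarith
  refine ⟨fun ω hω => ?_, fun ω ξ ξ' hω h1 h2 h3 h4 => ?_, fun ξ hξ h0 => ?_⟩
  · obtain ⟨x, hx, hx0⟩ := (hsub ω hω).1
    refine ⟨ω * x, ?_, by rwa [mul_pow, hω, one_mul]⟩
    rw [mem_closedBall, dist_eq_norm] at hx
    rwa [← mul_sub_one, norm_mul, hnorm ω hω, one_mul]
  · have h0 : ω ≠ 0 := by rintro rfl; simp [hm] at hω
    have := (hsub ω hω).2 _ (hmove ω ξ hω h1) _ (hmove ω ξ' hω h2)
      (by rwa [mul_div_cancel₀ _ h0, div_pow, hω, div_one])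
      (by rwa [mul_div_cancel₀ _ h0, div_pow, hω, div_one])
    exact (div_left_inj' h0).1 this
  · have h1 := hG ξ 0 hξ (by simp)
    rw [hG0, sub_zero, sub_zero] at h1
    have h2 : ξ ^ m - 1 = G ξ := by linear_combination -h0
    obtain ⟨ω, hω, hd⟩ := exists_root_of_unity_near m hm (θ := θ₀ / 2) (by positivity) (ξ := ξ) (by
      rw [h2]
      have h3 : min ε ((θ₀ / 2) ^ m / 4) * ‖ξ‖ ≤ (θ₀ / 2) ^ m / 4 * 2 := by
        gcongr
        exact min_le_right _ _
      have : 0 < (θ₀ / 2) ^ m := by positivity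
      linarith)
    exact ⟨ω, hω, hd.le⟩

/-! ### The field in the vertical chart at a pole -/

/-- The inverse of the vertical projection of the hemisphere around the pole `p`. -/
def chart (p : E3) (z : ℂ) : E3 := embed z + Real.sqrt (1 - ‖z‖ ^ 2) • p

lemma horiz_chart {p : E3} (hp : p = north ∨ p = -north) (z : ℂ) : horiz (chart p z) = z := by
  rw [chart, map_add, map_smul, horiz_embed, horiz_pole hp, smul_zero, add_zero]

lemma chart_zero (p : E3) : chart p 0 = p := by simp [chart]

lemma pole_two_sq {p : E3} (hp : p = north ∨ p = -north) : p 2 ^ 2 = 1 := by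
  rcases hp with rfl | rfl <;> simp [north]

lemma norm_chart {p : E3} (hp : p = north ∨ p = -north) {z : ℂ} (hz : ‖z‖ ≤ 1) :
    ‖chart p z‖ = 1 := by
  have h1 := norm_sq_eq (chart p z)
  have h2 : chart p z 2 = Real.sqrt (1 - ‖z‖ ^ 2) * p 2 := by simp [chart]
  rw [horiz_chart hp, h2, mul_pow, pole_two_sq hp, Real.sq_sqrt (by nlinarith [norm_nonneg z])] at h1
  exact (pow_eq_one_iff_of_nonneg (norm_nonneg _) two_ne_zero).1 (by linarith)

lemma inner_pole {p : E3} (hp : p = north ∨ p = -north) (e : E3) : ⟪e, p⟫ = e 2 * p 2 := by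
  rcases hp with rfl | rfl <;>
    simp [north, EuclideanSpace.inner_eq_star_dotProduct, dotProduct, Fin.sum_univ_three]

lemma inner_chart_nonneg {p : E3} (hp : p = north ∨ p = -north) (z : ℂ) : 0 ≤ ⟪chart p z, p⟫ := by
  have h2 : chart p z 2 = Real.sqrt (1 - ‖z‖ ^ 2) * p 2 := by simp [chart]
  rw [inner_pole hp, h2, mul_assoc, ← sq, pole_two_sq hp, mul_one]
  positivity

lemma chart_horiz {p : E3} (hp : p = north ∨ p = -north) {e : E3} (he : ‖e‖ = 1)
    (hep : 0 ≤ ⟪e, p⟫) : chart p (horiz e) = e := by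
  refine eq_of_horiz_eq (horiz_chart hp _) ?_
  have h2 : chart p (horiz e) 2 = Real.sqrt (1 - ‖horiz e‖ ^ 2) * p 2 := by simp [chart]
  have h3 := norm_sq_eq e
  rw [he] at h3
  have h4 := pole_two_sq hp
  rw [inner_pole hp] at hep
  rw [h2, show 1 - ‖horiz e‖ ^ 2 = (e 2 * p 2) ^ 2 by rw [mul_pow, h4]; linarith,
    Real.sqrt_sq hep, mul_assoc, ← sq, h4, mul_one]

/-- The heights a and b satisfy |a² - b²| = ||x|² - |y|²|, with a + b ≥ 1 and |x| + |y| ≤ 1, so the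
height is 1-Lipschitz on this disc. -/
lemma norm_chart_sub_le {p : E3} (hp : p = north ∨ p = -north) {x y : ℂ} (hx : ‖x‖ ≤ 1 / 2)
    (hy : ‖y‖ ≤ 1 / 2) : ‖chart p x - chart p y‖ ≤ 2 * ‖x - y‖ := by
  have e1 : chart p x - chart p y =
      embed (x - y) + (Real.sqrt (1 - ‖x‖ ^ 2) - Real.sqrt (1 - ‖y‖ ^ 2)) • p := by
    rw [chart, chart, map_sub, sub_smul]
    abel
  rw [e1]
  refine (norm_add_le _ _).trans ?_
  rw [norm_embed, norm_smul, norm_pole hp, mul_one, Real.norm_eq_abs]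
  have hsq : ∀ t : ℂ, ‖t‖ ≤ 1 / 2 → 1 / 2 ≤ Real.sqrt (1 - ‖t‖ ^ 2) ∧
      Real.sqrt (1 - ‖t‖ ^ 2) ^ 2 = 1 - ‖t‖ ^ 2 := fun t ht => by
    have := norm_nonneg t
    exact ⟨Real.le_sqrt_of_sq_le (by nlinarith), Real.sq_sqrt (by nlinarith)⟩
  obtain ⟨a1, a2⟩ := hsq x hx
  obtain ⟨b1, b2⟩ := hsq y hy
  set a := Real.sqrt (1 - ‖x‖ ^ 2)
  set b := Real.sqrt (1 - ‖y‖ ^ 2)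
  have h1 : |a - b| * (a + b) = |‖x‖ - ‖y‖| * (‖x‖ + ‖y‖) := by
    calc |a - b| * (a + b) = |(a - b) * (a + b)| := by
          rw [abs_mul, abs_of_nonneg (show 0 ≤ a + b by linarith)]
      _ = |-((‖x‖ - ‖y‖) * (‖x‖ + ‖y‖))| := by congr 1; linear_combination a2 - b2
      _ = _ := by rw [abs_neg, abs_mul, abs_of_nonneg (show 0 ≤ ‖x‖ + ‖y‖ by positivity)]
  have h2 := abs_norm_sub_norm_le x y
  have h3 : |a - b| * 1 ≤ |a - b| * (a + b) := by
    gcongr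
    linarith
  have h4 : |‖x‖ - ‖y‖| * (‖x‖ + ‖y‖) ≤ ‖x - y‖ * 1 := by
    gcongr
    linarith
  linarith

lemma continuous_chart (p : E3) : Continuous (chart p) := by
  unfold chart
  fun_prop

/-- The field is tangent to the sphere, and inside the open hemisphere the normal has a nonzero
vertical component, so a vanishing horizontal part leaves nothing. -/
lemma qPerp_chart_eq_zero_iff {Q : ℝ → E3} {s : ℕ} {τ : ℝ} {p : E3} (hp : p = north ∨ p = -north)
    {z : ℂ} (hz : ‖z‖ < 1) :
    qPerp Q s τ (chart p z) = 0 ↔ horiz (qPerp Q s τ (chart p z)) = 0 := by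
  refine ⟨fun h => by rw [h, map_zero], fun h => ?_⟩
  set V := qPerp Q s τ (chart p z) with hV
  have h1 : ⟪V, chart p z⟫ = 0 := by
    rw [hV, qPerp, inner_sub_left, real_inner_smul_left, real_inner_self_eq_norm_sq,
      norm_chart hp hz.le]
    ring
  have h0 : V 0 = 0 := by simpa using congrArg Complex.re h
  have h0' : V 1 = 0 := by simpa using congrArg Complex.im h
  have h2 : chart p z 2 = Real.sqrt (1 - ‖z‖ ^ 2) * p 2 := by simp [chart]
  have h3 : V 2 * (Real.sqrt (1 - ‖z‖ ^ 2) * p 2) = 0 := by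
    rw [EuclideanSpace.inner_eq_star_dotProduct] at h1
    simp [dotProduct, Fin.sum_univ_three, h0, h0', h2] at h1
    rcases h1 with (h | h) | h <;> simp [h]
  have h4 : Real.sqrt (1 - ‖z‖ ^ 2) ≠ 0 :=
    (Real.sqrt_pos.2 (by nlinarith [norm_nonneg z])).ne'
  have h5 : p 2 ≠ 0 := by
    intro h
    have := pole_two_sq hp
    rw [h] at this
    norm_num at this
  refine eq_of_horiz_eq (by rw [h, map_zero]) ?_
  simpa [h4, h5] using h3

/-- The leading coefficient of the straight field at the poles. -/
def poleCoeffAt (s : ℕ) (τ : ℝ) : ℂ := poleCoeff s * Complex.exp ((s * τ : ℝ) * Complex.I)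

lemma norm_poleCoeffAt (s : ℕ) (τ : ℝ) : ‖poleCoeffAt s τ‖ = ‖poleCoeff s‖ := by
  rw [poleCoeffAt, norm_mul, Complex.norm_exp_ofReal_mul_I, mul_one]

/-- The expansion of the straight field at the poles in operator form. -/
theorem exists_straightPlane_bounds {s : ℕ} (hs : 2 ≤ s) : ∃ A > 0, ∀ (τ : ℝ) (z : ℂ),
    s * ‖z‖ ≤ 1 →
    ‖straightPlane s τ z - poleCoeffAt s τ * (starRingEnd ℂ) z ^ (s - 1)‖ ≤ A * ‖z‖ ^ (s - 1) ∧
    ‖dStraightPlane s τ z - (poleCoeffAt s τ * ((s - 1 : ℕ) * (starRingEnd ℂ) z ^ (s - 2))) •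
      (Complex.conjCLE : ℂ →L[ℝ] ℂ)‖ ≤ A * ‖z‖ ^ (s - 1) ∧
    ‖straightPlane s τ z‖ ≤ A * ‖z‖ ^ (s - 1) ∧ ‖dStraightPlane s τ z‖ ≤ A * ‖z‖ ^ (s - 2) := by
  obtain ⟨A, hA, h⟩ := exists_straightPlane_expansion hs
  have hs1 : (1 : ℝ) ≤ s := by exact_mod_cast (by omega : 1 ≤ s)
  refine ⟨A + ‖poleCoeff s‖ * (s - 1 : ℕ) + ‖poleCoeff s‖, by positivity, fun τ z hz => ?_⟩
  set C := ‖poleCoeff s‖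
  have hC : 0 ≤ C := norm_nonneg _
  set k : ℝ := ((s - 1 : ℕ) : ℝ)
  have hk : 0 ≤ k := by positivity
  have hz1 : ‖z‖ ≤ 1 := by nlinarith [norm_nonneg z]
  obtain ⟨h1, h2⟩ := h τ z hz
  have p1 : ‖z‖ ^ s ≤ ‖z‖ ^ (s - 1) := pow_le_pow_of_le_one (norm_nonneg _) hz1 (by omega)
  have p2 : ‖z‖ ^ (s - 1) ≤ ‖z‖ ^ (s - 2) := pow_le_pow_of_le_one (norm_nonneg _) hz1 (by omega)
  have q1 : 0 ≤ ‖z‖ ^ (s - 1) := by positivity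
  have q2 : 0 ≤ ‖z‖ ^ (s - 2) := by positivity
  have b1 : ‖straightPlane s τ z - poleCoeffAt s τ * (starRingEnd ℂ) z ^ (s - 1)‖ ≤
      A * ‖z‖ ^ (s - 1) := h1.trans (by gcongr)
  have b2 : ‖dStraightPlane s τ z - (poleCoeffAt s τ * ((s - 1 : ℕ) *
      (starRingEnd ℂ) z ^ (s - 2))) • (Complex.conjCLE : ℂ →L[ℝ] ℂ)‖ ≤ A * ‖z‖ ^ (s - 1) := by
    refine ContinuousLinearMap.opNorm_le_bound _ (by positivity) fun v => ?_
    refine le_of_eq_of_le (congrArg norm ?_) (h2 v)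
    simp [poleCoeffAt]
    ring
  have e1 : ‖poleCoeffAt s τ * (starRingEnd ℂ) z ^ (s - 1)‖ = C * ‖z‖ ^ (s - 1) := by
    rw [norm_mul, norm_poleCoeffAt, norm_pow, RCLike.norm_conj]
  have e2 : ‖(poleCoeffAt s τ * ((s - 1 : ℕ) * (starRingEnd ℂ) z ^ (s - 2))) •
      (Complex.conjCLE : ℂ →L[ℝ] ℂ)‖ ≤ C * k * ‖z‖ ^ (s - 2) := by
    refine ContinuousLinearMap.opNorm_le_bound _ (by positivity) fun v => ?_
    rw [smul_apply, smul_eq_mul, norm_mul, norm_mul, norm_mul, norm_poleCoeffAt, norm_pow,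
      RCLike.norm_conj, Complex.norm_natCast]
    simp [C, k, mul_assoc]
  have t1 := norm_le_norm_sub_add (straightPlane s τ z)
    (poleCoeffAt s τ * (starRingEnd ℂ) z ^ (s - 1))
  have t2 := norm_le_norm_sub_add (dStraightPlane s τ z)
    ((poleCoeffAt s τ * ((s - 1 : ℕ) * (starRingEnd ℂ) z ^ (s - 2))) •
      (Complex.conjCLE : ℂ →L[ℝ] ℂ))
  have m1 : A * ‖z‖ ^ (s - 1) ≤ A * ‖z‖ ^ (s - 2) := by gcongr
  have n1 := mul_nonneg (mul_nonneg hC hk) q1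
  have n2 := mul_nonneg hC q1
  have n3 := mul_nonneg hC q2
  refine ⟨?_, ?_, ?_, ?_⟩ <;> nlinarith

lemma hasFDerivAt_conj_pow (C : ℂ) (m : ℕ) (z : ℂ) :
    HasFDerivAt (fun z : ℂ => C * (starRingEnd ℂ) z ^ m)
      ((C * (m * (starRingEnd ℂ) z ^ (m - 1))) • (Complex.conjCLE : ℂ →L[ℝ] ℂ)) z := by
  have h1 := ((hasDerivAt_pow m ((starRingEnd ℂ) z)).const_mul C).hasFDerivAt.restrictScalars ℝ
  have h2 := h1.comp z (Complex.conjCLE : ℂ →L[ℝ] ℂ).hasFDerivAt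
  refine h2.congr_fderiv ?_
  refine ContinuousLinearMap.ext fun v => ?_
  simp
  ring

/-- The remainder of the field in the chart at a pole. -/
def chartRem (Q : ℝ → E3) (s : ℕ) (p : E3) (τ : ℝ) (z : ℂ) : ℂ :=
  horiz (qPerp Q s τ (chart p z)) - horiz (qPerp Q s τ p) -
    poleCoeffAt s τ * (starRingEnd ℂ) z ^ (s - 1)

lemma qPerp_pole {p : E3} (hp : p = north ∨ p = -north) (Q : ℝ → E3) (s : ℕ) (τ : ℝ) :
    horiz (qPerp Q s τ p) = horiz (qVec Q s τ p) := by
  rw [qPerp, map_sub, map_smul, horiz_pole hp, smul_zero, sub_zero]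

lemma norm_qPerp_pole {p : E3} (hp : p = north ∨ p = -north) (Q : ℝ → E3) (s : ℕ) (τ : ℝ) :
    ‖qPerp Q s τ p‖ = ‖horiz (qVec Q s τ p)‖ := by
  have h := norm_sq_eq (qPerp Q s τ p)
  have h2 : qPerp Q s τ p 2 = 0 := by
    have := pole_two_sq hp
    rw [qPerp, inner_pole hp]
    simp only [PiLp.sub_apply, PiLp.smul_apply, smul_eq_mul]
    linear_combination (-(qVec Q s τ p 2)) * this
  rw [h2, qPerp_pole hp] at h
  exact (pow_left_inj₀ (norm_nonneg _) (norm_nonneg _) two_ne_zero).1 (by rw [h]; ring)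

/-- The remainder consists of the Taylor remainder of the straight field, the perturbation of the
field, and the normal correction a(z)z. On the disc of radius r their Lipschitz constants are of
order r^{s-1}, d, and r^{s-1} + d. Subtracting the value at the pole removes constants without
affecting these bounds. -/
theorem exists_chartRem_bounds {s : ℕ} (hs : 2 < s) : ∃ K > 0, ∀ Q, NearStraight Q → ∀ d,
    C1Close d Q straight → ∀ p : E3, p = north ∨ p = -north → ∀ τ,
    ‖qPerp Q s τ p‖ ≤ K * d ∧
    ∀ r : ℝ, s * r ≤ 1 → ∀ x y : ℂ, ‖x‖ ≤ r → ‖y‖ ≤ r →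
      ‖chartRem Q s p τ x - chartRem Q s p τ y‖ ≤ K * (r ^ (s - 1) + d) * ‖x - y‖ := by
  obtain ⟨K, hK, hKb⟩ := exists_c1Near s
  obtain ⟨A, hA, hexp⟩ := exists_straightPlane_bounds hs.le
  have hs1 : (3 : ℝ) ≤ s := by exact_mod_cast hs
  refine ⟨4 * A + 5 * K, by positivity, fun Q hQ d hd p hp τ => ?_⟩
  have hd0 : 0 ≤ d := (norm_nonneg _).trans (hd 0).1
  have hnear := hKb Q straight hQ nearStraight_straight d hd τ
  have hGlip := fun x y (hx : ‖x‖ ≤ 2) (hy : ‖y‖ ≤ 2) => hnear.lipschitz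
      (hasFDerivAt_qVec hQ.1 s τ) (hasFDerivAt_qVec isClosedCurve_straight s τ)
      (x := x) (y := y) hx hy
  constructor
  · have h1 := (hnear p (by rw [norm_pole hp]; norm_num)).1
    have h2 := (norm_horiz_le _).trans h1
    rw [map_sub, qVec_straight, horiz_embed, horiz_pole hp, straightPlane_zero hs.le, sub_zero] at h2
    rw [norm_qPerp_pole hp]
    nlinarith
  intro r hr x y hx hy
  have hr0 : 0 ≤ r := (norm_nonneg x).trans hx
  -- Since s ≥ 3, the disc lies well inside the region where the chart is 2-Lipschitz.
  have hr1 : r ≤ 1 / 3 := by nlinarith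
  have hin : ∀ z : ℂ, ‖z‖ ≤ r → s * ‖z‖ ≤ 1 := fun z hz =>
    (mul_le_mul_of_nonneg_left hz (by positivity)).trans hr
  have hP : ∀ z : ℂ, ‖z‖ ≤ r → ‖straightPlane s τ z‖ ≤ A * r ^ (s - 1) := fun z hz =>
    (hexp τ z (hin z hz)).2.2.1.trans (by gcongr)
  have hPlip : ‖straightPlane s τ x - straightPlane s τ y‖ ≤ A * r ^ (s - 2) * ‖x - y‖ := by
    refine (convex_closedBall (0 : ℂ) r).norm_image_sub_le_of_norm_hasFDerivWithin_le
      (fun z _ => (hasFDerivAt_straightPlane s τ z).hasFDerivWithinAt) (fun z hz => ?_)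
      (by simpa using hy) (by simpa using hx)
    have hz : ‖z‖ ≤ r := by simpa using hz
    exact (hexp τ z (hin z hz)).2.2.2.trans (by gcongr)
  have hLlip : ‖(straightPlane s τ x - poleCoeffAt s τ * (starRingEnd ℂ) x ^ (s - 1)) -
      (straightPlane s τ y - poleCoeffAt s τ * (starRingEnd ℂ) y ^ (s - 1))‖ ≤
      A * r ^ (s - 1) * ‖x - y‖ := by
    refine (convex_closedBall (0 : ℂ) r).norm_image_sub_le_of_norm_hasFDerivWithin_le
      (fun z _ => ((hasFDerivAt_straightPlane s τ z).sub
        (hasFDerivAt_conj_pow (poleCoeffAt s τ) (s - 1) z)).hasFDerivWithinAt) (fun z hz => ?_)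
      (by simpa using hy) (by simpa using hx)
    have hz : ‖z‖ ≤ r := by simpa using hz
    rw [show s - 1 - 1 = s - 2 by omega]
    exact (hexp τ z (hin z hz)).2.1.trans (by gcongr)
  have hχ : ∀ z : ℂ, ‖z‖ ≤ r → ‖chart p z‖ = 1 := fun z hz => norm_chart hp (by linarith)
  have hχlip := norm_chart_sub_le hp (x := x) (y := y) (by linarith) (by linarith)
  set q : ℂ → E3 := fun z => qVec Q s τ (chart p z) with hq
  set G : ℂ → E3 := fun z => q z - embed (straightPlane s τ z) with hG
  have hGq : ∀ z, G z = qVec Q s τ (chart p z) - qVec straight s τ (chart p z) := fun z => by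
    rw [qVec_straight, horiz_chart hp]
  have hGn : ∀ z : ℂ, ‖z‖ ≤ r → ‖G z‖ ≤ K * d := fun z hz => by
    rw [hGq]
    exact (hnear _ (by rw [hχ z hz]; norm_num)).1
  have hGl : ‖G x - G y‖ ≤ 2 * (K * d) * ‖x - y‖ := by
    rw [hGq, hGq]
    refine (hGlip _ _ (by rw [hχ x hx]; norm_num) (by rw [hχ y hy]; norm_num)).trans ?_
    calc K * d * ‖chart p x - chart p y‖ ≤ K * d * (2 * ‖x - y‖) := by gcongr
      _ = _ := by ring
  have hqe : ∀ z, q z = embed (straightPlane s τ z) + G z := fun z => by simp [hG]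
  have hqn : ∀ z : ℂ, ‖z‖ ≤ r → ‖q z‖ ≤ A * r ^ (s - 1) + K * d := fun z hz => by
    rw [hqe]
    refine (norm_add_le _ _).trans ?_
    rw [norm_embed]
    exact add_le_add (hP z hz) (hGn z hz)
  have hql : ‖q x - q y‖ ≤ (A * r ^ (s - 2) + 2 * (K * d)) * ‖x - y‖ := by
    have : q x - q y = embed (straightPlane s τ x - straightPlane s τ y) + (G x - G y) := by
      rw [hqe, hqe, map_sub]
      abel
    rw [this]
    refine (norm_add_le _ _).trans ?_
    rw [norm_embed, add_mul]
    exact add_le_add hPlip hGl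
  set a : ℂ → ℝ := fun z => ⟪q z, chart p z⟫ with ha
  have han : ‖a x‖ ≤ A * r ^ (s - 1) + K * d := by
    refine (norm_inner_le_norm _ _).trans ?_
    rw [hχ x hx, mul_one]
    exact hqn x hx
  have hal : ‖a x - a y‖ ≤
      (A * r ^ (s - 2) + 2 * (K * d) + 2 * (A * r ^ (s - 1) + K * d)) * ‖x - y‖ := by
    have e1 : a x - a y = ⟪q x - q y, chart p x⟫ + ⟪q y, chart p x - chart p y⟫ := by
      rw [ha, inner_sub_left, inner_sub_right]
      ring
    rw [e1]
    refine (norm_add_le _ _).trans ?_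
    have h1 := norm_inner_le_norm (𝕜 := ℝ) (q x - q y) (chart p x)
    have h2 := norm_inner_le_norm (𝕜 := ℝ) (q y) (chart p x - chart p y)
    rw [hχ x hx, mul_one] at h1
    have h3 : ‖q y‖ * ‖chart p x - chart p y‖ ≤ (A * r ^ (s - 1) + K * d) * (2 * ‖x - y‖) :=
      mul_le_mul (hqn y hy) hχlip (norm_nonneg _) (by positivity)
    linarith
  have hf : ∀ z, chartRem Q s p τ z =
      (straightPlane s τ z - poleCoeffAt s τ * (starRingEnd ℂ) z ^ (s - 1)) + horiz (G z) -
        (a z : ℂ) * z - horiz (qPerp Q s τ p) := fun z => by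
    have : horiz (qPerp Q s τ (chart p z)) = horiz (q z) - (a z : ℂ) * z := by
      rw [qPerp, map_sub, map_smul, horiz_chart hp, Complex.real_smul]
    rw [chartRem, this, hqe, map_add, horiz_embed]
    ring
  have e1 : chartRem Q s p τ x - chartRem Q s p τ y =
      ((straightPlane s τ x - poleCoeffAt s τ * (starRingEnd ℂ) x ^ (s - 1)) -
      (straightPlane s τ y - poleCoeffAt s τ * (starRingEnd ℂ) y ^ (s - 1))) + horiz (G x - G y) -
      (((a x : ℝ) : ℂ) * (x - y) + ((a x - a y : ℝ) : ℂ) * y) := by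
    rw [hf x, hf y, map_sub horiz (G x) (G y), Complex.ofReal_sub]
    ring
  rw [e1]
  have n1 : ‖((a x : ℝ) : ℂ) * (x - y)‖ ≤ (A * r ^ (s - 1) + K * d) * ‖x - y‖ := by
    rw [norm_mul, Complex.norm_real]
    gcongr
  have n2 : ‖((a x - a y : ℝ) : ℂ) * y‖ ≤
      (A * r ^ (s - 2) + 2 * (K * d) + 2 * (A * r ^ (s - 1) + K * d)) * ‖x - y‖ * r := by
    rw [norm_mul, Complex.norm_real]
    exact mul_le_mul hal hy (norm_nonneg _) (by positivity)
  have n3 := (norm_horiz_le (G x - G y)).trans hGl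
  have t1 := norm_sub_le (((straightPlane s τ x - poleCoeffAt s τ * (starRingEnd ℂ) x ^ (s - 1)) -
      (straightPlane s τ y - poleCoeffAt s τ * (starRingEnd ℂ) y ^ (s - 1))) + horiz (G x - G y))
      (((a x : ℝ) : ℂ) * (x - y) + ((a x - a y : ℝ) : ℂ) * y)
  have t2 := norm_add_le ((straightPlane s τ x - poleCoeffAt s τ * (starRingEnd ℂ) x ^ (s - 1)) -
      (straightPlane s τ y - poleCoeffAt s τ * (starRingEnd ℂ) y ^ (s - 1))) (horiz (G x - G y))
  have t3 := norm_add_le (((a x : ℝ) : ℂ) * (x - y)) (((a x - a y : ℝ) : ℂ) * y)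
  have hpw : r ^ (s - 2) * r = r ^ (s - 1) := by rw [← pow_succ]; congr 1; omega
  -- The Lipschitz constant of the normal component has only order r^{s-2}; the accompanying factor
  -- |y| ≤ r restores the order r^{s-1}.
  have n4 : (A * r ^ (s - 2) + 2 * (K * d) + 2 * (A * r ^ (s - 1) + K * d)) * ‖x - y‖ * r ≤
      (2 * A * r ^ (s - 1) + 2 * (K * d)) * ‖x - y‖ := by
    have hKd : 0 ≤ K * d := by positivity
    have hAr : 0 ≤ A * r ^ (s - 1) := by positivity
    have : (A * r ^ (s - 2) + 2 * (K * d) + 2 * (A * r ^ (s - 1) + K * d)) * r ≤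
        2 * A * r ^ (s - 1) + 2 * (K * d) := by nlinarith
    calc _ = (A * r ^ (s - 2) + 2 * (K * d) + 2 * (A * r ^ (s - 1) + K * d)) * r * ‖x - y‖ := by
          ring
      _ ≤ _ := by gcongr
  have n5 : 0 ≤ 4 * A * d * ‖x - y‖ := by positivity
  have n6 : 0 ≤ 5 * K * r ^ (s - 1) * ‖x - y‖ := by positivity
  linarith

/-! ### The linear part near a pole -/

lemma reflection_apply (u : ℂ) (v : E3) : reflection u v = embed (u * (starRingEnd ℂ) (horiz v)) := by
  simp [reflection]

/-- The derivative of C conj(z)^{s-1} is an anti-holomorphic map of size |z|^{s-2}. The Taylor error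
and the normal shift are smaller by a factor |z|, and d is small against |z|^{s-2} by assumption, so
after normalization the linear part is close to a unit reflection. -/
theorem exists_saddleCond_near_pole {s : ℕ} (hs : 2 < s) {p : E3} (hp : p = north ∨ p = -north) :
    ∃ η > 0, ∀ Q, NearStraight Q → ∀ d, C1Close d Q straight → ∀ τ e, ‖e‖ = 1 → ‖e - p‖ ≤ η →
      horiz e ≠ 0 → d ≤ η * ‖horiz e‖ ^ (s - 2) →
      SaddleCond (dqVec Q s τ e - ⟪qVec Q s τ e, e⟫ • ContinuousLinearMap.id ℝ E3) e := by
  obtain ⟨K, hK, hKb⟩ := exists_c1Near s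
  obtain ⟨A, hA, hexp⟩ := exists_straightPlane_bounds hs.le
  set C := ‖poleCoeff s‖ with hC
  have hC0 : 0 < C := norm_pos_iff.2 (poleCoeff_ne_zero (by omega))
  have hs1 : (3 : ℝ) ≤ s := by exact_mod_cast hs
  set k : ℝ := ((s - 1 : ℕ) : ℝ) with hk
  have hk1 : 1 ≤ k := by
    have : 1 ≤ s - 1 := by omega
    exact Nat.one_le_cast.2 this
  -- Unit reflections form a compact subset of the open saddle condition, so one tolerance `η₀`
  -- serves every direction of the coefficient.
  have hcomp : IsCompact ((fun u : ℂ => (reflection u, p)) '' sphere (0 : ℂ) 1) :=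
    (isCompact_sphere 0 1).image (continuous_reflection.prodMk continuous_const)
  obtain ⟨η₀, hη₀, hsub⟩ := hcomp.exists_thickening_subset_open isOpen_saddleCond (by
    rintro _ ⟨u, hu, rfl⟩
    have hu : ‖u‖ = 1 := by simpa using hu
    exact saddleCond_reflection (norm_pos_iff.1 (by rw [hu]; norm_num)) hp)
  refine ⟨min (min (1 / s) (η₀ / 2)) (η₀ * C / (2 * (2 * K + 2 * A))), by positivity,
    fun Q hQ d hd τ e he hep hz0 hdz => ?_⟩
  set η := min (min (1 / (s : ℝ)) (η₀ / 2)) (η₀ * C / (2 * (2 * K + 2 * A))) with hη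
  have hη1 : η ≤ 1 / s := (min_le_left _ _).trans (min_le_left _ _)
  have hη2 : η ≤ η₀ / 2 := (min_le_left _ _).trans (min_le_right _ _)
  have hη3 : (2 * K + 2 * A) * η ≤ η₀ * C / 2 := by
    have : η ≤ η₀ * C / (2 * (2 * K + 2 * A)) := min_le_right _ _
    rw [le_div_iff₀ (by positivity)] at this
    linarith
  have hd0 : 0 ≤ d := (norm_nonneg _).trans (hd 0).1
  set z := horiz e with hz
  have hzpos : 0 < ‖z‖ := norm_pos_iff.2 hz0
  have hzη : ‖z‖ ≤ η := by
    have := norm_horiz_le (e - p)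
    rw [map_sub, horiz_pole hp, sub_zero] at this
    exact this.trans hep
  have hsz : s * ‖z‖ ≤ 1 := by
    have := hzη.trans hη1
    rwa [le_div_iff₀ (by positivity), mul_comm] at this
  obtain ⟨-, h2, h3, -⟩ := hexp τ z hsz
  obtain ⟨g1, g2⟩ := hKb Q straight hQ nearStraight_straight d hd τ e (by rw [he]; norm_num)
  set w : ℂ := poleCoeffAt s τ * ((s - 1 : ℕ) * (starRingEnd ℂ) z ^ (s - 2)) with hw
  set l : ℝ := C * k * ‖z‖ ^ (s - 2) with hl
  have hl0 : 0 < l := by positivity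
  have hwn : ‖w‖ = l := by
    rw [hw, norm_mul, norm_mul, norm_poleCoeffAt, norm_pow, RCLike.norm_conj, Complex.norm_natCast,
      ← mul_assoc]
  set M := dqVec Q s τ e - ⟪qVec Q s τ e, e⟫ • ContinuousLinearMap.id ℝ E3 with hM
  have hpw : ‖z‖ ^ (s - 1) = ‖z‖ ^ (s - 2) * ‖z‖ := by rw [← pow_succ]; congr 1; omega
  have hin : |⟪qVec Q s τ e, e⟫| ≤ A * ‖z‖ ^ (s - 1) + K * d := by
    have h4 := norm_inner_le_norm (𝕜 := ℝ) (qVec Q s τ e) e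
    rw [he, mul_one] at h4
    refine h4.trans ?_
    have h5 := norm_le_norm_sub_add (qVec Q s τ e) (qVec straight s τ e)
    rw [qVec_straight s τ e, norm_embed] at h5
    rw [qVec_straight s τ e] at g1
    linarith
  have hMw : ‖M - reflection w‖ ≤ (2 * K + 2 * A) * η * ‖z‖ ^ (s - 2) := by
    refine ContinuousLinearMap.opNorm_le_bound _ (by positivity) fun v => ?_
    have e1 : (M - reflection w) v = (dqVec Q s τ e - dqVec straight s τ e) v +
        embed ((dStraightPlane s τ z - w • (Complex.conjCLE : ℂ →L[ℝ] ℂ)) (horiz v)) -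
        ⟪qVec Q s τ e, e⟫ • v := by
      rw [hM, dqVec_straight]
      simp [reflection]
      abel
    rw [e1]
    refine (norm_sub_le _ _).trans ((add_le_add (norm_add_le _ _) le_rfl).trans ?_)
    rw [norm_embed, norm_smul, Real.norm_eq_abs]
    have b1 := (dqVec Q s τ e - dqVec straight s τ e).le_of_opNorm_le g2 v
    have b2 := (dStraightPlane s τ z - w • (Complex.conjCLE : ℂ →L[ℝ] ℂ)).le_of_opNorm_le h2
      (horiz v)
    have b3 : A * ‖z‖ ^ (s - 1) * ‖horiz v‖ ≤ A * ‖z‖ ^ (s - 1) * ‖v‖ := by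
      gcongr
      exact norm_horiz_le v
    have b4 : |⟪qVec Q s τ e, e⟫| * ‖v‖ ≤ (A * ‖z‖ ^ (s - 1) + K * d) * ‖v‖ := by gcongr
    have b5 : A * ‖z‖ ^ (s - 1) ≤ A * (η * ‖z‖ ^ (s - 2)) := by
      rw [hpw, mul_comm η]
      gcongr
    have b6 : K * d ≤ K * (η * ‖z‖ ^ (s - 2)) := by gcongr
    have b7 : (2 * (K * d) + 2 * (A * ‖z‖ ^ (s - 1))) * ‖v‖ ≤
        (2 * (K * (η * ‖z‖ ^ (s - 2))) + 2 * (A * (η * ‖z‖ ^ (s - 2)))) * ‖v‖ := by gcongr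
    linarith
  refine SaddleCond.of_smul (c := l⁻¹) ?_
  have hmem : (l⁻¹ • M, e) ∈ thickening η₀
      ((fun u : ℂ => (reflection u, p)) '' sphere (0 : ℂ) 1) := by
    refine mem_thickening_iff.2 ⟨(reflection (l⁻¹ • w), p), ⟨l⁻¹ • w, ?_, rfl⟩, ?_⟩
    · rw [mem_sphere, dist_zero_right, norm_smul, hwn, norm_inv, Real.norm_of_nonneg hl0.le,
        inv_mul_cancel₀ hl0.ne']
    · rw [Prod.dist_eq, max_lt_iff]
      constructor
      · have e1 : l⁻¹ • M - reflection (l⁻¹ • w) = l⁻¹ • (M - reflection w) := by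
          refine ContinuousLinearMap.ext fun v => ?_
          simp [reflection_apply, smul_sub]
          rw [mul_assoc, ← Complex.ofReal_inv, ← Complex.real_smul, map_smul]
        rw [dist_eq_norm, e1, norm_smul, norm_inv, Real.norm_of_nonneg hl0.le,
          inv_mul_lt_iff₀ hl0]
        refine hMw.trans_lt ?_
        have b1 : (2 * K + 2 * A) * η * ‖z‖ ^ (s - 2) ≤ η₀ * C / 2 * ‖z‖ ^ (s - 2) := by gcongr
        have b2 : C * 1 * ‖z‖ ^ (s - 2) * η₀ ≤ C * k * ‖z‖ ^ (s - 2) * η₀ := by gcongr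
        have b3 : 0 < C * ‖z‖ ^ (s - 2) * η₀ := by positivity
        rw [hl]
        linarith
      · rw [dist_eq_norm]
        linarith
  exact hsub hmem

/-! ### The unfolding of the multi-saddles -/

/-- The scale b solves C conj(b)^{s-1} = -w, where w is the trigonometric, hence smooth, function of
time given by the field at the pole. A continuous root exists along an interval of times; around a
closed loop it may change branch. -/
lemma exists_pole_root {Q : ℝ → E3} (hQ : NearStraight Q) {s : ℕ} (hs : 2 < s) (p : E3) {I : Set ℝ}
    (hI : I.OrdConnected) (h0 : ∀ τ ∈ I, horiz (qPerp Q s τ p) ≠ 0) :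
    ∃ b : ℝ → ℂ, ContinuousOn b I ∧ ∀ τ ∈ I,
      poleCoeffAt s τ * (starRingEnd ℂ) (b τ) ^ (s - 1) = -horiz (qPerp Q s τ p) := by
  have hc0 : poleCoeff s ≠ 0 := poleCoeff_ne_zero (by omega)
  set v₀ := qPerp Q s 0 p
  set v₁ := qPerp Q s (0 + Real.pi / (2 * s)) p
  set u : ℝ → ℂ := fun τ => (starRingEnd ℂ) (-(horiz (Real.cos (s * τ) • v₀ + Real.sin (s * τ) • v₁) *
    Complex.exp ((-(s * τ) : ℝ) * Complex.I)) / poleCoeff s) with hu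
  have hw : ∀ τ, qPerp Q s τ p = Real.cos (s * τ) • v₀ + Real.sin (s * τ) • v₁ := fun τ => by
    have := qPerp_time_eq hQ.1 hQ.totalLength_pos.ne' (n := s) (by omega) 0 τ p
    rwa [zero_add] at this
  have hu' : ∀ τ, u τ = (starRingEnd ℂ) (-(horiz (qPerp Q s τ p) *
      Complex.exp ((-(s * τ) : ℝ) * Complex.I)) / poleCoeff s) := fun τ => by rw [hw]
  have hud : ContDiff ℝ 1 u := by
    have h1 : ContDiff ℝ 1 fun τ : ℝ => horiz (Real.cos (s * τ) • v₀ + Real.sin (s * τ) • v₁) := by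
      refine horiz.contDiff.comp ?_
      fun_prop
    have h2 : ContDiff ℝ 1 fun τ : ℝ => Complex.exp ((-(s * τ) : ℝ) * Complex.I) := by
      have h3 : ContDiff ℝ 1 fun τ : ℝ => ((-(s * τ) : ℝ) : ℂ) :=
        Complex.ofRealCLM.contDiff.comp (by fun_prop : ContDiff ℝ 1 fun τ : ℝ => -(s * τ))
      exact (h3.mul contDiff_const).cexp
    exact (Complex.conjCLE : ℂ →L[ℝ] ℂ).contDiff.comp ((h1.mul h2).neg.div_const (poleCoeff s))
  obtain ⟨b, hb, hbu⟩ := exists_continuous_root hud hI (fun τ hτ => by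
    rw [hu']
    simp [h0 τ hτ, Complex.exp_ne_zero, hc0]) (s - 1) (by omega)
  refine ⟨b, hb, fun τ hτ => ?_⟩
  rw [← map_pow, hbu τ hτ, hu', Complex.conj_conj, poleCoeffAt]
  have : Complex.exp ((s * τ : ℝ) * Complex.I) * Complex.exp ((-(s * τ) : ℝ) * Complex.I) = 1 := by
    rw [← Complex.exp_add, ← add_mul, ← Complex.ofReal_add, add_neg_cancel, Complex.ofReal_zero,
      zero_mul, Complex.exp_zero]
  generalize Complex.exp ((s * τ : ℝ) * Complex.I) = X at this ⊢
  generalize Complex.exp ((-(s * τ) : ℝ) * Complex.I) = Y at this ⊢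
  field_simp
  linear_combination (-horiz (qPerp Q s τ p)) * this

/-- In the variable ξ with z = b conj(ξ), the constant and leading terms of the field combine to w(1
- ξ^{s-1}). -/
lemma horiz_qPerp_chart_eq {Q : ℝ → E3} {s : ℕ} {p : E3} {τ : ℝ} {b : ℂ}
    (hw : horiz (qPerp Q s τ p) ≠ 0)
    (hb : poleCoeffAt s τ * (starRingEnd ℂ) b ^ (s - 1) = -horiz (qPerp Q s τ p)) (ξ : ℂ) :
    horiz (qPerp Q s τ (chart p (b * (starRingEnd ℂ) ξ))) = horiz (qPerp Q s τ p) *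
      (1 - ξ ^ (s - 1) +
        chartRem Q s p τ (b * (starRingEnd ℂ) ξ) / horiz (qPerp Q s τ p)) := by
  rw [mul_add, mul_div_cancel₀ _ hw, chartRem, map_mul, Complex.conj_conj, mul_pow]
  linear_combination (ξ ^ (s - 1)) * hb

lemma continuousOn_horiz_chart {Q : ℝ → E3} (hQ : IsClosedCurve Q) (s : ℕ) (p : E3) {b : ℝ → ℂ}
    {I : Set ℝ} (hb : ContinuousOn b I) :
    ContinuousOn (fun y : ℝ × ℂ => horiz (qPerp Q s y.1 (chart p (b y.1 * (starRingEnd ℂ) y.2))))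
      (I ×ˢ Set.univ) := by
  have h1 : ContinuousOn (fun y : ℝ × ℂ => b y.1 * (starRingEnd ℂ) y.2) (I ×ˢ Set.univ) := by
    refine ContinuousOn.mul ?_ (Complex.continuous_conj.comp continuous_snd).continuousOn
    exact hb.comp continuousOn_fst fun y hy => hy.1
  have h2 : ContinuousOn (fun y : ℝ × ℂ => (y.1, chart p (b y.1 * (starRingEnd ℂ) y.2)))
      (I ×ˢ Set.univ) := continuousOn_fst.prodMk ((continuous_chart p).comp_continuousOn h1)
  have h3 : Continuous fun x : ℝ × E3 => qPerp Q s x.1 x.2 := continuous_qPerp hQ s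
  have h4 := h3.comp_continuousOn h2
  exact horiz.continuous.comp_continuousOn h4

-- At scale |b|, where C|b|^{s-1} = |w|, both d and |z|^{s-1} are at most constant multiples of |w|.
-- The rescaled remainder G then has Lipschitz constant O(|b|), so the roots of unity persist and
-- yield the s-1 saddles. An a priori bound |z| ≤ 2|b| shows that no other zeros exist in the cap.
set_option maxHeartbeats 400000 in
theorem exists_unfolding {s : ℕ} (hs : 2 < s) {κ : ℝ} (hκ : 0 < κ) {c : ℝ} (hc : 0 < c) {p : E3}
    (hp : p = north ∨ p = -north) : ∃ δ > 0, ∀ Q, NearStraight Q → ∀ d, 0 < d → d ≤ δ →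
      C1Close d Q straight → ∀ I : Set ℝ, I.OrdConnected →
        (∀ τ ∈ I, c * d ≤ ‖qPerp Q s τ p‖) →
        ∃ z : Fin (s - 1) → ℝ → E3, (∀ k, ContinuousOn (z k) I) ∧
          ∀ τ ∈ I, Function.Injective (fun k => z k τ) ∧
            (∀ k, ‖z k τ - p‖ < κ ∧ IsSaddle (qPerp Q s τ) (z k τ)) ∧
            (∀ e : E3, ‖e‖ = 1 → 1 / 2 < ⟪e, p⟫ → qPerp Q s τ e = 0 → ∃ k, e = z k τ) := by
  have hs3 : (3 : ℝ) ≤ s := by exact_mod_cast hs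
  have hm0 : s - 1 ≠ 0 := by omega
  set C := ‖poleCoeff s‖ with hC
  have hC0 : 0 < C := norm_pos_iff.2 (poleCoeff_ne_zero (by omega))
  obtain ⟨θ, hθ, hθ1, ε, hε, hsep, hroots⟩ := exists_perturbed_roots (s - 1) hm0
  obtain ⟨K, hK, hrem⟩ := exists_chartRem_bounds hs
  obtain ⟨η, hη, hsad⟩ := exists_saddleCond_near_pole hs hp
  -- These bounds keep the disc in the domain of the expansion, absorb the remainder into half of
  -- the leading term, and make its part proportional to d at most |w|.
  set r := min (1 / (s : ℝ)) (min (C / (2 * K)) (c / K)) with hr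
  have hr0 : 0 < r := by positivity
  have hr1 : s * r ≤ 1 := by
    have : r ≤ 1 / s := min_le_left _ _
    rwa [le_div_iff₀ (by positivity), mul_comm] at this
  have hr2 : K * r ≤ C / 2 := by
    have : r ≤ C / (2 * K) := (min_le_right _ _).trans (min_le_left _ _)
    rw [le_div_iff₀ (by positivity)] at this
    linarith
  have hr3 : K * r ≤ c := by
    have : r ≤ c / K := (min_le_right _ _).trans (min_le_right _ _)
    rwa [le_div_iff₀ (by positivity), mul_comm] at this
  obtain ⟨δ₁, hδ₁, hzeros⟩ := zeros_near_pole (s := s) (by omega) hr0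
  -- β bounds |b|. Its constraints provide, in turn, the domain for |z| ≤ 2β, the Lipschitz constant
  -- ε of G, the distance 4β below κ and within η of the pole, and d ≤ η|z|^{s-2} at the zeros.
  set β := min (min (1 / (2 * (s : ℝ))) (ε / (K * (2 ^ (s - 1) / C + 1 / c))))
    (min (min (κ / 5) (η / 4)) (η * c / (C * 2 ^ (s - 2)))) with hβ
  have hβ0 : 0 < β := by positivity
  have hβ1 : s * (2 * β) ≤ 1 := by
    have : β ≤ 1 / (2 * s) := (min_le_left _ _).trans (min_le_left _ _)
    rw [le_div_iff₀ (by positivity)] at this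
    linarith
  have hβ2 : β * (K * (2 ^ (s - 1) / C + 1 / c)) ≤ ε := by
    have : β ≤ ε / (K * (2 ^ (s - 1) / C + 1 / c)) := (min_le_left _ _).trans (min_le_right _ _)
    rwa [le_div_iff₀ (by positivity)] at this
  have hβ3 : β ≤ κ / 5 := (min_le_right _ _).trans ((min_le_left _ _).trans (min_le_left _ _))
  have hβ4 : β ≤ η / 4 := (min_le_right _ _).trans ((min_le_left _ _).trans (min_le_right _ _))
  have hβ5 : β * (C * 2 ^ (s - 2)) ≤ η * c := by
    have : β ≤ η * c / (C * 2 ^ (s - 2)) := (min_le_right _ _).trans (min_le_right _ _)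
    rwa [le_div_iff₀ (by positivity)] at this
  refine ⟨min δ₁ (C * β ^ (s - 1) / K), by positivity, fun Q hQ d hd0 hdδ hd I hI hcI => ?_⟩
  have hzeros := hzeros Q hQ (hd.mono (hdδ.trans (min_le_left _ _))) p hp
  have hKd : K * d ≤ C * β ^ (s - 1) := by
    have := hdδ.trans (min_le_right _ _)
    rwa [le_div_iff₀ hK, mul_comm] at this
  set w : ℝ → ℂ := fun τ => horiz (qPerp Q s τ p) with hw
  have hwn : ∀ τ, ‖w τ‖ = ‖qPerp Q s τ p‖ := fun τ => by
    rw [hw, norm_qPerp_pole hp, ← qPerp_pole hp]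
  have hcw : ∀ τ ∈ I, c * d ≤ ‖w τ‖ := fun τ hτ => by rw [hwn]; exact hcI τ hτ
  have hwpos : ∀ τ ∈ I, 0 < ‖w τ‖ := fun τ hτ => (by positivity : 0 < c * d).trans_le (hcw τ hτ)
  have hw0 : ∀ τ ∈ I, w τ ≠ 0 := fun τ hτ => norm_pos_iff.1 (hwpos τ hτ)
  obtain ⟨b, hbc, hb⟩ := exists_pole_root hQ hs p hI hw0
  have hbw : ∀ τ ∈ I, C * ‖b τ‖ ^ (s - 1) = ‖w τ‖ := fun τ hτ => by
    have := congrArg norm (hb τ hτ)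
    rwa [norm_mul, norm_poleCoeffAt, norm_pow, RCLike.norm_conj, norm_neg] at this
  have hbpos : ∀ τ ∈ I, 0 < ‖b τ‖ := fun τ hτ => by
    rw [norm_pos_iff]
    intro h
    have h1 := hbw τ hτ
    rw [h, norm_zero, zero_pow hm0, mul_zero] at h1
    exact (hwpos τ hτ).ne h1
  -- From C|b|^{s-1} = |w| ≤ Kd ≤ Cβ^{s-1}, which is how δ was chosen.
  have hbβ : ∀ τ ∈ I, ‖b τ‖ ≤ β := fun τ hτ => by
    refine (pow_le_pow_iff_left₀ (norm_nonneg _) hβ0.le hm0).1 ?_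
    have h1 := hbw τ hτ
    have h2 := (hrem Q hQ d hd p hp τ).1
    rw [← hwn, ← h1] at h2
    exact le_of_mul_le_mul_left (h2.trans hKd) hC0
  set G : ℝ → ℂ → ℂ := fun τ ξ => chartRem Q s p τ (b τ * (starRingEnd ℂ) ξ) / w τ with hG
  have hG0 : ∀ τ, G τ 0 = 0 := fun τ => by
    simp [hG, chartRem, chart_zero, zero_pow hm0]
  have hnorm : ∀ τ ξ, ‖b τ * (starRingEnd ℂ) ξ‖ = ‖b τ‖ * ‖ξ‖ := fun τ ξ => by
    rw [norm_mul, RCLike.norm_conj]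
  have hGlip : ∀ τ ∈ I, ∀ x y, ‖x‖ ≤ 2 → ‖y‖ ≤ 2 → ‖G τ x - G τ y‖ ≤ ε * ‖x - y‖ := by
    intro τ hτ x y hx hy
    have hB := hbβ τ hτ
    have hB0 := hbpos τ hτ
    have h1 := (hrem Q hQ d hd p hp τ).2 (2 * ‖b τ‖)
      ((mul_le_mul_of_nonneg_left (by linarith) (by positivity)).trans hβ1)
      (b τ * (starRingEnd ℂ) x) (b τ * (starRingEnd ℂ) y)
      (by rw [hnorm]; nlinarith) (by rw [hnorm]; nlinarith)
    rw [← mul_sub, ← map_sub, hnorm] at h1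
    rw [hG]
    simp only
    rw [← sub_div, norm_div, div_le_iff₀ (hwpos τ hτ)]
    refine h1.trans ?_
    -- Here the assumption |w| ≥ cd enters: it bounds d by |w|/c, just as the definition of b
    -- expresses |b|^{s-1} through |w|.
    have h2 : (2 * ‖b τ‖) ^ (s - 1) + d ≤ (2 ^ (s - 1) / C + 1 / c) * ‖w τ‖ := by
      have h3 : d ≤ 1 / c * ‖w τ‖ := by
        rw [div_mul_eq_mul_div, one_mul, le_div_iff₀ hc, mul_comm]
        exact hcw τ hτ
      have h4 : (2 * ‖b τ‖) ^ (s - 1) = 2 ^ (s - 1) / C * ‖w τ‖ := by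
        rw [← hbw τ hτ, mul_pow]
        field_simp
      rw [h4, add_mul]
      linarith
    calc K * ((2 * ‖b τ‖) ^ (s - 1) + d) * (‖b τ‖ * ‖x - y‖)
        ≤ K * ((2 ^ (s - 1) / C + 1 / c) * ‖w τ‖) * (β * ‖x - y‖) := by gcongr
      _ = β * (K * (2 ^ (s - 1) / C + 1 / c)) * (‖x - y‖ * ‖w τ‖) := by ring
      _ ≤ ε * (‖x - y‖ * ‖w τ‖) := by gcongr
      _ = _ := by ring
  have hH : ∀ τ ∈ I, ∀ ξ, horiz (qPerp Q s τ (chart p (b τ * (starRingEnd ℂ) ξ))) = 0 ↔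
      1 - ξ ^ (s - 1) + G τ ξ = 0 := fun τ hτ ξ => by
    rw [horiz_qPerp_chart_eq (hw0 τ hτ) (hb τ hτ) ξ, mul_eq_zero, or_iff_right (hw0 τ hτ)]
  have hprim := Complex.isPrimitiveRoot_exp (s - 1) hm0
  set ω : Fin (s - 1) → ℂ :=
    fun k => Complex.exp (2 * Real.pi * Complex.I / (s - 1 : ℕ)) ^ (k : ℕ) with hω
  have hω1 : ∀ k, ω k ^ (s - 1) = 1 := fun k => by
    rw [hω, pow_right_comm, hprim.pow_eq_one, one_pow]
  have hωn : ∀ k, ‖ω k‖ = 1 := fun k => Complex.norm_eq_one_of_pow_eq_one (hω1 k) hm0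
  have hex : ∀ k τ, τ ∈ I → ∃ ξ, ‖ξ - ω k‖ ≤ θ ∧ 1 - ξ ^ (s - 1) + G τ ξ = 0 := fun k τ hτ =>
    (hroots (G τ) (hG0 τ) (hGlip τ hτ)).1 (ω k) (hω1 k)
  choose! ξ hξ1 hξ2 using hex
  have huniq := fun τ hτ => (hroots (G τ) (hG0 τ) (hGlip τ hτ)).2.1
  have hξn : ∀ k, ∀ τ ∈ I, 1 / 2 ≤ ‖ξ k τ‖ ∧ ‖ξ k τ‖ ≤ 2 := fun k τ hτ => by
    have h1 := hξ1 k τ hτ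
    have h2 := abs_norm_sub_norm_le (ξ k τ) (ω k)
    rw [hωn, abs_le] at h2
    constructor <;> linarith
  have hcont : ∀ k, ContinuousOn (ξ k) I := fun k => by
    refine continuousOn_of_unique (isCompact_closedBall (ω k) θ)
      (Φ := fun y : ℝ × ℂ => horiz (qPerp Q s y.1 (chart p (b y.1 * (starRingEnd ℂ) y.2)))) ?_
      (T := {0}) isClosed_singleton (fun τ hτ => ?_) fun τ hτ ζ hζ h0 => ?_
    · exact continuousOn_horiz_chart hQ.1 s p hbc
    · exact ⟨by rw [mem_closedBall, dist_eq_norm]; exact hξ1 k τ hτ, (hH τ hτ _).2 (hξ2 k τ hτ)⟩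
    · rw [mem_closedBall, dist_eq_norm] at hζ
      exact huniq τ hτ (ω k) _ _ (hω1 k) hζ (hξ1 k τ hτ) ((hH τ hτ _).1 h0) (hξ2 k τ hτ)
  refine ⟨fun k τ => chart p (b τ * (starRingEnd ℂ) (ξ k τ)), fun k =>
    (continuous_chart p).comp_continuousOn
      (hbc.mul (Complex.continuous_conj.comp_continuousOn (hcont k))),
    fun τ hτ => ⟨fun j k hjk => ?_, fun k => ?_, fun e he hep h0 => ?_⟩⟩
  · have h1 := congrArg horiz hjk
    simp only [horiz_chart hp] at h1
    have h2 := (starRingEnd ℂ).injective (mul_left_cancel₀ (norm_pos_iff.1 (hbpos τ hτ)) h1)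
    -- A common solution would place the two roots of unity within 2θ of each other, closer than
    -- distinct roots can be.
    have h3 : ω j = ω k := by
      refine hsep _ _ (hω1 j) (hω1 k) ?_
      have h4 := norm_sub_le_norm_sub_add_norm_sub (ω j) (ξ j τ) (ω k)
      have h5 := hξ1 j τ hτ
      have h6 := hξ1 k τ hτ
      rw [norm_sub_rev] at h5
      rw [← h2] at h6
      linarith
    exact Fin.ext (hprim.pow_inj j.2 k.2 h3)
  · set z := b τ * (starRingEnd ℂ) (ξ k τ) with hz
    have hzn : ‖z‖ = ‖b τ‖ * ‖ξ k τ‖ := hnorm _ _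
    obtain ⟨hξa, hξb⟩ := hξn k τ hτ
    have hB := hbβ τ hτ
    have hB0 := hbpos τ hτ
    have hz2 : ‖z‖ ≤ 2 * β := by rw [hzn]; nlinarith
    have hz1 : ‖b τ‖ / 2 ≤ ‖z‖ := by rw [hzn]; nlinarith
    have hzpos : 0 < ‖z‖ := by linarith
    have hzlt : ‖z‖ < 1 := by nlinarith
    have hep : ‖chart p z - p‖ ≤ 4 * β := by
      have := norm_sub_pole_le hp (norm_chart hp hzlt.le) (inner_chart_nonneg hp z)
      rw [horiz_chart hp] at this
      linarith
    refine ⟨by linarith, ?_⟩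
    have hzero : qPerp Q s τ (chart p z) = 0 :=
      (qPerp_chart_eq_zero_iff hp hzlt).2 ((hH τ hτ _).2 (hξ2 k τ hτ))
    refine isSaddle_tangential (norm_chart hp hzlt.le) (hasFDerivAt_qVec hQ.1 s τ _) hzero ?_
    refine hsad Q hQ d hd τ _ (norm_chart hp hzlt.le) (by linarith)
      (by rw [horiz_chart hp]; exact norm_pos_iff.1 hzpos) ?_
    rw [horiz_chart hp]
    have h1 : (‖b τ‖ / 2) ^ (s - 2) ≤ ‖z‖ ^ (s - 2) := by gcongr
    have h2 := hcw τ hτ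
    rw [← hbw τ hτ, show s - 1 = s - 2 + 1 by omega, pow_succ] at h2
    -- As |ξ| ≥ 1/2, |z| is at least |b|/2; the extra factor |b| ≤ β makes d small against
    -- |z|^{s-2}.
    have h3 : C * (‖b τ‖ ^ (s - 2) * ‖b τ‖) ≤ c * (η * (‖b τ‖ / 2) ^ (s - 2)) := by
      have h4 : ‖b τ‖ ^ (s - 2) = 2 ^ (s - 2) * (‖b τ‖ / 2) ^ (s - 2) := by
        rw [← mul_pow]
        congr 1
        ring
      calc C * (‖b τ‖ ^ (s - 2) * ‖b τ‖)
          = ‖b τ‖ * (C * 2 ^ (s - 2)) * (‖b τ‖ / 2) ^ (s - 2) := by rw [h4]; ring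
        _ ≤ β * (C * 2 ^ (s - 2)) * (‖b τ‖ / 2) ^ (s - 2) := by gcongr
        _ ≤ η * c * (‖b τ‖ / 2) ^ (s - 2) := by gcongr
        _ = _ := by ring
    have h5 : d ≤ η * (‖b τ‖ / 2) ^ (s - 2) := le_of_mul_le_mul_left (h2.trans h3) hc
    exact h5.trans (by gcongr)
  · have hnear := hzeros τ e he hep h0
    set z := horiz e with hz
    have hB0 := hbpos τ hτ
    have hzr : ‖z‖ ≤ r := by
      have := norm_horiz_le (e - p)
      rw [map_sub, horiz_pole hp, sub_zero] at this
      exact this.trans hnear.le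
    have hχ : chart p z = e := chart_horiz hp he (by linarith)
    have h1 := (hrem Q hQ d hd p hp τ).2 ‖z‖
      ((mul_le_mul_of_nonneg_left hzr (by positivity)).trans hr1) z 0 le_rfl (by simp)
    have h2 : chartRem Q s p τ 0 = 0 := by simp [chartRem, chart_zero, zero_pow hm0]
    rw [h2, sub_zero, sub_zero] at h1
    have h3 : ‖poleCoeffAt s τ * (starRingEnd ℂ) z ^ (s - 1)‖ ≤ ‖w τ‖ + ‖chartRem Q s p τ z‖ := by
      have : poleCoeffAt s τ * (starRingEnd ℂ) z ^ (s - 1) = -w τ - chartRem Q s p τ z := by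
        rw [chartRem, hχ, h0, map_zero]
        ring
      rw [this]
      refine (norm_sub_le _ _).trans ?_
      rw [norm_neg]
    rw [norm_mul, norm_poleCoeffAt, norm_pow, RCLike.norm_conj] at h3
    -- At a zero the leading term is bounded by |w| plus the remainder, which is at most half of the
    -- leading term plus another |w|. For s ≥ 3 one has 4 ≤ 2^{s-1}, hence |z| ≤ 2|b|, so the
    -- rescaled point lies in the disc treated by `exists_perturbed_roots`.
    have h4 : C * ‖z‖ ^ (s - 1) ≤ 4 * ‖w τ‖ := by
      have a1 : K * (‖z‖ ^ (s - 1) + d) * ‖z‖ ≤ K * (‖z‖ ^ (s - 1) + d) * r := by gcongr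
      have a2 : (K * r) * ‖z‖ ^ (s - 1) ≤ C / 2 * ‖z‖ ^ (s - 1) := by gcongr
      have a3 : (K * r) * d ≤ c * d := by gcongr
      have a4 := hcw τ hτ
      linarith
    have h5 : ‖z‖ ≤ 2 * ‖b τ‖ := by
      refine (pow_le_pow_iff_left₀ (norm_nonneg _) (by positivity) hm0).1 ?_
      have a1 : (4 : ℝ) ≤ 2 ^ (s - 1) := by
        calc (4 : ℝ) = 2 ^ 2 := by norm_num
          _ ≤ 2 ^ (s - 1) := pow_le_pow_right₀ (by norm_num) (by omega)
      rw [← hbw τ hτ] at h4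
      have a2 : ‖z‖ ^ (s - 1) ≤ 4 * ‖b τ‖ ^ (s - 1) :=
        le_of_mul_le_mul_left (by linarith) hC0
      rw [mul_pow]
      exact a2.trans (by gcongr)
    set ζ := (starRingEnd ℂ) (z / b τ) with hζ
    have hbζ : b τ * (starRingEnd ℂ) ζ = z := by
      rw [hζ, Complex.conj_conj, mul_div_cancel₀ _ (norm_pos_iff.1 hB0)]
    have hζn : ‖ζ‖ ≤ 2 := by
      rw [hζ, RCLike.norm_conj, norm_div, div_le_iff₀ hB0]
      exact h5
    have hζ0 : 1 - ζ ^ (s - 1) + G τ ζ = 0 := by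
      rw [← hH τ hτ, hbζ, hχ, h0, map_zero]
    obtain ⟨ω', hω', hd'⟩ := (hroots (G τ) (hG0 τ) (hGlip τ hτ)).2.2 ζ hζn hζ0
    have : NeZero (s - 1) := ⟨hm0⟩
    obtain ⟨i, hi, hiω⟩ := hprim.eq_pow_of_pow_eq_one hω'
    have hωi : ω ⟨i, hi⟩ = ω' := hiω
    refine ⟨⟨i, hi⟩, ?_⟩
    rw [← hωi] at hd'
    have := huniq τ hτ _ _ _ (hω1 ⟨i, hi⟩) hd' (hξ1 _ τ hτ) hζ0 (hξ2 _ τ hτ)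
    change e = chart p (b τ * (starRingEnd ℂ) (ξ ⟨i, hi⟩ τ))
    rw [← this, hbζ, hχ]

/-! ### First variation of the amplitude at the straight string -/

/-- The deformation of the straight-line string in the direction `η`. -/
def deform (η : ℝ → E3) (ε : ℝ) : ℝ → E3 := fun σ => straight σ + ε • η σ

lemma deform_zero (η : ℝ → E3) : deform η 0 = straight := by
  funext σ
  simp [deform]

lemma deriv_deform {η : ℝ → E3} (hη : IsClosedCurve η) (ε σ : ℝ) :
    deriv (deform η ε) σ = deriv straight σ + ε • deriv η σ := by
  have h1 := (hasDerivAt_straight σ).differentiableAt.hasDerivAt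
  have h2 := ((hη.1.differentiable one_ne_zero) σ).hasDerivAt
  exact (h1.add (h2.const_smul ε)).deriv

lemma isClosedCurve_deform {η : ℝ → E3} (hη : IsClosedCurve η) (ε : ℝ) :
    IsClosedCurve (deform η ε) :=
  ⟨isClosedCurve_straight.1.add (hη.1.const_smul ε), fun σ => by
    rw [deform, deform, isClosedCurve_straight.2 σ, hη.2 σ]⟩

lemma IsClosedCurve.exists_bound {η : ℝ → E3} (hη : IsClosedCurve η) :
    ∃ B > 0, ∀ σ, ‖η σ‖ ≤ B ∧ ‖deriv η σ‖ ≤ B := by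
  have hper' : Function.Periodic (deriv η) (2 * Real.pi) := fun σ => by
    rw [← deriv_comp_add_const]
    congr 1
    funext x
    exact hη.2 x
  obtain ⟨B₁, h1⟩ := isCompact_Icc (a := (0 : ℝ)) (b := 2 * Real.pi)
    |>.exists_bound_of_continuousOn hη.continuous.continuousOn
  obtain ⟨B₂, h2⟩ := isCompact_Icc (a := (0 : ℝ)) (b := 2 * Real.pi)
    |>.exists_bound_of_continuousOn hη.continuous_deriv.continuousOn
  refine ⟨max (max B₁ B₂) 1, by positivity, fun σ => ⟨?_, ?_⟩⟩
  · obtain ⟨y, hy, e⟩ := hη.2.exists_mem_Ico₀ Real.two_pi_pos σ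
    rw [e]
    exact (h1 y ⟨hy.1, hy.2.le⟩).trans ((le_max_left _ _).trans (le_max_left _ _))
  · obtain ⟨y, hy, e⟩ := hper'.exists_mem_Ico₀ Real.two_pi_pos σ
    rw [e]
    exact (h2 y ⟨hy.1, hy.2.le⟩).trans ((le_max_right _ _).trans (le_max_left _ _))

lemma c1Close_deform_of_dir {η ζ : ℝ → E3} (hη : IsClosedCurve η) (hζ : IsClosedCurve ζ) {ρ : ℝ}
    (h : C1Close ρ ζ η) {ε : ℝ} (hε : 0 ≤ ε) : C1Close (ε * ρ) (deform ζ ε) (deform η ε) := by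
  intro σ
  have h1 : deform ζ ε σ - deform η ε σ = ε • (ζ σ - η σ) := by
    simp only [deform, smul_sub]
    abel
  have h2 : deriv (deform ζ ε) σ - deriv (deform η ε) σ = ε • (deriv ζ σ - deriv η σ) := by
    rw [deriv_deform hη, deriv_deform hζ, smul_sub]
    abel
  rw [h1, h2, norm_smul, norm_smul, Real.norm_of_nonneg hε]
  exact ⟨mul_le_mul_of_nonneg_left (h σ).1 hε, mul_le_mul_of_nonneg_left (h σ).2 hε⟩

lemma c1Close_deform {η : ℝ → E3} (hη : IsClosedCurve η) {B : ℝ}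
    (hB : ∀ σ, ‖η σ‖ ≤ B ∧ ‖deriv η σ‖ ≤ B) (x y : ℝ) :
    C1Close (|x - y| * B) (deform η x) (deform η y) := by
  intro σ
  have h1 : deform η x σ - deform η y σ = (x - y) • η σ := by
    simp only [deform, sub_smul]
    abel
  have h2 : deriv (deform η x) σ - deriv (deform η y) σ = (x - y) • deriv η σ := by
    rw [deriv_deform hη, deriv_deform hη, sub_smul]
    abel
  rw [h1, h2, norm_smul, norm_smul, Real.norm_eq_abs]
  exact ⟨mul_le_mul_of_nonneg_left (hB σ).1 (abs_nonneg _),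
    mul_le_mul_of_nonneg_left (hB σ).2 (abs_nonneg _)⟩

lemma nearStraight_deform {η : ℝ → E3} (hη : IsClosedCurve η) {B : ℝ}
    (hB : ∀ σ, ‖η σ‖ ≤ B ∧ ‖deriv η σ‖ ≤ B) {ε : ℝ} (h : |ε| * B ≤ 1 / 2) :
    NearStraight (deform η ε) := by
  refine ⟨isClosedCurve_deform hη ε, ?_⟩
  have := c1Close_deform hη hB ε 0
  rw [deform_zero, sub_zero] at this
  exact this.mono h

/-- Domination through a Lipschitz bound requires differentiability of the integrand at 0 only,
which suits the norm of the velocity. -/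
lemma hasDerivAt_intervalIntegral_of_lip {E : Type*} [NormedAddCommGroup E] [NormedSpace ℝ E]
    {F : ℝ → ℝ → E} {F' : ℝ → E} {a b K r : ℝ} (hab : a ≤ b) (hr : 0 < r) (hK : 0 ≤ K)
    (hF : ∀ x, Continuous (F x)) (hF' : Continuous F')
    (hlip : ∀ t ∈ Set.Icc a b, ∀ x y, |x| < r → |y| < r → ‖F x t - F y t‖ ≤ K * |x - y|)
    (hd : ∀ t ∈ Set.Icc a b, HasDerivAt (fun x => F x t) (F' t) 0) :
    HasDerivAt (fun x => ∫ t in a..b, F x t) (∫ t in a..b, F' t) 0 := by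
  have hmem : ∀ t, t ∈ Set.uIoc a b → t ∈ Set.Icc a b := fun t ht => by
    rw [Set.uIoc_of_le hab] at ht
    exact ⟨ht.1.le, ht.2⟩
  refine (intervalIntegral.hasDerivAt_integral_of_dominated_loc_of_lip (s := ball 0 r)
    (bound := fun _ => K) (ball_mem_nhds 0 hr)
    (Eventually.of_forall fun x => (hF x).aestronglyMeasurable) ((hF 0).intervalIntegrable _ _)
    hF'.aestronglyMeasurable (Eventually.of_forall fun t ht => ?_) intervalIntegrable_const
    (Eventually.of_forall fun t ht => hd t (hmem t ht))).2
  refine LipschitzOnWith.of_dist_le_mul fun x hx y hy => ?_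
  rw [dist_eq_norm, Real.dist_eq, Real.coe_nnabs, abs_of_nonneg hK]
  exact hlip t (hmem t ht) x y (by simpa using hx) (by simpa using hy)

lemma hasDerivAt_norm_add_smul {a : E3} (ha : ‖a‖ = 1) (b : E3) :
    HasDerivAt (fun ε : ℝ => ‖a + ε • b‖) ⟪a, b⟫ 0 := by
  have h1 : HasDerivAt (fun ε : ℝ => a + ε • b) b 0 := by
    simpa using ((hasDerivAt_id (0 : ℝ)).smul_const b).const_add a
  have h2 := h1.norm_sq
  have h3 := h2.sqrt (by simp [ha])
  simp only [zero_smul, add_zero, ha, one_pow, Real.sqrt_one, mul_one] at h3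
  rw [mul_div_cancel_left₀ _ two_ne_zero] at h3
  simpa [Real.sqrt_sq] using h3

/-- Thanks to the factor ε, the average position enters the first variation only through its value
at ε = 0 and need not be differentiated. -/
lemma hasDerivAt_mul_of_continuousAt {g : ℝ → ℝ} (hg : ContinuousAt g 0) :
    HasDerivAt (fun ε => ε * g ε) (g 0) 0 := by
  rw [hasDerivAt_iff_tendsto_slope]
  refine (hg.tendsto.mono_left nhdsWithin_le_nhds).congr' ?_
  filter_upwards [self_mem_nhdsWithin] with y hy
  have : y ≠ 0 := hy
  simp [slope, this]

/-- The first variation of the arc length. -/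
def lengthRate (η : ℝ → E3) (σ : ℝ) : ℝ := ∫ t in (0 : ℝ)..σ, ⟪deriv straight t, deriv η t⟫

/-- The first variation of the phase at a pole of height `h`. -/
def phaseRate (s : ℕ) (h : ℝ) (η : ℝ → E3) (σ : ℝ) : ℝ :=
  s * (lengthRate η σ - h * (η σ 2 - (2 * Real.pi)⁻¹ * ∫ t in (0 : ℝ)..(2 * Real.pi), η t 2)) -
    s * lengthRate η (2 * Real.pi) / (2 * Real.pi) * σ

lemma continuous_inner_deriv {η : ℝ → E3} (hη : IsClosedCurve η) :
    Continuous fun t => ⟪deriv straight t, deriv η t⟫ :=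
  isClosedCurve_straight.continuous_deriv.inner hη.continuous_deriv

lemma hasDerivAt_arcLength_deform {η : ℝ → E3} (hη : IsClosedCurve η) {σ : ℝ} (hσ : 0 ≤ σ) :
    HasDerivAt (fun ε => arcLength (deform η ε) σ) (lengthRate η σ) 0 := by
  obtain ⟨B, hB0, hB⟩ := hη.exists_bound
  unfold arcLength lengthRate
  refine hasDerivAt_intervalIntegral_of_lip (r := 1) (K := B) hσ one_pos hB0.le
    (fun x => (isClosedCurve_deform hη x).continuous_deriv.norm) (continuous_inner_deriv hη)
    (fun t _ x y _ _ => ?_) (fun t _ => ?_)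
  · rw [mul_comm, Real.norm_eq_abs]
    exact (abs_norm_sub_norm_le _ _).trans (c1Close_deform hη hB x y t).2
  · simp only [deriv_deform hη]
    exact hasDerivAt_norm_add_smul (norm_deriv_straight t) _

/-- The straight string has no vertical component, so at a pole the scalar product in the phase
contains an explicit factor ε. -/
lemma phase_deform {η : ℝ → E3} (hη : IsClosedCurve η) (s : ℕ) {p : E3}
    (hp : p = north ∨ p = -north) (ε σ : ℝ) : phase (deform η ε) s 0 p σ =
      2 * Real.pi * s * (totalLength (deform η ε))⁻¹ * (arcLength (deform η ε) σ -
        ε * (p 2 * (η σ 2 - (totalLength (deform η ε))⁻¹ *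
          ∫ t in (0 : ℝ)..(2 * Real.pi), ‖deriv (deform η ε) t‖ * η t 2))) := by
  have hc := isClosedCurve_deform hη ε
  have h2 : ∀ t, deform η ε t 2 = ε * η t 2 := fun t => by simp [deform, straight]
  have h3 : meanPosition (deform η ε) 2 = ε * ((totalLength (deform η ε))⁻¹ *
      ∫ t in (0 : ℝ)..(2 * Real.pi), ‖deriv (deform η ε) t‖ * η t 2) := by
    unfold meanPosition
    have hcont : Continuous fun t => ‖deriv (deform η ε) t‖ • deform η ε t :=
      hc.continuous_deriv.norm.smul hc.continuous
    rw [PiLp.smul_apply, integral_apply hcont]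
    simp only [PiLp.smul_apply, h2, smul_eq_mul]
    have h4 : ∀ t, ‖deriv (deform η ε) t‖ * (ε * η t 2) =
        ε * (‖deriv (deform η ε) t‖ * η t 2) := fun t => by ring
    simp only [h4, intervalIntegral.integral_const_mul]
    ring
  rw [phase, inner_pole hp, PiLp.sub_apply, h2, h3]
  ring

lemma continuous_integral_norm_add_smul {a b : ℝ → E3} (ha : Continuous a) (hb : Continuous b)
    {f : ℝ → ℝ} (hf : Continuous f) :
    Continuous fun ε : ℝ => ∫ t in (0 : ℝ)..(2 * Real.pi), ‖a t + ε • b t‖ * f t := by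
  refine intervalIntegral.continuous_parametric_intervalIntegral_of_continuous' ?_ _ _
  unfold Function.uncurry
  fun_prop

lemma hasDerivAt_phase_deform {η : ℝ → E3} (hη : IsClosedCurve η) (s : ℕ) {p : E3}
    (hp : p = north ∨ p = -north) {σ : ℝ} (hσ : 0 ≤ σ) :
    HasDerivAt (fun ε => phase (deform η ε) s 0 p σ) (phaseRate s (p 2) η σ) 0 := by
  have hpi := Real.pi_ne_zero
  simp only [phase_deform hη s hp]
  have hL : HasDerivAt (fun ε => totalLength (deform η ε)) (lengthRate η (2 * Real.pi)) 0 :=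
    hasDerivAt_arcLength_deform hη Real.two_pi_pos.le
  have hL0 : totalLength (deform η 0) = 2 * Real.pi := by rw [deform_zero, totalLength_straight]
  have hinv := hL.inv (by rw [hL0]; positivity)
  have hJ : Continuous fun ε => ∫ t in (0 : ℝ)..(2 * Real.pi), ‖deriv (deform η ε) t‖ * η t 2 := by
    simp only [deriv_deform hη]
    exact continuous_integral_norm_add_smul isClosedCurve_straight.continuous_deriv
      hη.continuous_deriv (continuous_coord hη.continuous 2)
  have hg : ContinuousAt (fun ε => p 2 * (η σ 2 - (totalLength (deform η ε))⁻¹ *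
      ∫ t in (0 : ℝ)..(2 * Real.pi), ‖deriv (deform η ε) t‖ * η t 2)) 0 :=
    continuousAt_const.mul (continuousAt_const.sub (hinv.continuousAt.mul hJ.continuousAt))
  have hmain := (hinv.const_mul (2 * Real.pi * s)).mul
    ((hasDerivAt_arcLength_deform hη hσ).sub (hasDerivAt_mul_of_continuousAt hg))
  refine hmain.congr_deriv ?_
  have hJ0 : ∫ t in (0 : ℝ)..(2 * Real.pi), ‖deriv (deform η 0) t‖ * η t 2 =
      ∫ t in (0 : ℝ)..(2 * Real.pi), η t 2 := by
    simp [deform_zero, norm_deriv_straight]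
  simp only [Pi.sub_apply, Pi.inv_apply, hL0, hJ0]
  rw [deform_zero, arcLength_straight]
  unfold phaseRate
  field_simp
  ring

/-- The first variation of the `i`-th component of the amplitude at a pole of height `h`. -/
def amplitudeRate (s : ℕ) (h : ℝ) (η : ℝ → E3) (i : Fin 3) : ℂ :=
  ampConst * ∫ σ in (0 : ℝ)..(2 * Real.pi),
    ((deriv η σ i : ℂ) + (deriv straight σ i : ℂ) * (Complex.I * (phaseRate s h η σ : ℂ))) *
      Complex.exp (Complex.I * ((s * σ : ℝ) : ℂ))

lemma continuous_phaseRate {η : ℝ → E3} (hη : IsClosedCurve η) (s : ℕ) (h : ℝ) :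
    Continuous (phaseRate s h η) := by
  have h1 : Continuous (lengthRate η) := intervalIntegral.continuous_primitive
    (fun _ _ => (continuous_inner_deriv hη).intervalIntegrable _ _) 0
  have h3 := continuous_coord hη.continuous 2
  exact (continuous_const.mul (h1.sub (continuous_const.mul (h3.sub continuous_const)))).sub
    (continuous_const.mul continuous_id)

lemma norm_coord_le (v : E3) (i : Fin 3) : ‖(v i : ℂ)‖ ≤ ‖v‖ := by
  rw [Complex.norm_real]
  exact PiLp.norm_apply_le v i

lemma norm_exp_I_sub_le (x y : ℝ) :
    ‖Complex.exp (Complex.I * (x : ℂ)) - Complex.exp (Complex.I * (y : ℂ))‖ ≤ |x - y| := by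
  have h1 : Complex.exp (Complex.I * (x : ℂ)) - Complex.exp (Complex.I * (y : ℂ)) =
      Complex.exp (Complex.I * (y : ℂ)) * (Complex.exp (Complex.I * ((x - y : ℝ) : ℂ)) - 1) := by
    rw [mul_sub, ← Complex.exp_add]
    push_cast
    ring_nf
  rw [h1, norm_mul, mul_comm Complex.I, Complex.norm_exp_ofReal_mul_I, one_mul]
  exact Real.norm_exp_I_mul_ofReal_sub_one_le

theorem hasDerivAt_amplitude_deform {η : ℝ → E3} (hη : IsClosedCurve η) (s : ℕ) {p : E3}
    (hp : p = north ∨ p = -north) (i : Fin 3) :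
    HasDerivAt (fun ε => amplitude (deform η ε) s 0 p i) (amplitudeRate s (p 2) η i) 0 := by
  obtain ⟨B, hB0, hB⟩ := hη.exists_bound
  unfold amplitude amplitudeRate
  refine HasDerivAt.const_mul _ ?_
  have hph : ∀ ε, Continuous fun σ => phase (deform η ε) s 0 p σ := fun ε =>
    ((isClosedCurve_deform hη ε).continuous_phase s).comp (f := fun σ => (((0 : ℝ), p), σ))
      (by fun_prop)
  have hs := isClosedCurve_straight.continuous_deriv
  have hd := hη.continuous_deriv
  refine hasDerivAt_intervalIntegral_of_lip (r := 1 / (2 * B)) (K := B + 3 / 2 * (118 * s * B))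
    -- For |ε| < 1/(2B) the deformed curves stay near the straight string, where the phase estimate
    -- applies.
    Real.two_pi_pos.le (by positivity) (by positivity) (fun ε => ?_) ?_ (fun σ hσ x y hx hy => ?_)
    (fun σ hσ => ?_)
  · have h1 := continuous_coord (isClosedCurve_deform hη ε).continuous_deriv i
    exact (Complex.continuous_ofReal.comp h1).mul (Complex.continuous_exp.comp
      (continuous_const.mul (Complex.continuous_ofReal.comp (hph ε))))
  · have h1 := continuous_coord hs i
    have h2 := continuous_coord hd i
    have h3 := continuous_phaseRate hη s (p 2)
    have h4 : Continuous fun σ : ℝ => Complex.exp (Complex.I * ((s * σ : ℝ) : ℂ)) := by fun_prop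
    exact ((Complex.continuous_ofReal.comp h2).add ((Complex.continuous_ofReal.comp h1).mul
      (continuous_const.mul (Complex.continuous_ofReal.comp h3)))).mul h4
  · have hn : ∀ x, |x| < 1 / (2 * B) → NearStraight (deform η x) := fun x hx =>
      nearStraight_deform hη hB (by
        rw [lt_div_iff₀ (by positivity)] at hx
        linarith)
    have h1 := c1Close_deform hη hB x y
    have h2 := (hn x hx).abs_phase_sub_le (hn y hy) h1 s 0 (e := p)
      (by rw [norm_pole hp]; norm_num) hσ.1 hσ.2
    have e1 : ∀ a b u v : ℂ, a * u - b * v = (a - b) * u + b * (u - v) := fun a b u v => by ring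
    rw [e1]
    refine (norm_add_le _ _).trans ?_
    rw [norm_mul, norm_mul, mul_comm Complex.I, Complex.norm_exp_ofReal_mul_I, mul_one,
      mul_comm _ Complex.I]
    have h3 : ‖((deriv (deform η x) σ i : ℝ) : ℂ) - (deriv (deform η y) σ i : ℝ)‖ ≤ |x - y| * B := by
      rw [← Complex.ofReal_sub, ← PiLp.sub_apply]
      exact (norm_coord_le _ i).trans (h1 σ).2
    have h4 := (norm_coord_le (deriv (deform η y) σ) i).trans ((hn y hy).norm_deriv_le σ)
    have h5 := (norm_exp_I_sub_le (phase (deform η x) s 0 p σ) (phase (deform η y) s 0 p σ)).trans h2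
    have h6 := mul_le_mul h4 h5 (norm_nonneg _) (by norm_num)
    linarith
  · have h1 : HasDerivAt (fun ε : ℝ => ((deriv (deform η ε) σ i : ℝ) : ℂ)) (deriv η σ i : ℂ) 0 := by
      simp only [deriv_deform hη]
      refine HasDerivAt.ofReal_comp ?_
      simpa using ((hasDerivAt_id (0 : ℝ)).mul_const (deriv η σ i)).const_add (deriv straight σ i)
    have h2 := ((hasDerivAt_phase_deform hη s hp hσ.1).ofReal_comp.const_mul Complex.I).cexp
    have h3 := h1.mul h2
    refine h3.congr_deriv ?_
    have h4 : phase (deform η 0) s 0 p σ = s * σ := by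
      rw [deform_zero, phase_straight]
      rcases hp with rfl | rfl <;> simp [north]
    rw [h4, deform_zero]
    ring

/-! ### Vertical oscillations of the direction of deformation -/

/-- The vertical oscillation of wave number `s + 1`. -/
def verticalWave (s : ℕ) (σ : ℝ) : E3 := !₂[0, 0, Real.cos ((s + 1) * σ)]

lemma hasDerivAt_verticalWave (s : ℕ) (σ : ℝ) : HasDerivAt (verticalWave s)
    !₂[0, 0, -((s + 1) * Real.sin ((s + 1) * σ))] σ := by
  have h : HasDerivAt (fun σ : ℝ => (![0, 0, Real.cos ((s + 1) * σ)] : Fin 3 → ℝ))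
      ![0, 0, -((s + 1) * Real.sin ((s + 1) * σ))] σ := by
    rw [hasDerivAt_pi]
    intro i
    fin_cases i
    · simpa using hasDerivAt_const σ (0 : ℝ)
    · simpa using hasDerivAt_const σ (0 : ℝ)
    · have h1 : HasDerivAt (fun σ : ℝ => (s + 1 : ℝ) * σ) (s + 1) σ := by
        simpa using (hasDerivAt_id σ).const_mul (s + 1 : ℝ)
      refine h1.cos.congr_deriv ?_
      simp
      ring
  exact ((PiLp.continuousLinearEquiv 2 ℝ (fun _ : Fin 3 => ℝ)).symm : (Fin 3 → ℝ) →L[ℝ] E3)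
    |>.hasFDerivAt.comp_hasDerivAt σ h

lemma isClosedCurve_verticalWave (s : ℕ) : IsClosedCurve (verticalWave s) := by
  refine ⟨contDiff_one_iff_deriv.2 ⟨fun σ => (hasDerivAt_verticalWave s σ).differentiableAt, ?_⟩,
    fun σ => ?_⟩
  · have : deriv (verticalWave s) = fun σ => !₂[0, 0, -((s + 1) * Real.sin ((s + 1) * σ))] :=
      funext fun σ => (hasDerivAt_verticalWave s σ).deriv
    rw [this]
    refine (PiLp.continuous_toLp 2 _).comp (continuous_pi fun i => ?_)
    fin_cases i
    · simpa using continuous_const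
    · simpa using continuous_const
    · change Continuous fun σ : ℝ => -((s + 1) * Real.sin ((s + 1) * σ))
      fun_prop
  · have : Real.cos ((s + 1) * (σ + 2 * Real.pi)) = Real.cos ((s + 1) * σ) := by
      have := Real.cos_add_nat_mul_two_pi ((s + 1) * σ) (s + 1)
      rw [← this]
      push_cast
      ring_nf
    simp only [verticalWave, this]

lemma norm_vertical (x : ℝ) : ‖(!₂[0, 0, x] : E3)‖ = |x| := by
  simp [EuclideanSpace.norm_eq, Fin.sum_univ_three, Real.sqrt_sq_eq_abs]

/-- The direction `η` modified by a vertical oscillation. -/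
def addWave (η : ℝ → E3) (s : ℕ) (t σ : ℝ) : E3 := η σ + t • verticalWave s σ

lemma isClosedCurve_addWave {η : ℝ → E3} (hη : IsClosedCurve η) (s : ℕ) (t : ℝ) :
    IsClosedCurve (addWave η s t) :=
  ⟨hη.1.add ((isClosedCurve_verticalWave s).1.const_smul t), fun σ => by
    rw [addWave, addWave, hη.2 σ, (isClosedCurve_verticalWave s).2 σ]⟩

lemma deriv_addWave {η : ℝ → E3} (hη : IsClosedCurve η) (s : ℕ) (t σ : ℝ) :
    deriv (addWave η s t) σ = deriv η σ + t • !₂[0, 0, -((s + 1) * Real.sin ((s + 1) * σ))] :=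
  (((hη.1.differentiable one_ne_zero) σ).hasDerivAt.add
    ((hasDerivAt_verticalWave s σ).const_smul t)).deriv

lemma c1Close_addWave {η : ℝ → E3} (hη : IsClosedCurve η) (s : ℕ) {t r : ℝ} (ht : 0 ≤ t)
    (htr : t * (s + 1) ≤ r) : C1Close r (addWave η s t) η := by
  intro σ
  have h1 := Real.abs_cos_le_one ((s + 1) * σ)
  have h2 := Real.abs_sin_le_one ((s + 1) * σ)
  have h3 : (1 : ℝ) ≤ s + 1 := by linarith [Nat.cast_nonneg (α := ℝ) s]
  constructor
  · rw [addWave, add_sub_cancel_left, norm_smul, verticalWave, norm_vertical,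
      Real.norm_of_nonneg ht]
    refine le_trans ?_ htr
    gcongr
    linarith
  · rw [deriv_addWave hη, add_sub_cancel_left, norm_smul, norm_vertical, Real.norm_of_nonneg ht,
      abs_neg, abs_mul, abs_of_nonneg (by linarith : (0 : ℝ) ≤ s + 1)]
    refine le_trans ?_ htr
    gcongr
    nlinarith

/-- A vertical oscillation is orthogonal to the velocity of the straight string, so it does not
change the length to first order. -/
lemma lengthRate_addWave {η : ℝ → E3} (hη : IsClosedCurve η) (s : ℕ) (t σ : ℝ) :
    lengthRate (addWave η s t) σ = lengthRate η σ := by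
  unfold lengthRate
  congr 1
  funext x
  rw [deriv_addWave hη, inner_add_right, deriv_straight]
  simp [EuclideanSpace.inner_eq_star_dotProduct, dotProduct, Fin.sum_univ_three]

lemma integral_cos_wave (s : ℕ) :
    ∫ σ in (0 : ℝ)..(2 * Real.pi), Real.cos ((s + 1) * σ) = 0 := by
  have h0 : (s + 1 : ℝ) ≠ 0 := by positivity
  rw [intervalIntegral.integral_comp_mul_left (fun x => Real.cos x) h0, integral_cos]
  have : Real.sin ((s + 1) * (2 * Real.pi)) = 0 := by
    have := Real.sin_nat_mul_pi (2 * (s + 1))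
    rw [← this]
    push_cast
    ring_nf
  simp [this]

lemma phaseRate_addWave {η : ℝ → E3} (hη : IsClosedCurve η) (s : ℕ) (h t σ : ℝ) :
    phaseRate s h (addWave η s t) σ = phaseRate s h η σ - s * h * t * Real.cos ((s + 1) * σ) := by
  have h2 : ∀ x, addWave η s t x 2 = η x 2 + t * Real.cos ((s + 1) * x) := fun x => by
    simp [addWave, verticalWave]
  have hi : ∫ x in (0 : ℝ)..(2 * Real.pi), addWave η s t x 2 =
      ∫ x in (0 : ℝ)..(2 * Real.pi), η x 2 := by
    simp only [h2]
    have hc : Continuous fun x : ℝ => t * Real.cos ((s + 1) * x) := by fun_prop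
    rw [intervalIntegral.integral_add
      ((continuous_coord hη.continuous 2).intervalIntegrable _ _) (hc.intervalIntegrable _ _),
      intervalIntegral.integral_const_mul, integral_cos_wave, mul_zero, add_zero]
  unfold phaseRate
  rw [lengthRate_addWave hη, lengthRate_addWave hη, hi, h2]
  ring

/-- The response of the `i`-th component of the amplitude to the vertical oscillation. -/
def waveResponse (s : ℕ) (i : Fin 3) : ℂ := ∫ σ in (0 : ℝ)..(2 * Real.pi),
  (deriv straight σ i : ℂ) * Complex.I * (Real.cos ((s + 1) * σ) : ℂ) *
    Complex.exp (Complex.I * ((s * σ : ℝ) : ℂ))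

lemma continuous_waveResponse (s : ℕ) (i : Fin 3) : Continuous fun σ : ℝ =>
    (deriv straight σ i : ℂ) * Complex.I * (Real.cos ((s + 1) * σ) : ℂ) *
      Complex.exp (Complex.I * ((s * σ : ℝ) : ℂ)) := by
  have h1 := continuous_coord isClosedCurve_straight.continuous_deriv i
  have h2 : Continuous fun σ : ℝ => ((Real.cos ((s + 1) * σ) : ℝ) : ℂ) := by fun_prop
  have h3 : Continuous fun σ : ℝ => Complex.exp (Complex.I * ((s * σ : ℝ) : ℂ)) := by fun_prop
  exact (((Complex.continuous_ofReal.comp h1).mul continuous_const).mul h2).mul h3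

lemma amplitudeRate_addWave {η : ℝ → E3} (hη : IsClosedCurve η) (s : ℕ) (h t : ℝ) {i : Fin 3}
    (hi : i ≠ 2) : amplitudeRate s h (addWave η s t) i =
      amplitudeRate s h η i - ((ampConst * (s * h * t) : ℝ) : ℂ) * waveResponse s i := by
  have hd : ∀ σ, deriv (addWave η s t) σ i = deriv η σ i := fun σ => by
    rw [deriv_addWave hη]
    fin_cases i <;> simp at hi ⊢
  unfold amplitudeRate waveResponse
  simp only [hd, phaseRate_addWave hη]
  have hc : Continuous fun σ : ℝ =>
      ((deriv η σ i : ℂ) + (deriv straight σ i : ℂ) * (Complex.I * (phaseRate s h η σ : ℂ))) *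
      Complex.exp (Complex.I * ((s * σ : ℝ) : ℂ)) := by
    have h1 := continuous_coord isClosedCurve_straight.continuous_deriv i
    have h2 := continuous_coord hη.continuous_deriv i
    have h3 := continuous_phaseRate hη s h
    have h4 : Continuous fun σ : ℝ => Complex.exp (Complex.I * ((s * σ : ℝ) : ℂ)) := by fun_prop
    exact ((Complex.continuous_ofReal.comp h2).add ((Complex.continuous_ofReal.comp h1).mul
      (continuous_const.mul (Complex.continuous_ofReal.comp h3)))).mul h4
  have hw := continuous_waveResponse s i
  have hw2 : Continuous fun σ : ℝ => ((s * h * t : ℝ) : ℂ) *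
      ((deriv straight σ i : ℂ) * Complex.I * (Real.cos ((s + 1) * σ) : ℂ) *
        Complex.exp (Complex.I * ((s * σ : ℝ) : ℂ))) := continuous_const.mul hw
  rw [Complex.ofReal_mul ampConst, mul_assoc (ampConst : ℂ), ← mul_sub]
  congr 1
  rw [← intervalIntegral.integral_const_mul,
    ← intervalIntegral.integral_sub (hc.intervalIntegrable _ _) (hw2.intervalIntegrable _ _)]
  refine intervalIntegral.integral_congr fun σ _ => ?_
  dsimp only
  push_cast
  ring

lemma integral_exp_int {n : ℤ} (hn : n ≠ 0) :
    ∫ σ in (0 : ℝ)..(2 * Real.pi), Complex.exp ((n * Complex.I) * (σ : ℂ)) = 0 := by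
  have h0 : (n : ℂ) * Complex.I ≠ 0 := mul_ne_zero (by exact_mod_cast hn) Complex.I_ne_zero
  rw [integral_exp_mul_complex h0]
  have : Complex.exp ((n * Complex.I) * ((2 * Real.pi : ℝ) : ℂ)) = 1 := by
    rw [← Complex.exp_int_mul_two_pi_mul_I n]
    push_cast
    ring_nf
  rw [this]
  simp

/-- The wave number s+1 is in resonance with exactly one polarization: the first product has a
nonzero mean, the second only has nonzero frequencies. -/
lemma wave_kernel (s : ℕ) (σ : ℝ) :
    (Real.cos ((s + 1) * σ) : ℂ) * Complex.exp (Complex.I * ((s * σ : ℝ) : ℂ)) *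
      Complex.exp ((σ : ℂ) * Complex.I) =
      1 / 2 * Complex.exp ((((2 * s + 2 : ℤ) : ℂ) * Complex.I) * (σ : ℂ)) + 1 / 2 ∧
    (Real.cos ((s + 1) * σ) : ℂ) * Complex.exp (Complex.I * ((s * σ : ℝ) : ℂ)) *
      Complex.exp (-(σ : ℂ) * Complex.I) =
      1 / 2 * Complex.exp ((((2 * s : ℤ) : ℂ) * Complex.I) * (σ : ℂ)) +
      1 / 2 * Complex.exp ((((-2 : ℤ) : ℂ) * Complex.I) * (σ : ℂ)) := by
  have key : ∀ a b c d : ℂ, a + b + c = d →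
      Complex.exp a * Complex.exp b * Complex.exp c = Complex.exp d := fun a b c d h => by
    rw [← Complex.exp_add, ← Complex.exp_add, h]
  rw [Complex.ofReal_cos, Complex.cos]
  constructor
  · have h1 := key ((((s + 1) * σ : ℝ) : ℂ) * Complex.I) (Complex.I * ((s * σ : ℝ) : ℂ))
      ((σ : ℂ) * Complex.I) ((((2 * s + 2 : ℤ) : ℂ) * Complex.I) * (σ : ℂ)) (by push_cast; ring)
    have h2 := key (-(((s + 1) * σ : ℝ) : ℂ) * Complex.I) (Complex.I * ((s * σ : ℝ) : ℂ))
      ((σ : ℂ) * Complex.I) 0 (by push_cast; ring)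
    rw [Complex.exp_zero] at h2
    linear_combination (1 / 2) * h1 + (1 / 2) * h2
  · have h1 := key ((((s + 1) * σ : ℝ) : ℂ) * Complex.I) (Complex.I * ((s * σ : ℝ) : ℂ))
      (-(σ : ℂ) * Complex.I) ((((2 * s : ℤ) : ℂ) * Complex.I) * (σ : ℂ)) (by push_cast; ring)
    have h2 := key (-(((s + 1) * σ : ℝ) : ℂ) * Complex.I) (Complex.I * ((s * σ : ℝ) : ℂ))
      (-(σ : ℂ) * Complex.I) ((((-2 : ℤ) : ℂ) * Complex.I) * (σ : ℂ)) (by push_cast; ring)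
    linear_combination (1 / 2) * h1 + (1 / 2) * h2

lemma waveResponse_plus (s : ℕ) :
    waveResponse s 0 + Complex.I * waveResponse s 1 = -Real.pi := by
  unfold waveResponse
  have hw : Continuous fun σ : ℝ => Complex.I * ((deriv straight σ 1 : ℂ) * Complex.I *
      (Real.cos ((s + 1) * σ) : ℂ) * Complex.exp (Complex.I * ((s * σ : ℝ) : ℂ))) :=
    continuous_const.mul (continuous_waveResponse s 1)
  rw [← intervalIntegral.integral_const_mul, ← intervalIntegral.integral_add
    ((continuous_waveResponse s 0).intervalIntegrable _ _) (hw.intervalIntegrable _ _)]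
  have h1 : ∀ σ : ℝ, (deriv straight σ 0 : ℂ) * Complex.I * (Real.cos ((s + 1) * σ) : ℂ) *
      Complex.exp (Complex.I * ((s * σ : ℝ) : ℂ)) + Complex.I * ((deriv straight σ 1 : ℂ) *
      Complex.I * (Real.cos ((s + 1) * σ) : ℂ) * Complex.exp (Complex.I * ((s * σ : ℝ) : ℂ))) =
      -(1 / 2) * Complex.exp ((((2 * s + 2 : ℤ) : ℂ) * Complex.I) * (σ : ℂ)) - 1 / 2 := fun σ => by
    have h2 := (wave_kernel s σ).1
    rw [Complex.exp_mul_I] at h2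
    simp only [deriv_straight, PiLp.toLp_apply, Matrix.cons_val_zero, Matrix.cons_val_one,
      Complex.ofReal_neg, Complex.ofReal_sin, Complex.ofReal_cos σ]
    linear_combination -h2 + Complex.cos σ * (Real.cos ((s + 1) * σ) : ℂ) *
      Complex.exp (Complex.I * ((s * σ : ℝ) : ℂ)) * Complex.I_sq
  simp only [h1]
  have hc : Continuous fun σ : ℝ =>
      -(1 / 2) * Complex.exp ((((2 * s + 2 : ℤ) : ℂ) * Complex.I) * (σ : ℂ)) := by fun_prop
  rw [intervalIntegral.integral_sub (hc.intervalIntegrable _ _) intervalIntegrable_const,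
    intervalIntegral.integral_const_mul, integral_exp_int (by omega), mul_zero,
    intervalIntegral.integral_const]
  simp
  ring

lemma waveResponse_minus {s : ℕ} (hs : 1 ≤ s) :
    waveResponse s 0 - Complex.I * waveResponse s 1 = 0 := by
  unfold waveResponse
  have hw : Continuous fun σ : ℝ => Complex.I * ((deriv straight σ 1 : ℂ) * Complex.I *
      (Real.cos ((s + 1) * σ) : ℂ) * Complex.exp (Complex.I * ((s * σ : ℝ) : ℂ))) :=
    continuous_const.mul (continuous_waveResponse s 1)
  rw [← intervalIntegral.integral_const_mul, ← intervalIntegral.integral_sub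
    ((continuous_waveResponse s 0).intervalIntegrable _ _) (hw.intervalIntegrable _ _)]
  have h1 : ∀ σ : ℝ, (deriv straight σ 0 : ℂ) * Complex.I * (Real.cos ((s + 1) * σ) : ℂ) *
      Complex.exp (Complex.I * ((s * σ : ℝ) : ℂ)) - Complex.I * ((deriv straight σ 1 : ℂ) *
      Complex.I * (Real.cos ((s + 1) * σ) : ℂ) * Complex.exp (Complex.I * ((s * σ : ℝ) : ℂ))) =
      1 / 2 * Complex.exp ((((2 * s : ℤ) : ℂ) * Complex.I) * (σ : ℂ)) +
      1 / 2 * Complex.exp ((((-2 : ℤ) : ℂ) * Complex.I) * (σ : ℂ)) := fun σ => by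
    have h2 := (wave_kernel s σ).2
    rw [Complex.exp_mul_I, Complex.cos_neg, Complex.sin_neg] at h2
    simp only [deriv_straight, PiLp.toLp_apply, Matrix.cons_val_zero, Matrix.cons_val_one,
      Complex.ofReal_neg, Complex.ofReal_sin, Complex.ofReal_cos σ]
    linear_combination h2 - Complex.cos σ * (Real.cos ((s + 1) * σ) : ℂ) *
      Complex.exp (Complex.I * ((s * σ : ℝ) : ℂ)) * Complex.I_sq
  simp only [h1]
  have hc : ∀ n : ℤ, Continuous fun σ : ℝ =>
      1 / 2 * Complex.exp (((n : ℂ) * Complex.I) * (σ : ℂ)) := fun n => by fun_prop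
  rw [intervalIntegral.integral_add ((hc _).intervalIntegrable _ _)
    ((hc _).intervalIntegrable _ _), intervalIntegral.integral_const_mul,
    intervalIntegral.integral_const_mul, integral_exp_int (by omega), integral_exp_int (by omega)]
  simp

/-! ### Genericity of the non-degeneracy conditions -/

lemma amplitude_straight_pole {s : ℕ} (hs : 2 ≤ s) {p : E3} (hp : p = north ∨ p = -north)
    (i : Fin 3) : amplitude straight s 0 p i = 0 := by
  rw [amplitude_eq isClosedCurve_straight nearStraight_straight.totalLength_pos.ne' (by omega),
    qVec_straight, qVec_straight, horiz_pole hp, straightPlane_zero hs, straightPlane_zero hs]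
  simp

/-- In time the field at a pole is the half-sum of two vectors rotating in opposite directions, with
the two polarized moduli as their lengths. It traces an ellipse whose smaller half-axis is half of
the difference of these moduli. -/
lemma norm_qPerp_pole_ge {Q : ℝ → E3} (hQ : NearStraight Q) {s : ℕ} (hs : s ≠ 0) {p : E3}
    (hp : p = north ∨ p = -north) (τ : ℝ) :
    |‖amplitude Q s 0 p 0 + Complex.I * amplitude Q s 0 p 1‖ -
      ‖amplitude Q s 0 p 0 + -Complex.I * amplitude Q s 0 p 1‖| / 2 ≤ ‖qPerp Q s τ p‖ := by
  have hL := hQ.totalLength_pos.ne'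
  set x := horiz (qVec Q s 0 p) with hx
  set y := horiz (qVec Q s (Real.pi / (2 * s)) p) with hy
  have hm : amplitude Q s 0 p 0 + -Complex.I * amplitude Q s 0 p 1 =
      (starRingEnd ℂ) (x - Complex.I * y) := by
    rw [amplitude_eq hQ.1 hL hs, amplitude_eq hQ.1 hL hs, zero_add, hx, hy]
    apply Complex.ext <;> simp
    ring
  have ht := qVec_time_eq hQ.1 hL hs 0 τ p
  rw [zero_add, zero_add] at ht
  have ht' := congrArg horiz ht
  rw [map_add, map_smul, map_smul, ← hx, ← hy, Complex.real_smul, Complex.real_smul,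
    Complex.ofReal_cos, Complex.ofReal_sin] at ht'
  set θ : ℝ := s * τ with hθ
  have key : horiz (qVec Q s τ p) = (Complex.exp ((-θ : ℝ) * Complex.I) * (x + Complex.I * y) -
      -(Complex.exp ((θ : ℝ) * Complex.I) * (x - Complex.I * y))) / 2 := by
    rw [ht', Complex.ofReal_neg, Complex.exp_mul_I, Complex.exp_mul_I, Complex.cos_neg,
      Complex.sin_neg]
    linear_combination Complex.sin θ * y * Complex.I_sq
  rw [norm_qPerp_pole hp, key, norm_div, amplitude_plus_eq hQ hs, hm, Complex.norm_conj,
    Complex.norm_ofNat]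
  refine div_le_div_of_nonneg_right ?_ zero_le_two
  refine le_trans (le_of_eq ?_) (abs_norm_sub_norm_le _ _)
  rw [norm_neg, norm_mul, norm_mul, Complex.norm_exp_ofReal_mul_I, Complex.norm_exp_ofReal_mul_I,
    one_mul, one_mul]

/-- First-order expansion of the amplitude at a pole, uniformly in the direction of deformation. -/
lemma exists_amplitude_deform_near {s : ℕ} (hs : 2 ≤ s) {η : ℝ → E3} (hη : IsClosedCurve η) {p : E3}
    (hp : p = north ∨ p = -north) {g : ℝ} (hg : 0 < g) : ∃ ρ > 0, ∃ ε₀ > 0, ∀ ζ,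
      IsClosedCurve ζ → C1Close ρ ζ η → ∀ ε : ℝ, 0 < ε → ε < ε₀ → NearStraight (deform ζ ε) ∧
      ∀ i, ‖amplitude (deform ζ ε) s 0 p i - ε * amplitudeRate s (p 2) η i‖ ≤ g * ε := by
  obtain ⟨K, hK, hKb⟩ := exists_c1Near s
  obtain ⟨B, hB, hBb⟩ := hη.exists_bound
  have hd : ∀ i, ∀ᶠ ε in 𝓝 (0 : ℝ),
      ‖amplitude (deform η ε) s 0 p i - ε * amplitudeRate s (p 2) η i‖ ≤ g / 2 * ‖ε‖ := fun i => by
    have h1 := (hasDerivAt_amplitude_deform hη s hp i).isLittleO.bound (half_pos hg)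
    filter_upwards [h1] with ε h2
    rw [deform_zero, amplitude_straight_pole hs hp, sub_zero, sub_zero] at h2
    simpa using h2
  obtain ⟨ε₁, hε₁, hε₁b⟩ := Metric.eventually_nhds_iff.1 (eventually_all.2 hd)
  -- Half of the error is reserved for linearization along η, half for replacing η by ζ. The latter
  -- is Lipschitz in the curve and the curves differ by ερ, so it is uniform in ζ.
  refine ⟨min 1 (g / (4 * K)), by positivity, min ε₁ (1 / (2 * (B + 1))), by positivity,
    fun ζ hζ hζη ε hε hεε => ?_⟩
  have hρ1 := min_le_left (1 : ℝ) (g / (4 * K))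
  have hρ2 := min_le_right (1 : ℝ) (g / (4 * K))
  set ρ := min (1 : ℝ) (g / (4 * K)) with hρ
  have hεB : ε * (B + 1) ≤ 1 / 2 := by
    have := hεε.le.trans (min_le_right _ _)
    rw [le_div_iff₀ (by positivity)] at this
    linarith
  have hζB : ∀ σ, ‖ζ σ‖ ≤ B + 1 ∧ ‖deriv ζ σ‖ ≤ B + 1 := fun σ => by
    have h1 := norm_sub_norm_le (ζ σ) (η σ)
    have h2 := norm_sub_norm_le (deriv ζ σ) (deriv η σ)
    constructor <;> linarith [(hBb σ).1, (hBb σ).2, (hζη σ).1, (hζη σ).2]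
  have hnζ : NearStraight (deform ζ ε) :=
    nearStraight_deform hζ hζB (by rwa [abs_of_pos hε])
  have hnη : NearStraight (deform η ε) :=
    nearStraight_deform hη hBb (by rw [abs_of_pos hε]; nlinarith)
  refine ⟨hnζ, fun i => ?_⟩
  have hcl := c1Close_deform_of_dir hη hζ hζη hε.le
  have hq : ∀ τ, ‖(qVec (deform ζ ε) s τ p i : ℂ) - (qVec (deform η ε) s τ p i : ℂ)‖ ≤
      K * (ε * ρ) := fun τ => by
    have h1 := (hKb _ _ hnζ hnη _ hcl τ p (by rw [norm_pole hp]; norm_num)).1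
    have h2 := norm_coord_le (qVec (deform ζ ε) s τ p - qVec (deform η ε) s τ p) i
    rw [PiLp.sub_apply, Complex.ofReal_sub] at h2
    exact h2.trans h1
  have ha : ‖amplitude (deform ζ ε) s 0 p i - amplitude (deform η ε) s 0 p i‖ ≤
      2 * (K * (ε * ρ)) := by
    rw [amplitude_eq hnζ.1 hnζ.totalLength_pos.ne' (by omega),
      amplitude_eq hnη.1 hnη.totalLength_pos.ne' (by omega), add_sub_add_comm, ← mul_sub]
    refine (norm_add_le _ _).trans ?_
    rw [norm_mul, Complex.norm_I, one_mul]
    linarith [hq 0, hq (0 + Real.pi / (2 * s))]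
  have hb := hε₁b (y := ε) (by
    rw [dist_zero_right, Real.norm_of_nonneg hε.le]
    exact hεε.trans_le (min_le_left _ _)) i
  rw [Real.norm_of_nonneg hε.le] at hb
  have hKρ : 2 * (K * (ε * ρ)) ≤ g / 2 * ε := by
    rw [le_div_iff₀ (by positivity)] at hρ2
    nlinarith
  refine (norm_sub_le_norm_sub_add_norm_sub _ (amplitude (deform η ε) s 0 p i) _).trans ?_
  linarith

/-- The coefficients of positive and negative polarization in the linear response at the pole of
height `h`. -/
def polarizedRate (s : ℕ) (h : ℝ) (η : ℝ → E3) (ω : ℂ) : ℂ :=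
  amplitudeRate s h η 0 + ω * amplitudeRate s h η 1

/-- To first order the polarized amplitudes are ε times the polarized rates, so nonvanishing and
inequality of the moduli of the rates yield lower bounds linear in ε. -/
theorem exists_nondegenerate_at_pole {s : ℕ} (hs : 2 ≤ s) {η : ℝ → E3} (hη : IsClosedCurve η)
    {p : E3} (hp : p = north ∨ p = -north) (h0 : polarizedRate s (p 2) η Complex.I ≠ 0)
    (h1 : ‖polarizedRate s (p 2) η Complex.I‖ ≠ ‖polarizedRate s (p 2) η (-Complex.I)‖) :
    ∃ ρ > 0, ∃ c > 0, ∃ ε₀ > 0, ∀ ζ, IsClosedCurve ζ → C1Close ρ ζ η → ∀ ε : ℝ, 0 < ε → ε < ε₀ →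
      (∀ τ : ℝ, c * ε ≤ ‖qPerp (deform ζ ε) s τ p‖) ∧
      c * ε ≤ ‖amplitude (deform ζ ε) s 0 p 0 + Complex.I * amplitude (deform ζ ε) s 0 p 1‖ := by
  set a := polarizedRate s (p 2) η Complex.I with ha
  set b := polarizedRate s (p 2) η (-Complex.I) with hb
  set g := min ‖a‖ |‖a‖ - ‖b‖| with hg
  have hg0 : 0 < g := lt_min (norm_pos_iff.2 h0) (abs_pos.2 (sub_ne_zero.2 h1))
  have hga : g ≤ ‖a‖ := min_le_left _ _
  have hgb : g ≤ |‖a‖ - ‖b‖| := min_le_right _ _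
  -- An error g/8 per component gives g/4 per polarization and g/2 in the difference of moduli; half
  -- of the remaining g/2 is the constant g/4.
  obtain ⟨ρ, hρ, ε₀, hε₀, h⟩ := exists_amplitude_deform_near hs hη hp
    (by positivity : 0 < g / 8)
  refine ⟨ρ, hρ, g / 4, by positivity, ε₀, hε₀, fun ζ hζ hζη ε hε hεε => ?_⟩
  obtain ⟨hn, hi⟩ := h ζ hζ hζη ε hε hεε
  have hω : ∀ ω : ℂ, ‖ω‖ = 1 → |‖amplitude (deform ζ ε) s 0 p 0 +
      ω * amplitude (deform ζ ε) s 0 p 1‖ - ε * ‖polarizedRate s (p 2) η ω‖| ≤ g / 4 * ε :=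
    fun ω hω => by
      have h2 : ε * ‖polarizedRate s (p 2) η ω‖ = ‖(ε : ℂ) * polarizedRate s (p 2) η ω‖ := by
        rw [norm_mul, Complex.norm_of_nonneg hε.le]
      rw [h2]
      refine (abs_norm_sub_norm_le _ _).trans ?_
      have h3 : amplitude (deform ζ ε) s 0 p 0 + ω * amplitude (deform ζ ε) s 0 p 1 -
          ε * polarizedRate s (p 2) η ω =
          (amplitude (deform ζ ε) s 0 p 0 - ε * amplitudeRate s (p 2) η 0) +
          ω * (amplitude (deform ζ ε) s 0 p 1 - ε * amplitudeRate s (p 2) η 1) := by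
        rw [polarizedRate]
        ring
      rw [h3]
      refine (norm_add_le _ _).trans ?_
      rw [norm_mul, hω, one_mul]
      linarith [hi 0, hi 1]
  have h2 := abs_le.1 (hω Complex.I Complex.norm_I)
  have h3 := abs_le.1 (hω (-Complex.I) (by rw [norm_neg, Complex.norm_I]))
  rw [← ha] at h2
  rw [← hb] at h3
  refine ⟨fun τ => le_trans ?_ (norm_qPerp_pole_ge hn (by omega) hp τ), by nlinarith⟩
  rw [le_div_iff₀ two_pos]
  have h4 : g * ε ≤ |ε * ‖a‖ - ε * ‖b‖| := by
    rw [← mul_sub, abs_mul, abs_of_pos hε, mul_comm]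
    gcongr
  rcases le_abs'.1 h4 with h5 | h5
  · rw [abs_of_nonpos (by nlinarith)]
    linarith
  · rw [abs_of_nonneg (by nlinarith)]
    linarith

lemma polarizedRate_addWave_plus {η : ℝ → E3} (hη : IsClosedCurve η) (s : ℕ) (h t : ℝ) :
    polarizedRate s h (addWave η s t) Complex.I = polarizedRate s h η Complex.I +
      ((ampConst * (s * h) * Real.pi : ℝ) : ℂ) * t := by
  unfold polarizedRate
  rw [amplitudeRate_addWave hη s h t (by decide), amplitudeRate_addWave hη s h t (by decide)]
  push_cast
  linear_combination -(ampConst * (s * h * t) : ℂ) * waveResponse_plus s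

lemma polarizedRate_addWave_minus {η : ℝ → E3} (hη : IsClosedCurve η) {s : ℕ} (hs : 1 ≤ s)
    (h t : ℝ) : polarizedRate s h (addWave η s t) (-Complex.I) =
      polarizedRate s h η (-Complex.I) := by
  unfold polarizedRate
  rw [amplitudeRate_addWave hη s h t (by decide), amplitudeRate_addWave hη s h t (by decide)]
  linear_combination -((ampConst * (s * h * t) : ℝ) : ℂ) * waveResponse_minus hs

/-- The squared modulus is quadratic in t with leading coefficient γ² ≠ 0, so each value is taken at
most twice. -/
lemma finite_setOf_norm_eq (a : ℂ) {γ : ℝ} (hγ : γ ≠ 0) (m : ℝ) :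
    {t : ℝ | ‖a + (γ : ℂ) * t‖ = m}.Finite := by
  set k := √(m ^ 2 - a.im ^ 2)
  refine (Set.toFinite {(k - a.re) / γ, (-k - a.re) / γ}).subset fun t ht => ?_
  have h1 : ‖a + (γ : ℂ) * t‖ ^ 2 = m ^ 2 := by rw [ht]
  rw [← Complex.normSq_eq_norm_sq, Complex.normSq_apply] at h1
  simp only [Complex.add_re, Complex.add_im, Complex.mul_re, Complex.mul_im, Complex.ofReal_re,
    Complex.ofReal_im, mul_zero, zero_mul, sub_zero, add_zero] at h1
  have h2 : |a.re + γ * t| = k := by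
    rw [← Real.sqrt_sq_eq_abs]
    congr 1
    linarith
  simp only [Set.mem_insert_iff, Set.mem_singleton_iff, eq_div_iff hγ]
  rcases abs_choice (a.re + γ * t) with h3 | h3
  · left; linarith
  · right; linarith

/-- The strength t of the vertical oscillation has to avoid four finite sets: at each pole, those
where the positively polarized rate vanishes or has the same modulus as the negatively polarized
one, which does not depend on t. -/
theorem exists_generic_direction {s : ℕ} (hs : 2 ≤ s) {η : ℝ → E3} (hη : IsClosedCurve η) {r : ℝ}
    (hr : 0 < r) : ∃ η', IsClosedCurve η' ∧ C1Close r η' η ∧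
      ∃ ρ : ℝ, 0 < ρ ∧ ∃ c : ℝ, 0 < c ∧ ∃ ε₀ : ℝ, 0 < ε₀ ∧
        ∀ ζ : ℝ → E3, IsClosedCurve ζ → C1Close ρ ζ η' → ∀ ε : ℝ, 0 < ε → ε < ε₀ →
          ∀ p : E3, p = north ∨ p = -north → (∀ τ : ℝ, c * ε ≤ ‖qPerp (deform ζ ε) s τ p‖) ∧
            c * ε ≤ ‖amplitude (deform ζ ε) s 0 p 0 +
              Complex.I * amplitude (deform ζ ε) s 0 p 1‖ := by
  have hγ : ∀ p, p = north ∨ p = -north → ampConst * (s * p 2) * Real.pi ≠ 0 := fun p hp => by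
    have h1 : p 2 ≠ 0 := fun h => by simpa [h] using pole_two_sq hp
    have h2 : (s : ℝ) ≠ 0 := by positivity
    exact mul_ne_zero (mul_ne_zero ampConst_pos.ne' (mul_ne_zero h2 h1)) Real.pi_ne_zero
  have hfin : ∀ p, p = north ∨ p = -north → ∀ m : ℝ,
      {t : ℝ | ‖polarizedRate s (p 2) (addWave η s t) Complex.I‖ = m}.Finite := fun p hp m => by
    simp only [polarizedRate_addWave_plus hη]
    exact finite_setOf_norm_eq _ (hγ p hp) m
  have hN : north = north ∨ north = -north := Or.inl rfl
  have hS : -north = north ∨ -north = -north := Or.inr rfl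
  have hinf : (Set.Ioo (0 : ℝ) (r / (s + 1))).Infinite := Set.Ioo_infinite (by positivity)
  obtain ⟨t, ht, hbad⟩ := (hinf.sdiff ((((hfin _ hN 0).union
    (hfin _ hN ‖polarizedRate s (north 2) η (-Complex.I)‖)).union (hfin _ hS 0)).union
    (hfin _ hS ‖polarizedRate s ((-north) 2) η (-Complex.I)‖))).nonempty
  simp only [Set.mem_union, Set.mem_ofPred_eq, not_or, norm_eq_zero] at hbad
  obtain ⟨⟨⟨b1, b2⟩, b3⟩, b4⟩ := hbad
  have hc := isClosedCurve_addWave hη s t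
  obtain ⟨ρ₁, hρ₁, c₁, hc₁, ε₁, hε₁, H₁⟩ := exists_nondegenerate_at_pole hs hc hN b1
    (by rwa [polarizedRate_addWave_minus hη (by omega)])
  obtain ⟨ρ₂, hρ₂, c₂, hc₂, ε₂, hε₂, H₂⟩ := exists_nondegenerate_at_pole hs hc hS b3
    (by rwa [polarizedRate_addWave_minus hη (by omega)])
  refine ⟨addWave η s t, hc, c1Close_addWave hη s ht.1.le ?_, min ρ₁ ρ₂, lt_min hρ₁ hρ₂,
    min c₁ c₂, lt_min hc₁ hc₂, min ε₁ ε₂, lt_min hε₁ hε₂, fun ζ hζ hζη ε hε hεε p hp => ?_⟩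
  · exact ((lt_div_iff₀ (by positivity)).1 ht.2).le
  rcases hp with rfl | rfl
  · obtain ⟨h1, h2⟩ := H₁ ζ hζ (hζη.mono (min_le_left _ _)) ε hε (hεε.trans_le (min_le_left _ _))
    have h3 : min c₁ c₂ * ε ≤ c₁ * ε := mul_le_mul_of_nonneg_right (min_le_left _ _) hε.le
    exact ⟨fun τ => h3.trans (h1 τ), h3.trans h2⟩
  · obtain ⟨h1, h2⟩ := H₂ ζ hζ (hζη.mono (min_le_right _ _)) ε hε (hεε.trans_le (min_le_right _ _))
    have h3 : min c₁ c₂ * ε ≤ c₂ * ε := mul_le_mul_of_nonneg_right (min_le_right _ _) hε.le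
    exact ⟨fun τ => h3.trans (h1 τ), h3.trans h2⟩

/-! ### The evolution of the singular points -/

theorem exists_evolution_of_zeros {s : ℕ} (hs : 1 ≤ s) {κ : ℝ} (hκ : 0 < κ) {c : ℝ} (hc : 0 < c) :
    ∃ δ : ℝ, 0 < δ ∧
      ∀ Q : ℝ → E3, IsClosedCurve Q → ∀ d : ℝ, 0 < d → d ≤ δ → C1Close d Q straight →
        (∃ N : ℝ → E3, Continuous N ∧
          (∀ τ τ' : ℝ, N τ = N τ' ↔ ∃ j : ℤ, τ' = τ + j * (2 * Real.pi)) ∧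
          (∀ τ : ℝ, ‖N τ - equatorPoint τ‖ < κ) ∧
          (∀ τ : ℝ, ∀ k : ℕ, k < 2 * s → IsNode (qPerp Q s τ) (N (τ + k * Real.pi / s))) ∧
          (∀ (τ : ℝ) (e : E3), ‖e‖ = 1 → qPerp Q s τ e = 0 →
            (∃ k : ℕ, k < 2 * s ∧ e = N (τ + k * Real.pi / s)) ∨
            (2 ≤ s ∧ (‖e - north‖ < κ ∨ ‖e - -north‖ < κ)))) ∧
        (s = 2 → ∀ p : E3, p = north ∨ p = -north →
          ∃ z : ℝ → E3, Continuous z ∧ Function.Periodic z (Real.pi / s) ∧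
            (∀ τ : ℝ, ‖z τ - p‖ < κ ∧ IsSaddle (qPerp Q s τ) (z τ)) ∧
            (∀ (τ : ℝ) (e : E3), ‖e‖ = 1 → 1 / 2 < inner ℝ e p → qPerp Q s τ e = 0 → e = z τ) ∧
            (c * d ≤ ‖amplitude Q s 0 p 0 + Complex.I * amplitude Q s 0 p 1‖ →
              ∀ τ τ' : ℝ, z τ = z τ' ↔ ∃ j : ℤ, τ' = τ + j * (Real.pi / s))) ∧
        (2 < s → ∀ p : E3, p = north ∨ p = -north → ∀ I : Set ℝ, I.OrdConnected →
          (∀ τ ∈ I, c * d ≤ ‖qPerp Q s τ p‖) →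
          ∃ z : Fin (s - 1) → ℝ → E3, (∀ k, ContinuousOn (z k) I) ∧
            ∀ τ ∈ I, Function.Injective (fun k => z k τ) ∧
              (∀ k, ‖z k τ - p‖ < κ ∧ IsSaddle (qPerp Q s τ) (z k τ)) ∧
              (∀ e : E3, ‖e‖ = 1 → 1 / 2 < inner ℝ e p → qPerp Q s τ e = 0 →
                ∃ k, e = z k τ)) := by
  obtain ⟨δ₁, hδ₁, H₁⟩ := exists_nodes hs hκ
  have hnear : ∀ Q, IsClosedCurve Q → ∀ d ≤ min (1 / 2) δ₁, C1Close d Q straight →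
      NearStraight Q ∧ C1Close δ₁ Q straight := fun Q hQ d hd h =>
    ⟨⟨hQ, h.mono (hd.trans (min_le_left _ _))⟩, h.mono (hd.trans (min_le_right _ _))⟩
  have hN : north = north ∨ north = -north := Or.inl rfl
  have hS : -north = north ∨ -north = -north := Or.inr rfl
  obtain rfl | hs2 | hs2 : s = 2 ∨ s = 1 ∨ 2 < s := by omega
  · obtain ⟨δ₂, hδ₂, H₂⟩ := exists_saddle_two hκ hc hN
    obtain ⟨δ₃, hδ₃, H₃⟩ := exists_saddle_two hκ hc hS
    refine ⟨min (min (1 / 2) δ₁) (min δ₂ δ₃), by positivity, fun Q hQ d hd hdδ h => ?_⟩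
    obtain ⟨hn, h1⟩ := hnear Q hQ d (hdδ.trans (min_le_left _ _)) h
    have hd2 := hdδ.trans ((min_le_right _ _).trans (min_le_left _ _))
    have hd3 := hdδ.trans ((min_le_right _ _).trans (min_le_right _ _))
    refine ⟨H₁ Q hn h1, fun _ p hp => ?_, fun h2 => absurd h2 (lt_irrefl 2)⟩
    rcases hp with rfl | rfl
    · exact H₂ Q hn d hd hd2 h
    · exact H₃ Q hn d hd hd3 h
  · refine ⟨min (1 / 2) δ₁, by positivity, fun Q hQ d _ hdδ h => ?_⟩
    obtain ⟨hn, h1⟩ := hnear Q hQ d hdδ h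
    exact ⟨H₁ Q hn h1, fun h2 => by omega, fun h2 => by omega⟩
  · obtain ⟨δ₂, hδ₂, H₂⟩ := exists_unfolding hs2 hκ hc hN
    obtain ⟨δ₃, hδ₃, H₃⟩ := exists_unfolding hs2 hκ hc hS
    refine ⟨min (min (1 / 2) δ₁) (min δ₂ δ₃), by positivity, fun Q hQ d hd hdδ h => ?_⟩
    obtain ⟨hn, h1⟩ := hnear Q hQ d (hdδ.trans (min_le_left _ _)) h
    have hd2 := hdδ.trans ((min_le_right _ _).trans (min_le_left _ _))
    have hd3 := hdδ.trans ((min_le_right _ _).trans (min_le_right _ _))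
    refine ⟨H₁ Q hn h1, fun h2 => by omega, fun _ p hp => ?_⟩
    rcases hp with rfl | rfl
    · exact H₂ Q hn d hd hd2 h
    · exact H₃ Q hn d hd hd3 h

end StringCurve

end

open StringCurve in
theorem lemma3 :
    -- the straight-line string
    (∀ s : ℕ, 1 ≤ s → ∀ τ : ℝ,
      (∀ e : E3, ‖e‖ = 1 →
        (qPerp straight s τ e = 0 ↔
          (∃ k : ℕ, k < 2 * s ∧ e = equatorPoint (τ + k * Real.pi / s)) ∨
          (2 ≤ s ∧ (e = north ∨ e = -north)))) ∧
      {e : E3 | ‖e‖ = 1 ∧ e 2 = 0 ∧ qPerp straight s τ e = 0}.ncard = 2 * s ∧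
      (∀ k : ℕ, k < 2 * s →
        IsNode (qPerp straight s τ) (equatorPoint (τ + k * Real.pi / s))) ∧
      (s = 2 → IsSaddle (qPerp straight s τ) north ∧ IsSaddle (qPerp straight s τ) (-north)) ∧
      (2 < s → IsMultiSaddle (qPerp straight s τ) north (s - 1) ∧
        IsMultiSaddle (qPerp straight s τ) (-north) (s - 1)) ∧
      (∀ e : E3, qPerp straight s τ (rotZ τ e) = rotZ τ (qPerp straight s 0 e))) ∧
    -- small deformations
    (∀ s : ℕ, 1 ≤ s → ∀ κ : ℝ, 0 < κ → ∀ c : ℝ, 0 < c → ∃ δ : ℝ, 0 < δ ∧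
      ∀ Q : ℝ → E3, IsClosedCurve Q → ∀ d : ℝ, 0 < d → d ≤ δ → C1Close d Q straight →
        -- nodes near the equator, and no singular points elsewhere except near the poles
        (∃ N : ℝ → E3, Continuous N ∧
          (∀ τ τ' : ℝ, N τ = N τ' ↔ ∃ j : ℤ, τ' = τ + j * (2 * Real.pi)) ∧
          (∀ τ : ℝ, ‖N τ - equatorPoint τ‖ < κ) ∧
          (∀ τ : ℝ, ∀ k : ℕ, k < 2 * s → IsNode (qPerp Q s τ) (N (τ + k * Real.pi / s))) ∧
          (∀ (τ : ℝ) (e : E3), ‖e‖ = 1 → qPerp Q s τ e = 0 →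
            (∃ k : ℕ, k < 2 * s ∧ e = N (τ + k * Real.pi / s)) ∨
            (2 ≤ s ∧ (‖e - north‖ < κ ∨ ‖e - -north‖ < κ)))) ∧
        -- the saddles near the poles at `s = 2`
        (s = 2 → ∀ p : E3, p = north ∨ p = -north →
          ∃ z : ℝ → E3, Continuous z ∧ Function.Periodic z (Real.pi / s) ∧
            (∀ τ : ℝ, ‖z τ - p‖ < κ ∧ IsSaddle (qPerp Q s τ) (z τ)) ∧
            (∀ (τ : ℝ) (e : E3), ‖e‖ = 1 → 1 / 2 < inner ℝ e p → qPerp Q s τ e = 0 → e = z τ) ∧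
            (c * d ≤ ‖amplitude Q s 0 p 0 + Complex.I * amplitude Q s 0 p 1‖ →
              ∀ τ τ' : ℝ, z τ = z τ' ↔ ∃ j : ℤ, τ' = τ + j * (Real.pi / s))) ∧
        -- the unfolding of the multi-saddles at `s > 2`
        (2 < s → ∀ p : E3, p = north ∨ p = -north → ∀ I : Set ℝ, I.OrdConnected →
          (∀ τ ∈ I, c * d ≤ ‖qPerp Q s τ p‖) →
          ∃ z : Fin (s - 1) → ℝ → E3, (∀ k, ContinuousOn (z k) I) ∧
            ∀ τ ∈ I, Function.Injective (fun k => z k τ) ∧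
              (∀ k, ‖z k τ - p‖ < κ ∧ IsSaddle (qPerp Q s τ) (z k τ)) ∧
              (∀ e : E3, ‖e‖ = 1 → 1 / 2 < inner ℝ e p → qPerp Q s τ e = 0 →
                ∃ k, e = z k τ))) ∧
    -- the non-degeneracy conditions used above hold for generic directions of deformation
    (∀ s : ℕ, 2 ≤ s → ∀ η : ℝ → E3, IsClosedCurve η → ∀ r : ℝ, 0 < r →
      ∃ η' : ℝ → E3, IsClosedCurve η' ∧ C1Close r η' η ∧
        ∃ ρ : ℝ, 0 < ρ ∧ ∃ c : ℝ, 0 < c ∧ ∃ ε₀ : ℝ, 0 < ε₀ ∧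
          ∀ ζ : ℝ → E3, IsClosedCurve ζ → C1Close ρ ζ η' → ∀ ε : ℝ, 0 < ε → ε < ε₀ →
            ∀ p : E3, p = north ∨ p = -north →
              (∀ τ : ℝ, c * ε ≤ ‖qPerp (fun σ => straight σ + ε • ζ σ) s τ p‖) ∧
              c * ε ≤ ‖amplitude (fun σ => straight σ + ε • ζ σ) s 0 p 0 +
                Complex.I * amplitude (fun σ => straight σ + ε • ζ σ) s 0 p 1‖) ∧
    -- reversal of the field, and return of the pattern of singular points, after the time `π/s`
    (∀ Q : ℝ → E3, IsClosedCurve Q → ∀ s : ℕ, 1 ≤ s → ∀ τ : ℝ,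
      (∀ e : E3, qPerp Q s (τ + 2 * Real.pi) e = qPerp Q s τ e) ∧
      (∀ e : E3, qPerp Q s (τ + Real.pi / s) e = -qPerp Q s τ e) ∧
      (∀ p : E3, (qPerp Q s (τ + Real.pi / s) p = 0 ↔ qPerp Q s τ p = 0) ∧
        (IsNode (qPerp Q s (τ + Real.pi / s)) p ↔ IsNode (qPerp Q s τ) p) ∧
        (IsSaddle (qPerp Q s (τ + Real.pi / s)) p ↔ IsSaddle (qPerp Q s τ) p) ∧
        (∀ m : ℕ, IsMultiSaddle (qPerp Q s (τ + Real.pi / s)) p m ↔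
          IsMultiSaddle (qPerp Q s τ) p m))) := by
  refine ⟨fun s hs τ => ⟨fun e he => qPerp_straight_eq_zero_iff hs τ he, ncard_equator_zeros hs τ,
    fun k _ => isNode_straight hs τ k, ?_, fun h => ⟨isMultiSaddle_straight h τ (Or.inl rfl),
      isMultiSaddle_straight h τ (Or.inr rfl)⟩, fun e => ?_⟩,
    fun s hs κ hκ c hc => exists_evolution_of_zeros hs hκ hc,
    fun s hs η hη r hr => exists_generic_direction hs hη hr, fun Q hQ s hs τ => reversal hQ hs τ⟩
  · rintro rfl
    exact ⟨isSaddle_straight τ (Or.inl rfl), isSaddle_straight τ (Or.inr rfl)⟩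
  · simpa using qPerp_straight_rotate s 0 τ e
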